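/- **Notation.** For a real finite-dimensional space $V$ let $\mathbb E(V)$ be the space of positive definite symmetric bilinear forms on $V$ with the metric $\mathrm{tr}(dX\,X^{-1}dX\,X^{-1})$, and $\mathbb P\mathbb E(V)$ its quotient by positive scalars; $\mathbb P\mathbb E_n=\mathbb P\mathbb E(\mathbb R^n)$. Fix $m_1,\dots,m_\beta\ge 1$ and $\mathcal E=\prod_\tau\mathbb P\mathbb E_{m_\tau}$. *The set $\mathrm{Karp}$.* Let $F=(F_\tau)$ be a family of (partial) flags $\mathbb R^{m_\tau}=W_0\supsetneq W_1\supsetneq\dots\supsetneq W_{p+1}=0$, and let $\mathcal E_F$ be the product of the spaces $\mathbb P\mathbb E(W_{k-1}/W_k)$ over all subquotients of all $F_\tau$; so $\mathcal E_F=\mathcal E$ for the trivial flags. For a proper refinement $F'$ of $F$ (that is, a family of flags in the subquotients of $F$, not all trivial) let $\Delta_\circ(F,F')$ be the set of collections of real numbers, one for each subquotient of $F'$, strictly decreasing from the top to the bottom of the flag inside each subquotient of $F$, taken up to one common positive factor and an additive constant for each subquotient of $F$. Define inductively $$\mathrm{Karp}(\mathcal E_F)=\mathcal E_F\ \sqcup\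 \bigsqcup_{F'}\Delta_\circ(F,F')\times\mathrm{Karp}(\mathcal E_{F'}),$$ the union being over all proper refinements $F'$ of $F$. The copies of $\mathcal E_{F'}$ that arise are the boundary symmetric spaces of $\mathcal E_F$. *Limits of geodesics.* A non-constant geodesic in $\mathcal E_F$ has in each factor, in a suitable basis $(e_i)$ and up to scalars, the form $\mathrm{diag}(e^{\varphi_1t},e^{\varphi_2t},\dots)$. Its constructed limit is the point of $\Delta_\circ(F,F')\times\mathcal E_{F'}$, where $F'$ is formed by the spans of the $e_i$ with $\varphi_i<r$, $r\in\mathbb R$; the numbers are the values of the $\varphi_i$; and the form on the subquotient with the value $\psi$ is the one in which the $e_i$ with $\varphi_i=\psi$ are orthonormal. Two directed geodesics $\gamma,\mu$ lie in one solvable pencil if, up to a common reparametrization $t\mapsto at$, $a>0$, $\mu$ is the image of $\gamma$ under linear operators of the factors that preserve these flags and act by scalars on their subquotients. *Satake–Furstenberg compactification.* $\mathbb S_n$ is the set of pairs (flag of $\mathbb R^n$, positive definite forms up to scalars on its subquotients), and $\mathbb P\mathbb E_n\subset\mathbb S_n$ corresponds to the trivial flag. A sequence $X^{(j)}\in\mathbb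 P\mathbb E_n$ converges to $(W_\bullet,Q_\bullet)$ if there are orthogonal $h_j\to1$ such that, for $U_k=W_{k-1}\cap W_k^\perp$, the subspaces $h_jU_k$ are mutually $X^{(j)}$-orthogonal, the forms $X^{(j)}(h_j\cdot,h_j\cdot)|_{U_k}$ multiplied by suitable $l_{j,k}>0$ converge to $Q_k$ on $U_k\simeq W_{k-1}/W_k$, and $l_{j,k}/l_{j,k'}\to0$ for $k<k'$. *Karpelevich polyhedron and velocity compactification.* A linear space $V$ is compactified to $\overline V$ by the sphere of its rays. Let $J=\bigsqcup_\tau\{1,\dots,m_\tau\}$. For a partition $\mathfrak a$ of $J$ refining this decomposition let $\Xi[J;\mathfrak a]$ be $\mathbb R^J$ modulo the functions constant on each element of $\mathfrak a$. The Karpelevich polyhedron is the closure of the diagonal image of $\mathbb R^J$ in $\prod_{\mathfrak a}\overline{\Xi[J;\mathfrak a]}$. Let $\Lambda^+$ be the image in it of the functions that are non-increasing on each $\{1,\dots,m_\tau\}$, $\Lambda^{\rm Karp}$ its closure, and $\partial\Lambda=\Lambda^{\rm Karp}\setminus\Lambda^+$. The ordered logarithms of the eigenvalues give a map $\mathcal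 E\to\Lambda^+$. The velocity compactification is $\mathcal E^{\boxplus}=\mathcal E\sqcup\partial\Lambda$ with the topology generated by the open subsets of $\mathcal E$ and by the preimages of the open subsets of $\Lambda^{\rm Karp}$ under $\mathcal E^\boxplus\to\Lambda^{\rm Karp}$. *Hybrid.* For compact metrizable $X,Y$ and continuous maps $A\to X$, $A\to Y$ with dense images, the hybrid is the closure of the image of $A$ in $X\times Y$. **Theorem 5.2.** (a) For every $F$, each non-constant geodesic of $\mathcal E_F$ has a constructed limit, all points of $\bigsqcup_{F'}\Delta_\circ(F,F')\times\mathcal E_{F'}$ occur as such limits, and two geodesics have the same constructed limit iff they lie in one solvable pencil. (b) $\mathcal E^\boxplus$ is compact and metrizable, and $\mathcal E\to\mathcal E^\boxplus$ is continuous with dense image. Each $\mathbb S_n$ with $n=m_\tau$ carries a compact metrizable topology in which $\mathbb P\mathbb E_n$ is dense and sequences in $\mathbb P\mathbb E_n$ converge exactly as described above; and $\mathcal E\to\prod_\tau\mathbb S_{m_\tau}$ is continuous with dense image. (c) There is a compact metrizable topology on $\mathrm{Karp}(\mathbb P\mathbb E_{m_1}\times\dots\times\mathbb P\mathbb E_{m_\beta})$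 in which $\mathcal E$ is an open dense subspace with its usual topology, and in which each non-constant geodesic $\gamma(t)$ of $\mathcal E$ or of any boundary symmetric space converges, as $t\to+\infty$, to its constructed limit. With this topology, $\mathrm{Karp}(\mathcal E)$ is homeomorphic to the hybrid of $\mathcal E^\boxplus$ and $\prod_\tau\mathbb S_{m_\tau}$, by a homeomorphism that is the diagonal map $x\mapsto(x,x)$ on $\mathcal E$. -/

import Mathlib

open Filter Topology

noncomputable section

namespace Karpelevich

/-! ### Positive definite forms, up to scalar factors -/

/-- The space `E(V)` of positive definite symmetric bilinear forms on a real vector space. -/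
def PosForm (V : Type) [AddCommGroup V] [Module ℝ V] : Type :=
  {B : LinearMap.BilinForm ℝ V // (∀ v w, B v w = B w v) ∧ ∀ v, v ≠ 0 → 0 < B v v}

section Forms

variable {V : Type} [AddCommGroup V] [Module ℝ V]

instance : CoeFun (PosForm V) (fun _ => V → V → ℝ) := ⟨fun P v w => P.1 v w⟩

/-- The topology of pointwise convergence of forms. -/
instance : TopologicalSpace (PosForm V) :=
  TopologicalSpace.induced (fun P (p : V × V) => P p.1 p.2) inferInstance

/-- Proportionality with a positive factor. -/
instance PosForm.setoid (V : Type) [AddCommGroup V] [Module ℝ V] : Setoid (PosForm V) where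
  r P Q := ∃ a : ℝ, 0 < a ∧ ∀ v w, Q v w = a * P v w
  iseqv :=
    { refl := fun _ => ⟨1, one_pos, fun _ _ => (one_mul _).symm⟩
      symm := by
        rintro P Q ⟨a, ha, h⟩
        refine ⟨a⁻¹, inv_pos.mpr ha, fun v w => ?_⟩
        rw [h, ← mul_assoc, inv_mul_cancel₀ ha.ne', one_mul]
      trans := by
        rintro P Q R ⟨a, ha, h⟩ ⟨b, hb, k⟩
        exact ⟨b * a, mul_pos hb ha, fun v w => by rw [k, h, mul_assoc]⟩ }

/-- The space `PE(V)` of positive definite forms up to positive scalar factors, with the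
quotient topology. -/
def PE (V : Type) [AddCommGroup V] [Module ℝ V] : Type := Quotient (PosForm.setoid V)

instance : TopologicalSpace (PE V) :=
  inferInstanceAs (TopologicalSpace (Quotient (PosForm.setoid V)))

/-- The class of a form in `PE(V)`. -/
def PosForm.cls (P : PosForm V) : PE V := Quotient.mk (PosForm.setoid V) P

/-- The pull-back of a form under an injective linear map. -/
def PosForm.pull {U : Type} [AddCommGroup U] [Module ℝ U] (f : U →ₗ[ℝ] V)
    (hf : Function.Injective f) (P : PosForm V) : PosForm U :=
  ⟨P.1.compl₁₂ f f, fun v w => P.2.1 (f v) (f w), fun v hv =>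
    P.2.2 (f v) (fun h => hv (hf (by rw [h, map_zero])))⟩

/-- The pull-back on classes of forms. -/
def PE.pull {U : Type} [AddCommGroup U] [Module ℝ U] (f : U →ₗ[ℝ] V)
    (hf : Function.Injective f) : PE V → PE U :=
  Quotient.map (PosForm.pull f hf) (by
    rintro P Q ⟨a, ha, h⟩
    exact ⟨a, ha, fun v w => h (f v) (f w)⟩)

/-- A curve in `E(V)` is a geodesic of the invariant metric `tr (dX X⁻¹ dX X⁻¹)` (in an affine
parameter, constant curves allowed) iff it satisfies the geodesic equation
`X'' = X' X⁻¹ X'`. With `A = X⁻¹ X'` the two requirements below read `X' = X A`,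
`(X A)' = X A A`. -/
def IsGeodesicForm (X : ℝ → PosForm V) : Prop :=
  ∃ A : ℝ → V →ₗ[ℝ] V,
    (∀ t v w, HasDerivAt (fun s => X s v w) (X t v (A t w)) t) ∧
    (∀ t v w, HasDerivAt (fun s => X s v (A s w)) (X t v (A t (A t w))) t)

/-- A curve in `PE(V)` is a geodesic (possibly constant) iff it is the projection of a geodesic
of `E(V)`, since `E(V)` is the Riemannian product of `PE(V)` and of the line of scalars. -/
def IsGeodesicPE (x : ℝ → PE V) : Prop :=
  ∃ X : ℝ → PosForm V, IsGeodesicForm X ∧ ∀ t, (X t).cls = x t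

/-- In the coordinates of the basis `e`, the curve `x` is
`diag(exp(φ₁ t), …, exp(φₙ t))`, up to scalars. -/
def HasCanonicalForm {n : ℕ} (x : ℝ → PE V) (e : Module.Basis (Fin n) ℝ V) (φ : Fin n → ℝ) :
    Prop :=
  ∀ t, ∃ P : PosForm V, P.cls = x t ∧
    ∀ v w, P v w = ∑ i, Real.exp (φ i * t) * e.repr v i * e.repr w i

end Forms

/-! ### Partial flags and their subquotients -/

/-- A partial flag of a real vector space: a chain of subspaces that contains `0` and `V`. -/
structure PFlag (V : Type) [AddCommGroup V] [Module ℝ V] where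
  carrier : Set (Submodule ℝ V)
  chain : IsChain (· ≤ ·) carrier
  bot_mem : ⊥ ∈ carrier
  top_mem : ⊤ ∈ carrier

/-- The trivial flag `V ⊇ 0`. -/
def PFlag.trivial (V : Type) [AddCommGroup V] [Module ℝ V] : PFlag V where
  carrier := {⊥, ⊤}
  chain := by
    rintro A hA B hB -
    rcases hA with rfl | rfl
    · exact Or.inl bot_le
    · exact Or.inr le_top
  bot_mem := Or.inl rfl
  top_mem := Or.inr rfl

/-- A pair `lo < hi` of neighbouring members of a flag. -/
structure Cell {V : Type} [AddCommGroup V] [Module ℝ V] (F : PFlag V) where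
  lo : Submodule ℝ V
  hi : Submodule ℝ V
  lo_mem : lo ∈ F.carrier
  hi_mem : hi ∈ F.carrier
  lt : lo < hi
  gap : ∀ W ∈ F.carrier, ¬ (lo < W ∧ W < hi)

namespace Cell

variable {V : Type} [AddCommGroup V] [Module ℝ V] {F F' : PFlag V}

/-- The subquotient `hi / lo` of a flag. -/
abbrev Gr (c : Cell F) : Type := ↥c.hi ⧸ c.lo.submoduleOf c.hi

/-- The projection `hi → hi / lo`. -/
def proj (c : Cell F) (v : V) (hv : v ∈ c.hi) : c.Gr :=
  (c.lo.submoduleOf c.hi).mkQ ⟨v, hv⟩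

/-- The pair `d` of neighbours of one flag lies between the neighbours `c` of another one. -/
def Inside (d : Cell F') (c : Cell F) : Prop := c.lo ≤ d.lo ∧ d.hi ≤ c.hi

lemma lo_eq_bot (c : Cell (PFlag.trivial V)) : c.lo = ⊥ := by
  rcases c.lo_mem with h | h
  · exact h
  · exact absurd c.lt (by rw [h]; exact not_top_lt)

/-- The only subquotient of the trivial flag is `V` itself. -/
def toSpace (c : Cell (PFlag.trivial V)) : c.Gr →ₗ[ℝ] V :=
  (c.lo.submoduleOf c.hi).liftQ c.hi.subtype (by
    intro x hx
    rw [LinearMap.mem_ker]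
    have h : (x : V) ∈ c.lo := hx
    rw [lo_eq_bot, Submodule.mem_bot] at h
    exact h)

lemma toSpace_injective (c : Cell (PFlag.trivial V)) : Function.Injective c.toSpace := by
  rw [← LinearMap.ker_eq_bot, toSpace, Submodule.ker_liftQ_eq_bot]
  intro x hx
  have h : (x : V) = 0 := hx
  change (x : V) ∈ c.lo
  rw [h]
  exact c.lo.zero_mem

end Cell

/-- A point of `PE(V)` as a form on the subquotient `V / 0` of the trivial flag. -/
def trivialForms {V : Type} [AddCommGroup V] [Module ℝ V] (x : PE V)
    (c : Cell (PFlag.trivial V)) : PE c.Gr :=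
  x.pull c.toSpace c.toSpace_injective

/-- `ℝⁿ` with its standard inner product. -/
abbrev Sp (n : ℕ) : Type := EuclideanSpace ℝ (Fin n)

/-! ### The Satake--Furstenberg compactification -/

/-- The Semple--Satake space `S_n`: a flag of `ℝⁿ` and positive definite forms, up to scalars, on
its subquotients. -/
def Satake (n : ℕ) : Type := Σ F : PFlag (Sp n), ∀ c : Cell F, PE c.Gr

/-- The inclusion of `PE_n` as the stratum of the trivial flag. -/
def satakeIncl {n : ℕ} (x : PE (Sp n)) : Satake n := ⟨PFlag.trivial (Sp n), trivialForms x⟩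

/-- Convergence of a sequence of `PE_n` to a point `(F, Q)` of `S_n`. There are orthogonal
operators `h j → 1` carrying the orthogonal splitting of `ℝⁿ` given by `F` to splittings into
invariant subspaces of the matrices of the sequence (the spans of the packets of eigenvectors); on
each summand the forms, suitably normalised and transported by `h j`, converge to the form given
by `Q`; and eigenvalues of a packet nearer to the top of the flag become infinitely large
with respect to those of a packet nearer to the bottom. -/
def SatakeConverges {n : ℕ} (x : ℕ → PE (Sp n)) (s : Satake n) : Prop :=
  ∃ (P : ℕ → PosForm (Sp n)) (Q : ∀ c : Cell s.1, PosForm c.Gr)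
    (h : ℕ → Sp n ≃ₗᵢ[ℝ] Sp n) (l : ℕ → Cell s.1 → ℝ),
    (∀ j, (P j).cls = x j) ∧ (∀ c, (Q c).cls = s.2 c) ∧
    (∀ v, Tendsto (fun j => h j v) atTop (𝓝 v)) ∧
    (∀ j c, 0 < l j c) ∧
    (∀ c d : Cell s.1, c.hi ≤ d.lo → Tendsto (fun j => l j d / l j c) atTop (𝓝 0)) ∧
    (∀ j, ∀ c d : Cell s.1, c ≠ d → ∀ v ∈ c.hi ⊓ c.loᗮ, ∀ w ∈ d.hi ⊓ d.loᗮ,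
      P j (h j v) (h j w) = 0) ∧
    (∀ c : Cell s.1, ∀ v w : Sp n, ∀ (hv : v ∈ c.hi) (hw : w ∈ c.hi), v ∈ c.loᗮ → w ∈ c.loᗮ →
      Tendsto (fun j => l j c * P j (h j v) (h j w)) atTop (𝓝 (Q c (c.proj v hv) (c.proj w hw))))

/-- The topology of the Satake--Furstenberg compactification: the compact metrizable topology on
`S_n` in which `PE_n` is dense and the sequences in `PE_n` converge as described above. (A
metrizable topology is determined by the convergence of the sequences in a dense subset.) -/
structure IsSatakeTopology {n : ℕ} (T : TopologicalSpace (Satake n)) : Prop where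
  compact : CompactSpace (Satake n)
  metrizable : TopologicalSpace.MetrizableSpace (Satake n)
  dense : DenseRange (satakeIncl (n := n))
  tendsto_iff : ∀ (x : ℕ → PE (Sp n)) (s : Satake n),
    Tendsto (fun j => satakeIncl (x j)) atTop (𝓝 s) ↔ SatakeConverges x s

/-! ### The set `Karp(PE_{m₁} × … × PE_{m_β})` -/

section Karp

variable {β : ℕ} {m : Fin β → ℕ}

/-- The symmetric space `PE_{m₁} × … × PE_{m_β}`. -/
abbrev Space (m : Fin β → ℕ) : Type := ∀ τ, PE (Sp (m τ))

/-- A flag in each `ℝ^{m_τ}`. -/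
abbrev FlagTuple (m : Fin β → ℕ) : Type := ∀ τ, PFlag (Sp (m τ))

/-- The trivial flags. -/
def FlagTuple.trivial (m : Fin β → ℕ) : FlagTuple m := fun τ => PFlag.trivial (Sp (m τ))

/-- `F'` is a proper refinement of `F`. Equivalently, `F'` is a family of flags in all the
subquotients of `F`, not all of them trivial; the subquotients of these flags are the
subquotients of `F'`. -/
def Refines (F F' : FlagTuple m) : Prop :=
  (∀ τ, (F τ).carrier ⊆ (F' τ).carrier) ∧ ∃ τ, ¬ (F' τ).carrier ⊆ (F τ).carrier

/-- The product of the spaces `PE` over all the subquotients of all the flags of `F`. -/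
abbrev Fiber (F : FlagTuple m) : Type := ∀ τ, ∀ c : Cell (F τ), PE c.Gr

/-- Velocity vectors: a number for each subquotient of `F'`; inside each subquotient of `F` these
numbers strictly decrease from the top of the flag to its bottom. -/
def Velocity (F F' : FlagTuple m) : Type :=
  {ψ : ∀ τ, Cell (F' τ) → ℝ // ∀ τ (c : Cell (F τ)) (d d' : Cell (F' τ)),
    d.Inside c → d'.Inside c → d.hi ≤ d'.lo → ψ τ d < ψ τ d'}

/-- Velocities are considered up to one common positive factor and up to an additive constant for
each subquotient of `F`. -/
instance Velocity.setoid (F F' : FlagTuple m) : Setoid (Velocity F F') where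
  r ψ ψ' := ∃ (a : ℝ) (b : ∀ τ, Cell (F τ) → ℝ), 0 < a ∧
    ∀ τ (c : Cell (F τ)) (d : Cell (F' τ)), d.Inside c → ψ'.1 τ d = a * ψ.1 τ d + b τ c
  iseqv :=
    { refl := fun ψ => ⟨1, fun _ _ => 0, one_pos, fun _ _ _ _ => by ring⟩
      symm := by
        rintro ψ ψ' ⟨a, b, ha, h⟩
        refine ⟨a⁻¹, fun τ c => -(a⁻¹ * b τ c), inv_pos.mpr ha, fun τ c d hd => ?_⟩
        rw [h τ c d hd]
        field_simp
        ring
      trans := by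
        rintro ψ ψ' ψ'' ⟨a, b, ha, h⟩ ⟨a', b', ha', h'⟩
        refine ⟨a' * a, fun τ c => a' * b τ c + b' τ c, mul_pos ha' ha, fun τ c d hd => ?_⟩
        rw [h' τ c d hd, h τ c d hd]
        ring }

/-- The polyhedron `Δ_∘` of velocities. -/
def Delta (F F' : FlagTuple m) : Type := Quotient (Velocity.setoid F F')

/-- The class of a velocity vector. -/
def Velocity.cls {F F' : FlagTuple m} (ψ : Velocity F F') : Delta F F' :=
  Quotient.mk (Velocity.setoid F F') ψ

/-- `KarpAt F` is the Karpelevich compactification, as a set, of the product `Fiber F`. It consists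
of the points of `Fiber F` and of the points at infinity. The stratum at infinity given by flags
`F'` in the subquotients is the product of the polyhedron `Δ_∘` and of the
compactification of the product of the spaces `PE` of the new subquotients. -/
inductive KarpAt : FlagTuple m → Type
  | inner {F : FlagTuple m} (Q : Fiber F) : KarpAt F
  | bdry {F F' : FlagTuple m} (h : Refines F F') (ψ : Delta F F') (x : KarpAt F') : KarpAt F

/-- The set `Karp(PE_{m₁} × … × PE_{m_β})`. -/
abbrev Karp (m : Fin β → ℕ) : Type := KarpAt (FlagTuple.trivial m)

/-- The inclusion of the symmetric space in its compactification. -/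
def karpIncl (m : Fin β → ℕ) (x : Space m) : Karp m :=
  KarpAt.inner (fun τ => trivialForms (x τ))

/-- `Place F F'`: the data that specify one of the iterated boundary fibres `KarpAt F'` of
`KarpAt F`. -/
inductive Place : FlagTuple m → FlagTuple m → Type
  | here {F : FlagTuple m} : Place F F
  | step {F F' F'' : FlagTuple m} (h : Refines F F') (ψ : Delta F F') (p : Place F' F'') :
      Place F F''

/-- The inclusion of a boundary fibre. -/
def Place.embed : {F F' : FlagTuple m} → Place F F' → KarpAt F' → KarpAt F
  | _, _, .here, x => x
  | _, _, .step h ψ p, x => .bdry h ψ (p.embed x)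

/-! ### Geodesics, their limits, solvable pencils -/

/-- The boundary data of a geodesic in `Fiber F`: flags in the subquotients, velocity, and forms on
the subquotients of these flags. -/
structure BoundaryData (F : FlagTuple m) where
  flag : FlagTuple m
  refines : Refines F flag
  vel : Delta F flag
  forms : Fiber flag

/-- The point at infinity with given boundary data. -/
def BoundaryData.toKarp {F : FlagTuple m} (p : BoundaryData F) : KarpAt F :=
  .bdry p.refines p.vel (.inner p.forms)

/-- A (non-constant, affinely parametrised) geodesic in the Riemannian product `Fiber F`. -/
def IsGeodesic {F : FlagTuple m} (γ : ℝ → Fiber F) : Prop :=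
  (∀ τ c, IsGeodesicPE (fun t => γ t τ c)) ∧ ¬ ∀ t, γ t = γ 0

/-- `p` is the boundary data of the geodesic `γ`. If `γ(t)` is
`diag(exp(φ₁ t), exp(φ₂ t), …)` in some basis, this says that the flag is spanned by the basis
vectors with `φ_i` below the various levels, that the velocity is the collection of the values of
the `φ_i`, and that the forms on the subquotients are the coefficients of the
exponents `exp(φ_i t)`. -/
def IsGeodesicLimit {F : FlagTuple m} (γ : ℝ → Fiber F) (p : BoundaryData F) : Prop :=
  ∃ (X : ∀ τ, ∀ c : Cell (F τ), ℝ → PosForm c.Gr) (ψ : Velocity F p.flag)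
    (Q : ∀ τ, ∀ d : Cell (p.flag τ), PosForm d.Gr),
    (∀ τ c, IsGeodesicForm (X τ c)) ∧ (∀ τ c t, (X τ c t).cls = γ t τ c) ∧
    ψ.cls = p.vel ∧ (∀ τ d, (Q τ d).cls = p.forms τ d) ∧
    ∀ (τ : Fin β) (c : Cell (F τ)) (d : Cell (p.flag τ)) (h : d.Inside c) (v w : Sp (m τ))
      (hv : v ∈ d.hi) (hw : w ∈ d.hi),
      Tendsto (fun t : ℝ => Real.exp (-(ψ.1 τ d * t)) *
        X τ c t (c.proj v (h.2 hv)) (c.proj w (h.2 hw))) atTop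
        (𝓝 (Q τ d (d.proj v hv) (d.proj w hw)))

/-- `γ` and `μ`, as directed geodesics, lie in one solvable pencil: in canonical coordinates
for `γ`, the geodesic `μ` is the image of `γ`, up to a common linear change of the parameter,
under block triangular matrices with scalar diagonal blocks (the blocks being given by the
equal exponents). -/
def SameSolvablePencil {F : FlagTuple m} (γ μ : ℝ → Fiber F) : Prop :=
  ∃ a : ℝ, 0 < a ∧ ∀ τ, ∀ c : Cell (F τ), ∃ (n : ℕ) (e f : Module.Basis (Fin n) ℝ c.Gr)
    (φ : Fin n → ℝ) (s : ℝ → ℝ),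
    HasCanonicalForm (fun t => γ t τ c) e φ ∧
    HasCanonicalForm (fun t => μ t τ c) f (fun i => a * φ i) ∧
    ∀ i, f i - s (φ i) • e i ∈ Submodule.span ℝ (e '' {j | φ j < φ i})

end Karp

/-! ### The Karpelevich polyhedron -/

/-- The non-zero vectors `(v, s)` of `V × ℝ` with `s ≥ 0`. -/
def HalfCone (V : Type) [AddCommGroup V] : Type := {p : V × ℝ // p ≠ 0 ∧ 0 ≤ p.2}

instance (V : Type) [AddCommGroup V] [TopologicalSpace V] : TopologicalSpace (HalfCone V) :=
  inferInstanceAs (TopologicalSpace {p : V × ℝ // p ≠ 0 ∧ 0 ≤ p.2})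

/-- Proportionality with a positive factor. -/
instance HalfCone.setoid (V : Type) [AddCommGroup V] [Module ℝ V] : Setoid (HalfCone V) where
  r p q := ∃ a : ℝ, 0 < a ∧ q.1 = a • p.1
  iseqv :=
    { refl := fun _ => ⟨1, one_pos, (one_smul _ _).symm⟩
      symm := by
        rintro p q ⟨a, ha, h⟩
        refine ⟨a⁻¹, inv_pos.mpr ha, ?_⟩
        rw [h, smul_smul, inv_mul_cancel₀ ha.ne', one_smul]
      trans := by
        rintro p q r ⟨a, ha, h⟩ ⟨b, hb, k⟩
        exact ⟨b * a, mul_pos hb ha, by rw [k, h, smul_smul]⟩ }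

/-- The compactification of a linear space `V` by the sphere of its rays, as the half-sphere of
rays `(v : s)`, `s ≥ 0`, in `V × ℝ`: the points of `V` are `(v : 1)`, the point at infinity of
the ray of `v ≠ 0` is `(v : 0)`. -/
def RayComp (V : Type) [AddCommGroup V] [Module ℝ V] : Type := Quotient (HalfCone.setoid V)

instance (V : Type) [AddCommGroup V] [Module ℝ V] [TopologicalSpace V] :
    TopologicalSpace (RayComp V) :=
  inferInstanceAs (TopologicalSpace (Quotient (HalfCone.setoid V)))

/-- The inclusion of `V`. -/
def RayComp.incl {V : Type} [AddCommGroup V] [Module ℝ V] (v : V) : RayComp V :=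
  Quotient.mk (HalfCone.setoid V)
    ⟨(v, 1), fun h => one_ne_zero (congrArg Prod.snd h), zero_le_one⟩

section Hedron

variable {β : ℕ}

/-- The disjoint union of the sets `{1, …, m_τ}`. -/
abbrev Idx (m : Fin β → ℕ) : Type := Σ τ, Fin (m τ)

/-- The partitions of the index set, all of whose elements lie in one of the sets
`{1, …, m_τ}`. -/
def Part (m : Fin β → ℕ) : Type :=
  {a : Setoid (Idx m) // a ≤ Setoid.ker (Sigma.fst : Idx m → Fin β)}

/-- The functions that are constant on each element of a partition. -/
def constOn {m : Fin β → ℕ} (a : Part m) : Submodule ℝ (Idx m → ℝ) where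
  carrier := {f | ∀ i j, a.1 i j → f i = f j}
  zero_mem' := fun _ _ _ => rfl
  add_mem' := fun hf hg i j h => congrArg₂ (· + ·) (hf i j h) (hg i j h)
  smul_mem' := fun r _ hf i j h => congrArg (r * ·) (hf i j h)

/-- The space `Ξ[J; a]` of functions modulo the functions that are constant on each element
of `a`. -/
abbrev Xi {m : Fin β → ℕ} (a : Part m) : Type := (Idx m → ℝ) ⧸ constOn a

/-- The product of the compactified spaces `Ξ[J; a]` over all the partitions. -/
abbrev XiProduct (m : Fin β → ℕ) : Type := ∀ a : Part m, RayComp (Xi a)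

/-- The diagonal map of the space of functions to this product; it factors through the embedding of
the space `⨁ Ξ_{m_τ}` of functions modulo functions constant on each `{1, …, m_τ}`. -/
def xiDiag (m : Fin β → ℕ) (f : Idx m → ℝ) : XiProduct m :=
  fun _ => RayComp.incl (Submodule.Quotient.mk f)

/-- The Karpelevich polyhedron. -/
def karpHedron (m : Fin β → ℕ) : Set (XiProduct m) := closure (Set.range (xiDiag m))

/-- The image in the polyhedron of the positive Weyl chamber. -/
def chamber (m : Fin β → ℕ) : Set (XiProduct m) :=
  xiDiag m '' {f | ∀ τ, Antitone (fun i => f ⟨τ, i⟩)}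

/-- The closure of the positive Weyl chamber in the polyhedron. -/
def chamberKarp (m : Fin β → ℕ) : Set (XiProduct m) := closure (chamber m)

lemma chamberKarp_subset (m : Fin β → ℕ) : chamberKarp m ⊆ karpHedron m :=
  closure_mono (Set.image_subset_range _ _)

/-- The part of this closure at infinity. -/
def chamberBdry (m : Fin β → ℕ) : Set (XiProduct m) := chamberKarp m \ chamber m

end Hedron

/-! ### The velocity compactification and hybrids -/

section Eigen

variable {n : ℕ}

/-- The matrix of a form on `ℝⁿ`. -/
def PosForm.matrix (P : PosForm (Sp n)) : Matrix (Fin n) (Fin n) ℝ :=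
  Matrix.of fun i j => P (EuclideanSpace.single i 1) (EuclideanSpace.single j 1)

lemma PosForm.matrix_isHermitian (P : PosForm (Sp n)) : P.matrix.IsHermitian := by
  ext i j
  exact P.2.1 _ _

/-- The eigenvalues `λ₁ ≥ λ₂ ≥ … ≥ λₙ` of the matrix of a form. -/
def PosForm.eig (P : PosForm (Sp n)) (i : Fin n) : ℝ :=
  P.matrix_isHermitian.eigenvalues₀ (Fin.cast (Fintype.card_fin n).symm i)

/-- The logarithms of the eigenvalues, with the additive constant normalised by the condition that
their sum is zero. -/
def PosForm.logEig (P : PosForm (Sp n)) (i : Fin n) : ℝ :=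
  Real.log (P.eig i) - (∑ j, Real.log (P.eig j)) / n

lemma PosForm.apply_eq (P : PosForm (Sp n)) (v : Sp n) :
    P v v = ∑ i, ∑ j, v i * v j * P.matrix i j := by
  have hv : v = ∑ i, v i • EuclideanSpace.single i (1 : ℝ) := by
    ext k
    simp [Finset.sum_apply, Pi.single_apply]
  change P.1 v v = _
  conv_lhs => rw [hv]
  simp only [map_sum, map_smul, LinearMap.sum_apply, LinearMap.smul_apply, smul_eq_mul,
    Finset.mul_sum]
  rw [Finset.sum_comm]
  refine Finset.sum_congr rfl fun i _ => Finset.sum_congr rfl fun j _ => ?_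
  rw [← mul_assoc, mul_comm (v j)]
  rfl

lemma PosForm.matrix_posDef (P : PosForm (Sp n)) : P.matrix.PosDef := by
  refine Matrix.PosDef.of_dotProduct_mulVec_pos P.matrix_isHermitian fun x hx => ?_
  have h := P.2.2 (WithLp.toLp 2 x) (fun h => hx (congrArg WithLp.ofLp h))
  have h' := P.apply_eq (WithLp.toLp 2 x)
  refine lt_of_lt_of_eq h (h'.trans ?_)
  simp only [dotProduct, Matrix.mulVec, Finset.mul_sum, star_trivial]
  exact Finset.sum_congr rfl fun i _ => Finset.sum_congr rfl fun j _ => by ring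

lemma PosForm.eig_pos (P : PosForm (Sp n)) (i : Fin n) : 0 < P.eig i := by
  have h := P.matrix_posDef.eigenvalues_pos
    ((Fintype.equivOfCardEq (Fintype.card_fin _)) (Fin.cast (Fintype.card_fin n).symm i))
  unfold Matrix.IsHermitian.eigenvalues at h
  rw [Equiv.symm_apply_apply] at h
  exact h

lemma PosForm.eig_smul {P Q : PosForm (Sp n)} {a : ℝ} (ha : 0 < a)
    (h : ∀ v w, Q v w = a * P v w) (i : Fin n) : Q.eig i = a * P.eig i := by
  have hM : Q.matrix = a • P.matrix := by
    ext i j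
    exact h _ _
  have hc : Q.matrix.charpoly =
      ∏ k, (Polynomial.X - Polynomial.C (a * P.matrix_isHermitian.eigenvalues k)) := by
    refine Polynomial.funext fun x => ?_
    have e1 : Matrix.scalar (Fin n) x - Q.matrix =
        a • (Matrix.scalar (Fin n) (x / a) - P.matrix) := by
      rw [hM, smul_sub]
      congr 1
      ext i j
      by_cases hij : i = j
      · subst hij
        simp [mul_div_cancel₀ _ ha.ne']
      · simp [hij]
    rw [Matrix.eval_charpoly, e1, Matrix.det_smul, ← Matrix.eval_charpoly,
      P.matrix_isHermitian.charpoly_eq, Polynomial.eval_prod, Polynomial.eval_prod,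
      ← Finset.card_univ, ← Finset.prod_const, ← Finset.prod_mul_distrib]
    refine Finset.prod_congr rfl fun k _ => ?_
    simp [mul_sub, mul_div_cancel₀ _ ha.ne']
  have hf : Q.matrix_isHermitian.eigenvalues₀ =
      fun k => a * P.matrix_isHermitian.eigenvalues₀ k := by
    have hr : Q.matrix.charpoly.roots =
        Multiset.map (fun k => a * P.matrix_isHermitian.eigenvalues₀ k) Finset.univ.val := by
      have h1 := P.matrix_isHermitian.roots_charpoly_eq_eigenvalues
      rw [P.matrix_isHermitian.roots_charpoly_eq_eigenvalues₀] at h1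
      have h2 := congrArg (Multiset.map (fun x : ℝ => a * x)) h1
      rw [Multiset.map_map, Multiset.map_map] at h2
      rw [hc, Polynomial.roots_prod _ _
        (Finset.prod_ne_zero_iff.mpr fun k _ => Polynomial.X_sub_C_ne_zero _)]
      simp only [Polynomial.roots_X_sub_C, Multiset.bind_singleton]
      exact h2.symm
    rw [← List.ofFn_inj, ← Matrix.IsHermitian.sort_roots_charpoly_eq_eigenvalues₀, hr]
    simp_rw [Fin.univ_val_map, Multiset.map_coe, List.map_ofFn, Function.comp_def,
      RCLike.re_to_real, Multiset.coe_sort]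
    apply List.mergeSort_of_pairwise
    simp_rw [decide_eq_true_eq, ← List.sortedGE_iff_pairwise]
    exact Antitone.sortedGE_ofFn fun i j hij =>
      mul_le_mul_of_nonneg_left (P.matrix_isHermitian.eigenvalues₀_antitone hij) ha.le
  exact congrFun hf _

lemma PosForm.logEig_eq {P Q : PosForm (Sp n)} (h : PosForm.setoid (Sp n) P Q) :
    P.logEig = Q.logEig := by
  obtain ⟨a, ha, h⟩ := h
  funext i
  have hn : (n : ℝ) ≠ 0 := by
    have := i.pos
    positivity
  have hl : ∀ j, Real.log (Q.eig j) = Real.log a + Real.log (P.eig j) := fun j => by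
    rw [PosForm.eig_smul ha h, Real.log_mul ha.ne' (P.eig_pos j).ne']
  simp only [PosForm.logEig, hl, Finset.sum_add_distrib, Finset.sum_const, Finset.card_univ,
    Fintype.card_fin, nsmul_eq_mul]
  field_simp
  ring

/-- The normalised logarithms of the eigenvalues of a point of `PE_n`. -/
def PE.logEig (x : PE (Sp n)) : Fin n → ℝ :=
  Quotient.lift PosForm.logEig (fun _ _ h => PosForm.logEig_eq h) x

end Eigen

section Hybrid

variable {β : ℕ}

/-- The map of the symmetric space to the positive Weyl chamber given by the logarithms of the
eigenvalues. -/
def velocityMap (m : Fin β → ℕ) (x : Space m) : XiProduct m :=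
  xiDiag m (fun i => (x i.1).logEig i.2)

/-- The velocity compactification given by the Karpelevich polyhedron: the disjoint union of the
symmetric space and of the boundary of the closed Weyl chamber. -/
inductive VelComp (m : Fin β → ℕ) : Type
  | inner (x : Space m) : VelComp m
  | bdry (z : chamberBdry m) : VelComp m

/-- The map of the velocity compactification to the closed Weyl chamber. -/
def VelComp.toChamber {m : Fin β → ℕ} : VelComp m → XiProduct m
  | .inner x => velocityMap m x
  | .bdry z => z.1

/-- The topology of the velocity compactification: it is generated by the open subsets of
the symmetric space and by the preimages of open subsets of the closed Weyl chamber. Thus a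
sequence in the symmetric space converges to a point at infinity iff the logarithms of the
eigenvalues do. -/
instance (m : Fin β → ℕ) : TopologicalSpace (VelComp m) :=
  TopologicalSpace.generateFrom
    ({s | ∃ U : Set (Space m), IsOpen U ∧ s = VelComp.inner '' U} ∪
      {s | ∃ O : Set (XiProduct m), IsOpen O ∧ s = VelComp.toChamber ⁻¹' O})

/-- The hybrid of two compactifications `ξ : A → X` and `υ : A → Y`: the closure of the image of `A`
under the diagonal map. -/
def hybrid {A X Y : Type} [TopologicalSpace X] [TopologicalSpace Y] (ξ : A → X) (υ : A → Y) :
    Set (X × Y) :=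
  closure (Set.range fun a => (ξ a, υ a))

/-- A map `ξ : A → X` is a compactification in the sense used for hybrids: `X` is compact and
metrizable, `ξ` is continuous, and its image is dense. -/
structure IsCompactification {A X : Type} [TopologicalSpace A] [TopologicalSpace X]
    (ξ : A → X) : Prop where
  compact : CompactSpace X
  metrizable : TopologicalSpace.MetrizableSpace X
  continuous : Continuous ξ
  dense : DenseRange ξ

end Hybrid

end Karpelevich

end

/-! Everything is reduced to spectral data. A point of `PE_n` is an orthonormal frame with
non-increasing exponents modulo an additive constant. A point of `S_n` has such data too, adapted to
its flag (`IsSpectral`, `exists_isSpectral`), with exponents defined up to a constant in each cell;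
the frame is unique up to rotations inside eigenspaces (`IsSpectral.unique`). The invariants are the
ratios `exp(-|f i - f k|)`, set to zero for indices in different cells, and the matrices whose
eigenvectors are the frame and whose eigenvalues are the rows of ratios. These coordinates embed
`S_n` in a Euclidean space. The image is compact, being the continuous image of the compact set of
orthonormal frames with multiplicative systems of ratios.

The analytic core is `tendsto_spectral`: if forms, rescaled by factors constant on blocks, become
diagonal in nearly fixed frames, and the factors of different blocks have diverging quotients, then
the ordered exponents converge up to these factors, and eigenvectors of different limiting
eigenvalues become orthogonal. Eigenvalues are compared by the min-max principle, eigenvectors by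
polarisation. Continuity of eigenvalues, uniqueness of spectral data, one half of the description of
convergence in `S_n` and the convergence of geodesics are all instances of it.

A point of `Karp` has a velocity coordinate `vel` in the polyhedron and a Satake coordinate `sat`,
namely its deepest flag and forms. For a partition, the velocity coordinate is given by the first
level of the iterated construction whose velocities differ inside an element of the partition. The
two coordinates are linked by one closed relation, `pairRatio = ratio`, which holds on the symmetric
space and hence on the hybrid. The two coordinates determine a point (`KarpAt.ext_coord`),
compatible pairs are realised by recursion over the flags (`KarpAt.exists_coord`), and every point
is approximated from the symmetric space by adding large multiples of the velocities
(`KarpAt.exists_approx`). Therefore `karpMap` is a bijection onto the hybrid (`range_karpMap`), and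
the topology of `Karp` is the one pulled back by it.

For geodesics, the equation forces the operator `X⁻¹ X'` to be constant; it is self-adjoint, so a
geodesic is `diag(exp(φ i t))` in a basis. Its boundary data are the leading terms of sums of
exponentials (`IsAsymptotic`). Leading terms exist for every geodesic, all of them occur, and
equality of leading terms is equivalent to a block triangular change of basis with scalar diagonal
blocks (`sameSolvablePencil_iff`). Convergence to the leading terms is checked in the two
coordinates (`IsGeodesicLimit.tendsto`). -/

open Filter Topology

noncomputable section

namespace Karpelevich

/-! ### Diagonal forms -/

section BasisForm

variable {V : Type} [AddCommGroup V] [Module ℝ V] {ι : Type} [Fintype ι]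

/-- The form `diag(exp f₁, exp f₂, …)` in the coordinates of a basis. -/
def basisForm (e : Module.Basis ι ℝ V) (f : ι → ℝ) : PosForm V :=
  ⟨∑ i, Real.exp (f i) • (LinearMap.mul ℝ ℝ).compl₁₂ (e.coord i) (e.coord i), by
    constructor
    · intro v w
      simp only [LinearMap.sum_apply, LinearMap.smul_apply, LinearMap.compl₁₂_apply,
        LinearMap.mul_apply']
      exact Finset.sum_congr rfl fun i _ => by rw [mul_comm (e.coord i v)]
    · intro v hv
      simp only [LinearMap.sum_apply, LinearMap.smul_apply, LinearMap.compl₁₂_apply,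
        LinearMap.mul_apply', smul_eq_mul]
      obtain ⟨i, hi⟩ : ∃ i, e.repr v i ≠ 0 := by
        by_contra! h
        exact hv (e.repr.map_eq_zero_iff.mp (Finsupp.ext h))
      refine Finset.sum_pos' (fun k _ => mul_nonneg (Real.exp_pos _).le (mul_self_nonneg _))
        ⟨i, Finset.mem_univ _, mul_pos (Real.exp_pos _) (mul_self_pos.mpr hi)⟩⟩

/-- The bilinear map underlying a form. -/
def PosForm.bil (P : PosForm V) : V →ₗ[ℝ] V →ₗ[ℝ] ℝ := P.1

lemma basisForm_apply (e : Module.Basis ι ℝ V) (f : ι → ℝ) (v w : V) :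
    (basisForm e f).bil v w = ∑ i, Real.exp (f i) * e.repr v i * e.repr w i := by
  change (∑ i, Real.exp (f i) • (LinearMap.mul ℝ ℝ).compl₁₂ (e.coord i) (e.coord i)) v w = _
  simp only [LinearMap.sum_apply, LinearMap.smul_apply, LinearMap.compl₁₂_apply,
    LinearMap.mul_apply', smul_eq_mul, Module.Basis.coord_apply, mul_assoc]

lemma PosForm.ext_iff' {P Q : PosForm V} : P = Q ↔ ∀ v w, P.bil v w = Q.bil v w :=
  ⟨fun h _ _ => h ▸ rfl, fun h => Subtype.ext (LinearMap.ext₂ h)⟩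

lemma PosForm.cls_eq {P Q : PosForm V} :
    P.cls = Q.cls ↔ ∃ a : ℝ, 0 < a ∧ ∀ v w, Q.bil v w = a * P.bil v w :=
  ⟨fun h => Quotient.exact h, fun h => Quotient.sound h⟩

lemma PE.exists_rep (x : PE V) : ∃ P : PosForm V, P.cls = x := Quotient.exists_rep x

lemma PosForm.symm (P : PosForm V) (v w : V) : P.bil v w = P.bil w v := P.2.1 v w

lemma PosForm.pos (P : PosForm V) {v : V} (hv : v ≠ 0) : 0 < P.bil v v := P.2.2 v hv

lemma PosForm.self_nonneg (P : PosForm V) (v : V) : 0 ≤ P.bil v v := by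
  by_cases h : v = 0
  · simp [h]
  · exact (P.pos h).le

lemma PosForm.add_left (P : PosForm V) (u v w : V) :
    P.bil (u + v) w = P.bil u w + P.bil v w := by simp

lemma PosForm.add_right (P : PosForm V) (u v w : V) :
    P.bil u (v + w) = P.bil u v + P.bil u w := by simp

lemma PosForm.smul_left (P : PosForm V) (a : ℝ) (v w : V) :
    P.bil (a • v) w = a * P.bil v w := by simp

lemma PosForm.smul_right (P : PosForm V) (a : ℝ) (v w : V) :
    P.bil v (a • w) = a * P.bil v w := by simp

lemma PosForm.sum_left {κ : Type} (P : PosForm V) (s : Finset κ) (g : κ → V) (w : V) :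
    P.bil (∑ k ∈ s, g k) w = ∑ k ∈ s, P.bil (g k) w := by simp

lemma PosForm.sum_right {κ : Type} (P : PosForm V) (s : Finset κ) (g : κ → V) (w : V) :
    P.bil w (∑ k ∈ s, g k) = ∑ k ∈ s, P.bil w (g k) := by simp

lemma PosForm.pull_apply {U : Type} [AddCommGroup U] [Module ℝ U] (g : U →ₗ[ℝ] V)
    (hg : Function.Injective g) (P : PosForm V) (v w : U) :
    (P.pull g hg).bil v w = P.bil (g v) (g w) := rfl

/-- A positive multiple of a form. -/
def PosForm.scale (P : PosForm V) (a : ℝ) (ha : 0 < a) : PosForm V :=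
  ⟨a • P.1, fun v w => congrArg (a * ·) (P.2.1 v w), fun v hv => mul_pos ha (P.2.2 v hv)⟩

lemma PosForm.scale_apply (P : PosForm V) (a : ℝ) (ha : 0 < a) (v w : V) :
    (P.scale a ha).bil v w = a * P.bil v w := rfl

lemma PosForm.scale_cls (P : PosForm V) (a : ℝ) (ha : 0 < a) : (P.scale a ha).cls = P.cls :=
  (PosForm.cls_eq.mpr ⟨a, ha, fun _ _ => rfl⟩).symm

end BasisForm

/-- Orthonormal bases of `ℝⁿ`. -/
abbrev Frame (n : ℕ) : Type := OrthonormalBasis (Fin n) ℝ (Sp n)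

variable {n : ℕ}

/-- The form with the eigenvectors `u i` and the logarithms of eigenvalues `f i`. -/
def diagForm (u : Frame n) (f : Fin n → ℝ) : PosForm (Sp n) := basisForm u.toBasis f

lemma diagForm_apply (u : Frame n) (f : Fin n → ℝ) (v w : Sp n) :
    (diagForm u f).bil v w = ∑ i, Real.exp (f i) * inner ℝ (u i) v * inner ℝ (u i) w := by
  simp [diagForm, basisForm_apply, OrthonormalBasis.repr_apply_apply]

lemma Frame.inner_eq (u : Frame n) (i k : Fin n) :
    inner ℝ (u i) (u k) = if i = k then (1 : ℝ) else 0 :=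
  orthonormal_iff_ite.mp u.orthonormal i k

lemma diagForm_frame_left (u : Frame n) (f : Fin n → ℝ) (i : Fin n) (w : Sp n) :
    (diagForm u f).bil (u i) w = Real.exp (f i) * inner ℝ (u i) w := by
  rw [diagForm_apply, Finset.sum_eq_single i]
  · rw [u.inner_eq]; simp
  · intro k _ hk
    rw [u.inner_eq]; simp [hk]
  · simp

lemma diagForm_frame (u : Frame n) (f : Fin n → ℝ) (i k : Fin n) :
    (diagForm u f).bil (u i) (u k) = if i = k then Real.exp (f i) else 0 := by
  rw [diagForm_frame_left, u.inner_eq]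
  simp

/-- For `x ≥ 0` the difference on the right equals `exp(x/2) (1 - exp(-x))`, and the first factor is
at least one. It turns a discrepancy of eigenvalues into a bound that vanishes only when they
coincide. -/
lemma one_sub_exp_neg_abs_le (x : ℝ) :
    1 - Real.exp (-|x|) ≤ |Real.exp (x / 2) - Real.exp (-(x / 2))| := by
  wlog hx : 0 ≤ x generalizing x
  · have := this (-x) (by linarith)
    rw [abs_neg, neg_div, neg_neg, abs_sub_comm] at this
    exact this
  rw [abs_of_nonneg hx]
  refine le_trans ?_ (le_abs_self _)
  have e2 : 1 ≤ Real.exp (x / 2) := Real.one_le_exp (by linarith)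
  have e6 : Real.exp (-x) ≤ 1 := Real.exp_le_one_iff.mpr (by linarith)
  have e3 : Real.exp (-(x / 2)) = Real.exp (x / 2) * Real.exp (-x) := by
    rw [← Real.exp_add]; congr 1; ring
  rw [e3]
  nlinarith

/-- Near-equality of two forms makes eigenvectors with different eigenvalues almost orthogonal. -/
lemma abs_inner_mul_le {u u' : Frame n} {f f' : Fin n → ℝ} {ε : ℝ} (h0 : 0 ≤ ε) (h1 : ε < 1)
    (h : ∀ v, |(diagForm u f).bil v v - (diagForm u' f').bil v v| ≤ ε * (diagForm u' f').bil v v)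
    (i k : Fin n) :
    |inner ℝ (u i) (u' k)| * (1 - Real.exp (-|f i - f' k|)) ≤ ε / (1 - ε) := by
  -- The eigenvectors are normalised to unit length for their own forms. The mixed products `P(v,
  -- w)` and `Q(v, w)` then differ only in the sign of the exponent `(f i - f' k) / 2`.
  set v : Sp n := Real.exp (-(f i / 2)) • u i with hv
  set w : Sp n := Real.exp (-(f' k / 2)) • u' k with hw
  set g : ℝ := inner ℝ (u i) (u' k) with hg
  set P := diagForm u f
  set Q := diagForm u' f'
  have hexp : ∀ x : ℝ, Real.exp (-(x / 2)) * Real.exp (-(x / 2)) * Real.exp x = 1 := fun x => by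
    rw [← Real.exp_add, ← Real.exp_add, ← Real.exp_zero]; congr 1; ring
  have hPv : P.bil v v = 1 := by
    rw [hv, P.smul_left, P.smul_right, diagForm_frame, if_pos rfl, ← hexp (f i)]; ring
  have hQw : Q.bil w w = 1 := by
    rw [hw, Q.smul_left, Q.smul_right, diagForm_frame, if_pos rfl, ← hexp (f' k)]; ring
  have hPvw : P.bil v w = Real.exp ((f i - f' k) / 2) * g := by
    rw [hv, hw, P.smul_left, P.smul_right, diagForm_frame_left, ← hg]
    have : Real.exp ((f i - f' k) / 2) =
        Real.exp (-(f i / 2)) * (Real.exp (-(f' k / 2)) * Real.exp (f i)) := by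
      rw [← Real.exp_add, ← Real.exp_add]; congr 1; ring
    rw [this]; ring
  have hQvw : Q.bil v w = Real.exp (-((f i - f' k) / 2)) * g := by
    rw [Q.symm, hv, hw, Q.smul_left, Q.smul_right, diagForm_frame_left, real_inner_comm, ← hg]
    have : Real.exp (-((f i - f' k) / 2)) =
        Real.exp (-(f' k / 2)) * (Real.exp (-(f i / 2)) * Real.exp (f' k)) := by
      rw [← Real.exp_add, ← Real.exp_add]; congr 1; ring
    rw [this]; ring
  have hQv : (1 - ε) * Q.bil v v ≤ 1 := by
    have := (abs_le.mp (h v)).1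
    rw [hPv] at this
    linarith
  -- Polarisation: the closeness of the quadratic forms on `v + w` and `v - w` bounds the difference
  -- of the bilinear forms at `(v, w)`.
  have hplus := abs_le.mp (h (v + w))
  have hminus := abs_le.mp (h (v + (-1 : ℝ) • w))
  simp only [PosForm.add_left, PosForm.add_right, PosForm.smul_left,
    PosForm.smul_right] at hplus hminus
  have hPs := P.symm w v
  have hQs := Q.symm w v
  have key : |P.bil v w - Q.bil v w| ≤ ε * (Q.bil v v + Q.bil w w) / 2 := by
    rw [abs_le]
    constructor <;> nlinarith [hplus.1, hplus.2, hminus.1, hminus.2]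
  have h1' : 0 < 1 - ε := by linarith
  have hQv' : Q.bil v v ≤ 1 / (1 - ε) := by rw [le_div_iff₀ h1']; linarith
  have hone : 1 ≤ 1 / (1 - ε) := by rw [le_div_iff₀ h1']; linarith
  have bound : ε * (Q.bil v v + Q.bil w w) / 2 ≤ ε / (1 - ε) := by
    rw [hQw]
    have : ε * (Q.bil v v + 1) ≤ ε * (2 * (1 / (1 - ε))) := by
      apply mul_le_mul_of_nonneg_left _ h0; linarith
    have e : ε / (1 - ε) = ε * (1 / (1 - ε)) := by ring
    rw [e]; linarith
  refine le_trans ?_ (key.trans bound)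
  rw [hPvw, hQvw, ← sub_mul, abs_mul, mul_comm]
  refine mul_le_mul_of_nonneg_right ?_ (abs_nonneg _)
  exact one_sub_exp_neg_abs_le _

/-- Comparison of the ordered eigenvalues on a common invariant subspace. -/
lemma exp_le_mul_exp {u u' : Frame n} {f f' : Fin n → ℝ} {I : Set (Fin n)} {C : ℝ} (hC : 0 ≤ C)
    (hI : Submodule.span ℝ (u '' I) = Submodule.span ℝ (u' '' I))
    (hf : AntitoneOn f I) (hf' : AntitoneOn f' I)
    (h : ∀ v, (diagForm u f).bil v v ≤ C * (diagForm u' f').bil v v) {i : Fin n} (hi : i ∈ I) :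
    Real.exp (f i) ≤ C * Real.exp (f' i) := by
  classical
  have card : ∀ (w : Frame n) (S : Set (Fin n)),
      Module.finrank ℝ (Submodule.span ℝ (w '' S)) = S.ncard := fun w S => by
    have hli : LinearIndependent ℝ (fun x : S => w x) :=
      w.orthonormal.linearIndependent.comp _ Subtype.val_injective
    have := finrank_span_eq_card hli
    rw [← Nat.card_eq_fintype_card, Nat.card_coe_set_eq] at this
    rw [← this, Set.image_eq_range]
  -- Min-max principle. Inside the common span of dimension `|I|` the dimensions of `A` and `B` add
  -- up to `|I| + 1`, so they share a nonzero vector. On `A` the first form is at least `exp (f i)`,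
  -- on `B` the second one is at most `exp (f' i)`.
  set A := Submodule.span ℝ (u '' {k | k ∈ I ∧ k ≤ i})
  set B := Submodule.span ℝ (u' '' {k | k ∈ I ∧ i ≤ k})
  have hA : A ≤ Submodule.span ℝ (u '' I) :=
    Submodule.span_mono (Set.image_mono fun k hk => hk.1)
  have hB : B ≤ Submodule.span ℝ (u '' I) := by
    rw [hI]; exact Submodule.span_mono (Set.image_mono fun k hk => hk.1)
  have hne : A ⊓ B ≠ ⊥ := by
    intro hbot
    have h1 := Submodule.finrank_sup_add_finrank_inf_eq A B
    rw [hbot, finrank_bot, card, card] at h1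
    have h2 := Submodule.finrank_mono (sup_le hA hB)
    rw [card] at h2
    have h3 := Set.ncard_union_add_ncard_inter {k | k ∈ I ∧ k ≤ i} {k | k ∈ I ∧ i ≤ k}
    have h4 : {k | k ∈ I ∧ k ≤ i} ∪ {k | k ∈ I ∧ i ≤ k} = I := by
      ext k
      simp only [Set.mem_union, Set.mem_ofPred_eq]
      constructor
      · rintro (h | h) <;> exact h.1
      · intro h; rcases le_total k i with h' | h' <;> simp [h, h']
    have h5 : {k | k ∈ I ∧ k ≤ i} ∩ {k | k ∈ I ∧ i ≤ k} = {i} := by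
      ext k
      simp only [Set.mem_inter_iff, Set.mem_ofPred_eq, Set.mem_singleton_iff]
      constructor
      · rintro ⟨h, h'⟩; exact le_antisymm h.2 h'.2
      · rintro rfl; exact ⟨⟨hi, le_rfl⟩, ⟨hi, le_rfl⟩⟩
    rw [h4, h5, Set.ncard_singleton] at h3
    omega
  obtain ⟨v, hv, hv0⟩ := Submodule.exists_mem_ne_zero_of_ne_bot hne
  have zero : ∀ (w : Frame n) (S : Set (Fin n)) {k}, k ∉ S → v ∈ Submodule.span ℝ (w '' S) →
      inner ℝ (w k) v = 0 := by
    intro w S k hk hv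
    refine Submodule.span_induction (p := fun x _ => inner ℝ (w k) x = 0) ?_ ?_ ?_ ?_ hv
    · rintro _ ⟨l, hl, rfl⟩
      rw [w.inner_eq, if_neg]; rintro rfl; exact hk hl
    · simp
    · intro x y _ _ hx hy; rw [inner_add_right, hx, hy, add_zero]
    · intro a x _ hx; rw [inner_smul_right, hx, mul_zero]
  have norm : ∀ w : Frame n, ∑ k, inner ℝ (w k) v * inner ℝ (w k) v = inner ℝ v v := fun w => by
    rw [← w.sum_inner_mul_inner]
    exact Finset.sum_congr rfl fun k _ => by rw [real_inner_comm]
  have hpos : 0 < inner ℝ v v := real_inner_self_pos.mpr hv0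
  have lower : Real.exp (f i) * inner ℝ v v ≤ (diagForm u f).bil v v := by
    rw [diagForm_apply, ← norm u, Finset.mul_sum]
    refine Finset.sum_le_sum fun k _ => ?_
    by_cases hk : k ∈ {k | k ∈ I ∧ k ≤ i}
    · rw [mul_assoc]
      exact mul_le_mul_of_nonneg_right (Real.exp_le_exp.mpr (hf hk.1 hi hk.2)) (mul_self_nonneg _)
    · rw [zero u _ hk hv.1]; simp
  have upper : (diagForm u' f').bil v v ≤ Real.exp (f' i) * inner ℝ v v := by
    rw [diagForm_apply, ← norm u', Finset.mul_sum]
    refine Finset.sum_le_sum fun k _ => ?_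
    by_cases hk : k ∈ {k | k ∈ I ∧ i ≤ k}
    · rw [mul_assoc]
      exact mul_le_mul_of_nonneg_right (Real.exp_le_exp.mpr (hf' hi hk.1 hk.2)) (mul_self_nonneg _)
    · rw [zero u' _ hk hv.2]; simp
  have := (lower.trans (h v)).trans (mul_le_mul_of_nonneg_left upper hC)
  rw [← mul_assoc] at this
  exact le_of_mul_le_mul_right this hpos

/-- In the rescaled basis `exp(-g i / 2) u' i` the second form is the unit matrix, so the difference
of the forms is the quadratic form of a matrix minus the identity. It is bounded by the sum of the
absolute values of the entries times the squared length. -/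
lemma abs_diagForm_sub_le (u u' : Frame n) (f g : Fin n → ℝ) (v : Sp n) :
    |(diagForm u f).bil v v - (diagForm u' g).bil v v| ≤
      (∑ i, ∑ k, |Real.exp (-(g i + g k) / 2) * (diagForm u f).bil (u' i) (u' k) -
        if i = k then 1 else 0|) * (diagForm u' g).bil v v := by
  set P := diagForm u f with hP
  set y : Fin n → ℝ := fun i => Real.exp (g i / 2) * inner ℝ (u' i) v with hy
  set M : Fin n → Fin n → ℝ := fun i k => Real.exp (-(g i + g k) / 2) * P.bil (u' i) (u' k) with hM
  have hQ : (diagForm u' g).bil v v = ∑ i, y i * y i := by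
    rw [diagForm_apply]
    refine Finset.sum_congr rfl fun i _ => ?_
    have : Real.exp (g i) = Real.exp (g i / 2) * Real.exp (g i / 2) := by
      rw [← Real.exp_add]; congr 1; ring
    rw [this]; simp only [hy]; ring
  have hPv : P.bil v v = ∑ i, ∑ k, M i k * (y i * y k) := by
    conv_lhs => rw [← u'.sum_repr' v]
    rw [P.sum_left]
    refine Finset.sum_congr rfl fun i _ => ?_
    rw [P.sum_right]
    refine Finset.sum_congr rfl fun k _ => ?_
    rw [P.smul_left, P.smul_right]
    have : Real.exp (-(g i + g k) / 2) * (Real.exp (g i / 2) * Real.exp (g k / 2)) = 1 := by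
      rw [← Real.exp_add, ← Real.exp_add, ← Real.exp_zero]; congr 1; ring
    simp only [hM, hy]
    linear_combination (-(inner ℝ (u' i) v * inner ℝ (u' k) v * P.bil (u' i) (u' k))) * this
  have hQ' : ∑ i, y i * y i = ∑ i, ∑ k, (if i = k then (1 : ℝ) else 0) * (y i * y k) := by
    simp
  have hb : ∀ i k, |y i * y k| ≤ ∑ l, y l * y l := by
    intro i k
    have h1 : y i * y i ≤ ∑ l, y l * y l :=
      Finset.single_le_sum (f := fun l => y l * y l) (fun l _ => mul_self_nonneg _)
        (Finset.mem_univ i)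
    have h2 : y k * y k ≤ ∑ l, y l * y l :=
      Finset.single_le_sum (f := fun l => y l * y l) (fun l _ => mul_self_nonneg _)
        (Finset.mem_univ k)
    rw [abs_le]
    constructor <;> nlinarith [mul_self_nonneg (y i - y k), mul_self_nonneg (y i + y k)]
  rw [hPv, hQ]
  conv_lhs => rw [hQ']
  rw [← Finset.sum_sub_distrib, Finset.sum_mul]
  refine (Finset.abs_sum_le_sum_abs _ _).trans (Finset.sum_le_sum fun i _ => ?_)
  rw [← Finset.sum_sub_distrib, Finset.sum_mul]
  refine (Finset.abs_sum_le_sum_abs _ _).trans (Finset.sum_le_sum fun k _ => ?_)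
  rw [← sub_mul, abs_mul]
  exact mul_le_mul_of_nonneg_left (hb i k) (abs_nonneg _)

lemma Frame.inner_eq_zero_of_span {u u' : Frame n} {I : Set (Fin n)}
    (h : Submodule.span ℝ (u '' I) = Submodule.span ℝ (u' '' I)) {i k : Fin n} (hk : k ∈ I)
    (hi : i ∉ I) : inner ℝ (u' i) (u k) = 0 := by
  have hv : u k ∈ Submodule.span ℝ (u' '' I) := h ▸ Submodule.subset_span ⟨k, hk, rfl⟩
  refine Submodule.span_induction (p := fun x _ => inner ℝ (u' i) x = 0) ?_ ?_ ?_ ?_ hv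
  · rintro _ ⟨l, hl, rfl⟩
    rw [u'.inner_eq, if_neg]; rintro rfl; exact hi hl
  · simp
  · intro x y _ _ hx hy; rw [inner_add_right, hx, hy, add_zero]
  · intro a x _ hx; rw [inner_smul_right, hx, mul_zero]

lemma Frame.abs_inner_le (u u' : Frame n) (i k : Fin n) : |inner ℝ (u i) (u' k)| ≤ 1 := by
  refine (abs_real_inner_le_norm _ _).trans ?_
  rw [u.norm_eq_one, u'.norm_eq_one, one_mul]

open scoped Classical in
/-- The ratios of eigenvalues inside the classes of an equivalence relation. -/
def ratioOf (T : Setoid (Fin n)) (f : Fin n → ℝ) (i k : Fin n) : ℝ :=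
  if T i k then Real.exp (-|f i - f k|) else 0

lemma tendsto_exp_neg_abs {J : Type} {l : Filter J} {g : J → ℝ} (h : Tendsto g l atTop) :
    Tendsto (fun j => Real.exp (-|g j|)) l (𝓝 0) :=
  Real.tendsto_exp_neg_atTop_nhds_zero.comp (tendsto_abs_atTop_atTop.comp h)

/-- Asymptotics of the eigenvalues and of the eigenvectors of a family of forms that is close
to a family of block diagonal forms. The classes of `S` are the blocks preserved by the
forms, the classes of `T` are the blocks of equal order of growth. -/
lemma tendsto_spectral {J : Type} {l : Filter J} {S T : Setoid (Fin n)} {w w' : J → Frame n}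
    {u : Frame n} {g b : J → Fin n → ℝ} {f : Fin n → ℝ}
    (hspan : ∀ j i, Submodule.span ℝ (w j '' {k | S i k}) = Submodule.span ℝ (w' j '' {k | S i k}))
    (hg : ∀ j i k, i ≤ k → S i k → g j k ≤ g j i)
    (hf : ∀ i k, i ≤ k → T i k → f k ≤ f i)
    (hbT : ∀ j i k, T i k → b j i = b j k)
    (hbS : ∀ i k, i ≤ k → S i k → ¬ T i k → Tendsto (fun j => b j i - b j k) l atTop)
    (hw' : ∀ i, Tendsto (fun j => w' j i) l (𝓝 (u i)))
    (hM : ∀ i k, Tendsto (fun j => Real.exp (-(b j i + b j k) / 2) *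
      (diagForm (w j) (g j)).bil (w' j i) (w' j k)) l (𝓝 (if i = k then Real.exp (f i) else 0))) :
    (∀ i, Tendsto (fun j => g j i - b j i) l (𝓝 (f i))) ∧
    (∀ i k, S i k → Tendsto (fun j => Real.exp (-|g j i - g j k|)) l (𝓝 (ratioOf T f i k))) ∧
    (∀ i k, Tendsto (fun j => inner ℝ (u i) (w j k) * (1 - ratioOf T f i k)) l (𝓝 0)) := by
  -- `ε j` measures the relative distance of the given form from the model form with frame `w' j`
  -- and exponents `b j + f`.
  set ε : J → ℝ := fun j => ∑ i, ∑ k, |Real.exp (-((b j i + f i) + (b j k + f k)) / 2) *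
    (diagForm (w j) (g j)).bil (w' j i) (w' j k) - if i = k then 1 else 0| with hε
  have hε0 : ∀ j, 0 ≤ ε j := fun j =>
    Finset.sum_nonneg fun _ _ => Finset.sum_nonneg fun _ _ => abs_nonneg _
  have hεt : Tendsto ε l (𝓝 0) := by
    have : Tendsto ε l (𝓝 (∑ i : Fin n, ∑ k : Fin n, (0 : ℝ))) := by
      refine tendsto_finsetSum _ fun i _ => tendsto_finsetSum _ fun k _ => ?_
      refine (tendsto_zero_iff_abs_tendsto_zero _).mp ?_
      have h1 := (hM i k).const_mul (Real.exp (-(f i + f k) / 2))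
      have h2 := h1.sub_const (if i = k then (1 : ℝ) else 0)
      have e : Real.exp (-(f i + f k) / 2) * (if i = k then Real.exp (f i) else 0) -
          (if i = k then (1 : ℝ) else 0) = 0 := by
        split_ifs with hik
        · subst hik
          rw [← Real.exp_add, sub_eq_zero, ← Real.exp_zero]; congr 1; ring
        · simp
      rw [e] at h2
      refine h2.congr fun j => ?_
      rw [← mul_assoc, ← Real.exp_add]
      congr 4; ring
    simpa using this
  have hε1 : ∀ᶠ j in l, ε j < 1 := hεt.eventually_lt_const zero_lt_one
  have hcomp : ∀ j v, |(diagForm (w j) (g j)).bil v v - (diagForm (w' j) (b j + f)).bil v v| ≤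
      ε j * (diagForm (w' j) (b j + f)).bil v v := fun j v => abs_diagForm_sub_le _ _ _ _ v
  -- The min-max comparison needs ordered exponents. Inside a class of `T` the order comes from `f`;
  -- between different classes of `T` in one class of `S` it holds eventually, because the gaps of
  -- `b j` tend to infinity.
  have hanti : ∀ᶠ j in l, ∀ i, AntitoneOn (b j + f) {k | S i k} := by
    have : ∀ᶠ j in l, ∀ k k', k ≤ k' → S k k' → (b j + f) k' ≤ (b j + f) k := by
      rw [eventually_all]; intro k; rw [eventually_all]; intro k'
      by_cases h : k ≤ k' ∧ S k k'
      · by_cases hT : T k k'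
        · refine Eventually.of_forall fun j _ _ => ?_
          simp only [Pi.add_apply]
          rw [hbT j k k' hT]
          linarith [hf k k' h.1 hT]
        · filter_upwards [(hbS k k' h.1 h.2 hT).eventually_ge_atTop (f k' - f k)] with j hj _ _
          simp only [Pi.add_apply]
          linarith
      · exact Eventually.of_forall fun j h1 h2 => absurd ⟨h1, h2⟩ h
    filter_upwards [this] with j hj i k hk k' hk' hkk'
    exact hj k k' hkk' (S.trans (S.symm hk) hk')
  have hgI : ∀ j i, AntitoneOn (g j) {k | S i k} := fun j i k hk k' hk' hkk' =>
    hg j k k' hkk' (S.trans (S.symm hk) hk')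
  -- The min-max comparison in both directions squeezes the quotient of the ordered eigenvalues
  -- between `1 - ε j` and `1 + ε j`.
  have hexp : ∀ i, Tendsto (fun j => Real.exp (g j i - (b j i + f i))) l (𝓝 1) := by
    intro i
    have hup : Tendsto (fun j => 1 + ε j) l (𝓝 1) := by simpa using hεt.const_add 1
    have hlo : Tendsto (fun j => 1 - ε j) l (𝓝 1) := by simpa using hεt.const_sub 1
    refine tendsto_of_tendsto_of_tendsto_of_le_of_le' hlo hup ?_ ?_
    · filter_upwards [hε1, hanti] with j hj1 hja
      have hpos : 0 < 1 - ε j := by linarith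
      have := exp_le_mul_exp (C := 1 / (1 - ε j)) (by positivity) (hspan j i).symm
        (hja i) (hgI j i) (fun v => by
          rw [div_mul_eq_mul_div, one_mul, le_div_iff₀ hpos]
          have := (abs_le.mp (hcomp j v)).1
          linarith) (S.refl i)
      rw [div_mul_eq_mul_div, one_mul, le_div_iff₀ hpos] at this
      rw [Real.exp_sub, le_div_iff₀ (Real.exp_pos _), mul_comm]
      exact this
    · filter_upwards [hanti] with j hja
      have := exp_le_mul_exp (C := 1 + ε j) (by linarith [hε0 j]) (hspan j i)
        (hgI j i) (hja i) (fun v => by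
          have := (abs_le.mp (hcomp j v)).2
          linarith) (S.refl i)
      rw [Real.exp_sub, div_le_iff₀ (Real.exp_pos _)]
      exact this
  have hlim : ∀ i, Tendsto (fun j => g j i - b j i) l (𝓝 (f i)) := by
    intro i
    have h1 := ((Real.continuousAt_log one_ne_zero).tendsto.comp (hexp i)).add_const (f i)
    rw [Real.log_one, zero_add] at h1
    refine h1.congr fun j => ?_
    simp only [Function.comp, Real.log_exp]
    ring
  have hS : ∀ i k, S i k → Tendsto (fun j => Real.exp (-|g j k - (b j i + f i)|)) l
      (𝓝 (ratioOf T f i k)) := by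
    intro i k hik
    by_cases hT : T i k
    · rw [ratioOf, if_pos hT, abs_sub_comm]
      refine (Real.continuous_exp.tendsto _).comp (Tendsto.neg (Tendsto.abs ?_))
      refine ((hlim k).sub_const (f i)).congr fun j => ?_
      rw [hbT j i k hT]; ring
    · rw [ratioOf, if_neg hT]
      rcases le_total i k with h | h
      · have h1 := (hbS i k h hik hT).atTop_add ((hlim k).const_sub (f i))
        refine (tendsto_exp_neg_abs h1).congr fun j => ?_
        rw [← abs_neg]; congr 3; ring
      · have h1 := (hbS k i h (S.symm hik) fun h => hT (T.symm h)).atTop_add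
          ((hlim k).sub_const (f i))
        refine (tendsto_exp_neg_abs h1).congr fun j => ?_
        congr 3; ring
  refine ⟨hlim, fun i k hik => ?_, fun i k => ?_⟩
  · by_cases hT : T i k
    · rw [ratioOf, if_pos hT]
      refine (Real.continuous_exp.tendsto _).comp (Tendsto.neg (Tendsto.abs ?_))
      refine ((hlim i).sub (hlim k)).congr fun j => ?_
      rw [hbT j i k hT]; ring
    · rw [ratioOf, if_neg hT]
      rcases le_total i k with h | h
      · have h1 := (hbS i k h hik hT).atTop_add ((hlim i).sub (hlim k))
        refine (tendsto_exp_neg_abs h1).congr fun j => ?_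
        congr 3; ring
      · have h1 := (hbS k i h (S.symm hik) fun h => hT (T.symm h)).atTop_add
          ((hlim k).sub (hlim i))
        refine (tendsto_exp_neg_abs h1).congr fun j => ?_
        rw [← abs_neg]; congr 3; ring
  -- The limiting frame `u` may be replaced by `w' j`, for which the exact estimate
  -- `abs_inner_mul_le` is available; vectors in different classes of `S` are orthogonal outright.
  · have hdiff : Tendsto (fun j => inner ℝ (u i) (w j k) - inner ℝ (w' j i) (w j k)) l (𝓝 0) := by
      have h1 : Tendsto (fun j => ‖u i - w' j i‖) l (𝓝 0) := by
        have := ((hw' i).const_sub (u i)).norm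
        simpa using this
      refine squeeze_zero_norm (fun j => ?_) h1
      rw [← inner_sub_left]
      refine (norm_inner_le_norm _ _).trans ?_
      rw [(w j).norm_eq_one, mul_one]
    have hmain : Tendsto (fun j => inner ℝ (w' j i) (w j k) * (1 - ratioOf T f i k)) l (𝓝 0) := by
      by_cases hik : S i k
      · have h1 : Tendsto (fun j => inner ℝ (w' j i) (w j k) *
            (1 - Real.exp (-|g j k - (b j i + f i)|))) l (𝓝 0) := by
          have hb : Tendsto (fun j => ε j / (1 - ε j)) l (𝓝 0) := by
            have := hεt.div (hεt.const_sub 1) (by norm_num)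
            rw [zero_div] at this
            exact this
          refine squeeze_zero_norm' ?_ hb
          filter_upwards [hε1] with j hj
          have := abs_inner_mul_le (hε0 j) hj (hcomp j) k i
          rw [real_inner_comm] at this
          rw [Real.norm_eq_abs, abs_mul,
            abs_of_nonneg (a := 1 - _) (sub_nonneg.mpr (Real.exp_le_one_iff.mpr (by simp)))]
          exact this
        have h2 : Tendsto (fun j => inner ℝ (w' j i) (w j k) *
            (Real.exp (-|g j k - (b j i + f i)|) - ratioOf T f i k)) l (𝓝 0) := by
          have := ((hS i k hik).sub_const (ratioOf T f i k)).norm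
          rw [sub_self, norm_zero] at this
          refine squeeze_zero_norm (fun j => ?_) this
          rw [norm_mul]
          exact mul_le_of_le_one_left (norm_nonneg _) ((w' j).abs_inner_le (w j) i k)
        have := h1.add h2
        rw [add_zero] at this
        refine this.congr fun j => ?_
        ring
      · refine tendsto_const_nhds.congr fun j => ?_
        rw [Frame.inner_eq_zero_of_span (hspan j k) (S.refl k) fun h => hik (S.symm h), zero_mul]
    have := (hdiff.mul_const (1 - ratioOf T f i k)).add hmain
    rw [zero_mul, add_zero] at this
    refine this.congr fun j => ?_
    ring

/-- The spectral theorem. -/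
lemma exists_diagForm (P : PosForm (Sp n)) :
    ∃ u : Frame n, P = diagForm u (fun i => Real.log (P.eig i)) ∧
      Antitone fun i => Real.log (P.eig i) := by
  -- `σ` matches the decreasing list of eigenvalues with the indexing used for the eigenvector
  -- basis.
  set σ : Fin n ≃ Fin n := (finCongr (Fintype.card_fin n).symm).trans
    (Fintype.equivOfCardEq (Fintype.card_fin _)) with hσ
  have heig : ∀ i, P.matrix_isHermitian.eigenvalues (σ i) = P.eig i := by
    intro i
    simp only [Matrix.IsHermitian.eigenvalues, hσ, Equiv.trans_apply, Equiv.symm_apply_apply]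
    rfl
  set u : Frame n := P.matrix_isHermitian.eigenvectorBasis.reindex σ.symm
  have hu : ∀ i, u i = P.matrix_isHermitian.eigenvectorBasis (σ i) := fun i => by simp [u]
  have hP : ∀ v w, P.bil v w = inner ℝ v (WithLp.toLp 2 (P.matrix.mulVec w.ofLp)) := by
    intro v w
    have hx : ∀ v : Sp n, v = ∑ i, v i • EuclideanSpace.single i (1 : ℝ) := by
      intro v
      ext k
      simp [Finset.sum_apply, Pi.single_apply]
    conv_lhs => rw [hx v, hx w]
    rw [P.sum_left]
    simp only [EuclideanSpace.inner_eq_star_dotProduct, dotProduct, Matrix.mulVec, star_trivial]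
    refine Finset.sum_congr rfl fun i _ => ?_
    rw [P.sum_right, Finset.sum_mul]
    refine Finset.sum_congr rfl fun k _ => ?_
    rw [P.smul_left, P.smul_right]
    change _ = P.bil _ _ * _ * _
    ring
  refine ⟨u, PosForm.ext_iff'.mpr fun v w => ?_, fun i k hik => ?_⟩
  · conv_lhs => rw [← u.sum_repr' w]
    rw [P.sum_right, diagForm_apply]
    refine Finset.sum_congr rfl fun i _ => ?_
    rw [P.smul_right, hP, hu, Matrix.IsHermitian.mulVec_eigenvectorBasis, heig,
      Real.exp_log (P.eig_pos i)]
    rw [WithLp.toLp_smul, WithLp.toLp_ofLp, inner_smul_right, real_inner_comm v]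
    ring
  · exact Real.log_le_log (P.eig_pos k) (P.matrix_isHermitian.eigenvalues₀_antitone hik)

/-! ### Cells of flags -/

section Cells

variable {V : Type} [AddCommGroup V] [Module ℝ V] {F F' : PFlag V}

lemma PFlag.ext' {F F' : PFlag V} (h : F.carrier = F'.carrier) : F = F' := by
  cases F; cases F'; cases h; rfl

lemma Cell.ext' {c d : Cell F} (h : c.lo = d.lo) (h' : c.hi = d.hi) : c = d := by
  cases c; cases d; cases h; cases h'; rfl

lemma Cell.le_lo_or_hi_le (c : Cell F) {W : Submodule ℝ V} (hW : W ∈ F.carrier) :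
    W ≤ c.lo ∨ c.hi ≤ W := by
  rcases F.chain.total hW c.lo_mem with h | h
  · exact Or.inl h
  rcases F.chain.total hW c.hi_mem with h' | h'
  · by_contra! hc
    exact c.gap W hW ⟨lt_of_le_not_ge h hc.1, lt_of_le_not_ge h' hc.2⟩
  · exact Or.inr h'

lemma Cell.not_hi_le_lo (c : Cell F) : ¬ c.hi ≤ c.lo := not_le_of_gt c.lt

lemma Cell.trichotomy (c d : Cell F) : c = d ∨ c.hi ≤ d.lo ∨ d.hi ≤ c.lo := by
  rcases d.le_lo_or_hi_le c.hi_mem with h | h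
  · exact Or.inr (Or.inl h)
  rcases c.le_lo_or_hi_le d.hi_mem with h' | h'
  · exact Or.inr (Or.inr h')
  have hh := le_antisymm h' h
  refine Or.inl (Cell.ext' (le_antisymm ?_ ?_) hh)
  · rcases d.le_lo_or_hi_le c.lo_mem with k | k
    · exact k
    · exact absurd (hh.le.trans k) c.not_hi_le_lo
  · rcases c.le_lo_or_hi_le d.lo_mem with k | k
    · exact k
    · exact absurd (hh.ge.trans k) d.not_hi_le_lo

lemma Cell.eq_of_mem {c d : Cell F} {v : V} (h1 : v ∈ c.hi) (h2 : v ∉ c.lo) (h3 : v ∈ d.hi)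
    (h4 : v ∉ d.lo) : c = d := by
  rcases c.trichotomy d with h | h | h
  · exact h
  · exact absurd (h h1) h4
  · exact absurd (h h3) h2

lemma Cell.proj_eq_zero (c : Cell F) {v : V} (hv : v ∈ c.hi) : c.proj v hv = 0 ↔ v ∈ c.lo := by
  rw [Cell.proj, Submodule.mkQ_apply, Submodule.Quotient.mk_eq_zero]
  exact Iff.rfl

lemma Cell.proj_surjective (c : Cell F) (x : c.Gr) : ∃ v, ∃ hv : v ∈ c.hi, c.proj v hv = x := by
  obtain ⟨v, rfl⟩ := Submodule.mkQ_surjective _ x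
  exact ⟨v.1, v.2, rfl⟩

lemma Cell.proj_eq (c : Cell F) {v w : V} (hv : v ∈ c.hi) (hw : w ∈ c.hi) :
    c.proj v hv = c.proj w hw ↔ v - w ∈ c.lo := by
  rw [Cell.proj, Cell.proj, Submodule.mkQ_apply, Submodule.mkQ_apply, Submodule.Quotient.eq]
  exact Iff.rfl

lemma Cell.Inside.unique {d : Cell F'} {c c' : Cell F} (h : d.Inside c) (h' : d.Inside c') :
    c = c' := by
  obtain ⟨v, hv, hv'⟩ := SetLike.exists_of_lt d.lt
  exact Cell.eq_of_mem (h.2 hv) (fun k => hv' (h.1 k)) (h'.2 hv) (fun k => hv' (h'.1 k))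

variable [FiniteDimensional ℝ V]

/-- The cell consists of the smallest member that contains `v` and the largest member that does not;
both exist in finite dimension. -/
lemma PFlag.exists_cell_mem (F : PFlag V) {v : V} (hv : v ≠ 0) :
    ∃ c : Cell F, v ∈ c.hi ∧ v ∉ c.lo := by
  obtain ⟨A, ⟨hA, hvA⟩, hAmin⟩ := WellFounded.has_min (wellFounded_lt (α := Submodule ℝ V))
    {W | W ∈ F.carrier ∧ v ∈ W} ⟨⊤, F.top_mem, Submodule.mem_top⟩
  obtain ⟨B, ⟨hB, hvB⟩, hBmax⟩ := WellFounded.has_min (wellFounded_gt (α := Submodule ℝ V))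
    {W | W ∈ F.carrier ∧ v ∉ W} ⟨⊥, F.bot_mem, by simpa using hv⟩
  have hBA : B < A := by
    rcases F.chain.total hB hA with h | h
    · exact lt_of_le_of_ne h (fun h => hvB (h ▸ hvA))
    · exact absurd (h hvA) hvB
  refine ⟨⟨B, A, hB, hA, hBA, fun W hW ⟨h1, h2⟩ => ?_⟩, hvA, hvB⟩
  by_cases hv : v ∈ W
  · exact hAmin W ⟨hW, hv⟩ h2
  · exact hBmax W ⟨hW, hv⟩ h1

lemma Cell.finrank_lt (c : Cell F) : Module.finrank ℝ c.lo < Module.finrank ℝ c.hi :=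
  Submodule.finrank_lt_finrank_of_lt c.lt

/-- A cell is determined by the dimension of its upper member, since different cells are comparable.
-/
instance : Finite (Cell F) := by
  refine Finite.of_injective (fun c : Cell F => (⟨Module.finrank ℝ c.hi,
    Nat.lt_succ_of_le (Submodule.finrank_le c.hi)⟩ : Fin (Module.finrank ℝ V + 1))) ?_
  intro c d h
  have h : Module.finrank ℝ c.hi = Module.finrank ℝ d.hi := congrArg Fin.val h
  rcases c.trichotomy d with h' | h' | h'
  · exact h'
  · have := Submodule.finrank_mono h'
    have := d.finrank_lt
    omega
  · have := Submodule.finrank_mono h'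
    have := c.finrank_lt
    omega

instance : Fintype (Cell F) := Fintype.ofFinite _

/-- Each cell of a refinement lies in a cell of the flag. -/
lemma Cell.exists_inside (h : F.carrier ⊆ F'.carrier) (d : Cell F') :
    ∃ c : Cell F, d.Inside c := by
  obtain ⟨v, hv, hv'⟩ := SetLike.exists_of_lt d.lt
  obtain ⟨c, hc, hc'⟩ := F.exists_cell_mem (v := v) (fun h => hv' (h ▸ d.lo.zero_mem))
  refine ⟨c, ?_, ?_⟩
  · rcases d.le_lo_or_hi_le (h c.lo_mem) with k | k
    · exact k
    · exact absurd (k hv) hc'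
  · rcases d.le_lo_or_hi_le (h c.hi_mem) with k | k
    · exact absurd (k hc) hv'
    · exact k

lemma Cell.exists_inside_mem (h : F.carrier ⊆ F'.carrier) (c : Cell F) {v : V} (hv : v ∈ c.hi)
    (hv' : v ∉ c.lo) : ∃ d : Cell F', d.Inside c ∧ v ∈ d.hi ∧ v ∉ d.lo := by
  obtain ⟨d, hd, hd'⟩ := F'.exists_cell_mem (v := v) (fun h => hv' (h ▸ c.lo.zero_mem))
  refine ⟨d, ⟨?_, ?_⟩, hd, hd'⟩
  · rcases d.le_lo_or_hi_le (h c.lo_mem) with k | k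
    · exact k
    · exact absurd (k hd) hv'
  · rcases d.le_lo_or_hi_le (h c.hi_mem) with k | k
    · exact absurd (k hv) hd'
    · exact k

end Cells

/-! ### Indices of cells -/

/-- The indices of the vectors, in the order of decreasing eigenvalues, that span a member `W` of a
flag. -/
def tailSet (W : Submodule ℝ (Sp n)) : Set (Fin n) := {i | n ≤ i + Module.finrank ℝ W}

lemma mem_tailSet {W : Submodule ℝ (Sp n)} {i : Fin n} :
    i ∈ tailSet W ↔ n ≤ i + Module.finrank ℝ W := Iff.rfl

lemma tailSet_mono {W W' : Submodule ℝ (Sp n)} (h : W ≤ W') : tailSet W ⊆ tailSet W' := by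
  intro i hi
  have := Submodule.finrank_mono h
  rw [mem_tailSet] at *
  omega

lemma tailSet_upper {W : Submodule ℝ (Sp n)} {i k : Fin n} (hi : i ∈ tailSet W) (hik : i ≤ k) :
    k ∈ tailSet W := by
  rw [mem_tailSet] at *
  have : (i : ℕ) ≤ k := hik
  omega

lemma finrank_le (W : Submodule ℝ (Sp n)) : Module.finrank ℝ W ≤ n := by
  simpa using Submodule.finrank_le W

lemma exists_mem_tailSet {W W' : Submodule ℝ (Sp n)} (h : W < W') :
    ∃ i ∈ tailSet W', i ∉ tailSet W := by
  have h1 := Submodule.finrank_lt_finrank_of_lt h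
  have h2 := finrank_le W'
  refine ⟨⟨n - Module.finrank ℝ W', by omega⟩, ?_, ?_⟩ <;> rw [mem_tailSet] <;> simp <;> omega

section Index

variable {F F' : PFlag (Sp n)}

/-- The index `i` belongs to the cell `c`. -/
def Cell.Has (c : Cell F) (i : Fin n) : Prop := i ∈ tailSet c.hi ∧ i ∉ tailSet c.lo

lemma Cell.exists_has (c : Cell F) : ∃ i, c.Has i := exists_mem_tailSet c.lt

lemma Cell.Has.unique {c d : Cell F} {i : Fin n} (h : c.Has i) (h' : d.Has i) : c = d := by
  rcases c.trichotomy d with k | k | k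
  · exact k
  · exact absurd (tailSet_mono k h.1) h'.2
  · exact absurd (tailSet_mono k h'.1) h.2

lemma PFlag.exists_has (F : PFlag (Sp n)) (i : Fin n) : ∃ c : Cell F, c.Has i := by
  obtain ⟨A, ⟨hA, hvA⟩, hAmin⟩ := WellFounded.has_min (wellFounded_lt (α := Submodule ℝ (Sp n)))
    {W | W ∈ F.carrier ∧ i ∈ tailSet W} ⟨⊤, F.top_mem, by rw [mem_tailSet]; simp⟩
  obtain ⟨B, ⟨hB, hvB⟩, hBmax⟩ := WellFounded.has_min (wellFounded_gt (α := Submodule ℝ (Sp n)))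
    {W | W ∈ F.carrier ∧ i ∉ tailSet W} ⟨⊥, F.bot_mem, by rw [mem_tailSet]; simp⟩
  have hBA : B < A := by
    rcases F.chain.total hB hA with h | h
    · exact lt_of_le_of_ne h (fun h => hvB (h ▸ hvA))
    · exact absurd (tailSet_mono h hvA) hvB
  refine ⟨⟨B, A, hB, hA, hBA, fun W hW ⟨h1, h2⟩ => ?_⟩, hvA, hvB⟩
  by_cases hv : i ∈ tailSet W
  · exact hAmin W ⟨hW, hv⟩ h2
  · exact hBmax W ⟨hW, hv⟩ h1

/-- The cell of an index. -/
def PFlag.cellOf (F : PFlag (Sp n)) (i : Fin n) : Cell F := (F.exists_has i).choose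

lemma PFlag.cellOf_has (F : PFlag (Sp n)) (i : Fin n) : (F.cellOf i).Has i :=
  (F.exists_has i).choose_spec

lemma Cell.has_iff {c : Cell F} {i : Fin n} : c.Has i ↔ F.cellOf i = c :=
  ⟨fun h => (F.cellOf_has i).unique h, fun h => h ▸ F.cellOf_has i⟩

/-- Indices in the same cell. -/
def PFlag.rel (F : PFlag (Sp n)) : Setoid (Fin n) := Setoid.ker F.cellOf

lemma PFlag.rel_def {i k : Fin n} : F.rel i k ↔ F.cellOf i = F.cellOf k := Iff.rfl

lemma Cell.Has.rel {c : Cell F} {i k : Fin n} (hi : c.Has i) (hk : c.Has k) : F.rel i k :=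
  PFlag.rel_def.mpr ((Cell.has_iff.mp hi).trans (Cell.has_iff.mp hk).symm)

lemma Cell.mem_tailSet_of_has {c : Cell F} {i : Fin n} (h : c.Has i) {W : Submodule ℝ (Sp n)}
    (hW : W ∈ F.carrier) : i ∈ tailSet W ↔ c.hi ≤ W := by
  constructor
  · intro hi
    rcases c.le_lo_or_hi_le hW with k | k
    · exact absurd (tailSet_mono k hi) h.2
    · exact k
  · exact fun k => tailSet_mono k h.1

lemma PFlag.rel_iff {i k : Fin n} :
    F.rel i k ↔ ∀ W ∈ F.carrier, i ∈ tailSet W ↔ k ∈ tailSet W := by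
  constructor
  · intro h W hW
    rw [Cell.mem_tailSet_of_has (F.cellOf_has i) hW, Cell.mem_tailSet_of_has (F.cellOf_has k) hW,
      PFlag.rel_def.mp h]
  · intro h
    have hk := F.cellOf_has i
    exact hk.rel ⟨(h _ (F.cellOf i).hi_mem).mp hk.1,
      fun h' => hk.2 ((h _ (F.cellOf i).lo_mem).mpr h')⟩

lemma PFlag.rel_mono (h : F.carrier ⊆ F'.carrier) {i k : Fin n} (hik : F'.rel i k) : F.rel i k :=
  PFlag.rel_iff.mpr fun W hW => PFlag.rel_iff.mp hik W (h hW)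

/-- The sets `tailSet W` are closed upwards, so the classes of indices are intervals. -/
lemma PFlag.rel_convex {i j k : Fin n} (h : F.rel i k) (hij : i ≤ j) (hjk : j ≤ k) :
    F.rel i j :=
  PFlag.rel_iff.mpr fun W hW => ⟨fun hi => tailSet_upper hi hij,
    fun hj => (PFlag.rel_iff.mp h W hW).mpr (tailSet_upper hj hjk)⟩

lemma PFlag.cellOf_inside (h : F.carrier ⊆ F'.carrier) (i : Fin n) :
    (F'.cellOf i).Inside (F.cellOf i) := by
  have hF := F.cellOf_has i
  have hF' := F'.cellOf_has i
  constructor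
  · rcases (F'.cellOf i).le_lo_or_hi_le (h (F.cellOf i).lo_mem) with k | k
    · exact k
    · exact absurd (tailSet_mono k hF'.1) hF.2
  · rcases (F'.cellOf i).le_lo_or_hi_le (h (F.cellOf i).hi_mem) with k | k
    · exact absurd (tailSet_mono k hF.1) hF'.2
    · exact k

lemma Cell.Has.of_inside {d : Cell F'} {c : Cell F} (h : d.Inside c) {i : Fin n} (hi : d.Has i) :
    c.Has i :=
  ⟨tailSet_mono h.2 hi.1, fun h' => hi.2 (tailSet_mono h.1 h')⟩

lemma Cell.inside_of_has (h : F.carrier ⊆ F'.carrier) {d : Cell F'} {c : Cell F} {i : Fin n}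
    (hd : d.Has i) (hc : c.Has i) : d.Inside c := by
  rw [← Cell.has_iff.mp hd, ← Cell.has_iff.mp hc]
  exact PFlag.cellOf_inside h i

lemma Cell.lt_of_hi_le_lo {c d : Cell F} (h : c.hi ≤ d.lo) {i k : Fin n} (hi : d.Has i)
    (hk : c.Has k) : i < k := by
  by_contra! hki
  exact hi.2 (tailSet_upper (tailSet_mono h hk.1) hki)

lemma Cell.hi_le_lo_of_lt {c d : Cell F} (hcd : c ≠ d) {i k : Fin n} (hi : d.Has i)
    (hk : c.Has k) (hik : i ≤ k) : c.hi ≤ d.lo := by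
  rcases c.trichotomy d with h | h | h
  · exact absurd h hcd
  · exact h
  · exact absurd (Cell.lt_of_hi_le_lo h hk hi) (not_lt.mpr hik)

/-- The relation of the trivial flag relates everything. -/
lemma PFlag.trivial_rel (i k : Fin n) : (PFlag.trivial (Sp n)).rel i k := by
  rw [PFlag.rel_iff]
  rintro W (rfl | rfl) <;> (simp [mem_tailSet]; try omega)

/-- A member `W` of `F'` missing in `F` would lie strictly between the two members of a cell of `F`.
It would then separate two indices of this cell, which are related for `F` but not for `F'`. -/
lemma PFlag.eq_of_rel (h : F.carrier ⊆ F'.carrier) (hr : ∀ i k, F.rel i k → F'.rel i k) :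
    F = F' := by
  refine PFlag.ext' (Set.Subset.antisymm h fun W hW => ?_)
  by_contra hWF
  obtain ⟨A, ⟨hA, hvA⟩, hAmin⟩ := WellFounded.has_min (wellFounded_lt (α := Submodule ℝ (Sp n)))
    {A | A ∈ F.carrier ∧ W ≤ A} ⟨⊤, F.top_mem, le_top⟩
  have hWA : W < A := lt_of_le_of_ne hvA (fun k => hWF (k ▸ hA))
  obtain ⟨k, hk, hk'⟩ := exists_mem_tailSet hWA
  have hc := F.cellOf_has k
  set c := F.cellOf k
  have hcA : c.hi ≤ A := (Cell.mem_tailSet_of_has hc hA).mp hk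
  have hlo : c.lo < W := by
    rcases F'.chain.total (h c.lo_mem) hW with h' | h'
    · exact lt_of_le_of_ne h' (fun k => hWF (k ▸ c.lo_mem))
    · exact absurd (c.lt.trans_le hcA) (hAmin _ ⟨c.lo_mem, h'⟩)
  obtain ⟨j, hj, hj'⟩ := exists_mem_tailSet hlo
  have hWhi : W ≤ c.hi := by
    rcases F'.chain.total hW (h c.hi_mem) with h' | h'
    · exact h'
    · exact absurd (tailSet_mono h' hc.1) hk'
  have hcj : c.Has j := ⟨tailSet_mono hWhi hj, hj'⟩
  exact hk' ((PFlag.rel_iff.mp (hr j k (hcj.rel hc)) W hW).mp hj)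

end Index

/-! ### Orthogonal splittings given by flags -/

section Lift

variable {F : PFlag (Sp n)}

/-- The embedding of a subquotient as the orthogonal complement of `lo` in `hi`. -/
def Cell.lift (c : Cell F) : c.Gr →ₗ[ℝ] Sp n :=
  (c.lo.submoduleOf c.hi).liftQ
    ((LinearMap.id - c.lo.starProjection.toLinearMap) ∘ₗ c.hi.subtype) (by
      intro x hx
      have h : (x : Sp n) ∈ c.lo := hx
      rw [LinearMap.mem_ker]
      simp [Submodule.starProjection_eq_self_iff.mpr h])

lemma Cell.lift_proj (c : Cell F) {v : Sp n} (hv : v ∈ c.hi) :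
    c.lift (c.proj v hv) = v - c.lo.starProjection v := by
  rw [Cell.lift, Cell.proj, Submodule.mkQ_apply, Submodule.liftQ_apply]
  simp

lemma Cell.lift_injective (c : Cell F) : Function.Injective c.lift := by
  rw [← LinearMap.ker_eq_bot, LinearMap.ker_eq_bot']
  intro x hx
  obtain ⟨v, hv, rfl⟩ := c.proj_surjective x
  rw [Cell.lift_proj, sub_eq_zero] at hx
  rw [Cell.proj_eq_zero, hx]
  exact Submodule.starProjection_apply_mem _ _

lemma Cell.lift_mem_hi (c : Cell F) (x : c.Gr) : c.lift x ∈ c.hi := by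
  obtain ⟨v, hv, rfl⟩ := c.proj_surjective x
  rw [Cell.lift_proj]
  exact c.hi.sub_mem hv (c.lt.le (Submodule.starProjection_apply_mem _ _))

lemma Cell.lift_mem_orth (c : Cell F) (x : c.Gr) : c.lift x ∈ c.loᗮ := by
  obtain ⟨v, hv, rfl⟩ := c.proj_surjective x
  rw [Cell.lift_proj]
  exact Submodule.sub_starProjection_mem_orthogonal _

lemma Cell.lift_proj_of_orth (c : Cell F) {v : Sp n} (hv : v ∈ c.hi) (hv' : v ∈ c.loᗮ) :
    c.lift (c.proj v hv) = v := by
  rw [Cell.lift_proj, Submodule.starProjection_apply,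
    Submodule.orthogonalProjectionOnto_apply_of_mem_orthogonal hv', Submodule.coe_zero, sub_zero]

lemma Cell.proj_lift (c : Cell F) (x : c.Gr) : c.proj (c.lift x) (c.lift_mem_hi x) = x := by
  apply c.lift_injective
  rw [Cell.lift_proj_of_orth _ _ (c.lift_mem_orth x)]

/-- The orthogonal projection to a subquotient. -/
def Cell.quot (c : Cell F) : Sp n →ₗ[ℝ] c.Gr :=
  (c.lo.submoduleOf c.hi).mkQ ∘ₗ c.hi.orthogonalProjectionOnto.toLinearMap

lemma Cell.quot_of_mem (c : Cell F) {v : Sp n} (hv : v ∈ c.hi) : c.quot v = c.proj v hv := by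
  rw [Cell.quot, Cell.proj, LinearMap.comp_apply]
  congr 1
  exact Submodule.orthogonalProjectionOnto_mem_subspace_eq_self (⟨v, hv⟩ : c.hi)

lemma Cell.quot_of_mem_lo (c : Cell F) {v : Sp n} (hv : v ∈ c.lo) : c.quot v = 0 := by
  rw [c.quot_of_mem (c.lt.le hv), Cell.proj_eq_zero]
  exact hv

lemma Cell.quot_of_mem_orth (c : Cell F) {v : Sp n} (hv : v ∈ c.hiᗮ) : c.quot v = 0 := by
  rw [Cell.quot, LinearMap.comp_apply]
  have : c.hi.orthogonalProjectionOnto.toLinearMap v = 0 :=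
    Submodule.orthogonalProjectionOnto_apply_of_mem_orthogonal hv
  rw [this, map_zero]

lemma Cell.quot_lift (c : Cell F) (x : c.Gr) : c.quot (c.lift x) = x := by
  rw [c.quot_of_mem (c.lift_mem_hi x), Cell.proj_lift]

lemma Cell.quot_lift_of_ne {c d : Cell F} (h : c ≠ d) (x : c.Gr) : d.quot (c.lift x) = 0 := by
  rcases c.trichotomy d with k | k | k
  · exact absurd k h
  · exact d.quot_of_mem_lo (k (c.lift_mem_hi x))
  · exact d.quot_of_mem_orth (Submodule.orthogonal_le k (c.lift_mem_orth x))

/-- The orthogonal sum of forms on the subquotients. -/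
def glue (Q : ∀ c : Cell F, PosForm c.Gr) : PosForm (Sp n) :=
  ⟨∑ c, (Q c).bil.compl₁₂ c.quot c.quot, by
    constructor
    · intro v w
      simp only [LinearMap.sum_apply, LinearMap.compl₁₂_apply]
      exact Finset.sum_congr rfl fun c _ => (Q c).symm _ _
    · intro v hv
      simp only [LinearMap.sum_apply, LinearMap.compl₁₂_apply]
      obtain ⟨c, hc, hc'⟩ := F.exists_cell_mem hv
      refine Finset.sum_pos' (fun d _ => (Q d).self_nonneg _) ⟨c, Finset.mem_univ _, (Q c).pos ?_⟩
      rwa [c.quot_of_mem hc, Ne, Cell.proj_eq_zero]⟩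

lemma glue_apply (Q : ∀ c : Cell F, PosForm c.Gr) (v w : Sp n) :
    (glue Q).bil v w = ∑ c, (Q c).bil (c.quot v) (c.quot w) := by
  change (∑ c, (Q c).bil.compl₁₂ c.quot c.quot) v w = _
  simp only [LinearMap.sum_apply, LinearMap.compl₁₂_apply]

lemma glue_pull (Q : ∀ c : Cell F, PosForm c.Gr) (c : Cell F) :
    (glue Q).pull c.lift c.lift_injective = Q c := by
  rw [PosForm.ext_iff']
  intro x y
  rw [PosForm.pull_apply, glue_apply, Finset.sum_eq_single c]
  · rw [Cell.quot_lift, Cell.quot_lift]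
  · intro d _ hd
    rw [Cell.quot_lift_of_ne (Ne.symm hd), map_zero, LinearMap.zero_apply]
  · simp

end Lift

/-! ### Adapted frames -/

/-- Each member of the flag is spanned by the last vectors of the frame. -/
def Adapted (u : Frame n) (F : PFlag (Sp n)) : Prop :=
  ∀ W ∈ F.carrier, ∀ i, (i ∈ tailSet W → u i ∈ W) ∧ (i ∉ tailSet W → u i ∈ Wᗮ)

section Adapted

variable {F F' : PFlag (Sp n)} {u u' : Frame n}

lemma Adapted.mono (h : Adapted u F') (hF : F.carrier ⊆ F'.carrier) : Adapted u F :=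
  fun W hW => h W (hF hW)

lemma Adapted.mem_iff (h : Adapted u F) {W : Submodule ℝ (Sp n)} (hW : W ∈ F.carrier) {v : Sp n} :
    v ∈ W ↔ ∀ i, i ∉ tailSet W → inner ℝ (u i) v = 0 := by
  constructor
  · intro hv i hi
    exact Submodule.inner_left_of_mem_orthogonal hv ((h W hW i).2 hi)
  · intro hv
    rw [← u.sum_repr' v]
    refine W.sum_mem fun i _ => ?_
    by_cases hi : i ∈ tailSet W
    · exact W.smul_mem _ ((h W hW i).1 hi)
    · rw [hv i hi, zero_smul]; exact W.zero_mem

lemma Adapted.mem_hi (h : Adapted u F) {c : Cell F} {i : Fin n} (hi : c.Has i) : u i ∈ c.hi :=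
  (h _ c.hi_mem i).1 hi.1

lemma Adapted.mem_orth (h : Adapted u F) {c : Cell F} {i : Fin n} (hi : c.Has i) :
    u i ∈ c.loᗮ :=
  (h _ c.lo_mem i).2 hi.2

lemma Adapted.inner_eq_zero (h : Adapted u F) {c : Cell F} {i : Fin n} (hi : ¬ c.Has i)
    {v : Sp n} (hv : v ∈ c.hi) (hv' : v ∈ c.loᗮ) : inner ℝ (u i) v = 0 := by
  by_cases k : i ∈ tailSet c.hi
  · have k' : i ∈ tailSet c.lo := by
      by_contra k'
      exact hi ⟨k, k'⟩
    exact Submodule.inner_right_of_mem_orthogonal ((h _ c.lo_mem i).1 k') hv'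
  · exact Submodule.inner_left_of_mem_orthogonal hv ((h _ c.hi_mem i).2 k)

lemma Adapted.inner_lift_eq_zero (h : Adapted u F) {c : Cell F} {i : Fin n} (hi : ¬ c.Has i)
    (x : c.Gr) : inner ℝ (u i) (c.lift x) = 0 :=
  h.inner_eq_zero hi (c.lift_mem_hi x) (c.lift_mem_orth x)

lemma Adapted.inner_lift_proj (h : Adapted u F) {c : Cell F} {i : Fin n} (hi : c.Has i)
    {v : Sp n} (hv : v ∈ c.hi) : inner ℝ (u i) (c.lift (c.proj v hv)) = inner ℝ (u i) v := by
  rw [Cell.lift_proj, inner_sub_right, sub_eq_self]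
  exact Submodule.inner_left_of_mem_orthogonal (Submodule.starProjection_apply_mem _ _)
    (h.mem_orth hi)

lemma Adapted.lift_proj_frame (h : Adapted u F) {c : Cell F} {i : Fin n} (hi : c.Has i) :
    c.lift (c.proj (u i) (h.mem_hi hi)) = u i :=
  c.lift_proj_of_orth _ (h.mem_orth hi)

lemma Adapted.inner_frame_eq_zero (h : Adapted u F) (h' : Adapted u' F) {i k : Fin n}
    (hik : ¬ F.rel i k) : inner ℝ (u i) (u' k) = 0 :=
  h.inner_eq_zero (c := F.cellOf k) (fun hi => hik (hi.rel (F.cellOf_has k)))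
    (h'.mem_hi (F.cellOf_has k)) (h'.mem_orth (F.cellOf_has k))

lemma Adapted.span_eq (h : Adapted u F) (h' : Adapted u' F) (i : Fin n) :
    Submodule.span ℝ (u '' {k | F.rel i k}) = Submodule.span ℝ (u' '' {k | F.rel i k}) := by
  have key : ∀ {u u' : Frame n}, Adapted u F → Adapted u' F →
      Submodule.span ℝ (u '' {k | F.rel i k}) ≤ Submodule.span ℝ (u' '' {k | F.rel i k}) := by
    intro u u' h h'
    rw [Submodule.span_le]
    rintro _ ⟨k, hk, rfl⟩
    rw [SetLike.mem_coe, ← u'.sum_repr' (u k)]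
    refine Submodule.sum_mem _ fun j _ => ?_
    by_cases hj : F.rel i j
    · exact Submodule.smul_mem _ _ (Submodule.subset_span ⟨j, hj, rfl⟩)
    · rw [h'.inner_frame_eq_zero h (fun hjk => hj (F.rel.trans hk (F.rel.symm hjk))), zero_smul]
      exact Submodule.zero_mem _
  exact le_antisymm (key h h') (key h' h)

/-- Change of the frame in a diagonal form. -/
lemma Frame.sum_exchange (u u' : Frame n) {α α' : Fin n → ℝ} {v w : Sp n}
    (h : ∀ i k, inner ℝ (u i) w * inner ℝ (u' k) v * ((α i - α' k) * inner ℝ (u i) (u' k)) = 0) :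
    ∑ i, α i * inner ℝ (u i) v * inner ℝ (u i) w =
      ∑ k, α' k * inner ℝ (u' k) v * inner ℝ (u' k) w := by
  have h1 : ∀ i, inner ℝ (u i) v = ∑ k, inner ℝ (u i) (u' k) * inner ℝ (u' k) v := fun i =>
    (u'.sum_inner_mul_inner _ _).symm
  have h2 : ∀ k, inner ℝ (u' k) w = ∑ i, inner ℝ (u i) (u' k) * inner ℝ (u i) w := fun k => by
    rw [← u.sum_inner_mul_inner]
    exact Finset.sum_congr rfl fun i _ => by rw [real_inner_comm]
  -- Both sides become double sums over pairs of vectors of the two frames, and `h i k` is the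
  -- equality of the terms of one pair.
  simp_rw [h1, h2, Finset.mul_sum, Finset.sum_mul]
  rw [Finset.sum_comm]
  refine Finset.sum_congr rfl fun k _ => Finset.sum_congr rfl fun i _ => ?_
  linear_combination h i k

end Adapted

/-! ### Existence and uniqueness of spectral data -/

lemma Frame.finrank_span_image (w : Frame n) (S : Set (Fin n)) :
    Module.finrank ℝ (Submodule.span ℝ (w '' S)) = S.ncard := by
  classical
  have hli : LinearIndependent ℝ (fun x : S => w x) :=
    w.orthonormal.linearIndependent.comp _ Subtype.val_injective
  have := finrank_span_eq_card hli
  rw [← Nat.card_eq_fintype_card, Nat.card_coe_set_eq] at this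
  rw [← this, Set.image_eq_range]

lemma mem_iff_of_upper {U : Set (Fin n)} (hU : ∀ i k, i ∈ U → i ≤ k → k ∈ U) (i : Fin n) :
    i ∈ U ↔ n ≤ i + U.ncard := by
  constructor
  · intro hi
    have h1 : Set.Ici i ⊆ U := fun k hk => hU i k hi hk
    have h2 := Set.ncard_le_ncard h1 (Set.toFinite _)
    rw [← Finset.coe_Ici, Set.ncard_coe_finset, Fin.card_Ici] at h2
    omega
  · intro h
    by_contra hi
    have h1 : U ⊆ Set.Ioi i := fun k hk => by
      rw [Set.mem_Ioi]
      by_contra! hki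
      exact hi (hU k i hk hki)
    have h2 := Set.ncard_le_ncard h1 (Set.toFinite _)
    rw [← Finset.coe_Ioi, Set.ncard_coe_finset, Fin.card_Ioi] at h2
    omega

/-- A subspace on which a form is smaller than on the orthogonal complement is spanned by the last
eigenvectors. -/
lemma frame_mem_of_gap {u : Frame n} {f : Fin n → ℝ} (hf : Antitone f) {W : Submodule ℝ (Sp n)}
    {B : ℝ} (hcross : ∀ w ∈ W, ∀ b ∈ Wᗮ, (diagForm u f).bil w b = 0)
    (hW : ∀ w ∈ W, (diagForm u f).bil w w ≤ B * inner ℝ w w)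
    (hW' : ∀ b ∈ Wᗮ, b ≠ 0 → B * inner ℝ b b < (diagForm u f).bil b b) (i : Fin n) :
    (i ∈ tailSet W → u i ∈ W) ∧ (i ∉ tailSet W → u i ∈ Wᗮ) := by
  set P := diagForm u f
  -- As `W` and its complement are orthogonal for the form, both components `a`, `b` of an
  -- eigenvector have the same Rayleigh quotient `exp (f i)`. The gap at `B` allows only one of them
  -- to be nonzero.
  have main : ∀ i, (u i ∈ W ∧ Real.exp (f i) ≤ B) ∨ (u i ∈ Wᗮ ∧ B < Real.exp (f i)) := by
    intro i
    set a := W.starProjection (u i) with ha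
    set b := u i - a with hb
    have haW : a ∈ W := Submodule.starProjection_apply_mem _ _
    have hbW : b ∈ Wᗮ := Submodule.sub_starProjection_mem_orthogonal _
    have hu : u i = a + b := by rw [hb]; abel
    have hab : inner ℝ a b = 0 := Submodule.inner_right_of_mem_orthogonal haW hbW
    have h1 : P.bil a a = Real.exp (f i) * inner ℝ a a := by
      have := diagForm_frame_left u f i a
      rw [hu, P.add_left, P.symm b a, hcross a haW b hbW, inner_add_left, real_inner_comm a b,
        hab] at this
      simpa using this
    have h2 : P.bil b b = Real.exp (f i) * inner ℝ b b := by
      have := diagForm_frame_left u f i b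
      rw [hu, P.add_left, hcross a haW b hbW, inner_add_left, hab] at this
      simpa using this
    by_cases hb0 : b = 0
    · left
      have hua : u i = a := by rw [hu, hb0, add_zero]
      refine ⟨hua ▸ haW, ?_⟩
      have h3 := hW a haW
      rw [h1, ← hua, u.inner_eq, if_pos rfl] at h3
      linarith
    · right
      have h3 := hW' b hbW hb0
      rw [h2] at h3
      have hpos : 0 < inner ℝ b b := real_inner_self_pos.mpr hb0
      have hB : B < Real.exp (f i) := lt_of_mul_lt_mul_right h3 hpos.le
      refine ⟨?_, hB⟩
      have ha0 : a = 0 := by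
        by_contra ha0
        have h4 := hW a haW
        rw [h1] at h4
        have := le_of_mul_le_mul_right h4 (real_inner_self_pos.mpr ha0)
        linarith
      rw [hu, ha0, zero_add]
      exact hbW
  have hU : ∀ i k, i ∈ {i | Real.exp (f i) ≤ B} → i ≤ k → k ∈ {i | Real.exp (f i) ≤ B} :=
    fun i k hi hik => (Real.exp_le_exp.mpr (hf hik)).trans hi
  have hspan : Submodule.span ℝ (u '' {i | Real.exp (f i) ≤ B}) = W := by
    apply le_antisymm
    · rw [Submodule.span_le]
      rintro _ ⟨k, hk, rfl⟩
      rcases main k with h | h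
      · exact h.1
      · exact absurd h.2 (not_lt.mpr hk)
    · intro w hw
      rw [← u.sum_repr' w]
      refine Submodule.sum_mem _ fun k _ => ?_
      rcases main k with h | h
      · exact Submodule.smul_mem _ _ (Submodule.subset_span ⟨k, h.2, rfl⟩)
      · rw [Submodule.inner_left_of_mem_orthogonal hw h.1, zero_smul]
        exact Submodule.zero_mem _
  have hmem : i ∈ tailSet W ↔ Real.exp (f i) ≤ B := by
    rw [mem_tailSet, ← hspan, Frame.finrank_span_image, ← mem_iff_of_upper hU]
    rfl
  rw [hmem]
  rcases main i with h | h
  · exact ⟨fun _ => h.1, fun h' => absurd h.2 h'⟩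
  · exact ⟨fun h' => absurd h.2 (not_lt.mpr h'), fun _ => h.1⟩

/-- A frame and the logarithms of eigenvalues representing a point of `S_n`. -/
structure IsSpectral (u : Frame n) (f : Fin n → ℝ) (s : Satake n) : Prop where
  adapted : Adapted u s.1
  anti : ∀ i k, i ≤ k → s.1.rel i k → f k ≤ f i
  form : ∀ c : Cell s.1, ((diagForm u f).pull c.lift c.lift_injective).cls = s.2 c

lemma PosForm.exists_bounds (P : PosForm (Sp n)) :
    ∃ a b : ℝ, 0 < a ∧ 0 < b ∧ ∀ v, a * inner ℝ v v ≤ P.bil v v ∧ P.bil v v ≤ b * inner ℝ v v := by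
  obtain ⟨u, hP, -⟩ := exists_diagForm P
  set f := fun i => Real.log (P.eig i)
  have norm : ∀ v, ∑ k, inner ℝ (u k) v * inner ℝ (u k) v = inner ℝ v v := fun v => by
    rw [← u.sum_inner_mul_inner]
    exact Finset.sum_congr rfl fun k _ => by rw [real_inner_comm]
  have hs : ∀ g : Fin n → ℝ, 0 ≤ ∑ i, Real.exp (g i) := fun g =>
    Finset.sum_nonneg fun i _ => (Real.exp_pos _).le
  have hi : ∀ (g : Fin n → ℝ) i, Real.exp (g i) ≤ ∑ i, Real.exp (g i) + 1 := fun g i => by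
    have := Finset.single_le_sum (f := fun i => Real.exp (g i)) (fun i _ => (Real.exp_pos _).le)
      (Finset.mem_univ i)
    linarith
  -- The added ones keep both constants positive in dimension zero.
  refine ⟨(∑ i, Real.exp (-f i) + 1)⁻¹, ∑ i, Real.exp (f i) + 1,
    inv_pos.mpr (by linarith [hs fun i => -f i]), by linarith [hs f], fun v => ?_⟩
  rw [hP, diagForm_apply, ← norm, Finset.mul_sum, Finset.mul_sum]
  constructor
  · refine Finset.sum_le_sum fun i _ => ?_
    rw [mul_assoc]
    refine mul_le_mul_of_nonneg_right ?_ (mul_self_nonneg _)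
    rw [inv_le_comm₀ (by linarith [hs fun i => -f i]) (Real.exp_pos _), ← Real.exp_neg]
    exact hi (fun i => -f i) i
  · refine Finset.sum_le_sum fun i _ => ?_
    rw [mul_assoc]
    exact mul_le_mul_of_nonneg_right (hi f i) (mul_self_nonneg _)

/-- The forms of the cells are multiplied by `K ^ dim lo` and glued orthogonally. For `K` larger
than the quotient of the bounds of the unscaled sum, every member of the flag has smaller
eigenvalues than its complement, so an ordered eigenframe of the glued form is adapted to the flag.
-/
lemma exists_isSpectral (s : Satake n) : ∃ u f, IsSpectral u f s := by
  obtain ⟨F, q⟩ := s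
  choose Q hQ using fun c : Cell F => PE.exists_rep (q c)
  obtain ⟨a, b, ha, hb, hab⟩ := (glue Q).exists_bounds
  set K : ℝ := b / a + 1 with hK
  have hK1 : 1 ≤ K := by rw [hK]; linarith [div_pos hb ha]
  have hK0 : 0 < K := by linarith
  have hKa : b < K * a := by rw [hK]; field_simp; linarith
  set R : ∀ c : Cell F, PosForm c.Gr := fun c =>
    (Q c).scale (K ^ Module.finrank ℝ c.lo) (pow_pos hK0 _) with hR
  obtain ⟨u, hP, hanti⟩ := exists_diagForm (glue R)
  set f := fun i => Real.log ((glue R).eig i)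
  have hRv : ∀ v w, (diagForm u f).bil v w =
      ∑ c : Cell F, K ^ Module.finrank ℝ c.lo * (Q c).bil (c.quot v) (c.quot w) := by
    intro v w
    rw [← hP, glue_apply]
    rfl
  have hQv : ∀ v w, (glue Q).bil v w = ∑ c : Cell F, (Q c).bil (c.quot v) (c.quot w) := glue_apply Q
  refine ⟨u, f, ?_, fun i k hik _ => hanti hik, fun c => ?_⟩
  · intro W hW i
    -- The cells inside `W` have `dim lo ≤ dim W - 1`, which gives the bound `K ^ (dim W - 1) * b`
    -- on `W`. On the complement the form is at least `K ^ dim W * a`, which is larger because `b <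
    -- K * a`.
    refine frame_mem_of_gap (B := K ^ Module.finrank ℝ W * b / K) hanti ?_ ?_ ?_ i
    · intro w hw v hv
      rw [hRv]
      refine Finset.sum_eq_zero fun c _ => ?_
      rcases c.le_lo_or_hi_le hW with h | h
      · rw [c.quot_of_mem_lo (h hw)]; simp
      · rw [c.quot_of_mem_orth (Submodule.orthogonal_le h hv)]; simp
    · intro w hw
      have h1 := (hab w).2
      have h2 : (diagForm u f).bil w w ≤ K ^ Module.finrank ℝ W / K * (glue Q).bil w w := by
        rw [hRv, hQv, Finset.mul_sum]
        refine Finset.sum_le_sum fun c _ => ?_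
        rcases c.le_lo_or_hi_le hW with h | h
        · rw [c.quot_of_mem_lo (h hw)]; simp
        · refine mul_le_mul_of_nonneg_right ?_ ((Q c).self_nonneg _)
          rw [le_div_iff₀ hK0, ← pow_succ]
          refine pow_le_pow_right₀ hK1 ?_
          have := c.finrank_lt
          have := Submodule.finrank_mono h
          omega
      refine h2.trans ((mul_le_mul_of_nonneg_left h1 (by positivity)).trans (le_of_eq (by ring)))
    · intro v hv hv0
      have h1 := (hab v).1
      have h2 : K ^ Module.finrank ℝ W * (glue Q).bil v v ≤ (diagForm u f).bil v v := by
        rw [hRv, hQv, Finset.mul_sum]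
        refine Finset.sum_le_sum fun c _ => ?_
        rcases c.le_lo_or_hi_le hW with h | h
        · refine mul_le_mul_of_nonneg_right ?_ ((Q c).self_nonneg _)
          exact pow_le_pow_right₀ hK1 (Submodule.finrank_mono h)
        · rw [c.quot_of_mem_orth (Submodule.orthogonal_le h hv)]; simp
      refine lt_of_lt_of_le ?_ h2
      refine lt_of_lt_of_le ?_ (mul_le_mul_of_nonneg_left h1 (by positivity))
      rw [← mul_assoc, mul_div_assoc]
      refine mul_lt_mul_of_pos_right ?_ (real_inner_self_pos.mpr hv0)
      refine mul_lt_mul_of_pos_left ?_ (by positivity)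
      rw [div_lt_iff₀ hK0]
      linarith
  · rw [← hP, glue_pull, PosForm.scale_cls, hQ]

lemma ratioOf_ne_zero {T : Setoid (Fin n)} {f : Fin n → ℝ} {i k : Fin n} :
    ratioOf T f i k ≠ 0 ↔ T i k := by
  unfold ratioOf
  split_ifs with h
  · exact ⟨fun _ => h, fun _ => (Real.exp_pos _).ne'⟩
  · exact ⟨fun h' => absurd rfl h', fun h' => absurd h' h⟩

/-- The spectral data of a point are unique, up to constants in the cells and rotations of
eigenspaces. -/
lemma IsSpectral.unique {s : Satake n} {u u' : Frame n} {f f' : Fin n → ℝ} (h : IsSpectral u f s)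
    (h' : IsSpectral u' f' s) :
    (∀ i k, s.1.rel i k → f' i - f' k = f i - f k) ∧
      ∀ i k, inner ℝ (u i) (u' k) * (1 - ratioOf s.1.rel f i k) = 0 := by
  have hc : ∀ c : Cell s.1, ∃ a : ℝ, 0 < a ∧ ∀ x y, (diagForm u' f').bil (c.lift x) (c.lift y) =
      a * (diagForm u f).bil (c.lift x) (c.lift y) := fun c =>
    PosForm.cls_eq.mp ((h.form c).trans (h'.form c).symm)
  choose a ha hau using hc
  -- Uniqueness is the asymptotic statement for a one-point family, for which limits are equalities.
  have key := tendsto_spectral (J := Unit) (l := pure ()) (S := s.1.rel) (T := s.1.rel)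
    (w := fun _ => u') (w' := fun _ => u) (u := u) (g := fun _ => f')
    (b := fun _ i => Real.log (a (s.1.cellOf i))) (f := f)
    (fun _ i => h'.adapted.span_eq h.adapted i) (fun _ => h'.anti) h.anti
    (fun _ i k hik => by rw [PFlag.rel_def.mp hik]) (fun i k _ h1 h2 => absurd h1 h2)
    (fun i => tendsto_const_nhds) (fun i k => by
      rw [tendsto_pure_left]
      intro U hU
      convert mem_of_mem_nhds hU using 1
      by_cases hik : s.1.rel i k
      · have hi := s.1.cellOf_has i
        have hk : (s.1.cellOf i).Has k := PFlag.rel_def.mp hik ▸ s.1.cellOf_has k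
        have := hau _ (Cell.proj _ (u i) (h.adapted.mem_hi hi))
          (Cell.proj _ (u k) (h.adapted.mem_hi hk))
        rw [h.adapted.lift_proj_frame hi, h.adapted.lift_proj_frame hk, diagForm_frame] at this
        rw [this, ← PFlag.rel_def.mp hik, ← two_mul, neg_div, mul_div_cancel_left₀ _ two_ne_zero,
          Real.exp_neg, Real.exp_log (ha _), ← mul_assoc, inv_mul_cancel₀ (ha _).ne', one_mul]
      · have : (diagForm u' f').bil (u i) (u k) = 0 := by
          rw [diagForm_apply]
          refine Finset.sum_eq_zero fun j _ => ?_
          by_cases hj : s.1.rel j i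
          · rw [h'.adapted.inner_frame_eq_zero h.adapted (i := j) (k := k)
              (fun hjk => hik (s.1.rel.trans (s.1.rel.symm hj) hjk)), mul_zero]
          · rw [h'.adapted.inner_frame_eq_zero h.adapted hj, mul_zero, zero_mul]
        rw [this, mul_zero, if_neg]
        rintro rfl
        exact hik (s.1.rel.refl i))
  constructor
  · intro i k hik
    have h1 := tendsto_nhds_unique (key.1 i) (tendsto_const_nhds)
    have h2 := tendsto_nhds_unique (key.1 k) (tendsto_const_nhds)
    rw [PFlag.rel_def.mp hik] at h1
    rw [h1, h2]; ring
  · intro i k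
    exact tendsto_nhds_unique tendsto_const_nhds (key.2.2 i k)

lemma IsSpectral.ratioOf_eq {s : Satake n} {u u' : Frame n} {f f' : Fin n → ℝ}
    (h : IsSpectral u f s) (h' : IsSpectral u' f' s) :
    ratioOf s.1.rel f' = ratioOf s.1.rel f := by
  funext i k
  unfold ratioOf
  split_ifs with hik
  · rw [(h.unique h').1 i k hik]
  · rfl

/-- Spectral data determine the point. -/
lemma IsSpectral.eq {s s' : Satake n} {u u' : Frame n} {f f' : Fin n → ℝ} (h : IsSpectral u f s)
    (h' : IsSpectral u' f' s') (hr : ratioOf s.1.rel f = ratioOf s'.1.rel f')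
    (hu : ∀ i k, inner ℝ (u i) (u' k) * (1 - ratioOf s.1.rel f i k) = 0) : s = s' := by
  have hrel : ∀ i k, s.1.rel i k ↔ s'.1.rel i k := fun i k => by
    rw [← ratioOf_ne_zero (f := f), hr, ratioOf_ne_zero]
  have huz : ∀ i k, ¬ s.1.rel i k → inner ℝ (u i) (u' k) = 0 := fun i k hik => by
    have := hu i k
    rwa [not_not.mp (mt ratioOf_ne_zero.mp hik), sub_zero, mul_one] at this
  have flag : s.1 = s'.1 := by
    have sub : ∀ W ∈ s.1.carrier, W ∈ s'.1.carrier := by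
      intro W hW
      by_cases hbot : W = ⊥
      · exact hbot ▸ s'.1.bot_mem
      by_cases htop : W = ⊤
      · exact htop ▸ s'.1.top_mem
      have h0 : 0 < Module.finrank ℝ W :=
        Nat.pos_of_ne_zero fun k => hbot (Submodule.finrank_eq_zero.mp k)
      have h1 : Module.finrank ℝ W < n := by
        have := Submodule.finrank_lt htop
        simpa using this
      -- `i` is the last index outside `tailSet W` and `k` the first one inside. They are unrelated
      -- for both flags, so the second flag has a member breaking at the same place, hence of the
      -- same dimension as `W`.
      set i : Fin n := ⟨n - Module.finrank ℝ W - 1, by omega⟩ with hi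
      set k : Fin n := ⟨n - Module.finrank ℝ W, by omega⟩ with hk
      have hiW : i ∉ tailSet W := by rw [mem_tailSet]; simp [hi]; omega
      have hkW : k ∈ tailSet W := by rw [mem_tailSet]; simp [hk]; omega
      have hik : ¬ s'.1.rel i k := fun hik =>
        hiW ((PFlag.rel_iff.mp ((hrel i k).mpr hik) W hW).mpr hkW)
      rw [PFlag.rel_iff] at hik
      push Not at hik
      obtain ⟨W', hW', hcase⟩ := hik
      have hle : i ≤ k := by rw [Fin.le_def]; simp [hi, hk]
      have hW'ik : i ∉ tailSet W' ∧ k ∈ tailSet W' := by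
        rcases hcase with ⟨h1, h2⟩ | ⟨h1, h2⟩
        · exact absurd (tailSet_upper h1 hle) h2
        · exact ⟨h1, h2⟩
      have hrank : Module.finrank ℝ W' = Module.finrank ℝ W := by
        have h2 := hW'ik.1
        have h3 := hW'ik.2
        rw [mem_tailSet] at h2 h3
        simp only [hi, hk] at h2 h3
        omega
      have htail : tailSet W' = tailSet W := by
        ext j; rw [mem_tailSet, mem_tailSet, hrank]
      have : W ≤ W' := by
        intro v hv
        rw [h.adapted.mem_iff hW] at hv
        rw [h'.adapted.mem_iff hW', htail]
        intro j hj
        rw [← u.sum_inner_mul_inner]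
        refine Finset.sum_eq_zero fun l _ => ?_
        by_cases hl : l ∈ tailSet W
        · rw [real_inner_comm, huz l j fun k => hj ((PFlag.rel_iff.mp k W hW).mp hl), zero_mul]
        · rw [hv l hl, mul_zero]
      exact (Submodule.eq_of_le_of_finrank_eq this hrank.symm) ▸ hW'
    refine PFlag.eq_of_rel sub fun i k hik => (hrel i k).mp hik
  obtain ⟨F, q⟩ := s
  obtain ⟨F', q'⟩ := s'
  obtain rfl : F = F' := flag
  congr 1
  funext c
  refine (h.form c).symm.trans (Eq.trans ?_ (h'.form c))
  obtain ⟨j, hj⟩ := c.exists_has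
  refine PosForm.cls_eq.mpr ⟨Real.exp (f' j - f j), Real.exp_pos _, fun x y => ?_⟩
  -- A ratio determines the absolute value of a difference of exponents, and the monotonicity
  -- determines its sign.
  have hdiff : ∀ i, c.Has i → f' i - f' j = f i - f j := by
    have main : ∀ i k, i ≤ k → F.rel i k → f' i - f' k = f i - f k := by
      intro i k hik hR
      have := congrFun (congrFun hr i) k
      simp only [ratioOf] at this
      rw [if_pos hR, if_pos hR, Real.exp_eq_exp, neg_inj,
        abs_of_nonneg (sub_nonneg.mpr (h.anti i k hik hR)),
        abs_of_nonneg (sub_nonneg.mpr (h'.anti i k hik hR))] at this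
      exact this.symm
    intro i hi
    rcases le_total i j with hij | hij
    · exact main i j hij (hi.rel hj)
    · have := main j i hij (hj.rel hi)
      linarith
  rw [PosForm.pull_apply, PosForm.pull_apply, diagForm_apply, diagForm_apply, Finset.mul_sum]
  symm
  have := u.sum_exchange u' (α := fun i => Real.exp (f' j - f j) * Real.exp (f i))
    (α' := fun i => Real.exp (f' i)) (v := c.lift x) (w := c.lift y) (fun i k => by
      by_cases hi : c.Has i
      · by_cases hk : c.Has k
        · by_cases h0 : inner ℝ (u i) (u' k) = 0
          · rw [h0]; ring
          · have h1 := (mul_eq_zero.mp (hu i k)).resolve_left h0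
            simp only [ratioOf] at h1
            rw [if_pos (hi.rel hk), sub_eq_zero, eq_comm, Real.exp_eq_one_iff, neg_eq_zero,
              abs_eq_zero] at h1
            rw [← Real.exp_add]
            have : f' j - f j + f i = f' k := by linarith [hdiff i hi, hdiff k hk]
            rw [this]; ring
        · rw [h'.adapted.inner_lift_eq_zero hk]; ring
      · rw [h.adapted.inner_lift_eq_zero hi]; ring)
  rw [← this]
  exact Finset.sum_congr rfl fun i _ => by ring

/-! ### The topology of the Satake--Furstenberg compactification -/

lemma ratioOf_nonneg (T : Setoid (Fin n)) (f : Fin n → ℝ) (i k : Fin n) :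
    0 ≤ ratioOf T f i k := by
  unfold ratioOf; split_ifs
  · exact (Real.exp_pos _).le
  · exact le_rfl

lemma ratioOf_le_one (T : Setoid (Fin n)) (f : Fin n → ℝ) (i k : Fin n) :
    ratioOf T f i k ≤ 1 := by
  unfold ratioOf; split_ifs
  · exact Real.exp_le_one_iff.mpr (by simp)
  · exact zero_le_one

lemma ratioOf_symm (T : Setoid (Fin n)) (f : Fin n → ℝ) (i k : Fin n) :
    ratioOf T f i k = ratioOf T f k i := by
  unfold ratioOf
  rw [abs_sub_comm]
  by_cases h : T i k
  · rw [if_pos h, if_pos (T.symm h)]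
  · rw [if_neg h, if_neg fun h' => h (T.symm h')]

lemma ratioOf_self (T : Setoid (Fin n)) (f : Fin n → ℝ) (i : Fin n) : ratioOf T f i i = 1 := by
  unfold ratioOf
  rw [if_pos (T.refl i)]; simp

/-- The triangle inequality for exponents makes the ratios submultiplicative. The estimate says that
rows of ratios nearly agree at `k` and `l` when the eigenvalues `k` and `l` nearly coincide, which
is exactly when their eigenvectors may mix. -/
lemma abs_ratioOf_sub_le (T : Setoid (Fin n)) (f : Fin n → ℝ) (i k l : Fin n) :
    |ratioOf T f i k - ratioOf T f i l| ≤ 1 - ratioOf T f k l := by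
  by_cases hkl : T k l
  · have key : ∀ k l, T k l → ratioOf T f i k - ratioOf T f i l ≤ 1 - ratioOf T f k l := by
      intro k l hkl
      by_cases hik : T i k
      · have hil : T i l := T.trans hik hkl
        unfold ratioOf
        rw [if_pos hkl, if_pos hik, if_pos hil]
        have h1 : Real.exp (-|f i - f k|) * Real.exp (-|f k - f l|) ≤ Real.exp (-|f i - f l|) := by
          rw [← Real.exp_add]
          refine Real.exp_le_exp.mpr ?_
          have := abs_sub_le (f i) (f k) (f l)
          linarith
        have h2 : Real.exp (-|f i - f k|) ≤ 1 := Real.exp_le_one_iff.mpr (by simp)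
        have h3 : Real.exp (-|f k - f l|) ≤ 1 := Real.exp_le_one_iff.mpr (by simp)
        nlinarith [Real.exp_pos (-|f i - f k|)]
      · have := ratioOf_nonneg T f i l
        have h0 : ratioOf T f i k = 0 := not_not.mp (mt ratioOf_ne_zero.mp hik)
        have := ratioOf_le_one T f k l
        linarith
    rw [abs_le]
    have h1 := key k l hkl
    have h2 := key l k (T.symm hkl)
    rw [ratioOf_symm T f l k] at h2
    constructor <;> linarith
  · have h0 : ratioOf T f k l = 0 := not_not.mp (mt ratioOf_ne_zero.mp hkl)
    rw [h0, abs_le]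
    have h1 := ratioOf_nonneg T f i k
    have h2 := ratioOf_nonneg T f i l
    have h3 := ratioOf_le_one T f i k
    have h4 := ratioOf_le_one T f i l
    constructor <;> linarith

/-- Coordinates on the Satake--Furstenberg compactification: the ratios of eigenvalues and certain
matrices with the same eigenvectors. -/
def satakeCoord (u : Fin n → Sp n) (ρ : Fin n → Fin n → ℝ) :
    (Fin n → Fin n → ℝ) × (Fin n → Fin n → Fin n → ℝ) :=
  (ρ, fun i a b => ∑ k, ρ i k * inner ℝ (u k) (EuclideanSpace.single a (1 : ℝ)) *
    inner ℝ (u k) (EuclideanSpace.single b (1 : ℝ)))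

lemma continuous_satakeCoord : Continuous fun p : (Fin n → Sp n) × (Fin n → Fin n → ℝ) =>
    satakeCoord p.1 p.2 := by
  unfold satakeCoord
  fun_prop

/-- The ratios of eigenvalues of a point of `S_n`. -/
def Satake.ratio (s : Satake n) : Fin n → Fin n → ℝ :=
  ratioOf s.1.rel (exists_isSpectral s).choose_spec.choose

/-- The coordinates of a point of `S_n`. -/
def Satake.coord (s : Satake n) : (Fin n → Fin n → ℝ) × (Fin n → Fin n → Fin n → ℝ) :=
  satakeCoord (exists_isSpectral s).choose s.ratio

lemma IsSpectral.ratio_eq {s : Satake n} {u : Frame n} {f : Fin n → ℝ} (h : IsSpectral u f s) :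
    s.ratio = ratioOf s.1.rel f :=
  h.ratioOf_eq (exists_isSpectral s).choose_spec.choose_spec

/-- The coordinates do not depend on the choice of spectral data: if vectors `k`, `l` of two
spectral frames are not orthogonal, the ratio of `k` and `l` is one, so every row of ratios takes
equal values at `k` and `l`. -/
lemma IsSpectral.coord_eq {s : Satake n} {u : Frame n} {f : Fin n → ℝ} (h : IsSpectral u f s) :
    s.coord = satakeCoord u (ratioOf s.1.rel f) := by
  rw [Satake.coord, h.ratio_eq]
  unfold satakeCoord
  refine Prod.ext rfl ?_
  funext i a b
  symm
  refine Frame.sum_exchange u _ (α := fun k => ratioOf s.1.rel f i k)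
    (α' := fun k => ratioOf s.1.rel f i k) fun k l => ?_
  have h1 := (h.unique (exists_isSpectral s).choose_spec.choose_spec).2 k l
  have h2 := abs_ratioOf_sub_le s.1.rel f i k l
  rcases mul_eq_zero.mp h1 with h0 | h0
  · rw [h0]; ring
  · rw [h0] at h2
    rw [abs_nonpos_iff.mp h2]; ring

lemma Sp.eq_sum (v : Sp n) : v = ∑ a, v a • EuclideanSpace.single a (1 : ℝ) := by
  ext k
  simp [Finset.sum_apply, Pi.single_apply]

lemma sum_coord (u : Frame n) (α : Fin n → ℝ) (v w : Sp n) :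
    ∑ k, α k * inner ℝ (u k) v * inner ℝ (u k) w =
      ∑ a, ∑ b, v a * w b * ∑ k, α k * inner ℝ (u k) (EuclideanSpace.single a (1 : ℝ)) *
        inner ℝ (u k) (EuclideanSpace.single b (1 : ℝ)) := by
  have hx : ∀ (k : Fin n) (v : Sp n), inner ℝ (u k) v =
      ∑ a, v a * inner ℝ (u k) (EuclideanSpace.single a (1 : ℝ)) := fun k v => by
    conv_lhs => rw [Sp.eq_sum v, inner_sum]
    simp_rw [inner_smul_right]
  have hk : ∀ k, α k * inner ℝ (u k) v * inner ℝ (u k) w = ∑ a, ∑ b, v a * w b * (α k *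
      inner ℝ (u k) (EuclideanSpace.single a (1 : ℝ)) *
        inner ℝ (u k) (EuclideanSpace.single b (1 : ℝ))) := fun k => by
    rw [hx k v, hx k w, mul_assoc, Finset.sum_mul_sum, Finset.mul_sum]
    refine Finset.sum_congr rfl fun a _ => ?_
    rw [Finset.mul_sum]
    exact Finset.sum_congr rfl fun b _ => by ring
  simp_rw [hk, Finset.mul_sum]
  rw [Finset.sum_comm]
  exact Finset.sum_congr rfl fun a _ => Finset.sum_comm

/-- Evaluating the `k`-th matrix at the pair `(u k, u' l)` through either frame gives `⟨u k, u' l⟩ =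
ρ k l ⟨u k, u' l⟩`. This is the condition under which spectral data determine the same point. -/
lemma Satake.coord_injective : Function.Injective (Satake.coord (n := n)) := by
  intro s s' hss
  obtain ⟨u, f, h⟩ := exists_isSpectral s
  obtain ⟨u', f', h'⟩ := exists_isSpectral s'
  rw [h.coord_eq, h'.coord_eq] at hss
  have hr : ratioOf s.1.rel f = ratioOf s'.1.rel f' := congrArg Prod.fst hss
  refine h.eq h' hr fun k l => ?_
  have hm := congrFun (congrArg Prod.snd hss) k
  have e1 := sum_coord u (fun j => ratioOf s.1.rel f k j) (u k) (u' l)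
  have e2 := sum_coord u' (fun j => ratioOf s'.1.rel f' k j) (u k) (u' l)
  have e3 : ∑ j, ratioOf s.1.rel f k j * inner ℝ (u j) (u k) * inner ℝ (u j) (u' l) =
      ∑ j, ratioOf s'.1.rel f' k j * inner ℝ (u' j) (u k) * inner ℝ (u' j) (u' l) := by
    rw [e1, e2]
    refine Finset.sum_congr rfl fun a _ => Finset.sum_congr rfl fun b _ => ?_
    have := congrFun (congrFun hm a) b
    simp only [satakeCoord] at this
    rw [this]
  rw [Finset.sum_eq_single k, Finset.sum_eq_single l, u.inner_eq, u'.inner_eq, if_pos rfl,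
    if_pos rfl, ← hr, ratioOf_self, real_inner_comm] at e3
  · rw [real_inner_comm]
    linear_combination e3
  · intro j _ hj
    rw [u'.inner_eq, if_neg hj, mul_zero]
  · simp
  · intro j _ hj
    rw [u.inner_eq, if_neg hj]; ring
  · simp

/-- The topology of the Satake--Furstenberg compactification. -/
instance satakeTopology (n : ℕ) : TopologicalSpace (Satake n) :=
  TopologicalSpace.induced Satake.coord inferInstance

lemma Satake.isEmbedding_coord : IsEmbedding (Satake.coord (n := n)) :=
  ⟨⟨rfl⟩, Satake.coord_injective⟩

instance : TopologicalSpace.MetrizableSpace (Satake n) :=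
  Satake.isEmbedding_coord.metrizableSpace

lemma Satake.continuous_ratio : Continuous (Satake.ratio (n := n)) :=
  continuous_fst.comp Satake.isEmbedding_coord.continuous

/-- A criterion of convergence in `S_n` in terms of spectral data. -/
lemma tendsto_satake {J : Type} {l : Filter J} {x : J → Satake n} {s : Satake n}
    {w : J → Frame n} {g : J → Fin n → ℝ} {u : Frame n} {f : Fin n → ℝ}
    (h : ∀ j, IsSpectral (w j) (g j) (x j)) (hs : IsSpectral u f s)
    (hr : ∀ i k, Tendsto (fun j => ratioOf (x j).1.rel (g j) i k) l (𝓝 (ratioOf s.1.rel f i k)))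
    (hu : ∀ i k, Tendsto (fun j => inner ℝ (u i) (w j k) * (1 - ratioOf s.1.rel f i k)) l (𝓝 0)) :
    Tendsto x l (𝓝 s) := by
  rw [Satake.isEmbedding_coord.tendsto_nhds_iff, hs.coord_eq]
  have : Satake.coord ∘ x = fun j => satakeCoord (w j) (ratioOf (x j).1.rel (g j)) :=
    funext fun j => (h j).coord_eq
  rw [this]
  unfold satakeCoord
  refine Tendsto.prodMk_nhds (tendsto_pi_nhds.mpr fun i => tendsto_pi_nhds.mpr fun k => hr i k) ?_
  refine tendsto_pi_nhds.mpr fun i => tendsto_pi_nhds.mpr fun a => tendsto_pi_nhds.mpr fun b => ?_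
  set v : Sp n := EuclideanSpace.single a (1 : ℝ)
  set v' : Sp n := EuclideanSpace.single b (1 : ℝ)
  set ρ := ratioOf s.1.rel f
  set ρ' := fun j => ratioOf (x j).1.rel (g j)
  change Tendsto (fun j => ∑ k, ρ' j i k * inner ℝ (w j k) v * inner ℝ (w j k) v') l
    (𝓝 (∑ k, ρ i k * inner ℝ (u k) v * inner ℝ (u k) v'))
  -- Expanded in both frames, the error has two kinds of coefficients: `ρ i l - ρ i k` at
  -- overlapping vectors, controlled by `hu` through `abs_ratioOf_sub_le`, and `ρ' j i l - ρ i l`,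
  -- controlled by `hr`.
  have e : ∀ j, ∑ k, ρ' j i k * inner ℝ (w j k) v * inner ℝ (w j k) v' =
      ∑ k, ρ i k * inner ℝ (u k) v * inner ℝ (u k) v' +
      ∑ k, ∑ l, ((ρ i l - ρ i k) * inner ℝ (u k) (w j l) + (ρ' j i l - ρ i l) *
        inner ℝ (u k) (w j l)) * (inner ℝ (w j l) v * inner ℝ (u k) v') := by
    intro j
    have h1 : ∀ k, inner ℝ (u k) v = ∑ l, inner ℝ (u k) (w j l) * inner ℝ (w j l) v := fun k =>
      ((w j).sum_inner_mul_inner _ _).symm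
    have h2 : ∀ l, inner ℝ (w j l) v' = ∑ k, inner ℝ (u k) (w j l) * inner ℝ (u k) v' := fun l => by
      rw [← u.sum_inner_mul_inner]
      exact Finset.sum_congr rfl fun i _ => by rw [real_inner_comm]
    have h3 : ∑ l, ρ' j i l * inner ℝ (w j l) v * inner ℝ (w j l) v' =
        ∑ k, ∑ l, ρ' j i l * inner ℝ (w j l) v * (inner ℝ (u k) (w j l) * inner ℝ (u k) v') := by
      rw [Finset.sum_comm]
      refine Finset.sum_congr rfl fun l _ => ?_
      rw [h2, Finset.mul_sum]
    have h4 : ∑ k, ρ i k * inner ℝ (u k) v * inner ℝ (u k) v' =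
        ∑ k, ∑ l, ρ i k * (inner ℝ (u k) (w j l) * inner ℝ (w j l) v) * inner ℝ (u k) v' := by
      refine Finset.sum_congr rfl fun k _ => ?_
      rw [h1, Finset.mul_sum, Finset.sum_mul]
    rw [h3, h4, ← Finset.sum_add_distrib]
    refine Finset.sum_congr rfl fun k _ => ?_
    rw [← Finset.sum_add_distrib]
    exact Finset.sum_congr rfl fun l _ => by ring
  simp_rw [e]
  have hz : ∑ k, ρ i k * inner ℝ (u k) v * inner ℝ (u k) v' =
      ∑ k, ρ i k * inner ℝ (u k) v * inner ℝ (u k) v' + ∑ k : Fin n, ∑ l : Fin n, (0 : ℝ) := by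
    simp
  conv => arg 3; rw [hz]
  refine Tendsto.add tendsto_const_nhds ?_
  refine tendsto_finsetSum _ fun k _ => tendsto_finsetSum _ fun r _ => ?_
  have t1 : Tendsto (fun j => (ρ i r - ρ i k) * inner ℝ (u k) (w j r)) l (𝓝 0) := by
    refine squeeze_zero_norm (fun j => ?_) (tendsto_zero_iff_abs_tendsto_zero _ |>.mp (hu k r))
    simp only [Function.comp_apply]
    rw [Real.norm_eq_abs, abs_mul, abs_mul, mul_comm]
    refine mul_le_mul_of_nonneg_left ?_ (abs_nonneg _)
    rw [abs_sub_comm]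
    exact (abs_ratioOf_sub_le s.1.rel f i k r).trans (le_abs_self _)
  have t2 : Tendsto (fun j => (ρ' j i r - ρ i r) * inner ℝ (u k) (w j r)) l (𝓝 0) := by
    have := (hr i r).sub_const (ρ i r)
    rw [sub_self] at this
    refine squeeze_zero_norm (fun j => ?_) (tendsto_zero_iff_abs_tendsto_zero _ |>.mp this)
    simp only [Function.comp_apply]
    rw [Real.norm_eq_abs, abs_mul]
    exact mul_le_of_le_one_right (abs_nonneg _) (u.abs_inner_le (w j) k r)
  have t3 := t1.add t2
  rw [add_zero] at t3
  have t4 := (tendsto_zero_iff_abs_tendsto_zero _).mp t3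
  have t5 := t4.mul_const (‖v‖ * |inner ℝ (u k) v'|)
  rw [zero_mul] at t5
  refine squeeze_zero_norm (fun j => ?_) t5
  simp only [Function.comp_apply]
  rw [Real.norm_eq_abs, abs_mul, abs_mul (inner ℝ (w j r) v)]
  refine mul_le_mul_of_nonneg_left (mul_le_mul_of_nonneg_right ?_ (abs_nonneg _)) (abs_nonneg _)
  refine (abs_real_inner_le_norm _ _).trans ?_
  rw [(w j).norm_eq_one, one_mul]

/-- The possible collections of ratios of ordered eigenvalues. -/
def IsRatio (ρ : Fin n → Fin n → ℝ) : Prop :=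
  (∀ i, ρ i i = 1) ∧ (∀ i k, ρ i k = ρ k i) ∧ (∀ i k, 0 ≤ ρ i k ∧ ρ i k ≤ 1) ∧
    ∀ i j k, i ≤ j → j ≤ k → ρ i k = ρ i j * ρ j k

lemma IsSpectral.isRatio {s : Satake n} {u : Frame n} {f : Fin n → ℝ} (h : IsSpectral u f s) :
    IsRatio (ratioOf s.1.rel f) := by
  refine ⟨ratioOf_self _ _, ratioOf_symm _ _,
    fun i k => ⟨ratioOf_nonneg _ _ i k, ratioOf_le_one _ _ i k⟩, fun i j k hij hjk => ?_⟩
  by_cases hik : s.1.rel i k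
  · have h1 := PFlag.rel_convex hik hij hjk
    have h2 := s.1.rel.trans (s.1.rel.symm h1) hik
    unfold ratioOf
    rw [if_pos hik, if_pos h1, if_pos h2, ← Real.exp_add,
      abs_of_nonneg (sub_nonneg.mpr (h.anti _ _ hij h1)),
      abs_of_nonneg (sub_nonneg.mpr (h.anti _ _ hjk h2)),
      abs_of_nonneg (sub_nonneg.mpr (h.anti _ _ (hij.trans hjk) hik))]
    congr 1; ring
  · rw [not_not.mp (mt ratioOf_ne_zero.mp hik)]
    by_cases h1 : s.1.rel i j
    · rw [not_not.mp (mt ratioOf_ne_zero.mp fun h2 => hik (s.1.rel.trans h1 h2)), mul_zero]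
    · rw [not_not.mp (mt ratioOf_ne_zero.mp h1), zero_mul]

/-- The flag of the spans of the last vectors of a frame, with given breaks. -/
def ratioFlag (u : Frame n) (ρ : Fin n → Fin n → ℝ) : PFlag (Sp n) where
  carrier := {W | ∃ p : ℕ, (∀ i k : Fin n, (i : ℕ) < p → p ≤ k → ρ i k = 0) ∧
    W = Submodule.span ℝ (u '' {k | p ≤ k})}
  chain := by
    rintro _ ⟨p, -, rfl⟩ _ ⟨q, -, rfl⟩ -
    rcases le_total p q with h | h
    · exact Or.inr (Submodule.span_mono (Set.image_mono fun k hk => le_trans h hk))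
    · exact Or.inl (Submodule.span_mono (Set.image_mono fun k hk => le_trans h hk))
  bot_mem := ⟨n, fun i k _ h => absurd h (not_le.mpr k.2), by
    have : {k : Fin n | n ≤ (k : ℕ)} = ∅ := by
      ext k; simp
    rw [this]; simp⟩
  top_mem := ⟨0, fun i k h => absurd h (Nat.not_lt_zero _), by
    have : {k : Fin n | 0 ≤ (k : ℕ)} = Set.univ := by
      ext k; simp
    rw [this, Set.image_univ]
    have := u.toBasis.span_eq
    rw [OrthonormalBasis.coe_toBasis] at this
    exact this.symm⟩

lemma tailSet_span (u : Frame n) (p : ℕ) :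
    tailSet (Submodule.span ℝ (u '' {k : Fin n | p ≤ k})) = {k : Fin n | p ≤ k} := by
  ext i
  rw [mem_tailSet, Frame.finrank_span_image]
  exact (mem_iff_of_upper (U := {k : Fin n | p ≤ k})
    (fun i k (hi : p ≤ (i : ℕ)) (hik : (i : ℕ) ≤ k) => hi.trans hik) i).symm

lemma ratioFlag_adapted (u : Frame n) (ρ : Fin n → Fin n → ℝ) : Adapted u (ratioFlag u ρ) := by
  rintro _ ⟨p, -, rfl⟩ i
  rw [tailSet_span]
  refine ⟨fun hi => Submodule.subset_span ⟨i, hi, rfl⟩, fun hi => ?_⟩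
  rw [Submodule.mem_orthogonal]
  intro v hv
  refine Submodule.span_induction (p := fun x _ => inner ℝ x (u i) = 0) ?_ ?_ ?_ ?_ hv
  · rintro _ ⟨l, hl, rfl⟩
    rw [u.inner_eq, if_neg]; rintro rfl; exact hi hl
  · simp
  · intro x y _ _ hx hy; rw [inner_add_left, hx, hy, add_zero]
  · intro a x _ hx; rw [inner_smul_left, hx, mul_zero]

/-- If `ρ i k` vanishes, let `p` be the first index after `i` with `ρ i p = 0`. Multiplicativity
along the order makes all ratios across `p` vanish, so the flag has a member breaking at `p`. -/
lemma ratioFlag_rel (u : Frame n) {ρ : Fin n → Fin n → ℝ} (hρ : IsRatio ρ) (i k : Fin n) :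
    (ratioFlag u ρ).rel i k ↔ ρ i k ≠ 0 := by
  wlog hik : i ≤ k generalizing i k
  · rw [hρ.2.1 i k, ← this k i (le_of_not_ge hik)]
    exact ⟨fun h => (ratioFlag u ρ).rel.symm h, fun h => (ratioFlag u ρ).rel.symm h⟩
  constructor
  · intro h h0
    have hne : {l | i ≤ l ∧ ρ i l = 0}.Nonempty := ⟨k, hik, h0⟩
    obtain ⟨p, ⟨hip, hp⟩, hmin⟩ := WellFounded.has_min (wellFounded_lt (α := Fin n)) _ hne
    have hW : Submodule.span ℝ (u '' {k | (p : ℕ) ≤ k}) ∈ (ratioFlag u ρ).carrier := by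
      refine ⟨p, fun i' k' hi' hk' => ?_, rfl⟩
      have hi'' : i' < p := hi'
      have hk'' : p ≤ k' := hk'
      rw [hρ.2.2.2 i' p k' hi''.le hk'']
      suffices ρ i' p = 0 by rw [this, zero_mul]
      rcases le_total i' i with h1 | h1
      · rw [hρ.2.2.2 i' i p h1 hip, hp, mul_zero]
      · have h2 : ρ i i' ≠ 0 := fun h2 => hmin i' ⟨h1, h2⟩ hi''
        rw [hρ.2.2.2 i i' p h1 hi''.le] at hp
        exact (mul_eq_zero.mp hp).resolve_left h2
    have := PFlag.rel_iff.mp h _ hW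
    rw [tailSet_span] at this
    have hpk : p ≤ k := by
      by_contra! hpk
      exact hmin k ⟨hik, h0⟩ hpk
    have hpi : p ≤ i := this.mpr hpk
    have := le_antisymm hpi hip
    subst this
    rw [hρ.1] at hp
    exact one_ne_zero hp
  · intro h
    rw [PFlag.rel_iff]
    rintro _ ⟨p, hp, rfl⟩
    rw [tailSet_span]
    refine ⟨fun (hi : p ≤ (i : ℕ)) => le_trans hi (Fin.le_def.mp hik), fun hk => ?_⟩
    by_contra hi
    exact h (hp i k (not_le.mp hi) hk)

/-- The exponent of an index is the logarithm of its ratio with the first index of its class;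
multiplicativity recovers all other ratios. Thus every pair of a frame and a system of ratios is
realised. -/
lemma exists_isSpectral_of_isRatio (u : Frame n) {ρ : Fin n → Fin n → ℝ} (hρ : IsRatio ρ) :
    ∃ s f, IsSpectral u f s ∧ ratioOf s.1.rel f = ρ := by
  set F := ratioFlag u ρ
  have hne : ∀ i, {k | ρ k i ≠ 0}.Nonempty := fun i => ⟨i, by simp [hρ.1]⟩
  set r : Fin n → Fin n := fun i => wellFounded_lt.min {k | ρ k i ≠ 0} (hne i) with hr
  have hri : ∀ i, ρ (r i) i ≠ 0 := fun i => wellFounded_lt.min_mem _ (hne i)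
  have hrle : ∀ i, r i ≤ i := fun i =>
    not_lt.mp (wellFounded_lt.not_lt_min {k | ρ k i ≠ 0} (x := i) (by simp [hρ.1]))
  have hreq : ∀ i k, ρ i k ≠ 0 → r i = r k := by
    intro i k hik
    have : {j | ρ j i ≠ 0} = {j | ρ j k ≠ 0} := by
      ext j
      rw [← ratioFlag_rel u hρ] at hik
      simp only [Set.mem_ofPred_eq, ← ratioFlag_rel u hρ]
      exact ⟨fun h => F.rel.trans h hik, fun h => F.rel.trans h (F.rel.symm hik)⟩
    simp only [hr, this]
  set f : Fin n → ℝ := fun i => Real.log (ρ (r i) i) with hf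
  have hfk : ∀ i k, i ≤ k → ρ i k ≠ 0 → f k = f i + Real.log (ρ i k) := by
    intro i k hik h0
    simp only [hf]
    rw [← hreq i k h0, hρ.2.2.2 (r i) i k (hrle i) hik, Real.log_mul (hri i) h0]
  refine ⟨⟨F, fun c => ((diagForm u f).pull c.lift c.lift_injective).cls⟩, f,
    ⟨ratioFlag_adapted u ρ, fun i k hik hR => ?_, fun c => rfl⟩, ?_⟩
  · rw [hfk i k hik ((ratioFlag_rel u hρ i k).mp hR)]
    linarith [Real.log_nonpos (hρ.2.2.1 i k).1 (hρ.2.2.1 i k).2]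
  · funext i k
    wlog hik : i ≤ k generalizing i k
    · rw [ratioOf_symm, hρ.2.1 i k]
      exact this k i (le_of_not_ge hik)
    unfold ratioOf
    split_ifs with hR
    · have h0 := (ratioFlag_rel u hρ i k).mp hR
      have hpos : 0 < ρ i k := lt_of_le_of_ne (hρ.2.2.1 i k).1 (Ne.symm h0)
      rw [hfk i k hik h0, sub_add_cancel_left, abs_neg,
        abs_of_nonpos (Real.log_nonpos hpos.le (hρ.2.2.1 i k).2), neg_neg, Real.exp_log hpos]
    · by_contra h0
      exact hR ((ratioFlag_rel u hρ i k).mpr (Ne.symm h0))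

/-- Frames together with ratios. -/
def spectralSet (n : ℕ) : Set ((Fin n → Sp n) × (Fin n → Fin n → ℝ)) :=
  {p | Orthonormal ℝ p.1 ∧ IsRatio p.2}

lemma isCompact_spectralSet : IsCompact (spectralSet n) := by
  refine Metric.isCompact_of_isClosed_isBounded ?_ ?_
  · have : spectralSet n = {p | (∀ i k, inner ℝ (p.1 i) (p.1 k) = if i = k then (1 : ℝ) else 0) ∧
        IsRatio p.2} := by
      ext p
      simp only [spectralSet, Set.mem_ofPred_eq, orthonormal_iff_ite]
    rw [this]
    simp only [IsRatio, Set.ofPred_and, Set.ofPred_forall]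
    refine IsClosed.inter ?_ (IsClosed.inter ?_ (IsClosed.inter ?_ (IsClosed.inter ?_ ?_)))
    · exact isClosed_iInter fun i => isClosed_iInter fun k =>
        isClosed_eq (by fun_prop) continuous_const
    · exact isClosed_iInter fun i => isClosed_eq (by fun_prop) continuous_const
    · exact isClosed_iInter fun i => isClosed_iInter fun k =>
        isClosed_eq (by fun_prop) (by fun_prop)
    · exact isClosed_iInter fun i => isClosed_iInter fun k => IsClosed.inter
        (isClosed_le continuous_const (by fun_prop)) (isClosed_le (by fun_prop) continuous_const)
    · exact isClosed_iInter fun i => isClosed_iInter fun j => isClosed_iInter fun k =>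
        isClosed_iInter fun _ => isClosed_iInter fun _ =>
        isClosed_eq (by fun_prop) (by fun_prop)
  · rw [isBounded_iff_forall_norm_le]
    refine ⟨1, fun p hp => ?_⟩
    rw [Prod.norm_def]
    refine max_le ?_ ?_
    · exact (pi_norm_le_iff_of_nonneg zero_le_one).mpr fun i => (hp.1.1 i).le
    · refine (pi_norm_le_iff_of_nonneg zero_le_one).mpr fun i =>
        (pi_norm_le_iff_of_nonneg zero_le_one).mpr fun k => ?_
      rw [Real.norm_eq_abs, abs_of_nonneg (hp.2.2.2.1 i k).1]
      exact (hp.2.2.2.1 i k).2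

/-- An orthonormal family as a frame. -/
def frameOf (u : Fin n → Sp n) (hu : Orthonormal ℝ u) : Frame n :=
  OrthonormalBasis.mk hu (hu.linearIndependent.span_eq_top_of_card_eq_finrank' (by simp)).ge

lemma coe_frameOf (u : Fin n → Sp n) (hu : Orthonormal ℝ u) : ⇑(frameOf u hu) = u := by
  simp [frameOf]

lemma exists_coord_eq {p : (Fin n → Sp n) × (Fin n → Fin n → ℝ)} (hp : p ∈ spectralSet n) :
    ∃ (u : Frame n) (s : Satake n) (f : Fin n → ℝ), ⇑u = p.1 ∧ IsSpectral u f s ∧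
      s.coord = satakeCoord p.1 p.2 := by
  obtain ⟨s, f, h, hr⟩ := exists_isSpectral_of_isRatio (frameOf p.1 hp.1) hp.2
  refine ⟨_, s, f, coe_frameOf _ _, h, ?_⟩
  rw [h.coord_eq, hr, coe_frameOf]

/-- The coordinate image is the continuous image of the compact set of frames with ratios, without
any condition relating flag and frame, since vanishing ratios encode the flag. -/
instance : CompactSpace (Satake n) := by
  have : Set.range (Satake.coord (n := n)) =
      (fun p : (Fin n → Sp n) × (Fin n → Fin n → ℝ) => satakeCoord p.1 p.2) '' spectralSet n := by
    ext y
    constructor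
    · rintro ⟨s, rfl⟩
      obtain ⟨u, f, h⟩ := exists_isSpectral s
      exact ⟨(u, ratioOf s.1.rel f), ⟨u.orthonormal, h.isRatio⟩, h.coord_eq.symm⟩
    · rintro ⟨p, hp, rfl⟩
      obtain ⟨u, s, f, -, -, h⟩ := exists_coord_eq hp
      exact ⟨s, h⟩
  rw [← isCompact_univ_iff, Satake.isEmbedding_coord.isCompact_iff, Set.image_univ, this]
  exact isCompact_spectralSet.image continuous_satakeCoord

/-! ### The symmetric space in its Satake--Furstenberg compactification -/

lemma Cell.lift_eq_toSpace (c : Cell (PFlag.trivial (Sp n))) : c.lift = c.toSpace := by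
  refine LinearMap.ext fun x => ?_
  obtain ⟨v, hv, rfl⟩ := c.proj_surjective x
  have h1 : c.toSpace (c.proj v hv) = v := by
    rw [Cell.toSpace, Cell.proj, Submodule.mkQ_apply, Submodule.liftQ_apply]
    rfl
  have h2 : v ∈ c.loᗮ := by rw [c.lo_eq_bot, Submodule.bot_orthogonal_eq_top]; trivial
  rw [h1, c.lift_proj_of_orth hv h2]

lemma trivial_adapted (u : Frame n) : Adapted u (PFlag.trivial (Sp n)) := by
  rintro W (rfl | rfl) i
  · refine ⟨fun h => ?_, fun _ => ?_⟩
    · rw [mem_tailSet, finrank_bot] at h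
      omega
    · rw [Submodule.bot_orthogonal_eq_top]; exact Submodule.mem_top
  · refine ⟨fun _ => Submodule.mem_top, fun h => absurd ?_ h⟩
    rw [mem_tailSet]; simp

lemma isSpectral_incl (u : Frame n) {f : Fin n → ℝ} (hf : Antitone f) :
    IsSpectral u f (satakeIncl (diagForm u f).cls) := by
  refine ⟨trivial_adapted u, fun i k hik _ => hf hik, fun c => ?_⟩
  change _ = ((diagForm u f).pull c.toSpace c.toSpace_injective).cls
  congr 1
  rw [PosForm.ext_iff']
  intro x y
  have h := Cell.lift_eq_toSpace c
  rw [PosForm.pull_apply, PosForm.pull_apply]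
  exact congrArg₂ (fun a b => (diagForm u f).bil a b) (LinearMap.congr_fun h x)
    (LinearMap.congr_fun h y)

lemma ratioOf_incl (x : PE (Sp n)) (f : Fin n → ℝ) (i k : Fin n) :
    ratioOf (satakeIncl x).1.rel f i k = Real.exp (-|f i - f k|) :=
  if_pos (PFlag.trivial_rel i k)

lemma PE.exists_diagForm (x : PE (Sp n)) :
    ∃ (u : Frame n) (f : Fin n → ℝ), Antitone f ∧ x = (diagForm u f).cls := by
  obtain ⟨P, rfl⟩ := x.exists_rep
  obtain ⟨u, hP, hf⟩ := Karpelevich.exists_diagForm P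
  exact ⟨u, _, hf, congrArg _ hP⟩

lemma IsSpectral.eq_incl {s : Satake n} {u : Frame n} {f : Fin n → ℝ} (h : IsSpectral u f s)
    (hs : ∀ i k, s.1.rel i k) : s = satakeIncl (diagForm u f).cls := by
  have h' := isSpectral_incl u (f := f) (fun i k hik => h.anti i k hik (hs i k))
  refine h.eq h' ?_ fun i k => ?_
  · funext i k
    rw [ratioOf_incl, ratioOf, if_pos (hs i k)]
  · rw [u.inner_eq]
    split_ifs with hik
    · rw [hik, ratioOf_self]; ring
    · ring

lemma satakeIncl_injective (hn : 0 < n) : Function.Injective (satakeIncl (n := n)) := by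
  intro x y hxy
  obtain ⟨P, rfl⟩ := x.exists_rep
  obtain ⟨Q, rfl⟩ := y.exists_rep
  have h : trivialForms P.cls = trivialForms Q.cls := eq_of_heq (Sigma.mk.inj_iff.mp hxy).2
  set c := (PFlag.trivial (Sp n)).cellOf ⟨0, hn⟩
  have hsurj : ∀ v : Sp n, ∃ x, c.toSpace x = v := by
    intro v
    have hc : c.hi = ⊤ := by
      rcases c.hi_mem with h | h
      · exact absurd c.lt (by rw [h]; exact not_lt_bot)
      · exact h
    refine ⟨c.proj v (hc ▸ Submodule.mem_top), ?_⟩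
    rw [← c.lift_eq_toSpace, c.lift_proj_of_orth]
    rw [c.lo_eq_bot, Submodule.bot_orthogonal_eq_top]
    exact Submodule.mem_top
  obtain ⟨a, ha, hPQ⟩ := PosForm.cls_eq.mp (show (P.pull c.toSpace c.toSpace_injective).cls =
    (Q.pull c.toSpace c.toSpace_injective).cls from congrFun h c)
  refine PosForm.cls_eq.mpr ⟨a, ha, fun v w => ?_⟩
  obtain ⟨v, rfl⟩ := hsurj v
  obtain ⟨w, rfl⟩ := hsurj w
  exact hPQ v w

/-! ### Continuity of spectral data and the embedding of the symmetric space -/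

lemma continuous_bil (v w : Sp n) : Continuous fun P : PosForm (Sp n) => P.bil v w :=
  (continuous_apply (v, w)).comp
    (continuous_induced_dom (f := fun (P : PosForm (Sp n)) (p : Sp n × Sp n) => P p.1 p.2))

lemma tendsto_posForm {J : Type} {l : Filter J} {P : J → PosForm (Sp n)} {Q : PosForm (Sp n)} :
    Tendsto P l (𝓝 Q) ↔ ∀ v w, Tendsto (fun j => (P j).bil v w) l (𝓝 (Q.bil v w)) := by
  rw [nhds_induced, tendsto_comap_iff, tendsto_pi_nhds]
  exact ⟨fun h v w => h (v, w), fun h p => h p.1 p.2⟩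

lemma continuous_cls : Continuous (PosForm.cls : PosForm (Sp n) → PE (Sp n)) :=
  continuous_quotient_mk'

lemma continuous_of_cls {X : Type} [TopologicalSpace X] {F : PE (Sp n) → X}
    (h : Continuous fun P : PosForm (Sp n) => F P.cls) : Continuous F :=
  (isQuotientMap_quotient_mk' (s := PosForm.setoid (Sp n))).continuous_iff.mpr h

/-- The asymptotic theorem is applied along the neighbourhood filter of `P`, with the eigenframe of
`P` as the fixed frame, a single block and no rescaling. -/
lemma spectral_continuity (P : PosForm (Sp n)) :
    (∀ i, Tendsto (fun Q : PosForm (Sp n) => Real.log (Q.eig i)) (𝓝 P)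
      (𝓝 (Real.log (P.eig i)))) ∧
    Tendsto (fun Q : PosForm (Sp n) => satakeIncl Q.cls) (𝓝 P) (𝓝 (satakeIncl P.cls)) := by
  choose u hu hanti using fun Q : PosForm (Sp n) => exists_diagForm Q
  have hsp : ∀ Q : PosForm (Sp n),
      IsSpectral (u Q) (fun i => Real.log (Q.eig i)) (satakeIncl Q.cls) := fun Q => by
    have := isSpectral_incl (u Q) (hanti Q)
    rwa [← hu Q] at this
  have htriv := PFlag.trivial_rel (n := n)
  have key := tendsto_spectral (J := PosForm (Sp n)) (l := 𝓝 P) (S := (PFlag.trivial (Sp n)).rel)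
    (T := (PFlag.trivial (Sp n)).rel) (w := u) (w' := fun _ => u P) (u := u P)
    (g := fun Q i => Real.log (Q.eig i)) (b := fun _ _ => 0) (f := fun i => Real.log (P.eig i))
    (fun Q i => (trivial_adapted _).span_eq (trivial_adapted _) i) (fun Q i k hik _ => hanti Q hik)
    (fun i k hik _ => hanti P hik) (fun _ _ _ _ => rfl) (fun i k _ _ h => absurd (htriv i k) h)
    (fun i => tendsto_const_nhds) (fun i k => by
      have h1 := (continuous_bil (u P i) (u P k)).tendsto P
      have h2 : P.bil (u P i) (u P k) = if i = k then Real.exp (Real.log (P.eig i)) else 0 := by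
        have h3 := diagForm_frame (u P) (fun i => Real.log (P.eig i)) i k
        rwa [← hu P] at h3
      rw [← h2]
      refine h1.congr fun Q => ?_
      rw [← hu Q]
      simp)
  refine ⟨fun i => ?_, ?_⟩
  · simpa using key.1 i
  · refine tendsto_satake hsp (hsp P) (fun i k => ?_) key.2.2
    refine (key.2.1 i k (htriv i k)).congr fun Q => ?_
    rw [ratioOf_incl]

lemma continuous_satakeIncl : Continuous (satakeIncl (n := n)) :=
  continuous_of_cls (continuous_iff_continuousAt.mpr fun P => (spectral_continuity P).2)

lemma continuous_logEig : Continuous (PE.logEig (n := n)) := by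
  refine continuous_of_cls (continuous_pi fun i => ?_)
  change Continuous fun P : PosForm (Sp n) => Real.log (P.eig i) - (∑ j, Real.log (P.eig j)) / n
  have h : ∀ i, Continuous fun P : PosForm (Sp n) => Real.log (P.eig i) := fun i =>
    continuous_iff_continuousAt.mpr fun P => (spectral_continuity P).1 i
  exact (h i).sub ((continuous_finsetSum _ fun j _ => h j).div_const _)

lemma logEig_sub (u : Frame n) {f : Fin n → ℝ} (hf : Antitone f) (i k : Fin n) :
    (diagForm u f).cls.logEig i - (diagForm u f).cls.logEig k = f i - f k := by
  obtain ⟨u', hP, hf'⟩ := exists_diagForm (diagForm u f)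
  have h1 := isSpectral_incl u hf
  have h2 := isSpectral_incl u' hf'
  rw [← hP] at h2
  have := (h1.unique h2).1 i k (PFlag.trivial_rel i k)
  rw [← this]
  change Real.log _ - _ - (Real.log _ - _) = _
  ring

/-- The form representing a point of `PE_n`, normalised to have the greatest eigenvalue one. -/
lemma exists_normal_form (hn : 0 < n) (x : PE (Sp n)) : ∃ P : PosForm (Sp n), P.cls = x ∧
    ∀ v w, P.bil v w = ∑ a, ∑ b, v a * w b * (satakeIncl x).coord.2 ⟨0, hn⟩ a b := by
  obtain ⟨u, f, hf, rfl⟩ := x.exists_diagForm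
  refine ⟨(diagForm u f).scale (Real.exp (-f ⟨0, hn⟩)) (Real.exp_pos _), PosForm.scale_cls _ _ _,
    fun v w => ?_⟩
  rw [(isSpectral_incl u hf).coord_eq, PosForm.scale_apply, diagForm_apply, Finset.mul_sum]
  have := sum_coord u (fun k => ratioOf (satakeIncl (diagForm u f).cls).1.rel f ⟨0, hn⟩ k) v w
  refine Eq.trans (Finset.sum_congr rfl fun k _ => ?_) this
  rw [ratioOf_incl, abs_of_nonneg (sub_nonneg.mpr (hf (Fin.le_def.mpr (Nat.zero_le _)))),
    ← mul_assoc, ← mul_assoc,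
    ← Real.exp_add]
  congr 3; ring_nf

/-- The representative with greatest eigenvalue one is linear in the coordinates of its image, which
makes the inverse map continuous. -/
lemma isEmbedding_satakeIncl (hn : 0 < n) : IsEmbedding (satakeIncl (n := n)) := by
  refine ⟨isInducing_iff_nhds.mpr fun x => le_antisymm
    (continuous_satakeIncl.tendsto x).le_comap ?_, satakeIncl_injective hn⟩
  choose P hP hPv using exists_normal_form (n := n) hn
  have h1 : Tendsto P (comap satakeIncl (𝓝 (satakeIncl x))) (𝓝 (P x)) := by
    rw [tendsto_posForm]
    intro v w
    simp_rw [hPv]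
    have h2 : Tendsto (fun y => (satakeIncl y).coord.2) (comap satakeIncl (𝓝 (satakeIncl x)))
        (𝓝 (satakeIncl x).coord.2) :=
      ((continuous_snd.comp Satake.isEmbedding_coord.continuous).tendsto (satakeIncl x)).comp
        tendsto_comap
    refine tendsto_finsetSum _ fun a _ => tendsto_finsetSum _ fun b _ => Tendsto.const_mul _ ?_
    exact tendsto_pi_nhds.mp (tendsto_pi_nhds.mp (tendsto_pi_nhds.mp h2 _) a) b
  have h3 := (continuous_cls.tendsto (P x)).comp h1
  rw [hP] at h3
  have h4 : PosForm.cls ∘ P = id := funext hP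
  rw [h4] at h3
  exact h3

/-- Applied to `b = ψ i - ψ k` and `a = f k - f i`, it shows that adding a large multiple of a
velocity `ψ` to exponents `f` orders them wherever `ψ` strictly decreases. -/
lemma exists_mono_shift {J : Type} [Finite J] (a b : J → ℝ) :
    ∃ N : ℝ, 0 ≤ N ∧ ∀ i, 0 < b i → a i ≤ N * b i := by
  cases nonempty_fintype J
  refine ⟨∑ i, |a i| / |b i|, Finset.sum_nonneg fun i _ => by positivity, fun i hi => ?_⟩
  have h1 : |a i| / |b i| ≤ ∑ i, |a i| / |b i| :=
    Finset.single_le_sum (f := fun i => |a i| / |b i|) (fun i _ => by positivity)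
      (Finset.mem_univ i)
  rw [div_le_iff₀ (abs_pos.mpr hi.ne'), abs_of_pos hi] at h1
  exact (le_abs_self _).trans h1

/-- With the frame kept, the exponents of different cells are driven apart by growing multiples of
`dim lo`, a function constant on cells and decreasing from the top to the bottom. -/
lemma denseRange_satakeIncl : DenseRange (satakeIncl (n := n)) := by
  intro s
  obtain ⟨u, f, h⟩ := exists_isSpectral s
  set ψ : Fin n → ℝ := fun i => Module.finrank ℝ (s.1.cellOf i).lo with hψ
  have hψ1 : ∀ i k, s.1.rel i k → ψ i = ψ k := fun i k hik => by
    simp only [hψ]; rw [PFlag.rel_def.mp hik]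
  have hψ2 : ∀ i k, i ≤ k → ¬ s.1.rel i k → 0 < ψ i - ψ k := fun i k hik hR => by
    have h1 := Cell.hi_le_lo_of_lt (fun h => hR (PFlag.rel_def.mpr h.symm)) (s.1.cellOf_has i)
      (s.1.cellOf_has k) hik
    have h2 := Submodule.finrank_mono h1
    have h3 := (s.1.cellOf k).finrank_lt
    have : Module.finrank ℝ (s.1.cellOf k).lo < Module.finrank ℝ (s.1.cellOf i).lo := by omega
    exact sub_pos.mpr (Nat.cast_lt.mpr this)
  obtain ⟨N, hN0, hN⟩ := exists_mono_shift (fun p : Fin n × Fin n => f p.2 - f p.1)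
    (fun p => ψ p.1 - ψ p.2)
  set g : ℕ → Fin n → ℝ := fun j i => f i + (N + j) * ψ i with hg
  have hganti : ∀ j, Antitone (g j) := fun j i k hik => by
    simp only [hg]
    by_cases hR : s.1.rel i k
    · rw [hψ1 i k hR]
      linarith [h.anti i k hik hR]
    · have h1 := hψ2 i k hik hR
      have h2 := hN (i, k) h1
      have h3 : (0 : ℝ) ≤ j * (ψ i - ψ k) := by positivity
      simp only at h2
      nlinarith
  refine mem_closure_of_tendsto (f := fun j : ℕ => satakeIncl (diagForm u (g j)).cls)
    (b := atTop) (tendsto_satake (fun j => isSpectral_incl u (hganti j)) h (fun i k => ?_)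
      fun i k => ?_) (Eventually.of_forall fun j => ⟨_, rfl⟩)
  · simp_rw [ratioOf_incl]
    by_cases hR : s.1.rel i k
    · refine tendsto_const_nhds.congr fun j => ?_
      rw [ratioOf, if_pos hR]
      simp only [hg, hψ1 i k hR]
      congr 3; ring
    · rw [ratioOf, if_neg hR]
      have main : ∀ i k, i ≤ k → ¬ s.1.rel i k →
          Tendsto (fun j => Real.exp (-|g j i - g j k|)) atTop (𝓝 0) := by
        intro i k hik hR
        refine tendsto_exp_neg_abs ?_
        have h1 : Tendsto (fun j : ℕ => (j : ℝ) * (ψ i - ψ k)) atTop atTop :=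
          tendsto_natCast_atTop_atTop.atTop_mul_const (hψ2 i k hik hR)
        refine (tendsto_atTop_add_const_left _ (f i - f k + N * (ψ i - ψ k)) h1).congr fun j => ?_
        simp only [hg]; ring
      rcases le_total i k with hik | hik
      · exact main i k hik hR
      · simp_rw [abs_sub_comm (g _ i)]
        exact main k i hik fun h' => hR (s.1.rel.symm h')
  · refine tendsto_const_nhds.congr fun j => ?_
    rw [u.inner_eq]
    split_ifs with hik
    · rw [hik, ratioOf_self]; ring
    · ring

lemma tendsto_neg_log_atTop {J : Type} {l : Filter J} {g : J → ℝ} (h : Tendsto g l (𝓝 0))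
    (hpos : ∀ j, 0 < g j) : Tendsto (fun j => -Real.log (g j)) l atTop := by
  have h1 : Tendsto g l (𝓝[>] 0) :=
    tendsto_nhdsWithin_iff.mpr ⟨h, Eventually.of_forall hpos⟩
  exact tendsto_neg_atBot_atTop.comp (Real.tendsto_log_nhdsGT_zero.comp h1)

/-- The definition provides the hypotheses of `tendsto_spectral`: the moving frames are `h j`
applied to a spectral frame of the limit, and the shifts are the logarithms of the normalising
factors, corrected by the factor between `Q c` and the chosen diagonal form. -/
lemma tendsto_of_satakeConverges {x : ℕ → PE (Sp n)} {s : Satake n} (h : SatakeConverges x s) :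
    Tendsto (fun j => satakeIncl (x j)) atTop (𝓝 s) := by
  obtain ⟨P, Q, h, l, hP, hQ, hh, hl, hll, hcross, hlim⟩ := h
  obtain ⟨u, f, hs⟩ := exists_isSpectral s
  choose w hw hanti using fun j => exists_diagForm (P j)
  have hsp : ∀ j, IsSpectral (w j) (fun i => Real.log ((P j).eig i)) (satakeIncl (x j)) :=
    fun j => by
      have := isSpectral_incl (w j) (hanti j)
      rwa [← hw j, hP j] at this
  have hc : ∀ c : Cell s.1, ∃ a : ℝ, 0 < a ∧ ∀ x y, (Q c).bil x y =
      a * (diagForm u f).bil (c.lift x) (c.lift y) := fun c =>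
    PosForm.cls_eq.mp ((hs.form c).trans (hQ c).symm)
  choose a ha haQ using hc
  have key := tendsto_spectral (J := ℕ) (l := atTop) (S := (PFlag.trivial (Sp n)).rel)
    (T := s.1.rel) (w := w) (w' := fun j => u.map (h j)) (u := u)
    (g := fun j i => Real.log ((P j).eig i))
    (b := fun j i => Real.log (a (s.1.cellOf i)) - Real.log (l j (s.1.cellOf i))) (f := f)
    (fun j i => (trivial_adapted _).span_eq (trivial_adapted _) i) (fun j i k hik _ => hanti j hik)
    hs.anti (fun j i k hik => by rw [PFlag.rel_def.mp hik]) (fun i k hik _ hR => ?_)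
    (fun i => ?_) (fun i k => ?_)
  · refine tendsto_satake hsp hs (fun i k => ?_) key.2.2
    simp_rw [ratioOf_incl]
    exact key.2.1 i k (PFlag.trivial_rel i k)
  · have h1 := hll _ _ (Cell.hi_le_lo_of_lt (fun h => hR (PFlag.rel_def.mpr h.symm))
      (s.1.cellOf_has i) (s.1.cellOf_has k) hik)
    have h2 := tendsto_neg_log_atTop h1 fun j => div_pos (hl _ _) (hl _ _)
    refine (tendsto_atTop_add_const_left _
      (Real.log (a (s.1.cellOf i)) - Real.log (a (s.1.cellOf k))) h2).congr fun j => ?_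
    rw [Real.log_div (hl _ _).ne' (hl _ _).ne']
    ring
  · simp only [OrthonormalBasis.map_apply]
    exact hh (u i)
  · simp only [OrthonormalBasis.map_apply]
    by_cases hik : s.1.rel i k
    · have hi := s.1.cellOf_has i
      have hk : (s.1.cellOf i).Has k := PFlag.rel_def.mp hik ▸ s.1.cellOf_has k
      set c := s.1.cellOf i
      have h1 : Tendsto (fun j => l j c * (P j).bil (h j (u i)) (h j (u k))) atTop
          (𝓝 ((Q c).bil (c.proj (u i) (hs.adapted.mem_hi hi)) (c.proj (u k)
            (hs.adapted.mem_hi hk)))) :=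
        hlim c (u i) (u k) (hs.adapted.mem_hi hi) (hs.adapted.mem_hi hk) (hs.adapted.mem_orth hi)
          (hs.adapted.mem_orth hk)
      rw [haQ, hs.adapted.lift_proj_frame hi, hs.adapted.lift_proj_frame hk, diagForm_frame] at h1
      have h2 := h1.const_mul (a c)⁻¹
      rw [← mul_assoc, inv_mul_cancel₀ (ha c).ne', one_mul] at h2
      refine h2.congr fun j => ?_
      rw [← hw j, ← PFlag.rel_def.mp hik, ← two_mul, neg_div, mul_div_cancel_left₀ _ two_ne_zero,
        neg_sub, Real.exp_sub, Real.exp_log (ha _), Real.exp_log (hl _ _)]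
      ring
    · rw [if_neg (show i ≠ k from fun h => hik (h ▸ s.1.rel.refl i))]
      refine tendsto_const_nhds.congr fun j => ?_
      have h1 : (P j).bil (h j (u i)) (h j (u k)) = 0 :=
        hcross j (s.1.cellOf i) (s.1.cellOf k) (fun h => hik (PFlag.rel_def.mpr h)) (u i)
          ⟨hs.adapted.mem_hi (s.1.cellOf_has i), hs.adapted.mem_orth (s.1.cellOf_has i)⟩ (u k)
          ⟨hs.adapted.mem_hi (s.1.cellOf_has k), hs.adapted.mem_orth (s.1.cellOf_has k)⟩
      rw [← hw j, h1, mul_zero]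

/-- The frames representing a point of `S_n`. -/
def spectralFrames (s : Satake n) : Set (Fin n → Sp n) :=
  {v | ∃ (u : Frame n) (f : Fin n → ℝ), ⇑u = v ∧ IsSpectral u f s}

/-- Spectral frames of a convergent family approach the spectral frames of the limit. -/
lemma tendsto_infDist_spectralFrames {J : Type} {l : Filter J} {x : J → Satake n} {s : Satake n}
    {w : J → Frame n} {g : J → Fin n → ℝ} (h : ∀ j, IsSpectral (w j) (g j) (x j))
    (hx : Tendsto x l (𝓝 s)) :
    Tendsto (fun j => Metric.infDist (⇑(w j)) (spectralFrames s)) l (𝓝 0) := by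
  rw [Metric.tendsto_nhds]
  intro ε hε
  -- The data whose frames stay at distance `ε` from those of `s` form a compact set. Its coordinate
  -- image is closed and misses `s`, hence is eventually avoided.
  set A := spectralSet n ∩ {p | ε ≤ Metric.infDist p.1 (spectralFrames s)} with hA
  have hAc : IsCompact A := isCompact_spectralSet.inter_right
    (isClosed_le continuous_const ((Metric.continuous_infDist_pt _).comp continuous_fst))
  have hclosed : IsClosed ((fun p : (Fin n → Sp n) × (Fin n → Fin n → ℝ) =>
      satakeCoord p.1 p.2) '' A) := (hAc.image continuous_satakeCoord).isClosed
  have hs : s.coord ∉ (fun p : (Fin n → Sp n) × (Fin n → Fin n → ℝ) =>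
      satakeCoord p.1 p.2) '' A := by
    rintro ⟨p, ⟨hp, hpA⟩, hps⟩
    obtain ⟨u, s', f, hu, hs', hc⟩ := exists_coord_eq hp
    have : s' = s := Satake.coord_injective (hc.trans hps)
    subst this
    have h0 : Metric.infDist p.1 (spectralFrames s') = 0 :=
      Metric.infDist_zero_of_mem ⟨u, f, hu, hs'⟩
    rw [Set.mem_ofPred_eq, h0] at hpA
    linarith
  have := (Satake.isEmbedding_coord.continuous.tendsto s).comp hx
  filter_upwards [this.eventually (hclosed.isOpen_compl.mem_nhds hs)] with j hj
  rw [Real.dist_eq, sub_zero, abs_of_nonneg Metric.infDist_nonneg]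
  by_contra! hcon
  exact hj ⟨(w j, ratioOf (x j).1.rel (g j)), ⟨⟨(w j).orthonormal, (h j).isRatio⟩, hcon⟩,
    (h j).coord_eq.symm⟩

/-- Eigenframes need not converge because of multiple eigenvalues, but they approach the set of
spectral frames of the limit. One compares the eigenframe `w j` with a varying spectral frame `v j`
of the limit; the orthogonal operator carrying `v j` to `w j` tends to the identity. -/
lemma satakeConverges_of_tendsto {x : ℕ → PE (Sp n)} {s : Satake n}
    (h : Tendsto (fun j => satakeIncl (x j)) atTop (𝓝 s)) : SatakeConverges x s := by
  choose w g hg hx using fun j => (x j).exists_diagForm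
  have hsp : ∀ j, IsSpectral (w j) (g j) (satakeIncl (x j)) := fun j => by
    rw [hx j]; exact isSpectral_incl (w j) (hg j)
  obtain ⟨u, f, hs⟩ := exists_isSpectral s
  have hdist := tendsto_infDist_spectralFrames hsp h
  have hne : (spectralFrames s).Nonempty := ⟨u, u, f, rfl, hs⟩
  have hex : ∀ j : ℕ, ∃ (v : Frame n) (f' : Fin n → ℝ), IsSpectral v f' s ∧
      dist (⇑(w j)) (⇑v) < Metric.infDist (⇑(w j)) (spectralFrames s) + 1 / ((j : ℝ) + 1) := by
    intro j
    obtain ⟨_, ⟨v, f', rfl, hv⟩, hd⟩ := (Metric.infDist_lt_iff hne).mp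
      (lt_add_of_pos_right (Metric.infDist (⇑(w j)) (spectralFrames s))
        (show 0 < 1 / ((j : ℝ) + 1) by positivity))
    exact ⟨v, f', hv, hd⟩
  choose v f' hv hd using hex
  have hvw : ∀ i, Tendsto (fun j => w j i - v j i) atTop (𝓝 0) := by
    intro i
    have h1 : Tendsto (fun j : ℕ => Metric.infDist (⇑(w j)) (spectralFrames s) +
        1 / ((j : ℝ) + 1)) atTop (𝓝 0) := by
      simpa using hdist.add tendsto_one_div_add_atTop_nhds_zero_nat
    refine squeeze_zero_norm (fun j => ?_) h1
    rw [← dist_eq_norm]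
    exact (dist_le_pi_dist (⇑(w j)) (⇑(v j)) i).trans (hd j).le
  have hratio : ∀ i k, Tendsto (fun j => Real.exp (-|g j i - g j k|)) atTop
      (𝓝 (ratioOf s.1.rel f i k)) := by
    intro i k
    have h1 := (Satake.continuous_ratio.tendsto s).comp h
    rw [hs.ratio_eq] at h1
    refine (tendsto_pi_nhds.mp (tendsto_pi_nhds.mp h1 i) k).congr fun j => ?_
    rw [Function.comp_apply, (hsp j).ratio_eq, ratioOf_incl]
  have hdiff : ∀ i k, s.1.rel i k → Tendsto (fun j => g j i - g j k) atTop (𝓝 (f i - f k)) := by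
    have main : ∀ i k, i ≤ k → s.1.rel i k →
        Tendsto (fun j => g j i - g j k) atTop (𝓝 (f i - f k)) := by
      intro i k hik hR
      have h1 := hratio i k
      rw [ratioOf, if_pos hR] at h1
      have h2 := ((Real.continuousAt_log (Real.exp_pos _).ne').tendsto.comp h1).neg
      rw [Real.log_exp, neg_neg, abs_of_nonneg (sub_nonneg.mpr (hs.anti i k hik hR))] at h2
      refine h2.congr fun j => ?_
      rw [Function.comp_apply, Real.log_exp, neg_neg, abs_of_nonneg (sub_nonneg.mpr (hg j hik))]
    intro i k hR
    rcases le_total i k with hik | hik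
    · exact main i k hik hR
    · have := (main k i hik (s.1.rel.symm hR)).neg
      rw [neg_sub] at this
      exact this.congr fun j => by ring
  set H : ℕ → Sp n ≃ₗᵢ[ℝ] Sp n := fun j => (v j).equiv (w j) (Equiv.refl _) with hH
  have hHi : ∀ j i (y : Sp n), inner ℝ (w j i) (H j y) = inner ℝ (v j i) y := by
    intro j i y
    have : H j (v j i) = w j i := by simp [hH]
    rw [← this, LinearIsometryEquiv.inner_map_map]
  have hPH : ∀ j y z, (diagForm (w j) (g j)).bil (H j y) (H j z) =
      ∑ i, Real.exp (g j i) * inner ℝ (v j i) y * inner ℝ (v j i) z := by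
    intro j y z
    rw [diagForm_apply]
    simp_rw [hHi]
  choose r hr using fun c : Cell s.1 => c.exists_has
  refine ⟨fun j => diagForm (w j) (g j), fun c => (diagForm u f).pull c.lift c.lift_injective, H,
    -- The factor of a cell makes the eigenvalue at its marked index `r c` equal to that of the
    -- limiting form.
    fun j c => Real.exp (f (r c) - g j (r c)), fun j => (hx j).symm, hs.form, fun y => ?_,
    fun j c => Real.exp_pos _, fun c d hcd => ?_, fun j c d hcd y hy z hz => ?_,
    fun c y z hy hz hy' hz' => ?_⟩
  · have e : ∀ j, H j y = y + ∑ i, inner ℝ (v j i) y • (w j i - v j i) := by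
      intro j
      simp_rw [smul_sub, Finset.sum_sub_distrib]
      rw [(v j).sum_repr' y, ← (w j).sum_repr' (H j y)]
      simp_rw [hHi]
      abel
    simp_rw [e]
    have h0 : y = y + ∑ i : Fin n, (0 : Sp n) := by simp
    conv => arg 3; rw [h0]
    refine Tendsto.add tendsto_const_nhds (tendsto_finsetSum _ fun i _ => ?_)
    have h1 := ((hvw i).norm).const_mul ‖y‖
    rw [norm_zero, mul_zero] at h1
    refine squeeze_zero_norm (fun j => ?_) h1
    rw [norm_smul]
    refine mul_le_mul_of_nonneg_right ?_ (norm_nonneg _)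
    refine (norm_inner_le_norm _ _).trans ?_
    rw [(v j).norm_eq_one, one_mul]
  · have hlt := Cell.lt_of_hi_le_lo hcd (hr d) (hr c)
    have hR : ¬ s.1.rel (r d) (r c) := fun hR => by
      have h1 := PFlag.rel_def.mp hR
      rw [Cell.has_iff.mp (hr d), Cell.has_iff.mp (hr c)] at h1
      subst h1
      exact d.not_hi_le_lo hcd
    have h1 := hratio (r d) (r c)
    rw [ratioOf, if_neg hR] at h1
    have h2 := h1.const_mul (Real.exp (f (r d) - f (r c)))
    rw [mul_zero] at h2
    refine h2.congr fun j => ?_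
    rw [abs_of_nonneg (sub_nonneg.mpr (hg j hlt.le)), ← Real.exp_add, ← Real.exp_sub]
    congr 1; ring
  · change (diagForm (w j) (g j)).bil (H j y) (H j z) = 0
    rw [hPH]
    refine Finset.sum_eq_zero fun i _ => ?_
    by_cases hi : c.Has i
    · rw [(hv j).adapted.inner_eq_zero (c := d) (fun hi' => hcd (hi.unique hi')) hz.1 hz.2,
        mul_zero]
    · rw [(hv j).adapted.inner_eq_zero hi hy.1 hy.2, mul_zero, zero_mul]
  · change Tendsto (fun j => Real.exp (f (r c) - g j (r c)) *
      (diagForm (w j) (g j)).bil (H j y) (H j z)) atTop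
      (𝓝 ((diagForm u f).bil (c.lift (c.proj y hy)) (c.lift (c.proj z hz))))
    rw [c.lift_proj_of_orth hy hy', c.lift_proj_of_orth hz hz']
    -- The limiting form has the same expression in all frames `v j`, because they differ from `u`
    -- by rotations inside eigenspaces.
    have e1 : ∀ j, (diagForm u f).bil y z =
        ∑ i, Real.exp (f i) * inner ℝ (v j i) y * inner ℝ (v j i) z := by
      intro j
      rw [diagForm_apply]
      refine u.sum_exchange (v j) (α := fun i => Real.exp (f i)) (α' := fun i => Real.exp (f i))
        fun i k => ?_
      by_cases h0 : inner ℝ (u i) (v j k) = 0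
      · rw [h0]; ring
      · have h1 := (mul_eq_zero.mp ((hs.unique (hv j)).2 i k)).resolve_left h0
        by_cases hR : s.1.rel i k
        · rw [ratioOf, if_pos hR, sub_eq_zero, eq_comm, Real.exp_eq_one_iff, neg_eq_zero,
            abs_eq_zero, sub_eq_zero] at h1
          rw [h1]; ring
        · rw [ratioOf, if_neg hR] at h1
          norm_num at h1
    have e2 : ∀ j, Real.exp (f (r c) - g j (r c)) * (diagForm (w j) (g j)).bil (H j y) (H j z) =
        (diagForm u f).bil y z + ∑ i, (Real.exp (f (r c) + (g j i - g j (r c))) - Real.exp (f i)) *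
          (inner ℝ (v j i) y * inner ℝ (v j i) z) := by
      intro j
      rw [hPH, e1 j, Finset.mul_sum, ← Finset.sum_add_distrib]
      refine Finset.sum_congr rfl fun i _ => ?_
      have : Real.exp (f (r c) + (g j i - g j (r c))) =
          Real.exp (f (r c) - g j (r c)) * Real.exp (g j i) := by
        rw [← Real.exp_add]; congr 1; ring
      rw [this]; ring
    simp_rw [e2]
    have h0 : (diagForm u f).bil y z = (diagForm u f).bil y z + ∑ i : Fin n, (0 : ℝ) := by simp
    conv => arg 3; rw [h0]
    refine Tendsto.add tendsto_const_nhds (tendsto_finsetSum _ fun i _ => ?_)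
    by_cases hi : c.Has i
    · have h1 : Tendsto (fun j => Real.exp (f (r c) + (g j i - g j (r c))) - Real.exp (f i)) atTop
          (𝓝 0) := by
        have h2 := (Real.continuous_exp.tendsto _).comp
          ((hdiff i (r c) (hi.rel (hr c))).const_add (f (r c)))
        have h3 := h2.sub_const (Real.exp (f i))
        rw [add_sub_cancel, sub_self] at h3
        exact h3
      have h2 := ((tendsto_zero_iff_abs_tendsto_zero _).mp h1).mul_const (‖y‖ * ‖z‖)
      rw [zero_mul] at h2
      refine squeeze_zero_norm (fun j => ?_) h2
      rw [Function.comp_apply, norm_mul, Real.norm_eq_abs]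
      refine mul_le_mul_of_nonneg_left ?_ (abs_nonneg _)
      rw [norm_mul]
      refine mul_le_mul ?_ ?_ (norm_nonneg _) (norm_nonneg _)
      · refine (norm_inner_le_norm _ _).trans ?_
        rw [(v j).norm_eq_one, one_mul]
      · refine (norm_inner_le_norm _ _).trans ?_
        rw [(v j).norm_eq_one, one_mul]
    · refine tendsto_const_nhds.congr fun j => ?_
      rw [(hv j).adapted.inner_eq_zero hi hy hy']
      ring

lemma isSatakeTopology (n : ℕ) : IsSatakeTopology (satakeTopology n) where
  compact := inferInstance
  metrizable := inferInstance
  dense := denseRange_satakeIncl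
  tendsto_iff _ _ := ⟨satakeConverges_of_tendsto, tendsto_of_satakeConverges⟩

/-! ### The compactification of a linear space by the sphere of rays -/

section Ray

variable {V : Type} [AddCommGroup V] [Module ℝ V]

open scoped Classical in
/-- The point `(v : s)` of the compactification, for `(v, s) ≠ 0`, `s ≥ 0`. -/
def RayComp.pt (v : V) (s : ℝ) : RayComp V :=
  if h : (v, s) ≠ 0 ∧ 0 ≤ s then Quotient.mk (HalfCone.setoid V) ⟨(v, s), h⟩ else RayComp.incl 0

lemma RayComp.pt_eq {v : V} {s : ℝ} (h : (v, s) ≠ 0 ∧ 0 ≤ s) :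
    RayComp.pt v s = Quotient.mk (HalfCone.setoid V) ⟨(v, s), h⟩ := dif_pos h

lemma RayComp.incl_eq (v : V) : RayComp.incl v = RayComp.pt v 1 := by
  rw [RayComp.pt_eq ⟨fun h => one_ne_zero (congrArg Prod.snd h), zero_le_one⟩]
  rfl

lemma RayComp.exists_pt (z : RayComp V) :
    ∃ v s, ((v, s) : V × ℝ) ≠ 0 ∧ 0 ≤ s ∧ z = RayComp.pt v s := by
  obtain ⟨⟨⟨v, s⟩, h⟩, rfl⟩ := Quotient.exists_rep z
  exact ⟨v, s, h.1, h.2, (RayComp.pt_eq h).symm⟩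

lemma RayComp.pt_eq_pt {v v' : V} {s s' : ℝ} (h : (v, s) ≠ 0) (hs : 0 ≤ s) (h' : (v', s') ≠ 0)
    (hs' : 0 ≤ s') :
    RayComp.pt v s = RayComp.pt v' s' ↔ ∃ a : ℝ, 0 < a ∧ v' = a • v ∧ s' = a * s := by
  rw [RayComp.pt_eq ⟨h, hs⟩, RayComp.pt_eq ⟨h', hs'⟩]
  constructor
  · intro e
    obtain ⟨a, ha, e⟩ := Quotient.exact e
    exact ⟨a, ha, congrArg Prod.fst e, congrArg Prod.snd e⟩
  · rintro ⟨a, ha, rfl, rfl⟩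
    exact Quotient.sound ⟨a, ha, rfl⟩

lemma RayComp.pt_smul {v : V} {s : ℝ} (h : (v, s) ≠ 0) (hs : 0 ≤ s) {a : ℝ} (ha : 0 < a) :
    RayComp.pt (a • v) (a * s) = RayComp.pt v s := by
  refine ((RayComp.pt_eq_pt h hs ?_ (by positivity)).mpr ⟨a, ha, rfl, rfl⟩).symm
  intro e
  have : a • (v, s) = 0 := e
  exact h ((smul_eq_zero_iff_right ha.ne').mp this)

/-- The unit half-sphere. -/
def halfSphere (V : Type) [AddCommGroup V] [Module ℝ V] [FiniteDimensional ℝ V] :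
    Set (EuclideanSpace ℝ (Fin (Module.finrank ℝ V)) × ℝ) := {p | ‖p‖ = 1 ∧ 0 ≤ p.2}

lemma isCompact_halfSphere [FiniteDimensional ℝ V] : IsCompact (halfSphere V) := by
  have : halfSphere V = Metric.sphere 0 1 ∩ {p | 0 ≤ p.2} := by
    ext p; simp [halfSphere]
  rw [this]
  exact (isCompact_sphere 0 1).inter_right (isClosed_le continuous_const continuous_snd)

variable [TopologicalSpace V]

lemma RayComp.tendsto_pt {J : Type} {l : Filter J} {v : J → V} {s : J → ℝ} {v₀ : V} {s₀ : ℝ}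
    (hv : Tendsto v l (𝓝 v₀)) (hs : Tendsto s l (𝓝 s₀))
    (h : ∀ᶠ j in l, (v j, s j) ≠ 0 ∧ 0 ≤ s j) (h₀ : (v₀, s₀) ≠ 0 ∧ 0 ≤ s₀) :
    Tendsto (fun j => RayComp.pt (v j) (s j)) l (𝓝 (RayComp.pt v₀ s₀)) := by
  have hc : ContinuousOn (fun p : V × ℝ => RayComp.pt p.1 p.2) {p | p ≠ 0 ∧ 0 ≤ p.2} := by
    rw [continuousOn_iff_continuous_domRestrict]
    have : Continuous fun p : HalfCone V => (Quotient.mk (HalfCone.setoid V) p : RayComp V) :=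
      continuous_quotient_mk'
    refine this.congr fun p => ?_
    exact (RayComp.pt_eq p.2).symm
  have h1 := (hc (v₀, s₀) h₀).tendsto
  exact h1.comp (tendsto_nhdsWithin_iff.mpr ⟨hv.prodMk_nhds hs, h⟩)

variable [IsTopologicalAddGroup V] [ContinuousSMul ℝ V] [T2Space V] [FiniteDimensional ℝ V]

lemma RayComp.exists_halfSphere (v : V) {s : ℝ} (h : (v, s) ≠ 0) (hs : 0 ≤ s) :
    ∃ a : ℝ, 0 < a ∧ (toEuclidean (a • v), a * s) ∈ halfSphere V := by
  set p : EuclideanSpace ℝ (Fin (Module.finrank ℝ V)) × ℝ := (toEuclidean v, s) with hp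
  have hp0 : p ≠ 0 := by
    intro e
    apply h
    have h1 : toEuclidean v = 0 := congrArg Prod.fst e
    have h2 : s = 0 := congrArg Prod.snd e
    rw [map_eq_zero_iff _ toEuclidean.injective] at h1
    rw [h1, h2]; rfl
  have hn : 0 < ‖p‖ := norm_pos_iff.mpr hp0
  refine ⟨‖p‖⁻¹, inv_pos.mpr hn, ?_, by positivity⟩
  have : ((toEuclidean (‖p‖⁻¹ • v), ‖p‖⁻¹ * s) :
      EuclideanSpace ℝ (Fin (Module.finrank ℝ V)) × ℝ) = ‖p‖⁻¹ • p := by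
    rw [map_smul, hp]; rfl
  rw [this, norm_smul, norm_inv, norm_norm, inv_mul_cancel₀ hn.ne']

lemma halfSphere_ne_zero {p : EuclideanSpace ℝ (Fin (Module.finrank ℝ V)) × ℝ}
    (hp : p ∈ halfSphere V) : ((toEuclidean.symm p.1, p.2) : V × ℝ) ≠ 0 := by
  intro e
  have h1 : toEuclidean.symm p.1 = (0 : V) := congrArg Prod.fst e
  have h2 : p.2 = 0 := congrArg Prod.snd e
  rw [map_eq_zero_iff _ toEuclidean.symm.injective] at h1
  have : p = 0 := Prod.ext h1 h2
  have h3 := hp.1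
  rw [this, norm_zero] at h3
  exact zero_ne_one h3

/-- Every ray meets the unit half-sphere of Euclidean coordinates, so the space is a continuous
image of a compact set. -/
instance : CompactSpace (RayComp V) := by
  have h : (fun p : EuclideanSpace ℝ (Fin (Module.finrank ℝ V)) × ℝ =>
      (RayComp.pt (toEuclidean.symm p.1) p.2 : RayComp V)) '' halfSphere V = Set.univ := by
    rw [Set.eq_univ_iff_forall]
    intro z
    obtain ⟨v, s, h, hs, rfl⟩ := z.exists_pt
    obtain ⟨a, ha, hmem⟩ := RayComp.exists_halfSphere v h hs
    refine ⟨_, hmem, ?_⟩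
    simp only [ContinuousLinearEquiv.symm_apply_apply]
    exact RayComp.pt_smul h hs ha
  rw [← isCompact_univ_iff, ← h]
  refine isCompact_halfSphere.image_of_continuousOn fun p hp => ?_
  refine RayComp.tendsto_pt ?_ ?_ ?_ ⟨halfSphere_ne_zero hp, hp.2⟩
  · exact ((toEuclidean.symm.continuous.comp continuous_fst).tendsto p).mono_left inf_le_left
  · exact (continuous_snd.tendsto p).mono_left inf_le_left
  · filter_upwards [self_mem_nhdsWithin] with q hq
    exact ⟨halfSphere_ne_zero hq, hq.2⟩

/-- The normalised representative of a point of the compactification. -/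
def RayComp.normal : RayComp V → EuclideanSpace ℝ (Fin (Module.finrank ℝ V)) × ℝ :=
  Quotient.lift (fun p : HalfCone V => ‖((toEuclidean p.1.1, p.1.2) :
    EuclideanSpace ℝ (Fin (Module.finrank ℝ V)) × ℝ)‖⁻¹ • (toEuclidean p.1.1, p.1.2)) (by
      rintro p q ⟨a, ha, h⟩
      have h1 : ((toEuclidean q.1.1, q.1.2) : EuclideanSpace ℝ (Fin (Module.finrank ℝ V)) × ℝ) =
          a • (toEuclidean p.1.1, p.1.2) := by
        rw [h]
        refine Prod.ext ?_ rfl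
        change toEuclidean (a • p.1.1) = a • toEuclidean p.1.1
        rw [map_smul]
      rw [h1, norm_smul, Real.norm_of_nonneg ha.le, mul_inv, smul_smul, mul_comm, ← mul_assoc,
        mul_inv_cancel₀ ha.ne', one_mul])

lemma HalfCone.norm_pos (p : HalfCone V) : 0 < ‖((toEuclidean p.1.1, p.1.2) :
    EuclideanSpace ℝ (Fin (Module.finrank ℝ V)) × ℝ)‖ := by
  rw [norm_pos_iff]
  intro e
  have h1 : toEuclidean p.1.1 = 0 := congrArg Prod.fst e
  have h2 : p.1.2 = 0 := congrArg Prod.snd e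
  rw [map_eq_zero_iff _ toEuclidean.injective] at h1
  exact p.2.1 (Prod.ext h1 h2)

lemma RayComp.continuous_normal : Continuous (RayComp.normal : RayComp V → _) := by
  refine Continuous.quotient_lift ?_ _
  have hc : Continuous fun p : HalfCone V => ((toEuclidean p.1.1, p.1.2) :
      EuclideanSpace ℝ (Fin (Module.finrank ℝ V)) × ℝ) := by
    have h0 : Continuous fun p : HalfCone V => p.1 := continuous_subtype_val
    exact (toEuclidean.continuous.comp (continuous_fst.comp h0)).prodMk (continuous_snd.comp h0)
  exact (hc.norm.inv₀ fun p => (HalfCone.norm_pos p).ne').smul hc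

lemma RayComp.normal_injective : Function.Injective (RayComp.normal : RayComp V → _) := by
  intro z z'
  induction z using Quotient.inductionOn with | _ p
  induction z' using Quotient.inductionOn with | _ q
  intro h
  have hp := HalfCone.norm_pos p
  have hq := HalfCone.norm_pos q
  set A := ‖((toEuclidean p.1.1, p.1.2) : EuclideanSpace ℝ (Fin (Module.finrank ℝ V)) × ℝ)‖ with hA
  set B := ‖((toEuclidean q.1.1, q.1.2) : EuclideanSpace ℝ (Fin (Module.finrank ℝ V)) × ℝ)‖ with hB
  have h : A⁻¹ • ((toEuclidean p.1.1, p.1.2) : EuclideanSpace ℝ (Fin (Module.finrank ℝ V)) × ℝ) =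
    B⁻¹ • (toEuclidean q.1.1, q.1.2) := h
  refine Quotient.sound ⟨B * A⁻¹, by positivity, ?_⟩
  have h1 : ((toEuclidean q.1.1, q.1.2) : EuclideanSpace ℝ (Fin (Module.finrank ℝ V)) × ℝ) =
      (B * A⁻¹) • (toEuclidean p.1.1, p.1.2) := by
    rw [mul_smul, h, smul_smul, mul_inv_cancel₀ hq.ne', one_smul]
  have h3 : q.1.2 = (B * A⁻¹) * p.1.2 :=
    congrArg (Prod.snd : EuclideanSpace ℝ (Fin (Module.finrank ℝ V)) × ℝ → ℝ) h1
  refine Prod.ext ?_ h3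
  apply toEuclidean.injective
  have h2 : toEuclidean q.1.1 = (B * A⁻¹) • toEuclidean p.1.1 := congrArg Prod.fst h1
  rw [h2, ← map_smul]
  rfl

/-- The normalised representative is a continuous injection of a compact space into a Hausdorff one,
hence a closed embedding in a metric space. -/
instance : TopologicalSpace.MetrizableSpace (RayComp V) :=
  ((RayComp.continuous_normal (V := V)).isClosedEmbedding
    (RayComp.normal_injective (V := V))).isEmbedding.metrizableSpace

end Ray

/-! ### The Karpelevich polyhedron -/

section Hedron

variable {β : ℕ} {m : Fin β → ℕ}

instance : Finite (Part m) := by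
  refine Finite.of_injective (β := Idx m → Idx m → Prop) (fun a i k => a.1 i k) ?_
  intro a b h
  exact Subtype.ext (Setoid.ext fun i k => iff_of_eq (congrFun (congrFun h i) k))

instance : Fintype (Part m) := Fintype.ofFinite _

instance (a : Part m) : T2Space (Xi a) := by
  have : IsClosed ((constOn a : Submodule ℝ (Idx m → ℝ)) : Set (Idx m → ℝ)) :=
    Submodule.closed_of_finiteDimensional _
  have := Submodule.t3_quotient_of_isClosed (constOn a)
  infer_instance

/-- The class of a function modulo functions constant on the elements of a partition. -/
def Part.mk (a : Part m) (g : Idx m → ℝ) : Xi a := Submodule.Quotient.mk g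

lemma Part.mk_eq_zero {a : Part m} {g : Idx m → ℝ} :
    a.mk g = 0 ↔ ∀ i k, a.1 i k → g i = g k := by
  rw [Part.mk, Submodule.Quotient.mk_eq_zero]
  exact Iff.rfl

lemma Part.mk_eq {a : Part m} {g g' : Idx m → ℝ} :
    a.mk g = a.mk g' ↔ ∀ i k, a.1 i k → g i - g k = g' i - g' k := by
  rw [Part.mk, Part.mk, Submodule.Quotient.eq]
  refine forall₃_congr fun i k _ => ?_
  simp only [Pi.sub_apply]
  constructor <;> intro h <;> linarith

lemma Part.mk_smul (a : Part m) (r : ℝ) (g : Idx m → ℝ) : a.mk (r • g) = r • a.mk g := rfl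

lemma Part.mk_surjective (a : Part m) (x : Xi a) : ∃ g, a.mk g = x :=
  Submodule.Quotient.mk_surjective _ x

lemma Part.continuous_mk (a : Part m) : Continuous a.mk :=
  (constOn a).mkQ.continuous_of_finiteDimensional

lemma Part.pair_ne_zero {a : Part m} {g : Idx m → ℝ} {s : ℝ} :
    ((a.mk g, s) : Xi a × ℝ) ≠ 0 ↔ a.mk g ≠ 0 ∨ s ≠ 0 := by
  rw [Ne, Prod.mk_eq_zero, not_and_or]

/-- The point `(g : s)` of the compactification of `Ξ[J; a]`. -/
def Part.pt (a : Part m) (g : Idx m → ℝ) (s : ℝ) : RayComp (Xi a) := RayComp.pt (a.mk g) s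

lemma xiDiag_apply (f : Idx m → ℝ) (a : Part m) : xiDiag m f a = a.pt f 1 := RayComp.incl_eq _

lemma Part.pt_smul {a : Part m} {g : Idx m → ℝ} {s : ℝ} (h : a.mk g ≠ 0 ∨ s ≠ 0) (hs : 0 ≤ s)
    {r : ℝ} (hr : 0 < r) : a.pt (r • g) (r * s) = a.pt g s :=
  RayComp.pt_smul (Part.pair_ne_zero.mpr h) hs hr

lemma Part.tendsto_pt {J : Type} {l : Filter J} {a : Part m} {x : J → Xi a} {s : J → ℝ}
    {g₀ : Idx m → ℝ} {s₀ : ℝ} (hx : Tendsto x l (𝓝 (a.mk g₀))) (hs : Tendsto s l (𝓝 s₀))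
    (h : ∀ᶠ j in l, 0 < s j) (h₀ : a.mk g₀ ≠ 0 ∨ s₀ ≠ 0) (hs₀ : 0 ≤ s₀) :
    Tendsto (fun j => RayComp.pt (x j) (s j)) l (𝓝 (a.pt g₀ s₀)) :=
  RayComp.tendsto_pt hx hs (h.mono fun _ hj => ⟨fun e => hj.ne' (congrArg Prod.snd e), hj.le⟩)
    ⟨Part.pair_ne_zero.mpr h₀, hs₀⟩

/-- The difference of values at two equivalent points. -/
def Part.diff (a : Part m) {i k : Idx m} (h : a.1 i k) : Xi a →ₗ[ℝ] ℝ :=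
  (constOn a).liftQ ((LinearMap.proj i : (Idx m → ℝ) →ₗ[ℝ] ℝ) - LinearMap.proj k) (by
    intro g hg
    rw [LinearMap.mem_ker, LinearMap.sub_apply, LinearMap.proj_apply, LinearMap.proj_apply]
    exact sub_eq_zero.mpr (hg i k h))

lemma Part.diff_mk (a : Part m) {i k : Idx m} (h : a.1 i k) (g : Idx m → ℝ) :
    a.diff h (a.mk g) = g i - g k := by
  rw [Part.diff, Part.mk, Submodule.liftQ_apply]
  rfl

/-- The projection to functions modulo a finer partition. -/
def Part.refine {a a' : Part m} (h : a'.1 ≤ a.1) : Xi a →ₗ[ℝ] Xi a' :=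
  Submodule.factor (show constOn a ≤ constOn a' from fun _ hg i k hik => hg i k (h hik))

lemma Part.refine_mk {a a' : Part m} (h : a'.1 ≤ a.1) (g : Idx m → ℝ) :
    Part.refine h (a.mk g) = a'.mk g := rfl

/-- Functions non-increasing along the equivalent indices. -/
def Part.Anti (a : Part m) (g : Idx m → ℝ) : Prop :=
  ∀ τ (i k : Fin (m τ)), i ≤ k → a.1 ⟨τ, i⟩ ⟨τ, k⟩ → g ⟨τ, k⟩ ≤ g ⟨τ, i⟩

/-- Structure of the points of the closed Weyl chamber. -/
lemma exists_rep_of_mem_chamberKarp {z : XiProduct m} (hz : z ∈ chamberKarp m) (a : Part m) :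
    ∃ (g : Idx m → ℝ) (s : ℝ), 0 ≤ s ∧ (a.mk g ≠ 0 ∨ s ≠ 0) ∧ a.Anti g ∧
      ∀ a' : Part m, a'.1 ≤ a.1 → (a'.mk g ≠ 0 ∨ s ≠ 0) → z a' = a'.pt g s := by
  obtain ⟨U, hU, hUz⟩ := mem_closure_iff_ultrafilter.mp hz
  have hex : ∀ y : XiProduct m, ∃ f : Idx m → ℝ, y ∈ chamber m →
      (∀ τ, Antitone (fun i => f ⟨τ, i⟩)) ∧ xiDiag m f = y := by
    intro y
    by_cases hy : y ∈ chamber m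
    · obtain ⟨f, hf, rfl⟩ := hy
      exact ⟨f, fun _ => ⟨hf, rfl⟩⟩
    · exact ⟨0, fun h => absurd h hy⟩
  choose f hf using hex
  have hne : ∀ y, ((a.mk (f y), (1 : ℝ)) : Xi a × ℝ) ≠ 0 := fun y =>
    Part.pair_ne_zero.mpr (Or.inr one_ne_zero)
  -- Approximating chamber points `(f : 1)` are normalised to the half-sphere over `Ξ[J; a]`, where
  -- a limit `(g : s)` exists along the ultrafilter. Normalising over `a` alone serves all finer
  -- partitions simultaneously.
  choose N hN hNp using fun y => RayComp.exists_halfSphere (a.mk (f y)) (hne y) zero_le_one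
  set p : XiProduct m → EuclideanSpace ℝ (Fin (Module.finrank ℝ (Xi a))) × ℝ :=
    fun y => (toEuclidean (N y • a.mk (f y)), N y * 1) with hp
  obtain ⟨q, hq, hUq⟩ := isCompact_halfSphere (V := Xi a).ultrafilter_le_nhds (U.map p)
    (le_principal_iff.mpr (Filter.mem_map.mpr (univ_mem' hNp)))
  have hUq : Tendsto p U (𝓝 q) := hUq
  obtain ⟨g, hg⟩ := a.mk_surjective (toEuclidean.symm q.1)
  have t1 : Tendsto (fun y => N y • a.mk (f y)) U (𝓝 (a.mk g)) := by
    rw [hg]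
    have := (toEuclidean (E := Xi a)).symm.continuous.tendsto q.1 |>.comp
      ((continuous_fst.tendsto q).comp hUq)
    refine this.congr fun y => ?_
    simp [hp]
  have t2 : Tendsto N U (𝓝 q.2) := by
    refine ((continuous_snd.tendsto q).comp hUq).congr fun y => ?_
    simp [hp]
  have hne0 : a.mk g ≠ 0 ∨ q.2 ≠ 0 := by
    rw [← Part.pair_ne_zero, hg]
    exact halfSphere_ne_zero hq
  refine ⟨g, q.2, hq.2, hne0, ?_, ?_⟩
  · intro τ i k hik hR
    have h1 := ((a.diff hR).continuous_of_finiteDimensional.tendsto _).comp t1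
    rw [a.diff_mk] at h1
    refine sub_nonneg.mp (ge_of_tendsto h1 ?_)
    filter_upwards [hU] with y hy
    rw [Function.comp_apply, map_smul, a.diff_mk, smul_eq_mul]
    exact mul_nonneg (hN y).le (sub_nonneg.mpr ((hf y hy).1 τ hik))
  · intro a' haa' h'
    -- The limit `(g : s)` projects to the coordinate of a finer partition as long as the projection
    -- does not vanish.
    have h1 := ((Part.refine haa').continuous_of_finiteDimensional.tendsto _).comp t1
    rw [Part.refine_mk] at h1
    have h2 := Part.tendsto_pt h1 t2 (Eventually.of_forall hN) h' hq.2
    have h3 : Tendsto (fun y : XiProduct m => y a') U (𝓝 (z a')) :=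
      ((continuous_apply a').tendsto z).mono_left hUz
    refine tendsto_nhds_unique h3 (h2.congr' ?_)
    filter_upwards [hU] with y hy
    have h4 : y a' = a'.pt (f y) 1 := by
      rw [← xiDiag_apply, (hf y hy).2]
    rw [h4, ← Part.pt_smul (Or.inr one_ne_zero) zero_le_one (hN y), mul_one, Function.comp_apply,
      map_smul, Part.refine_mk]
    rfl

open scoped Classical in
/-- The ratio of exponents at a point at a finite or an infinite distance. -/
def expRatio (d s : ℝ) : ℝ := if s = 0 then 0 else Real.exp (-|d| / s)

/-- From `x ≤ exp x` at `x = |d| / s`. The bound yields continuity of the ratio at the infinite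
points `s = 0`. -/
lemma expRatio_le {d s : ℝ} (hd : d ≠ 0) (hs : 0 ≤ s) : expRatio d s ≤ s / |d| := by
  unfold expRatio
  split_ifs with h
  · rw [h, zero_div]
  · have hs' : 0 < s := lt_of_le_of_ne hs (Ne.symm h)
    have hd' : 0 < |d| := abs_pos.mpr hd
    have h1 : |d| / s ≤ Real.exp (|d| / s) := by
      have := Real.add_one_le_exp (|d| / s)
      linarith
    have h2 := inv_anti₀ (by positivity) h1
    rwa [inv_div, ← Real.exp_neg, ← neg_div] at h2

lemma expRatio_nonneg (d s : ℝ) : 0 ≤ expRatio d s := by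
  unfold expRatio
  split_ifs
  · exact le_rfl
  · exact (Real.exp_pos _).le

lemma expRatio_smul {a : ℝ} (ha : 0 < a) (d s : ℝ) : expRatio (a * d) (a * s) = expRatio d s := by
  unfold expRatio
  by_cases h : s = 0
  · rw [if_pos h, if_pos (by rw [h, mul_zero])]
  · rw [if_neg h, if_neg (mul_ne_zero ha.ne' h), abs_mul, abs_of_pos ha, neg_div, neg_div,
      mul_div_mul_left _ _ ha.ne']

lemma tendsto_expRatio {J : Type} {l : Filter J} {d s : J → ℝ} {d₀ s₀ : ℝ}
    (hd : Tendsto d l (𝓝 d₀)) (hs : Tendsto s l (𝓝 s₀)) (h : ∀ᶠ j in l, 0 ≤ s j)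
    (h₀ : d₀ ≠ 0 ∨ s₀ ≠ 0) : Tendsto (fun j => expRatio (d j) (s j)) l (𝓝 (expRatio d₀ s₀)) := by
  by_cases hs₀ : s₀ = 0
  · have hd₀ : d₀ ≠ 0 := h₀.resolve_right (not_not.mpr hs₀)
    have e : expRatio d₀ s₀ = 0 := if_pos hs₀
    rw [e]
    have h1 := hs.div hd.abs (abs_ne_zero.mpr hd₀)
    rw [hs₀, zero_div] at h1
    refine squeeze_zero' (Eventually.of_forall fun j => expRatio_nonneg _ _) ?_ h1
    filter_upwards [h, hd.eventually_ne hd₀] with j h1 h2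
    exact expRatio_le h2 h1
  · have e : expRatio d₀ s₀ = Real.exp (-|d₀| / s₀) := if_neg hs₀
    rw [e]
    refine ((Real.continuous_exp.tendsto _).comp (hd.abs.neg.div hs hs₀)).congr' ?_
    filter_upwards [hs.eventually_ne hs₀] with j hj
    exact (if_neg hj).symm

/-- The partition whose only nontrivial element is a pair. -/
def pairPart {τ : Fin β} (i k : Fin (m τ)) : Part m :=
  ⟨⟨fun x y => x = y ∨ ((x = ⟨τ, i⟩ ∨ x = ⟨τ, k⟩) ∧ (y = ⟨τ, i⟩ ∨ y = ⟨τ, k⟩)),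
    ⟨fun _ => Or.inl rfl, fun h => h.elim (fun h => Or.inl h.symm) fun h => Or.inr ⟨h.2, h.1⟩, by
      rintro x y z (rfl | h) (rfl | h')
      · exact Or.inl rfl
      · exact Or.inr h'
      · exact Or.inr h
      · exact Or.inr ⟨h.1, h'.2⟩⟩⟩, by
    rintro x y (rfl | ⟨rfl | rfl, rfl | rfl⟩) <;> rfl⟩

lemma pairPart_rel {τ : Fin β} (i k : Fin (m τ)) : (pairPart i k).1 ⟨τ, i⟩ ⟨τ, k⟩ :=
  Or.inr ⟨Or.inl rfl, Or.inr rfl⟩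

lemma pairPart_le {τ : Fin β} {i k : Fin (m τ)} {a : Setoid (Idx m)} (h : a ⟨τ, i⟩ ⟨τ, k⟩) :
    (pairPart i k).1 ≤ a := by
  rintro x y (rfl | ⟨rfl | rfl, rfl | rfl⟩)
  · exact a.refl _
  · exact a.refl _
  · exact h
  · exact a.symm h
  · exact a.refl _

lemma pairPart_mk_eq_zero {τ : Fin β} {i k : Fin (m τ)} {g : Idx m → ℝ} :
    (pairPart i k).mk g = 0 ↔ g ⟨τ, i⟩ - g ⟨τ, k⟩ = 0 := by
  rw [Part.mk_eq_zero, sub_eq_zero]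
  refine ⟨fun h => h _ _ (pairPart_rel i k), fun h => ?_⟩
  rintro x y (rfl | ⟨rfl | rfl, rfl | rfl⟩)
  · rfl
  · rfl
  · exact h
  · exact h.symm
  · rfl

/-- The ratio of the exponents at two indices, as a function on the compactified line. -/
def pairRatio {τ : Fin β} (i k : Fin (m τ)) : RayComp (Xi (pairPart (m := m) i k)) → ℝ :=
  Quotient.lift (fun p => expRatio ((pairPart i k).diff (pairPart_rel i k) p.1.1) p.1.2) (by
    rintro p q ⟨a, ha, h⟩
    rw [h, Prod.smul_fst, Prod.smul_snd, map_smul, smul_eq_mul, smul_eq_mul, expRatio_smul ha])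

lemma pairRatio_pt {τ : Fin β} (i k : Fin (m τ)) {g : Idx m → ℝ} {s : ℝ} (hs : 0 ≤ s)
    (h : (pairPart i k).mk g ≠ 0 ∨ s ≠ 0) :
    pairRatio i k ((pairPart i k).pt g s) = expRatio (g ⟨τ, i⟩ - g ⟨τ, k⟩) s := by
  rw [Part.pt, RayComp.pt_eq ⟨Part.pair_ne_zero.mpr h, hs⟩]
  change expRatio ((pairPart i k).diff (pairPart_rel i k) ((pairPart i k).mk g)) s = _
  rw [Part.diff_mk]

lemma continuous_pairRatio {τ : Fin β} (i k : Fin (m τ)) :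
    Continuous (pairRatio (m := m) i k) := by
  refine Continuous.quotient_lift (continuous_iff_continuousAt.mpr fun p => ?_) _
  have h0 : Continuous fun p : HalfCone (Xi (pairPart (m := m) i k)) => p.1 :=
    continuous_subtype_val
  refine tendsto_expRatio (((LinearMap.continuous_of_finiteDimensional _).comp
    (continuous_fst.comp h0)).tendsto p) ((continuous_snd.comp h0).tendsto p)
    (Eventually.of_forall fun q => q.2.2) ?_
  obtain ⟨g, hg⟩ := (pairPart i k).mk_surjective p.1.1
  have h1 := p.2.1
  rw [show p.1 = ((pairPart i k).mk g, p.1.2) from Prod.ext hg.symm rfl, Part.pair_ne_zero,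
    Ne, pairPart_mk_eq_zero] at h1
  change (pairPart i k).diff (pairPart_rel i k) p.1.1 ≠ 0 ∨ _
  rw [← hg, Part.diff_mk]
  exact h1

end Hedron

/-! ### The velocity compactification -/

section Velocity

variable {β : ℕ} {m : Fin β → ℕ}

lemma Part.pt_congr {a : Part m} {g g' : Idx m → ℝ} (h : ∀ i k, a.1 i k → g i - g k = g' i - g' k)
    (s : ℝ) : a.pt g s = a.pt g' s := by
  rw [Part.pt, Part.pt, Part.mk_eq.mpr h]

lemma velocityMap_diagForm (u : ∀ τ, Frame (m τ)) {f : Idx m → ℝ}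
    (hf : ∀ τ, Antitone fun i => f ⟨τ, i⟩) :
    velocityMap m (fun τ => (diagForm (u τ) fun i => f ⟨τ, i⟩).cls) = xiDiag m f := by
  funext a
  rw [velocityMap, xiDiag_apply, xiDiag_apply]
  refine Part.pt_congr ?_ 1
  rintro ⟨τ, i⟩ ⟨σ, k⟩ hik
  obtain rfl : τ = σ := a.2 hik
  exact logEig_sub (u τ) (hf τ) i k

lemma Space.exists_diagForm (x : Space m) : ∃ (u : ∀ τ, Frame (m τ)) (f : Idx m → ℝ),
    (∀ τ, Antitone fun i => f ⟨τ, i⟩) ∧ x = fun τ => (diagForm (u τ) fun i => f ⟨τ, i⟩).cls := by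
  choose u f hf hx using fun τ => PE.exists_diagForm (x τ)
  exact ⟨u, fun i => f i.1 i.2, hf, funext hx⟩

lemma velocityMap_mem (x : Space m) : velocityMap m x ∈ chamber m := by
  obtain ⟨u, f, hf, rfl⟩ := x.exists_diagForm
  rw [velocityMap_diagForm u hf]
  exact ⟨f, hf, rfl⟩

lemma continuous_xiDiag : Continuous (xiDiag m) := by
  refine continuous_pi fun a => continuous_iff_continuousAt.mpr fun f => ?_
  have h := Part.tendsto_pt (a.continuous_mk.tendsto f) (tendsto_const_nhds (x := (1 : ℝ)))
    (Eventually.of_forall fun _ => one_pos) (Or.inr one_ne_zero) zero_le_one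
  unfold ContinuousAt
  simp only [xiDiag_apply]
  exact h

lemma continuous_velocityMap : Continuous (velocityMap m) := by
  refine continuous_xiDiag.comp (continuous_pi fun i => ?_)
  exact (continuous_apply i.2).comp (continuous_logEig.comp (continuous_apply i.1))

lemma pairRatio_xiDiag {τ : Fin β} (i k : Fin (m τ)) (f : Idx m → ℝ) :
    pairRatio i k (xiDiag m f (pairPart i k)) = Real.exp (-|f ⟨τ, i⟩ - f ⟨τ, k⟩|) := by
  rw [xiDiag_apply, pairRatio_pt i k zero_le_one (Or.inr one_ne_zero), expRatio,
    if_neg one_ne_zero, div_one]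

/-- This relation is the only link between the velocity and the Satake coordinates. Both sides are
continuous on the compactifications, so it passes to the hybrid. -/
lemma pairRatio_velocityMap (x : Space m) {τ : Fin β} (i k : Fin (m τ)) :
    pairRatio i k (velocityMap m x (pairPart i k)) = (satakeIncl (x τ)).ratio i k := by
  obtain ⟨u, f, hf, rfl⟩ := x.exists_diagForm
  rw [velocityMap_diagForm u hf, pairRatio_xiDiag, (isSpectral_incl (u τ) (hf τ)).ratio_eq]
  exact (ratioOf_incl (diagForm (u τ) fun i => f ⟨τ, i⟩).cls (fun i => f ⟨τ, i⟩) i k).symm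

/-- The coarsest partition. -/
def Part.top (m : Fin β → ℕ) : Part m := ⟨Setoid.ker Sigma.fst, le_rfl⟩

/-- The last coordinate of the normalised representative of a point of a compactified space; it
vanishes at the points at infinity. -/
def height (z : XiProduct m) : ℝ := (RayComp.normal (z (Part.top m))).2

lemma continuous_height : Continuous (height (m := m)) :=
  continuous_snd.comp (RayComp.continuous_normal.comp (continuous_apply _))

lemma height_ne_zero_iff {z : XiProduct m} {g : Idx m → ℝ} {s : ℝ} (hs : 0 ≤ s)
    (h : (Part.top m).mk g ≠ 0 ∨ s ≠ 0) (hz : z (Part.top m) = (Part.top m).pt g s) :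
    height z ≠ 0 ↔ s ≠ 0 := by
  rw [height, hz, Part.pt, RayComp.pt_eq ⟨Part.pair_ne_zero.mpr h, hs⟩]
  set p : HalfCone (Xi (Part.top m)) := ⟨((Part.top m).mk g, s), Part.pair_ne_zero.mpr h, hs⟩
  have hp := HalfCone.norm_pos p
  change ‖_‖⁻¹ * s ≠ 0 ↔ _
  rw [mul_ne_zero_iff, and_iff_right]
  exact inv_ne_zero hp.ne'

/-- If the coordinate `(g : s)` of the coarsest partition is finite, all other coordinates are its
projections and the point is the image of the function `g / s`. Thus the chamber is open in its
closure. -/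
lemma mem_chamber_iff {z : XiProduct m} (hz : z ∈ chamberKarp m) :
    z ∈ chamber m ↔ height z ≠ 0 := by
  constructor
  · rintro ⟨f, hf, rfl⟩
    rw [height_ne_zero_iff zero_le_one (Or.inr one_ne_zero) (xiDiag_apply f _)]
    exact one_ne_zero
  · intro h
    obtain ⟨g, s, hs, h0, hanti, hrep⟩ := exists_rep_of_mem_chamberKarp hz (Part.top m)
    rw [height_ne_zero_iff hs h0 (hrep _ le_rfl h0)] at h
    have hs' : 0 < s := lt_of_le_of_ne hs h.symm
    refine ⟨s⁻¹ • g, fun τ i k hik => ?_, ?_⟩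
    · exact mul_le_mul_of_nonneg_left (hanti τ i k hik rfl) (inv_pos.mpr hs').le
    · funext a
      rw [xiDiag_apply, hrep a a.2 (Or.inr h), ← inv_mul_cancel₀ h]
      exact Part.pt_smul (Or.inr h) hs (inv_pos.mpr hs')

lemma VelComp.toChamber_mem (q : VelComp m) : q.toChamber ∈ chamberKarp m := by
  cases q with
  | inner x => exact subset_closure (velocityMap_mem x)
  | bdry z => exact z.2.1

lemma VelComp.continuous_toChamber : Continuous (VelComp.toChamber (m := m)) :=
  continuous_def.mpr fun O hO => TopologicalSpace.isOpen_generateFrom_of_mem (Or.inr ⟨O, hO, rfl⟩)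

lemma VelComp.inner_injective : Function.Injective (VelComp.inner (m := m)) :=
  fun _ _ h => by injection h

lemma VelComp.isOpenEmbedding_inner : IsOpenEmbedding (VelComp.inner (m := m)) := by
  refine IsOpenEmbedding.of_continuous_injective_isOpenMap ?_ VelComp.inner_injective ?_
  · refine continuous_generateFrom_iff.mpr ?_
    rintro s (⟨U, hU, rfl⟩ | ⟨O, hO, rfl⟩)
    · rwa [Set.preimage_image_eq _ VelComp.inner_injective]
    · exact hO.preimage continuous_velocityMap
  · exact fun U hU => TopologicalSpace.isOpen_generateFrom_of_mem (Or.inl ⟨U, hU, rfl⟩)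

/-- Among the generating open sets only the preimages from the chamber can contain a point at
infinity. -/
lemma VelComp.tendsto_bdry {J : Type} {l : Filter J} {q : J → VelComp m} {z : chamberBdry m}
    (h : Tendsto (fun j => (q j).toChamber) l (𝓝 z.1)) : Tendsto q l (𝓝 (VelComp.bdry z)) := by
  refine TopologicalSpace.tendsto_nhds_generateFrom_iff.mpr ?_
  rintro s (⟨U, hU, rfl⟩ | ⟨O, hO, rfl⟩) hs
  · obtain ⟨x, -, hx⟩ := hs
    cases hx
  · exact h (hO.mem_nhds hs)

lemma isEmbedding_spaceSatake (hm : ∀ τ, 0 < m τ) :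
    IsEmbedding fun (x : Space m) (τ : Fin β) => satakeIncl (x τ) :=
  IsEmbedding.piMap fun τ => isEmbedding_satakeIncl (hm τ)

/-- Properness of the velocity map over the open chamber. A limit exists in the compact product of
the spaces `S_n`; its ratios are limits of exponentials at a finite point, hence nonzero, so its
flags are trivial. -/
lemma exists_limit_of_velocityMap (hm : ∀ τ, 0 < m τ) {U : Ultrafilter (Space m)} {z : XiProduct m}
    (hz : z ∈ chamber m) (h : Tendsto (velocityMap m) U (𝓝 z)) :
    ∃ x, (U : Filter (Space m)) ≤ 𝓝 x := by
  obtain ⟨f, hf, rfl⟩ := hz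
  obtain ⟨s, -, hs⟩ := isCompact_univ.ultrafilter_le_nhds
    (U.map fun (x : Space m) (τ : Fin β) => satakeIncl (x τ)) (by simp)
  have hs : Tendsto (fun (x : Space m) (τ : Fin β) => satakeIncl (x τ)) U (𝓝 s) := hs
  have hx : ∀ τ, ∃ x, s τ = satakeIncl x := by
    intro τ
    obtain ⟨u, g, hg⟩ := exists_isSpectral (s τ)
    refine ⟨_, hg.eq_incl fun i k => ?_⟩
    rw [← ratioOf_ne_zero (f := g), ← hg.ratio_eq]
    have h1 : Tendsto (fun x : Space m => (satakeIncl (x τ)).ratio i k) U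
        (𝓝 ((s τ).ratio i k)) :=
      tendsto_pi_nhds.mp (tendsto_pi_nhds.mp
        ((Satake.continuous_ratio.tendsto _).comp (tendsto_pi_nhds.mp hs τ)) i) k
    have h2 := ((continuous_pairRatio i k).comp (continuous_apply (pairPart i k))).tendsto
      (xiDiag m f) |>.comp h
    rw [Function.comp_apply, pairRatio_xiDiag] at h2
    have h3 := tendsto_nhds_unique h1 (h2.congr fun x => pairRatio_velocityMap x i k)
    rw [h3]
    exact (Real.exp_pos _).ne'
  choose x hx using hx
  refine ⟨x, ?_⟩
  have : s = fun τ => satakeIncl (x τ) := funext hx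
  rw [this] at hs
  exact (isEmbedding_spaceSatake hm).isInducing.tendsto_nhds_iff.mpr hs

/-- The chamber coordinate has a limit along an ultrafilter. If this limit is infinite, it is the
required boundary point; if it is finite, the ultrafilter lives on the symmetric space and
properness applies. -/
lemma VelComp.compactSpace (hm : ∀ τ, 0 < m τ) : CompactSpace (VelComp m) := by
  refine ⟨isCompact_iff_ultrafilter_le_nhds.mpr fun U _ => ?_⟩
  have hK : IsCompact (chamberKarp m) := isClosed_closure.isCompact
  obtain ⟨z, hz, hU⟩ := hK.ultrafilter_le_nhds (U.map VelComp.toChamber)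
    (le_principal_iff.mpr (Filter.mem_map.mpr (univ_mem' VelComp.toChamber_mem)))
  have hU : Tendsto VelComp.toChamber U (𝓝 z) := hU
  by_cases hc : z ∈ chamber m
  · have hin : Set.range (VelComp.inner (m := m)) ∈ U := by
      have h1 := (continuous_height.tendsto z).comp hU |>.eventually_ne ((mem_chamber_iff hz).mp hc)
      filter_upwards [h1] with q hq
      cases q with
      | inner x => exact ⟨x, rfl⟩
      | bdry y => exact absurd ((mem_chamber_iff y.2.1).mpr hq) y.2.2
    set U' := U.comap VelComp.inner_injective hin with hU'
    have hmap : Filter.map VelComp.inner (U' : Filter (Space m)) = U := by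
      rw [hU', Ultrafilter.coe_comap]
      exact Filter.map_comap_of_mem hin
    have h2 : Tendsto (velocityMap m) U' (𝓝 z) := by
      rw [← hmap, tendsto_map'_iff] at hU
      exact hU
    obtain ⟨x, hx⟩ := exists_limit_of_velocityMap hm hc h2
    refine ⟨VelComp.inner x, trivial, ?_⟩
    rw [← hmap]
    exact (VelComp.isOpenEmbedding_inner.continuous.tendsto x).mono_left hx
  · exact ⟨VelComp.bdry ⟨z, hz, hc⟩, trivial, VelComp.tendsto_bdry (q := id) hU⟩

lemma space_t2 (hm : ∀ τ, 0 < m τ) : T2Space (Space m) := (isEmbedding_spaceSatake hm).t2Space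

lemma VelComp.t2Space (hm : ∀ τ, 0 < m τ) : T2Space (VelComp m) := by
  have := space_t2 hm
  refine ⟨fun p q hpq => ?_⟩
  by_cases h : p.toChamber = q.toChamber
  · cases p with
    | inner x =>
      cases q with
      | inner y =>
        obtain ⟨U, V, hU, hV, hx, hy, hUV⟩ := t2_separation fun e : x = y => hpq (by rw [e])
        exact ⟨_, _, VelComp.isOpenEmbedding_inner.isOpenMap U hU,
          VelComp.isOpenEmbedding_inner.isOpenMap V hV, Set.mem_image_of_mem _ hx,
          Set.mem_image_of_mem _ hy,
          Set.disjoint_image_of_injective VelComp.inner_injective hUV⟩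
      | bdry z =>
        exact absurd (velocityMap_mem x) (by rw [show velocityMap m x = z.1 from h]; exact z.2.2)
    | bdry z =>
      cases q with
      | inner y =>
        exact absurd (velocityMap_mem y)
          (by rw [show velocityMap m y = z.1 from h.symm]; exact z.2.2)
      | bdry z' => exact absurd (congrArg VelComp.bdry (Subtype.ext h)) hpq
  · exact separated_by_continuous VelComp.continuous_toChamber h

/-! ### Metrizability of the velocity compactification and density of the symmetric space -/

lemma secondCountable_of_compact_metrizable (X : Type) [TopologicalSpace X] [CompactSpace X]
    [TopologicalSpace.MetrizableSpace X] : SecondCountableTopology X := by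
  let := TopologicalSpace.metrizableSpaceMetric X
  infer_instance

lemma VelComp.secondCountable (hm : ∀ τ, 0 < m τ) : SecondCountableTopology (VelComp m) := by
  have : SecondCountableTopology (XiProduct m) := secondCountable_of_compact_metrizable _
  have : SecondCountableTopology (∀ τ, Satake (m τ)) := secondCountable_of_compact_metrizable _
  have : SecondCountableTopology (Space m) := (isEmbedding_spaceSatake hm).secondCountableTopology
  set b : Set (Set (VelComp m)) :=
    (fun U => VelComp.inner '' U) '' TopologicalSpace.countableBasis (Space m) ∪
      (fun O => VelComp.toChamber ⁻¹' O) '' TopologicalSpace.countableBasis (XiProduct m) with hb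
  refine ⟨b, ((TopologicalSpace.countable_countableBasis _).image _).union
    ((TopologicalSpace.countable_countableBasis _).image _), le_antisymm ?_ ?_⟩
  · refine le_generateFrom ?_
    rintro s (⟨U, hU, rfl⟩ | ⟨O, hO, rfl⟩)
    · exact VelComp.isOpenEmbedding_inner.isOpenMap _
        (TopologicalSpace.isOpen_of_mem_countableBasis hU)
    · exact (TopologicalSpace.isOpen_of_mem_countableBasis hO).preimage VelComp.continuous_toChamber
  · refine le_generateFrom ?_
    rintro s (⟨U, hU, rfl⟩ | ⟨O, hO, rfl⟩)
    · obtain ⟨S, hS, rfl⟩ := (TopologicalSpace.isBasis_countableBasis (Space m)).open_eq_sUnion hU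
      rw [Set.image_sUnion]
      refine @isOpen_sUnion _ (TopologicalSpace.generateFrom b) _ ?_
      rintro _ ⟨V, hV, rfl⟩
      exact TopologicalSpace.isOpen_generateFrom_of_mem (Or.inl ⟨V, hS hV, rfl⟩)
    · obtain ⟨S, hS, rfl⟩ :=
        (TopologicalSpace.isBasis_countableBasis (XiProduct m)).open_eq_sUnion hO
      rw [Set.preimage_sUnion]
      refine @isOpen_biUnion _ _ (TopologicalSpace.generateFrom b) _ _ fun V hV => ?_
      exact TopologicalSpace.isOpen_generateFrom_of_mem (Or.inr ⟨V, hS hV, rfl⟩)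

lemma VelComp.metrizableSpace (hm : ∀ τ, 0 < m τ) :
    TopologicalSpace.MetrizableSpace (VelComp m) := by
  have := VelComp.compactSpace hm
  have := VelComp.t2Space hm
  have := VelComp.secondCountable hm
  exact TopologicalSpace.metrizableSpace_of_t3_secondCountable _

lemma VelComp.denseRange_inner : DenseRange (VelComp.inner (m := m)) := by
  intro q
  cases q with
  | inner x => exact subset_closure ⟨x, rfl⟩
  | bdry z =>
    obtain ⟨U, hU, hUz⟩ := mem_closure_iff_ultrafilter.mp z.2.1
    have hex : ∀ y : XiProduct m, ∃ x : Space m, y ∈ chamber m → velocityMap m x = y := by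
      intro y
      by_cases hy : y ∈ chamber m
      · obtain ⟨f, hf, rfl⟩ := hy
        exact ⟨_, fun _ => velocityMap_diagForm (fun τ => EuclideanSpace.basisFun _ ℝ) hf⟩
      · exact ⟨fun τ => (diagForm (EuclideanSpace.basisFun _ ℝ) 0).cls, fun h => absurd h hy⟩
    choose x hx using hex
    refine mem_closure_of_tendsto (f := fun y => VelComp.inner (x y)) (b := (U : Filter _))
      (VelComp.tendsto_bdry ?_) (Eventually.of_forall fun y => ⟨x y, rfl⟩)
    refine Tendsto.congr' ?_ (tendsto_id.mono_left hUz)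
    filter_upwards [hU] with y hy
    exact (hx y hy).symm

lemma VelComp.isCompactification (hm : ∀ τ, 0 < m τ) :
    IsCompactification (VelComp.inner : Space m → VelComp m) where
  compact := VelComp.compactSpace hm
  metrizable := VelComp.metrizableSpace hm
  continuous := VelComp.isOpenEmbedding_inner.continuous
  dense := VelComp.denseRange_inner

lemma isCompactification_spaceSatake (m : Fin β → ℕ) :
    IsCompactification (fun (x : Space m) (τ : Fin β) => satakeIncl (x τ)) where
  compact := inferInstance
  metrizable := inferInstance
  continuous := continuous_pi fun τ => continuous_satakeIncl.comp (continuous_apply τ)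
  dense := DenseRange.piMap fun _ => denseRange_satakeIncl

end Velocity

/-! ### Coordinates on the set `Karp` -/

section KarpCoordinates

variable {β : ℕ} {m : Fin β → ℕ}

/-- The partition of the indices given by a tuple of flags. -/
def FlagTuple.part (F : FlagTuple m) : Part m :=
  ⟨Setoid.ker fun x : Idx m => (⟨x.1, (F x.1).cellOf x.2⟩ : Σ τ, Cell (F τ)),
    fun x y h => congrArg (Sigma.fst : (Σ τ, Cell (F τ)) → Fin β)
      (show (⟨x.1, (F x.1).cellOf x.2⟩ : Σ τ, Cell (F τ)) = ⟨y.1, (F y.1).cellOf y.2⟩ from h)⟩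

lemma FlagTuple.part_rel {F : FlagTuple m} {τ : Fin β} {i k : Fin (m τ)} :
    F.part.1 ⟨τ, i⟩ ⟨τ, k⟩ ↔ (F τ).rel i k := by
  rw [PFlag.rel_def]
  change (⟨τ, (F τ).cellOf i⟩ : Σ τ, Cell (F τ)) = ⟨τ, (F τ).cellOf k⟩ ↔ _
  constructor
  · intro h
    exact eq_of_heq (Sigma.mk.inj h).2
  · intro h
    rw [h]

lemma FlagTuple.part_mono {F F' : FlagTuple m} (h : ∀ τ, (F τ).carrier ⊆ (F' τ).carrier) :
    F'.part.1 ≤ F.part.1 := by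
  rintro ⟨τ, i⟩ ⟨σ, k⟩ hik
  obtain rfl : τ = σ := F'.part.2 hik
  exact FlagTuple.part_rel.mpr (PFlag.rel_mono (h τ) (FlagTuple.part_rel.mp hik))

lemma Refines.part_le {F F' : FlagTuple m} (h : Refines F F') : F'.part.1 ≤ F.part.1 :=
  FlagTuple.part_mono h.1

lemma FlagTuple.eq_of_part_le {F F' : FlagTuple m} (h : ∀ τ, (F τ).carrier ⊆ (F' τ).carrier)
    (h' : F.part.1 ≤ F'.part.1) : F = F' :=
  funext fun τ => PFlag.eq_of_rel (h τ) fun _ _ hik =>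
    FlagTuple.part_rel.mp (h' (FlagTuple.part_rel.mpr hik))

lemma Refines.not_part_le {F F' : FlagTuple m} (h : Refines F F') : ¬ F.part.1 ≤ F'.part.1 := by
  intro h'
  obtain ⟨τ, hτ⟩ := h.2
  exact hτ (by rw [FlagTuple.eq_of_part_le h.1 h'])

lemma FlagTuple.trivial_part (m : Fin β → ℕ) : (FlagTuple.trivial m).part = Part.top m := by
  refine Subtype.ext (le_antisymm (FlagTuple.part _).2 ?_)
  rintro ⟨τ, i⟩ ⟨σ, k⟩ hik
  obtain rfl : τ = σ := hik
  exact FlagTuple.part_rel.mpr (PFlag.trivial_rel i k)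

/-- A velocity as a function of the indices. -/
def Velocity.fn {F F' : FlagTuple m} (ψ : Velocity F F') (x : Idx m) : ℝ :=
  ψ.1 x.1 ((F' x.1).cellOf x.2)

lemma Velocity.fn_eq {F F' : FlagTuple m} (ψ : Velocity F F') {x y : Idx m} (h : F'.part.1 x y) :
    ψ.fn x = ψ.fn y := by
  obtain ⟨τ, i⟩ := x
  obtain ⟨σ, k⟩ := y
  obtain rfl : τ = σ := F'.part.2 h
  exact congrArg (ψ.1 τ) (PFlag.rel_def.mp (FlagTuple.part_rel.mp h))

lemma Velocity.fn_lt {F F' : FlagTuple m} (hF : Refines F F') (ψ : Velocity F F') {τ : Fin β}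
    {i k : Fin (m τ)} (h : (F τ).rel i k) (h' : ¬ (F' τ).rel i k) (hik : i ≤ k) :
    ψ.fn ⟨τ, k⟩ < ψ.fn ⟨τ, i⟩ := by
  refine ψ.2 τ ((F τ).cellOf i) _ _ ?_ (PFlag.cellOf_inside (hF.1 τ) i) ?_
  · rw [PFlag.rel_def.mp h]
    exact PFlag.cellOf_inside (hF.1 τ) k
  · exact Cell.hi_le_lo_of_lt (fun e => h' (PFlag.rel_def.mpr e.symm)) (PFlag.cellOf_has _ i)
      (PFlag.cellOf_has _ k) hik

/-- Strict monotonicity lets the velocity recover the classes of `F'` inside those of `F`. -/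
lemma Velocity.fn_eq_iff {F F' : FlagTuple m} (hF : Refines F F') (ψ : Velocity F F')
    {x y : Idx m} (h : F.part.1 x y) : ψ.fn x = ψ.fn y ↔ F'.part.1 x y := by
  refine ⟨fun e => ?_, ψ.fn_eq⟩
  obtain ⟨τ, i⟩ := x
  obtain ⟨σ, k⟩ := y
  obtain rfl : τ = σ := F.part.2 h
  have h := FlagTuple.part_rel.mp h
  rw [FlagTuple.part_rel]
  by_contra h'
  rcases le_total i k with hik | hik
  · exact (ψ.fn_lt hF h h' hik).ne' e
  · exact (ψ.fn_lt hF ((F τ).rel.symm h) (fun h1 => h' ((F' τ).rel.symm h1)) hik).ne e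

lemma Velocity.mk_fn_eq_zero {F F' : FlagTuple m} (hF : Refines F F') (ψ : Velocity F F')
    {a : Part m} (ha : a.1 ≤ F.part.1) : a.mk ψ.fn = 0 ↔ a.1 ≤ F'.part.1 := by
  rw [Part.mk_eq_zero]
  constructor
  · intro h x y hxy
    exact (ψ.fn_eq_iff hF (ha hxy)).mp (h x y hxy)
  · intro h x y hxy
    exact ψ.fn_eq (h hxy)

/-- The additive constants disappear in differences inside the classes of `F`; conversely, they are
recovered from one marked index in each cell. -/
lemma Velocity.cls_eq {F F' : FlagTuple m} (hF : Refines F F') {ψ ψ' : Velocity F F'} :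
    ψ.cls = ψ'.cls ↔ ∃ a : ℝ, 0 < a ∧ ∀ x y, F.part.1 x y →
      ψ'.fn x - ψ'.fn y = a * (ψ.fn x - ψ.fn y) := by
  constructor
  · intro h
    obtain ⟨a, b, ha, h⟩ := Quotient.exact h
    refine ⟨a, ha, ?_⟩
    rintro ⟨τ, i⟩ ⟨σ, k⟩ hik
    obtain rfl : τ = σ := F.part.2 hik
    have h1 := h τ _ _ (PFlag.cellOf_inside (hF.1 τ) i)
    have h2 := h τ _ _ (PFlag.cellOf_inside (hF.1 τ) k)
    rw [← PFlag.rel_def.mp (FlagTuple.part_rel.mp hik)] at h2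
    change ψ'.1 τ _ - ψ'.1 τ _ = a * (ψ.1 τ _ - ψ.1 τ _)
    rw [h1, h2]
    ring
  · rintro ⟨a, ha, h⟩
    choose i hi using fun (τ : Fin β) (c : Cell (F τ)) => c.exists_has
    refine Quotient.sound ⟨a, fun τ c => ψ'.fn ⟨τ, i τ c⟩ - a * ψ.fn ⟨τ, i τ c⟩, ha, ?_⟩
    intro τ c d hdc
    obtain ⟨k, hk⟩ := d.exists_has
    have h1 := h ⟨τ, k⟩ ⟨τ, i τ c⟩ (FlagTuple.part_rel.mpr ((hk.of_inside hdc).rel (hi τ c)))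
    have h2 : ∀ χ : Velocity F F', χ.fn ⟨τ, k⟩ = χ.1 τ d := fun χ =>
      congrArg (χ.1 τ) (Cell.has_iff.mp hk)
    rw [h2, h2] at h1
    linarith

/-- The forms of a point of `Fiber F`, as a point of the Satake compactification. -/
def Fiber.sat {F : FlagTuple m} (Q : Fiber F) (τ : Fin β) : Satake (m τ) := ⟨F τ, Q τ⟩

/-- A frame diagonalizing the forms of a point of `Fiber F`. -/
def Fiber.frame {F : FlagTuple m} (Q : Fiber F) (τ : Fin β) : Frame (m τ) :=
  (exists_isSpectral (Q.sat τ)).choose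

/-- Logarithms of the eigenvalues of the forms of a point of `Fiber F`. -/
def Fiber.exps {F : FlagTuple m} (Q : Fiber F) (x : Idx m) : ℝ :=
  (exists_isSpectral (Q.sat x.1)).choose_spec.choose x.2

lemma Fiber.isSpectral {F : FlagTuple m} (Q : Fiber F) (τ : Fin β) :
    IsSpectral (Q.frame τ) (fun i => Q.exps ⟨τ, i⟩) (Q.sat τ) :=
  (exists_isSpectral (Q.sat τ)).choose_spec.choose_spec

open scoped Classical in
/-- The coordinates of a point of `Karp` in the polyhedron. -/
def KarpAt.vel : {F : FlagTuple m} → KarpAt F → XiProduct m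
  | _, .inner Q => fun a => a.pt Q.exps 1
  -- The velocity `ψ` dominates all deeper levels, so it determines the ray unless it vanishes
  -- modulo functions constant on the elements of `a`, that is, unless `a` refines the partition of
  -- `F'`. Only partitions that refine the one of the initial flags are meaningful here.
  | _, .bdry (F' := F') _ ψ x => fun a =>
      if a.1 ≤ F'.part.1 then x.vel a else a.pt (Quotient.out ψ).fn 0

/-- The projection of `Karp` to the product of the Satake compactifications. -/
def KarpAt.sat : {F : FlagTuple m} → KarpAt F → ∀ τ, Satake (m τ)
  | _, .inner Q => Q.sat
  | _, .bdry _ _ x => x.sat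

lemma KarpAt.subset_sat {F : FlagTuple m} (x : KarpAt F) (τ : Fin β) :
    (F τ).carrier ⊆ (x.sat τ).1.carrier := by
  induction x with
  | inner Q => exact subset_rfl
  | bdry h ψ x ih => exact (h.1 τ).trans ih

lemma KarpAt.vel_inner {F : FlagTuple m} (Q : Fiber F) (a : Part m) :
    (KarpAt.inner Q).vel a = a.pt Q.exps 1 := rfl

lemma KarpAt.vel_bdry_of_le {F F' : FlagTuple m} (h : Refines F F') (ψ : Delta F F')
    (x : KarpAt F') {a : Part m} (ha : a.1 ≤ F'.part.1) :
    (KarpAt.bdry h ψ x).vel a = x.vel a := if_pos ha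

/-- The chosen representative of the class is immaterial: another one changes the vector by a
positive factor and by constants on the classes of `F`, which leaves the ray unchanged. -/
lemma KarpAt.vel_bdry_of_not_le {F F' : FlagTuple m} (h : Refines F F') (ψ : Velocity F F')
    (x : KarpAt F') {a : Part m} (ha : a.1 ≤ F.part.1) (ha' : ¬ a.1 ≤ F'.part.1) :
    (KarpAt.bdry h ψ.cls x).vel a = a.pt ψ.fn 0 := by
  have e : (KarpAt.bdry h ψ.cls x).vel a = a.pt (Quotient.out ψ.cls).fn 0 := if_neg ha'
  rw [e]
  obtain ⟨r, hr, h1⟩ := (Velocity.cls_eq h).mp (Quotient.out_eq ψ.cls)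
  have h2 : a.pt ψ.fn 0 = a.pt (r • (Quotient.out ψ.cls).fn) 0 := Part.pt_congr (fun i k hik => by
    rw [h1 i k (ha hik), Pi.smul_apply, Pi.smul_apply, smul_eq_mul, smul_eq_mul, mul_sub]) 0
  rw [h2]
  have h3 := Part.pt_smul (a := a) (g := (Quotient.out ψ.cls).fn) (s := 0)
    (Or.inl fun e => ha' ((Velocity.mk_fn_eq_zero h _ ha).mp e)) le_rfl hr
  rw [mul_zero] at h3
  exact h3.symm

lemma Delta.exists_rep {F F' : FlagTuple m} (ψ : Delta F F') : ∃ χ : Velocity F F', χ.cls = ψ :=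
  Quotient.exists_rep ψ

lemma pt_eq_pt_zero {a : Part m} {g g' : Idx m → ℝ} (hg : a.mk g ≠ 0) (hg' : a.mk g' ≠ 0)
    (h : a.pt g 0 = a.pt g' 0) :
    ∃ r : ℝ, 0 < r ∧ ∀ i k, a.1 i k → g' i - g' k = r * (g i - g k) := by
  obtain ⟨r, hr, h1, -⟩ := (RayComp.pt_eq_pt (Part.pair_ne_zero.mpr (Or.inl hg)) le_rfl
    (Part.pair_ne_zero.mpr (Or.inl hg')) le_rfl).mp h
  rw [← Part.mk_smul] at h1
  refine ⟨r, hr, fun i k hik => ?_⟩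
  rw [Part.mk_eq.mp h1 i k hik, Pi.smul_apply, Pi.smul_apply, smul_eq_mul, smul_eq_mul, mul_sub]

lemma pt_one_ne_pt_zero {a : Part m} {g g' : Idx m → ℝ} (hg' : a.mk g' ≠ 0) :
    a.pt g 1 ≠ a.pt g' 0 := by
  intro h
  obtain ⟨r, hr, -, h1⟩ := (RayComp.pt_eq_pt (Part.pair_ne_zero.mpr (Or.inr one_ne_zero))
    zero_le_one (Part.pair_ne_zero.mpr (Or.inl hg')) le_rfl).mp h
  rw [mul_one] at h1
  exact hr.ne h1

/-- Inside a common flag the union of both is a flag with the same classes, so both coincide with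
it. -/
lemma PFlag.eq_of_rel_of_subset {n : ℕ} {F F' L : PFlag (Sp n)} (h : F.carrier ⊆ L.carrier)
    (h' : F'.carrier ⊆ L.carrier) (hr : ∀ i k, F.rel i k ↔ F'.rel i k) : F = F' := by
  set G : PFlag (Sp n) := ⟨F.carrier ∪ F'.carrier, L.chain.mono (Set.union_subset h h'),
    Or.inl F.bot_mem, Or.inl F.top_mem⟩ with hG
  have key : ∀ i k, F.rel i k → G.rel i k := by
    intro i k hik
    rw [PFlag.rel_iff]
    rintro W (hW | hW)
    · exact PFlag.rel_iff.mp hik W hW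
    · exact PFlag.rel_iff.mp ((hr i k).mp hik) W hW
  have h1 : F = G := PFlag.eq_of_rel Set.subset_union_left key
  have h2 : F' = G := PFlag.eq_of_rel Set.subset_union_right fun i k hik =>
    key i k ((hr i k).mpr hik)
  rw [h1, ← h2]

/-- The two kinds of coordinates determine a point. -/
lemma KarpAt.ext_coord {F : FlagTuple m} (x y : KarpAt F) (hs : x.sat = y.sat)
    (hv : ∀ a : Part m, a.1 ≤ F.part.1 → x.vel a = y.vel a) : x = y := by
  induction x with
  | inner Q =>
    cases y with
    | inner Q' =>
      congr 1
      funext τ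
      have h1 : (⟨_, Q τ⟩ : Satake (m τ)) = ⟨_, Q' τ⟩ := congrFun hs τ
      exact eq_of_heq (Sigma.mk.inj h1).2
    | bdry h ψ y =>
      obtain ⟨ψ, rfl⟩ := ψ.exists_rep
      -- The coordinate of the partition of `F` itself is finite at an inner point and infinite at a
      -- boundary point.
      have h1 := hv _ le_rfl
      rw [KarpAt.vel_inner, KarpAt.vel_bdry_of_not_le h ψ y le_rfl h.not_part_le] at h1
      exact absurd h1 (pt_one_ne_pt_zero fun e =>
        h.not_part_le ((Velocity.mk_fn_eq_zero h ψ le_rfl).mp e))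
  | bdry h ψ x ih =>
    obtain ⟨ψ, rfl⟩ := ψ.exists_rep
    have hψ := fun e => h.not_part_le ((Velocity.mk_fn_eq_zero h ψ le_rfl).mp e)
    have h1 := hv _ le_rfl
    rw [KarpAt.vel_bdry_of_not_le h ψ x le_rfl h.not_part_le] at h1
    cases y with
    | inner Q' =>
      rw [KarpAt.vel_inner] at h1
      exact absurd h1.symm (pt_one_ne_pt_zero hψ)
    | bdry h' ψ' y =>
      obtain ⟨ψ', rfl⟩ := ψ'.exists_rep
      rw [KarpAt.vel_bdry_of_not_le h' ψ' y le_rfl h'.not_part_le] at h1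
      obtain ⟨r, hr, h2⟩ := pt_eq_pt_zero hψ
        (fun e => h'.not_part_le ((Velocity.mk_fn_eq_zero h' ψ' le_rfl).mp e)) h1
      rename_i F₁ F₂ F₃
      -- Proportional velocities have the same level sets, so the two flags have the same classes.
      -- Both are parts of the common final flag given by the Satake coordinate, hence they are
      -- equal.
      have hF : F₂ = F₃ := by
        funext τ
        have hs' : y.sat = x.sat := hs.symm
        have hy := y.subset_sat τ
        rw [hs'] at hy
        refine PFlag.eq_of_rel_of_subset (x.subset_sat τ) hy ?_
        intro i k
        have key : (F₁ τ).rel i k → ((F₂ τ).rel i k ↔ (F₃ τ).rel i k) := by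
          intro hik
          have hik' := FlagTuple.part_rel.mpr hik
          rw [← FlagTuple.part_rel, ← FlagTuple.part_rel, ← ψ.fn_eq_iff h hik',
            ← ψ'.fn_eq_iff h' hik', ← sub_eq_zero (a := ψ'.fn _), h2 _ _ hik', mul_eq_zero,
            or_iff_right hr.ne', sub_eq_zero]
        exact ⟨fun e => (key (PFlag.rel_mono (h.1 τ) e)).mp e,
          fun e => (key (PFlag.rel_mono (h'.1 τ) e)).mpr e⟩
      subst hF
      have hψψ' : ψ.cls = ψ'.cls := (Velocity.cls_eq h).mpr ⟨r, hr, h2⟩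
      rw [hψψ', ih y hs fun a ha => ?_]
      have h3 := hv a (le_trans ha h.part_le)
      rwa [KarpAt.vel_bdry_of_le h _ x ha, KarpAt.vel_bdry_of_le h' _ y ha] at h3

lemma pairPart_le_part {F : FlagTuple m} {τ : Fin β} {i k : Fin (m τ)} :
    (pairPart i k).1 ≤ F.part.1 ↔ (F τ).rel i k :=
  ⟨fun h => FlagTuple.part_rel.mp (h (pairPart_rel i k)),
    fun h => pairPart_le (FlagTuple.part_rel.mpr h)⟩

lemma ratioOf_of_rel {n : ℕ} {T : Setoid (Fin n)} {i k : Fin n} (h : T i k) (f : Fin n → ℝ) :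
    ratioOf T f i k = Real.exp (-|f i - f k|) := if_pos h

/-- A pair of indices separated at some level has an infinite velocity coordinate and lies in
different cells of the final flag, so both sides vanish. A pair never separated is compared through
the final exponents. -/
lemma KarpAt.pairRatio_vel {F : FlagTuple m} (x : KarpAt F) {τ : Fin β} {i k : Fin (m τ)}
    (hik : (F τ).rel i k) : pairRatio i k (x.vel (pairPart i k)) = (x.sat τ).ratio i k := by
  induction x with
  | inner Q =>
    rw [KarpAt.vel_inner, pairRatio_pt i k zero_le_one (Or.inr one_ne_zero), expRatio,
      if_neg one_ne_zero, div_one]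
    change _ = (Q.sat τ).ratio i k
    rw [(Q.isSpectral τ).ratio_eq]
    exact (ratioOf_of_rel hik _).symm
  | bdry h ψ x ih =>
    rename_i F₁ F₂
    by_cases hik' : (F₂ τ).rel i k
    · rw [KarpAt.vel_bdry_of_le h ψ x (pairPart_le_part.mpr hik')]
      exact ih hik'
    · obtain ⟨ψ, rfl⟩ := ψ.exists_rep
      have hle := pairPart_le_part.mpr hik
      have hn := fun e => hik' (pairPart_le_part.mp e)
      rw [KarpAt.vel_bdry_of_not_le h ψ x hle hn, pairRatio_pt i k le_rfl
        (Or.inl fun e => hn ((ψ.mk_fn_eq_zero h hle).mp e)), expRatio, if_pos rfl]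
      obtain ⟨u, f, hu⟩ := exists_isSpectral (x.sat τ)
      change 0 = (x.sat τ).ratio i k
      rw [hu.ratio_eq]
      by_contra hne
      exact hik' (PFlag.rel_mono (x.subset_sat τ) (ratioOf_ne_zero.mp (Ne.symm hne)))

end KarpCoordinates

/-! ### The image of `Karp` in coordinates -/

section KarpImage

variable {β : ℕ} {m : Fin β → ℕ}

/-- The members of the flag `L` at which the function `g` has a jump inside each class
of `F`. -/
def jumpFlag {n : ℕ} (F L : PFlag (Sp n)) (g : Fin n → ℝ) : PFlag (Sp n) where
  carrier := {W ∈ L.carrier | ∀ i k, F.rel i k → i ∉ tailSet W → k ∈ tailSet W → g k < g i}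
  chain := L.chain.mono fun _ h => h.1
  bot_mem := ⟨L.bot_mem, fun i k _ _ hk => by
    rw [mem_tailSet, finrank_bot] at hk
    exact absurd hk (by have := k.2; omega)⟩
  top_mem := ⟨L.top_mem, fun i k _ hi _ => by
    rw [mem_tailSet, finrank_top, finrank_euclideanSpace_fin] at hi
    exact absurd (Nat.le_add_left _ _) hi⟩

lemma subset_jumpFlag {n : ℕ} {F L : PFlag (Sp n)} (h : F.carrier ⊆ L.carrier) (g : Fin n → ℝ) :
    F.carrier ⊆ (jumpFlag F L g).carrier :=
  fun W hW => ⟨h hW, fun _ _ hik hi hk => absurd ((PFlag.rel_iff.mp hik W hW).mpr hk) hi⟩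

/-- Let `p` be the first index in the class at which `g` drops below `g i`. Since `g` is constant on
the classes of `L`, the cell of `p` in `L` starts exactly at `p`, and its upper member is a jump
separating `i` from `k`. -/
lemma jumpFlag_rel {n : ℕ} {F L : PFlag (Sp n)} {g : Fin n → ℝ} (h : F.carrier ⊆ L.carrier)
    (hg : ∀ i k, i ≤ k → F.rel i k → g k ≤ g i) (hL : ∀ i k, L.rel i k → g i = g k) {i k : Fin n}
    (hik : F.rel i k) : (jumpFlag F L g).rel i k ↔ g i = g k := by
  have key : ∀ i k, i ≤ k → F.rel i k → (jumpFlag F L g).rel i k → g i = g k := by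
    intro i k hle hik hr
    by_contra hne
    have hlt : g k < g i := lt_of_le_of_ne (hg i k hle hik) (Ne.symm hne)
    obtain ⟨p, ⟨hip, hgp⟩, hmin⟩ := WellFounded.has_min (wellFounded_lt (α := Fin n))
      {p | F.rel i p ∧ g p < g i} ⟨k, hik, hlt⟩
    have hmin : ∀ q, F.rel i q → q < p → g i ≤ g q := fun q h1 h2 => by
      by_contra h3
      exact hmin q ⟨h1, not_le.mp h3⟩ h2
    have hc := L.cellOf_has p
    set c := L.cellOf p with hcdef
    have htail : ∀ q, q ∈ tailSet c.hi ↔ p ≤ q := by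
      intro q
      refine ⟨fun hq => ?_, fun hq => tailSet_upper
        ((Cell.mem_tailSet_of_has hc c.hi_mem).mpr le_rfl) hq⟩
      by_contra hqp
      have hqp : q < p := not_le.mp hqp
      have hLqp : L.rel q p := by
        rw [PFlag.rel_def, ← hcdef, ← Cell.has_iff]
        refine ⟨hq, fun hlo => ?_⟩
        exact c.not_hi_le_lo ((Cell.mem_tailSet_of_has hc c.lo_mem).mp
          (tailSet_upper hlo hqp.le))
      have h1 := hmin q (F.rel.trans hip (F.rel.symm (PFlag.rel_mono h hLqp))) hqp
      rw [hL q p hLqp] at h1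
      exact absurd hgp (not_lt.mpr h1)
    have hW : c.hi ∈ (jumpFlag F L g).carrier := by
      refine ⟨c.hi_mem, fun i' k' hik' hi' hk' => ?_⟩
      rw [htail] at hi' hk'
      have hi' := not_le.mp hi'
      have h1 : F.rel i' p := PFlag.rel_convex hik' hi'.le hk'
      have h2 := hg p k' hk' (F.rel.trans (F.rel.symm h1) hik')
      have h3 := hmin i' (F.rel.trans hip (F.rel.symm h1)) hi'
      linarith
    have hpk : p ≤ k := by
      by_contra h1
      exact absurd (hmin k hik (not_le.mp h1)) (not_le.mpr hlt)
    have hpi : i < p := by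
      by_contra h1
      exact absurd (hg p i (not_lt.mp h1) (F.rel.symm hip)) (not_le.mpr hgp)
    have h1 := PFlag.rel_iff.mp hr c.hi hW
    rw [htail, htail] at h1
    exact absurd (h1.mpr hpk) (not_le.mpr hpi)
  constructor
  · intro hr
    rcases le_total i k with hle | hle
    · exact key i k hle hik hr
    · exact (key k i hle (F.rel.symm hik) ((jumpFlag F L g).rel.symm hr)).symm
  · intro e
    rw [PFlag.rel_iff]
    intro W hW
    by_contra hne
    rcases not_iff.mp hne with h1
    by_cases hi : i ∈ tailSet W
    · have hk : k ∉ tailSet W := fun hk => (h1.mpr hk) hi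
      exact absurd e.symm (hW.2 k i (F.rel.symm hik) hk hi).ne'
    · exact absurd e (hW.2 i k hik hi (h1.mp hi)).ne'

lemma expRatio_zero (d : ℝ) : expRatio d 0 = 0 := if_pos rfl

lemma expRatio_of_ne {d s : ℝ} (h : s ≠ 0) : expRatio d s = Real.exp (-|d| / s) := if_neg h

lemma FlagTuple.part_rel_ratio {z : XiProduct m} {s : ∀ τ, Satake (m τ)}
    (hzs : ∀ τ (i k : Fin (m τ)), pairRatio i k (z (pairPart i k)) = (s τ).ratio i k)
    {F : FlagTuple m} {g : Idx m → ℝ} {s₀ : ℝ} (hs₀ : 0 ≤ s₀)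
    (hz : ∀ a : Part m, a.1 ≤ F.part.1 → (a.mk g ≠ 0 ∨ s₀ ≠ 0) → z a = a.pt g s₀)
    {τ : Fin β} {i k : Fin (m τ)} (hik : (F τ).rel i k) (h : g ⟨τ, i⟩ - g ⟨τ, k⟩ ≠ 0 ∨ s₀ ≠ 0) :
    (s τ).ratio i k = expRatio (g ⟨τ, i⟩ - g ⟨τ, k⟩) s₀ := by
  have h' : (pairPart i k).mk g ≠ 0 ∨ s₀ ≠ 0 := by
    rwa [Ne, pairPart_mk_eq_zero]
  rw [← hzs, hz _ (pairPart_le_part.mpr hik) h', pairRatio_pt i k hs₀ h']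

lemma Satake.ratio_ne_zero {n : ℕ} {s : Satake n} {i k : Fin n} :
    s.ratio i k ≠ 0 ↔ s.1.rel i k := by
  obtain ⟨u, f, hu⟩ := exists_isSpectral s
  rw [hu.ratio_eq]
  exact ratioOf_ne_zero

/-- A function of the indices that is constant exactly on the classes of `F'` inside the classes
of `F`, as a velocity. -/
lemma exists_velocity {F F' : FlagTuple m} (h : Refines F F') {g : Idx m → ℝ} (hg : F.part.Anti g)
    (hr : ∀ τ i k, (F τ).rel i k → ((F' τ).rel i k ↔ g ⟨τ, i⟩ = g ⟨τ, k⟩)) :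
    ∃ ψ : Velocity F F', ψ.fn = g := by
  choose i hi using fun (τ : Fin β) (d : Cell (F' τ)) => d.exists_has
  have hgi : ∀ τ (d : Cell (F' τ)) k, d.Has k → g ⟨τ, i τ d⟩ = g ⟨τ, k⟩ := fun τ d k hk =>
    (hr τ _ _ (PFlag.rel_mono (h.1 τ) ((hi τ d).rel hk))).mp ((hi τ d).rel hk)
  refine ⟨⟨fun τ d => g ⟨τ, i τ d⟩, fun τ c d d' hd hd' hdd' => ?_⟩, ?_⟩
  · have h1 : i τ d' < i τ d := Cell.lt_of_hi_le_lo hdd' (hi τ d') (hi τ d)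
    have h2 : (F τ).rel (i τ d') (i τ d) :=
      ((hi τ d').of_inside hd').rel ((hi τ d).of_inside hd)
    refine lt_of_le_of_ne (hg τ _ _ h1.le (FlagTuple.part_rel.mpr h2)) fun e => ?_
    have h3 := (hr τ _ _ h2).mpr e.symm
    have h4 : d' = d := by
      have h5 := PFlag.rel_def.mp h3
      rwa [Cell.has_iff.mp (hi τ d'), Cell.has_iff.mp (hi τ d)] at h5
    rw [h4] at hdd'
    exact d.not_hi_le_lo hdd'
  · funext x
    exact hgi x.1 _ x.2 (PFlag.cellOf_has _ _)

/-- Every pair of compatible coordinates is given by a point of `Karp`. -/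
lemma KarpAt.exists_coord {z : XiProduct m} (hz : z ∈ chamberKarp m) {s : ∀ τ, Satake (m τ)}
    (hzs : ∀ τ (i k : Fin (m τ)), pairRatio i k (z (pairPart i k)) = (s τ).ratio i k)
    (F : FlagTuple m) (hF : ∀ τ, (F τ).carrier ⊆ (s τ).1.carrier) :
    ∃ x : KarpAt F, x.sat = s ∧ ∀ a : Part m, a.1 ≤ F.part.1 → x.vel a = z a := by
  -- Each proper refinement separates a pair of indices, so the number of related pairs decreases.
  induction hN : {p : Idx m × Idx m | F.part.1 p.1 p.2}.ncard using Nat.strong_induction_on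
    generalizing F with | _ N ih
  obtain ⟨g, s₀, hs₀, h0, hanti, hrep⟩ := exists_rep_of_mem_chamberKarp hz F.part
  by_cases hne : s₀ = 0
  · subst hne
    have hg : F.part.mk g ≠ 0 := h0.resolve_right (not_not.mpr rfl)
    -- Unequal velocities force a zero ratio, so `g` is constant on the cells of the final flag. Its
    -- level sets are therefore given by members of that flag, and these form the next refinement.
    have hL : ∀ τ i k, (s τ).1.rel i k → g ⟨τ, i⟩ = g ⟨τ, k⟩ := by
      intro τ i k hik
      by_contra hne
      have h1 := FlagTuple.part_rel_ratio hzs le_rfl hrep (PFlag.rel_mono (hF τ) hik)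
        (Or.inl (sub_ne_zero.mpr hne))
      rw [expRatio_zero] at h1
      exact Satake.ratio_ne_zero.mpr hik h1
    set F' : FlagTuple m := fun τ => jumpFlag (F τ) (s τ).1 (fun i => g ⟨τ, i⟩) with hF'
    have hr : ∀ τ i k, (F τ).rel i k → ((F' τ).rel i k ↔ g ⟨τ, i⟩ = g ⟨τ, k⟩) :=
      fun τ i k hik => jumpFlag_rel (hF τ)
        (fun i k hle hik => hanti τ i k hle (FlagTuple.part_rel.mpr hik)) (hL τ) hik
    have hsub : ∀ τ, (F τ).carrier ⊆ (F' τ).carrier := fun τ => subset_jumpFlag (hF τ) _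
    obtain ⟨x₁, y₁, hxy, hgxy⟩ : ∃ x y, F.part.1 x y ∧ g x ≠ g y := by
      rw [Ne, Part.mk_eq_zero] at hg
      push Not at hg
      exact hg
    have hxy' : ¬ F'.part.1 x₁ y₁ := by
      obtain ⟨τ, i⟩ := x₁
      obtain ⟨σ, k⟩ := y₁
      obtain rfl : τ = σ := F.part.2 hxy
      rw [FlagTuple.part_rel, hr τ i k (FlagTuple.part_rel.mp hxy)]
      exact hgxy
    have href : Refines F F' := by
      refine ⟨hsub, ?_⟩
      by_contra hcon
      push Not at hcon
      exact hxy' (FlagTuple.part_mono hcon hxy)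
    obtain ⟨ψ, hψ⟩ := exists_velocity href hanti hr
    have hlt : {p : Idx m × Idx m | F'.part.1 p.1 p.2}.ncard < N := by
      rw [← hN]
      refine Set.ncard_lt_ncard ?_ (Set.toFinite _)
      exact ⟨fun p hp => href.part_le hp, fun hcon => hxy' (hcon (a := (x₁, y₁)) hxy)⟩
    obtain ⟨x, hx, hxv⟩ := ih _ hlt F' (fun τ W hW => hW.1) rfl
    refine ⟨.bdry href ψ.cls x, hx, fun a ha => ?_⟩
    by_cases ha' : a.1 ≤ F'.part.1
    · rw [KarpAt.vel_bdry_of_le href _ x ha', hxv a ha']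
    · rw [KarpAt.vel_bdry_of_not_le href ψ x ha ha', hψ, hrep a ha (Or.inl fun e => ha' ?_)]
      rw [← hψ] at e
      exact (ψ.mk_fn_eq_zero href ha).mp e
  · have hs₀' : 0 < s₀ := lt_of_le_of_ne hs₀ (Ne.symm hne)
    -- At a finite coordinate all ratios inside the classes of `F` are positive, so `F` is already
    -- the final flag, and the ratios determine the differences of exponents.
    have hratio : ∀ τ i k, (F τ).rel i k →
        (s τ).ratio i k = Real.exp (-|g ⟨τ, i⟩ - g ⟨τ, k⟩| / s₀) := fun τ i k hik => by
      rw [FlagTuple.part_rel_ratio hzs hs₀ hrep hik (Or.inr hne), expRatio_of_ne hne]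
    obtain rfl : F = fun τ => (s τ).1 := by
      funext τ
      refine PFlag.eq_of_rel (hF τ) fun i k hik => ?_
      rw [← Satake.ratio_ne_zero, hratio τ i k hik]
      exact (Real.exp_pos _).ne'
    set Q : Fiber (fun τ => (s τ).1) := fun τ => (s τ).2
    refine ⟨.inner Q, rfl, fun a ha => ?_⟩
    rw [KarpAt.vel_inner, hrep a ha (Or.inr hne), ← Part.pt_smul (Or.inr hne) hs₀
      (inv_pos.mpr hs₀'),
      inv_mul_cancel₀ hne]
    refine Part.pt_congr ?_ 1
    rintro ⟨τ, i⟩ ⟨σ, k⟩ hik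
    obtain rfl : τ = σ := a.2 hik
    have hik := FlagTuple.part_rel.mp (ha hik)
    have key : ∀ i k, i ≤ k → (s τ).1.rel i k →
        Q.exps ⟨τ, i⟩ - Q.exps ⟨τ, k⟩ = s₀⁻¹ * (g ⟨τ, i⟩ - g ⟨τ, k⟩) := by
      intro i k hle hik
      have h1 := hratio τ i k hik
      have h2 : (s τ).ratio i k = _ := congrFun (congrFun (Q.isSpectral τ).ratio_eq i) k
      rw [h2] at h1
      have h3 := (ratioOf_of_rel (T := (Q.sat τ).1.rel) hik (fun i => Q.exps ⟨τ, i⟩)).symm.trans h1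
      have h4 := Real.exp_injective h3
      have h5 : Q.exps ⟨τ, k⟩ ≤ Q.exps ⟨τ, i⟩ := (Q.isSpectral τ).anti i k hle hik
      have h6 := hanti τ i k hle (FlagTuple.part_rel.mpr hik)
      rw [abs_of_nonneg (sub_nonneg.mpr h5), abs_of_nonneg (sub_nonneg.mpr h6), neg_div,
        neg_inj] at h4
      rw [h4, div_eq_inv_mul]
    rw [Pi.smul_apply, Pi.smul_apply, smul_eq_mul, smul_eq_mul, ← mul_sub]
    rcases le_total i k with hle | hle
    · exact key i k hle hik
    · have := key k i hle ((s τ).1.rel.symm hik)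
      linarith

lemma Fiber.exps_anti {F : FlagTuple m} (Q : Fiber F) : F.part.Anti Q.exps :=
  fun τ i k hle hik => (Q.isSpectral τ).anti i k hle (FlagTuple.part_rel.mp hik)

/-- Every point of `Karp` is a limit, in the coordinates of the polyhedron, of functions. -/
lemma KarpAt.exists_approx {F : FlagTuple m} (x : KarpAt F) : ∃ f : ℕ → Idx m → ℝ,
    (∀ j, F.part.Anti (f j)) ∧
      ∀ a : Part m, a.1 ≤ F.part.1 → Tendsto (fun j => a.pt (f j) 1) atTop (𝓝 (x.vel a)) := by
  induction x with
  | inner Q => exact ⟨fun _ => Q.exps, fun _ => Q.exps_anti, fun a _ => tendsto_const_nhds⟩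
  | bdry h ψ x ih =>
    rename_i F F'
    obtain ⟨ψ, rfl⟩ := ψ.exists_rep
    obtain ⟨f, hf, hlim⟩ := ih
    choose N hN0 hN using fun j => exists_mono_shift
      (fun p : Idx m × Idx m => f j p.2 - f j p.1) (fun p => ψ.fn p.1 - ψ.fn p.2)
    -- The summand `N j` makes `M j ψ + f j` non-increasing; the second one makes `M j` tend to
    -- infinity and `f j / M j` tend to zero, so that the ray of `ψ` survives in the limit.
    set M : ℕ → ℝ := fun j => N j + (j + 1) * (1 + ∑ i, |f j i|) with hM
    have hMpos : ∀ j, 0 < M j := fun j => by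
      have := hN0 j
      have : 0 ≤ ∑ i, |f j i| := Finset.sum_nonneg fun _ _ => abs_nonneg _
      positivity
    have hMj : ∀ j : ℕ, ((j : ℝ) + 1) * (1 + ∑ i, |f j i|) ≤ M j := fun j =>
      le_add_of_nonneg_left (hN0 j)
    have hsum : ∀ j, 0 ≤ ∑ i, |f j i| := fun j => Finset.sum_nonneg fun _ _ => abs_nonneg _
    refine ⟨fun j => M j • ψ.fn + f j, fun j τ i k hle hik => ?_, fun a ha => ?_⟩
    · change M j * ψ.fn ⟨τ, k⟩ + f j ⟨τ, k⟩ ≤ M j * ψ.fn ⟨τ, i⟩ + f j ⟨τ, i⟩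
      by_cases hik' : (F' τ).rel i k
      · rw [ψ.fn_eq (FlagTuple.part_rel.mpr hik')]
        have := hf j τ i k hle (FlagTuple.part_rel.mpr hik')
        linarith
      · have h1 := ψ.fn_lt h (FlagTuple.part_rel.mp hik) hik' hle
        have h2 := hN j (⟨τ, i⟩, ⟨τ, k⟩) (sub_pos.mpr h1)
        have h3 : N j * (ψ.fn ⟨τ, i⟩ - ψ.fn ⟨τ, k⟩) ≤ M j * (ψ.fn ⟨τ, i⟩ - ψ.fn ⟨τ, k⟩) := by
          refine mul_le_mul_of_nonneg_right ?_ (sub_pos.mpr h1).le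
          have := hsum j
          have : (0 : ℝ) ≤ ((j : ℝ) + 1) * (1 + ∑ i, |f j i|) := by positivity
          linarith
        have h2 : f j ⟨τ, k⟩ - f j ⟨τ, i⟩ ≤ N j * (ψ.fn ⟨τ, i⟩ - ψ.fn ⟨τ, k⟩) := h2
        nlinarith
    · by_cases ha' : a.1 ≤ F'.part.1
      · rw [KarpAt.vel_bdry_of_le h _ x ha']
        refine (hlim a ha').congr fun j => Part.pt_congr (fun i k hik => ?_) 1
        change _ = M j * ψ.fn i + f j i - (M j * ψ.fn k + f j k)
        rw [ψ.fn_eq (ha' hik)]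
        ring
      · rw [KarpAt.vel_bdry_of_not_le h ψ x ha ha']
        have hinv : Tendsto (fun j => (M j)⁻¹) atTop (𝓝 0) := by
          have h1 : Tendsto M atTop atTop := by
            refine tendsto_atTop_mono (fun j => ?_) tendsto_natCast_atTop_atTop
            have := hMj j
            have := hsum j
            nlinarith [Nat.cast_nonneg (α := ℝ) j]
          exact tendsto_inv_atTop_zero.comp h1
        have hquot : Tendsto (fun j => ψ.fn + (M j)⁻¹ • f j) atTop (𝓝 ψ.fn) := by
          have h0 : Tendsto (fun j => (M j)⁻¹ • f j) atTop (𝓝 0) := by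
            refine tendsto_pi_nhds.mpr fun i => ?_
            refine squeeze_zero_norm (fun j => ?_) tendsto_one_div_add_atTop_nhds_zero_nat
            rw [Pi.smul_apply, smul_eq_mul, Real.norm_eq_abs, abs_mul,
              abs_of_pos (inv_pos.mpr (hMpos j)), inv_mul_eq_div, div_le_div_iff₀ (hMpos j)
              (by positivity), one_mul]
            have h1 : |f j i| ≤ ∑ i, |f j i| :=
              Finset.single_le_sum (f := fun i => |f j i|) (fun _ _ => abs_nonneg _)
                (Finset.mem_univ i)
            have := hMj j
            nlinarith [Nat.cast_nonneg (α := ℝ) j]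
          have h1 := (tendsto_const_nhds (x := ψ.fn)).add h0
          rwa [add_zero] at h1
        have h2 := Part.tendsto_pt ((a.continuous_mk.tendsto _).comp hquot) hinv
          (Eventually.of_forall fun j => inv_pos.mpr (hMpos j))
          (Or.inl fun e => ha' ((ψ.mk_fn_eq_zero h ha).mp e)) le_rfl
        refine h2.congr fun j => ?_
        have h3 := Part.pt_smul (a := a) (g := M j • ψ.fn + f j) (s := 1) (Or.inr one_ne_zero)
          zero_le_one (inv_pos.mpr (hMpos j))
        rw [← h3, smul_add, smul_smul, inv_mul_cancel₀ (hMpos j).ne', one_smul, mul_one]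
        rfl

end KarpImage

/-! ### The topology of `Karp` -/

section KarpTopology

variable {β : ℕ} {m : Fin β → ℕ}

/-- A point of the stratum of the trivial flags, as a point of the symmetric space. -/
def Fiber.toSpace (Q : Fiber (FlagTuple.trivial m)) : Space m :=
  fun τ => (diagForm (Q.frame τ) fun i => Q.exps ⟨τ, i⟩).cls

lemma Fiber.exps_antitone (Q : Fiber (FlagTuple.trivial m)) (τ : Fin β) :
    Antitone fun i => Q.exps ⟨τ, i⟩ :=
  fun i k hik => Q.exps_anti τ i k hik (FlagTuple.part_rel.mpr (PFlag.trivial_rel i k))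

lemma Fiber.sat_eq (Q : Fiber (FlagTuple.trivial m)) (τ : Fin β) :
    Q.sat τ = satakeIncl (Q.toSpace τ) :=
  (Q.isSpectral τ).eq_incl fun i k => PFlag.trivial_rel i k

lemma Fiber.karpIncl_toSpace (Q : Fiber (FlagTuple.trivial m)) :
    karpIncl m Q.toSpace = KarpAt.inner Q := by
  rw [karpIncl]
  congr 1
  funext τ
  have h : (⟨PFlag.trivial _, Q τ⟩ : Satake (m τ)) = ⟨_, trivialForms (Q.toSpace τ)⟩ := Q.sat_eq τ
  exact (eq_of_heq (Sigma.mk.inj h).2).symm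

lemma Fiber.velocityMap_toSpace (Q : Fiber (FlagTuple.trivial m)) :
    velocityMap m Q.toSpace = (KarpAt.inner Q).vel := by
  refine (velocityMap_diagForm Q.frame Q.exps_antitone).trans (funext fun a => ?_)
  exact xiDiag_apply _ _

lemma Part.le_trivial (a : Part m) : a.1 ≤ (FlagTuple.trivial m).part.1 := by
  rw [FlagTuple.trivial_part]
  exact a.2

/-- Approximation of a point of `Karp` by points of the symmetric space. -/
lemma KarpAt.exists_seq (x : Karp m) : ∃ y : ℕ → Space m,
    Tendsto (fun j => velocityMap m (y j)) atTop (𝓝 x.vel) ∧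
      Tendsto (fun j τ => satakeIncl (y j τ)) atTop (𝓝 x.sat) := by
  obtain ⟨f, hf, hlim⟩ := x.exists_approx
  have hanti : ∀ j τ, Antitone fun i => f j ⟨τ, i⟩ := fun j τ i k hik =>
    hf j τ i k hik (FlagTuple.part_rel.mpr (PFlag.trivial_rel i k))
  choose u g hu using fun τ => exists_isSpectral (x.sat τ)
  refine ⟨fun j τ => (diagForm (u τ) fun i => f j ⟨τ, i⟩).cls, ?_, ?_⟩
  · refine tendsto_pi_nhds.mpr fun a => ?_
    refine (hlim a a.le_trivial).congr fun j => ?_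
    rw [velocityMap_diagForm u (hanti j), xiDiag_apply]
  · refine tendsto_pi_nhds.mpr fun τ => ?_
    -- With the frame of the final forms kept fixed, only the ratios have to converge, and these are
    -- functions of the velocity coordinates.
    refine tendsto_satake (fun j => isSpectral_incl (u τ) (hanti j τ)) (hu τ) ?_ ?_
    · intro i k
      have h1 := ((continuous_pairRatio i k).tendsto _).comp
        (hlim (pairPart i k) (Part.le_trivial _))
      rw [x.pairRatio_vel (PFlag.trivial_rel i k), (hu τ).ratio_eq] at h1
      refine h1.congr fun j => ?_
      rw [Function.comp_apply, ← xiDiag_apply, pairRatio_xiDiag]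
      exact (ratioOf_incl (diagForm (u τ) fun i => f j ⟨τ, i⟩).cls (fun i => f j ⟨τ, i⟩) i k).symm
    · intro i k
      have h0 : Inner.inner ℝ (u τ i) (u τ k) * (1 - ratioOf (x.sat τ).1.rel (g τ) i k) = 0 := by
        rw [Frame.inner_eq]
        by_cases hik : i = k
        · rw [hik, ratioOf_self, sub_self, mul_zero]
        · rw [if_neg hik, zero_mul]
      rw [h0]
      exact tendsto_const_nhds

/-- Approximation puts the point in the closed chamber; the coordinate of the coarsest partition is
infinite, so the height vanishes. -/
lemma KarpAt.vel_bdry_mem {F' : FlagTuple m} (h : Refines (FlagTuple.trivial m) F')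
    (ψ : Delta (FlagTuple.trivial m) F') (x : KarpAt F') :
    (KarpAt.bdry h ψ x).vel ∈ chamberBdry m := by
  have hmem : (KarpAt.bdry h ψ x).vel ∈ chamberKarp m := by
    obtain ⟨y, hy, -⟩ := (KarpAt.bdry h ψ x).exists_seq
    exact mem_closure_of_tendsto hy (Eventually.of_forall fun j => velocityMap_mem _)
  refine ⟨hmem, ?_⟩
  rw [mem_chamber_iff hmem, not_not]
  obtain ⟨ψ, rfl⟩ := ψ.exists_rep
  have h1 := KarpAt.vel_bdry_of_not_le h ψ x le_rfl h.not_part_le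
  have h2 := fun e => h.not_part_le ((ψ.mk_fn_eq_zero h le_rfl).mp e)
  rw [FlagTuple.trivial_part] at h1 h2
  by_contra hne
  exact (height_ne_zero_iff le_rfl (Or.inl h2) h1).mp hne rfl

/-- The projection of `Karp` to the velocity compactification. -/
def KarpAt.toVelComp : Karp m → VelComp m
  | .inner Q => VelComp.inner (Fiber.toSpace Q)
  | .bdry h ψ x => VelComp.bdry ⟨(KarpAt.bdry h ψ x).vel, KarpAt.vel_bdry_mem h ψ x⟩

lemma KarpAt.toChamber_toVelComp (x : Karp m) : (toVelComp x).toChamber = x.vel := by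
  cases x with
  | inner Q => exact Fiber.velocityMap_toSpace Q
  | bdry h ψ x => rfl

/-- The map of `Karp` to the product of two compactifications. -/
def karpMap (x : Karp m) : VelComp m × ∀ τ, Satake (m τ) := (KarpAt.toVelComp x, x.sat)

lemma karpMap_injective : Function.Injective (karpMap (m := m)) := by
  intro x y h
  refine KarpAt.ext_coord x y (congrArg Prod.snd h) fun a _ => ?_
  rw [← KarpAt.toChamber_toVelComp, ← KarpAt.toChamber_toVelComp,
    show KarpAt.toVelComp x = KarpAt.toVelComp y from congrArg Prod.fst h]

lemma karpIncl_injective (hm : ∀ τ, 0 < m τ) : Function.Injective (karpIncl m) := by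
  intro x y h
  have h1 : (karpIncl m x).sat = (karpIncl m y).sat := by rw [h]
  funext τ
  exact satakeIncl_injective (hm τ) (congrFun h1 τ)

lemma karpMap_karpIncl (hm : ∀ τ, 0 < m τ) (x : Space m) :
    karpMap (karpIncl m x) = (VelComp.inner x, fun τ => satakeIncl (x τ)) := by
  refine Prod.ext ?_ rfl
  change VelComp.inner (Fiber.toSpace fun τ => trivialForms (x τ)) = _
  congr 1
  exact karpIncl_injective hm (Fiber.karpIncl_toSpace _)

/-- One inclusion is the approximation of points of `Karp`. For the other one, a point of the hybrid
satisfies the closed relation between ratios: over the symmetric space its Satake coordinate is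
forced by continuity, and at infinity it is realised by `KarpAt.exists_coord`. -/
lemma range_karpMap (hm : ∀ τ, 0 < m τ) : Set.range (karpMap (m := m)) =
    hybrid (VelComp.inner : Space m → VelComp m) (fun (x : Space m) τ => satakeIncl (x τ)) := by
  refine Set.Subset.antisymm ?_ ?_
  · rintro _ ⟨x, rfl⟩
    cases hx : x with
    | inner Q =>
      refine subset_closure ⟨Fiber.toSpace Q, ?_⟩
      rw [← Fiber.karpIncl_toSpace, karpMap_karpIncl hm]
    | bdry h ψ x' =>
      rw [← hx]
      obtain ⟨y, hy1, hy2⟩ := x.exists_seq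
      refine mem_closure_of_tendsto (f := fun j => (VelComp.inner (y j), fun τ =>
        satakeIncl (y j τ)))
        (Tendsto.prodMk_nhds ?_ hy2) (Eventually.of_forall fun j => ⟨y j, rfl⟩)
      rw [hx] at hy1 ⊢
      exact VelComp.tendsto_bdry hy1
  · rintro ⟨q, s⟩ hqs
    have hqs' := hqs
    obtain ⟨U, hU, hUq⟩ := mem_closure_iff_ultrafilter.mp hqs
    have hpair : ∀ τ (i k : Fin (m τ)), pairRatio i k (q.toChamber (pairPart i k)) =
        (s τ).ratio i k := by
      intro τ i k
      have hcl : IsClosed {p : VelComp m × ∀ τ, Satake (m τ) |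
          pairRatio i k (p.1.toChamber (pairPart i k)) = (p.2 τ).ratio i k} := by
        refine isClosed_eq ?_ ?_
        · exact (continuous_pairRatio i k).comp ((continuous_apply (pairPart i k)).comp
            (VelComp.continuous_toChamber.comp continuous_fst))
        · exact continuous_pi_iff.mp (continuous_pi_iff.mp (Satake.continuous_ratio.comp
            (continuous_pi_iff.mp continuous_snd τ)) i) k
      refine closure_minimal ?_ hcl hqs
      rintro _ ⟨x, rfl⟩
      exact pairRatio_velocityMap x i k
    cases q with
    | inner x =>
      refine ⟨karpIncl m x, ?_⟩
      rw [karpMap_karpIncl hm]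
      refine Prod.ext rfl ?_
      have hex : ∀ p : VelComp m × ∀ τ, Satake (m τ), ∃ y : Space m,
          p ∈ Set.range (fun x : Space m => (VelComp.inner x, fun τ => satakeIncl (x τ))) →
            (VelComp.inner y, fun τ => satakeIncl (y τ)) = p := by
        intro p
        by_cases hp : p ∈ Set.range
            (fun x : Space m => ((VelComp.inner x, fun τ => satakeIncl (x τ)) :
              VelComp m × ∀ τ, Satake (m τ)))
        · obtain ⟨y, hy⟩ := hp
          exact ⟨y, fun _ => hy⟩
        · exact ⟨x, fun h => absurd h hp⟩
      choose y hy using hex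
      have t1 : Tendsto (fun p => VelComp.inner (y p)) U (𝓝 (VelComp.inner x)) := by
        refine Tendsto.congr' ?_ ((continuous_fst.tendsto _).comp (tendsto_id.mono_left hUq))
        filter_upwards [hU] with p hp
        exact (congrArg Prod.fst (hy p hp)).symm
      have t2 : Tendsto (fun p τ => satakeIncl (y p τ)) U (𝓝 s) := by
        refine Tendsto.congr' ?_ ((continuous_snd.tendsto (VelComp.inner x, s)).comp
          (tendsto_id.mono_left hUq))
        filter_upwards [hU] with p hp
        exact (congrArg Prod.snd (hy p hp)).symm
      -- The symmetric space is embedded in the velocity compactification, so the approximating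
      -- points themselves converge to `x`, and continuity of the Satake inclusion identifies `s`.
      have t3 : Tendsto y U (𝓝 x) :=
        VelComp.isOpenEmbedding_inner.isInducing.tendsto_nhds_iff.mpr t1
      exact tendsto_nhds_unique
        (((isCompactification_spaceSatake m).continuous.tendsto x).comp t3) t2
    | bdry z =>
      obtain ⟨x, hxs, hxv⟩ := KarpAt.exists_coord z.2.1 hpair (FlagTuple.trivial m) (by
        rintro τ W (rfl | rfl)
        · exact (s τ).1.bot_mem
        · exact (s τ).1.top_mem)
      have hv : x.vel = z.1 := funext fun a => hxv a a.le_trivial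
      refine ⟨x, Prod.ext ?_ hxs⟩
      cases x with
      | inner Q =>
        exact absurd (velocityMap_mem (Fiber.toSpace Q))
          (by rw [Fiber.velocityMap_toSpace, hv]; exact z.2.2)
      | bdry h ψ x => exact congrArg VelComp.bdry (Subtype.ext hv)

/-- The topology of the Karpelevich compactification. -/
@[reducible]
def karpTopology (m : Fin β → ℕ) : TopologicalSpace (Karp m) :=
  TopologicalSpace.induced karpMap inferInstance

/-- `Karp` as a hybrid. -/
def karpEquiv (hm : ∀ τ, 0 < m τ) : Karp m ≃
    hybrid (VelComp.inner : Space m → VelComp m) (fun (x : Space m) τ => satakeIncl (x τ)) :=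
  (Equiv.ofInjective _ karpMap_injective).trans (Equiv.setCongr (range_karpMap hm))

lemma karpEquiv_apply (hm : ∀ τ, 0 < m τ) (x : Karp m) :
    (karpEquiv hm x : VelComp m × ∀ τ, Satake (m τ)) = karpMap x := rfl

-- The homeomorphism with the hybrid

attribute [local instance] karpTopology

lemma isEmbedding_karpMap : IsEmbedding (karpMap (m := m)) := ⟨⟨rfl⟩, karpMap_injective⟩

/-- The homeomorphism of `Karp` and of the hybrid. -/
def karpHomeo (hm : ∀ τ, 0 < m τ) : Karp m ≃ₜ
    hybrid (VelComp.inner : Space m → VelComp m) (fun (x : Space m) τ => satakeIncl (x τ)) where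
  toEquiv := karpEquiv hm
  continuous_toFun := by
    refine Continuous.subtype_mk isEmbedding_karpMap.continuous _
  continuous_invFun := by
    refine isEmbedding_karpMap.isInducing.continuous_iff.mpr ?_
    refine continuous_subtype_val.congr fun p => ?_
    obtain ⟨x, rfl⟩ := (karpEquiv hm).surjective p
    change _ = karpMap ((karpEquiv hm).symm (karpEquiv hm x))
    rw [Equiv.symm_apply_apply, karpEquiv_apply]

lemma karpTopology_compactSpace (hm : ∀ τ, 0 < m τ) : CompactSpace (Karp m) := by
  have := VelComp.compactSpace hm
  have : CompactSpace (hybrid (VelComp.inner : Space m → VelComp m)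
      (fun (x : Space m) τ => satakeIncl (x τ))) :=
    isCompact_iff_compactSpace.mp isClosed_closure.isCompact
  exact (karpHomeo hm).symm.compactSpace

lemma karpTopology_metrizableSpace (hm : ∀ τ, 0 < m τ) :
    TopologicalSpace.MetrizableSpace (Karp m) := by
  have := VelComp.metrizableSpace hm
  exact isEmbedding_karpMap.metrizableSpace

/-- The projection to the velocity compactification is continuous, restricts to the open embedding
of the symmetric space, and pulls its open image back to the inner stratum. -/
lemma isOpenEmbedding_karpIncl (hm : ∀ τ, 0 < m τ) : IsOpenEmbedding (karpIncl m) := by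
  have hcomp : karpMap ∘ karpIncl m =
      fun x => (VelComp.inner x, fun τ => satakeIncl (x τ)) := funext (karpMap_karpIncl hm)
  have hcont : Continuous (karpIncl m) := by
    rw [isEmbedding_karpMap.isInducing.continuous_iff, hcomp]
    exact VelComp.isOpenEmbedding_inner.continuous.prodMk
      (isCompactification_spaceSatake m).continuous
  have hfst : Continuous fun x : Karp m => KarpAt.toVelComp x :=
    continuous_fst.comp isEmbedding_karpMap.continuous
  refine ⟨IsEmbedding.of_comp hcont hfst ?_, ?_⟩
  · have : (fun x : Karp m => KarpAt.toVelComp x) ∘ karpIncl m = VelComp.inner :=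
      funext fun x => congrArg Prod.fst (karpMap_karpIncl hm x)
    rw [this]
    exact VelComp.isOpenEmbedding_inner.isEmbedding
  · have : Set.range (karpIncl m) =
        (fun x : Karp m => KarpAt.toVelComp x) ⁻¹' Set.range VelComp.inner := by
      ext x
      cases x with
      | inner Q => exact ⟨fun _ => ⟨_, rfl⟩, fun _ => ⟨_, Fiber.karpIncl_toSpace Q⟩⟩
      | bdry h ψ x =>
        refine ⟨?_, ?_⟩
        · rintro ⟨y, hy⟩
          cases hy
        · rintro ⟨y, hy⟩
          cases hy
    rw [this]
    exact VelComp.isOpenEmbedding_inner.isOpen_range.preimage hfst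

lemma denseRange_karpIncl (hm : ∀ τ, 0 < m τ) : DenseRange (karpIncl m) := by
  intro x
  rw [isEmbedding_karpMap.isInducing.closure_eq_preimage_closure_image, Set.mem_preimage,
    ← Set.range_comp, show karpMap ∘ karpIncl m =
      fun x => (VelComp.inner x, fun τ => satakeIncl (x τ)) from funext (karpMap_karpIncl hm)]
  have h : karpMap x ∈ Set.range (karpMap (m := m)) := ⟨x, rfl⟩
  rwa [range_karpMap hm] at h

/-! ### Convergence in the boundary fibres -/

lemma tendsto_karp {J : Type} {l : Filter J} {x : J → Karp m} {F' : FlagTuple m}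
    (h : Refines (FlagTuple.trivial m) F') (ψ : Delta (FlagTuple.trivial m) F') (y : KarpAt F')
    (hv : ∀ a, Tendsto (fun j => (x j).vel a) l (𝓝 ((KarpAt.bdry h ψ y).vel a)))
    (hs : ∀ τ, Tendsto (fun j => (x j).sat τ) l (𝓝 (y.sat τ))) :
    Tendsto x l (𝓝 (KarpAt.bdry h ψ y)) := by
  refine isEmbedding_karpMap.isInducing.tendsto_nhds_iff.mpr (Tendsto.prodMk_nhds ?_ ?_)
  · refine VelComp.tendsto_bdry (tendsto_pi_nhds.mpr fun a => ?_)
    simp only [KarpAt.toChamber_toVelComp]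
    exact hv a
  · exact tendsto_pi_nhds.mpr hs

lemma Place.embed_sat {F F' : FlagTuple m} (P : Place F F') (x : KarpAt F') :
    (P.embed x).sat = x.sat := by
  induction P with
  | here => rfl
  | step h ψ P ih => exact ih x

/-- A velocity coordinate that is decided at one of the levels above the fibre is constant along it;
the others are the coordinates inside the fibre. -/
lemma Place.tendsto_vel {F F' : FlagTuple m} (P : Place F F') {J : Type} {l : Filter J}
    {x : J → KarpAt F'} {y : KarpAt F'}
    (h : ∀ a : Part m, a.1 ≤ F'.part.1 → Tendsto (fun j => (x j).vel a) l (𝓝 (y.vel a)))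
    {a : Part m} (ha : a.1 ≤ F.part.1) :
    Tendsto (fun j => (P.embed (x j)).vel a) l (𝓝 ((P.embed y).vel a)) := by
  induction P with
  | here => exact h a ha
  | step hF ψ P ih =>
    rename_i F₁ F₂ F₃
    by_cases ha' : a.1 ≤ F₂.part.1
    · refine (ih h ha').congr' ?_ |>.trans ?_
      · exact Eventually.of_forall fun j => (KarpAt.vel_bdry_of_le hF ψ _ ha').symm
      · exact le_of_eq (congrArg _ (KarpAt.vel_bdry_of_le hF ψ _ ha').symm)
    · obtain ⟨ψ, rfl⟩ := ψ.exists_rep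
      have e : ∀ x : KarpAt F₃, ((Place.step hF ψ.cls P).embed x).vel a = a.pt ψ.fn 0 := fun x =>
        KarpAt.vel_bdry_of_not_le hF ψ _ ha ha'
      simp only [e]
      exact tendsto_const_nhds

/-- Convergence to a point at infinity in a boundary fibre. -/
lemma Place.tendsto_embed {F F' : FlagTuple m} (P : Place (FlagTuple.trivial m) F) {J : Type}
    {l : Filter J} {x : J → KarpAt F} (h : Refines F F') (ψ : Delta F F') (y : KarpAt F')
    (hv : ∀ a : Part m, a.1 ≤ F.part.1 →
      Tendsto (fun j => (x j).vel a) l (𝓝 ((KarpAt.bdry h ψ y).vel a)))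
    (hs : ∀ τ, Tendsto (fun j => (x j).sat τ) l (𝓝 (y.sat τ))) :
    Tendsto (fun j => P.embed (x j)) l (𝓝 (P.embed (KarpAt.bdry h ψ y))) := by
  have hv' := fun a : Part m => P.tendsto_vel hv a.le_trivial
  have hs' : ∀ τ, Tendsto (fun j => (P.embed (x j)).sat τ) l
      (𝓝 ((P.embed (KarpAt.bdry h ψ y)).sat τ)) := by
    intro τ
    simp only [Place.embed_sat]
    exact hs τ
  cases P with
  | here => exact tendsto_karp h ψ y hv' hs'
  | step h₁ ψ₁ P => exact tendsto_karp h₁ ψ₁ _ hv' hs'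

end KarpTopology

/-! ### Geodesics of the space of positive definite forms -/

section Geodesics

variable {V : Type} [AddCommGroup V] [Module ℝ V]

lemma differentiableAt_det {ι : Type} [Fintype ι] [DecidableEq ι] {M : ℝ → Matrix ι ι ℝ} {t : ℝ}
    (h : ∀ i j, DifferentiableAt ℝ (fun s => M s i j) t) :
    DifferentiableAt ℝ (fun s => (M s).det) t := by
  simp only [Matrix.det_apply']
  refine DifferentiableAt.fun_sum fun σ _ => DifferentiableAt.const_mul ?_ _
  exact DifferentiableAt.fun_finsetProd fun i _ => h _ _

/-- By Cramer's rule the solution is a quotient of determinants. It supplies the differentiability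
of `A = X⁻¹ X'`, which the geodesic equation does not postulate. -/
lemma differentiableAt_of_mulVec_eq {ι : Type} [Fintype ι] [DecidableEq ι]
    {M : ℝ → Matrix ι ι ℝ} {y d : ℝ → ι → ℝ} {t : ℝ}
    (hM : ∀ i j, DifferentiableAt ℝ (fun s => M s i j) t)
    (hy : ∀ i, DifferentiableAt ℝ (fun s => y s i) t) (hdet : ∀ s, (M s).det ≠ 0)
    (h : ∀ s, (M s).mulVec (d s) = y s) (i : ι) : DifferentiableAt ℝ (fun s => d s i) t := by
  have hd : ∀ s, d s i = ((M s).updateCol i (y s)).det / (M s).det := by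
    intro s
    rw [eq_div_iff (hdet s), ← Matrix.cramer_apply, Matrix.cramer_eq_adjugate_mulVec, ← h s,
      Matrix.mulVec_mulVec, Matrix.adjugate_mul, Matrix.smul_mulVec, Matrix.one_mulVec,
      Pi.smul_apply, smul_eq_mul, mul_comm]
  simp only [hd]
  refine DifferentiableAt.fun_div (differentiableAt_det fun j k => ?_)
    (differentiableAt_det hM) (hdet t)
  by_cases hk : k = i
  · subst hk
    simp only [Matrix.updateCol_self]
    exact hy j
  · simp only [Matrix.updateCol_ne hk]
    exact hM j k

lemma PosForm.eq_zero_of_basis {ι : Type} (P : PosForm V) (b : Module.Basis ι ℝ V)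
    {v : V} (h : ∀ i, P.bil (b i) v = 0) : v = 0 := by
  by_contra hv
  have h1 : ∀ w, P.bil w v = 0 := by
    intro w
    have : P.bil.flip v = 0 := b.ext fun i => h i
    exact LinearMap.congr_fun this w
  exact (P.pos hv).ne' (h1 v)

lemma PosForm.gram_det_ne_zero {ι : Type} [Fintype ι] [DecidableEq ι] (P : PosForm V)
    (b : Module.Basis ι ℝ V) : (Matrix.of fun i j => P.bil (b i) (b j)).det ≠ 0 := by
  intro h
  obtain ⟨x, hx, hx0⟩ := Matrix.exists_mulVec_eq_zero_iff.mpr h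
  have h1 : ∑ j, x j • b j = 0 := by
    refine P.eq_zero_of_basis b fun i => ?_
    rw [P.sum_right]
    have h2 := congrFun hx0 i
    simp only [Matrix.mulVec, dotProduct, Matrix.of_apply, Pi.zero_apply] at h2
    rw [← h2]
    exact Finset.sum_congr rfl fun j _ => by rw [P.smul_right, mul_comm]
  exact hx (funext fun j => Fintype.linearIndependent_iff.mp b.linearIndependent x h1 j)

/-- The operator `X⁻¹ X'` is constant along a geodesic. -/
lemma IsGeodesicForm.exists_operator [FiniteDimensional ℝ V] {X : ℝ → PosForm V}
    (h : IsGeodesicForm X) : ∃ A : V →ₗ[ℝ] V,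
      ∀ t v w, HasDerivAt (fun s => (X s).bil v w) ((X t).bil v (A w)) t := by
  obtain ⟨A, h1, h2⟩ := h
  have h1 : ∀ t v w, HasDerivAt (fun s => (X s).bil v w) ((X t).bil v (A t w)) t := h1
  have h2 : ∀ t v w, HasDerivAt (fun s => (X s).bil v (A s w)) ((X t).bil v (A t (A t w))) t := h2
  suffices hconst : ∀ t w, A t w = A 0 w from ⟨A 0, fun t v w => by
    rw [← hconst t w]; exact h1 t v w⟩
  set b := Module.finBasis ℝ V
  have hdiff : ∀ w i t, HasDerivAt (fun s => b.repr (A s w) i) 0 t := by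
    intro w i t
    have hd : ∀ i, DifferentiableAt ℝ (fun s => b.repr (A s w) i) t := by
      refine differentiableAt_of_mulVec_eq (M := fun s => Matrix.of fun i j =>
        (X s).bil (b i) (b j))
        (y := fun s i => (X s).bil (b i) (A s w)) (d := fun s => b.repr (A s w))
        (fun i j => (h1 t (b i) (b j)).differentiableAt)
        (fun i => (h2 t (b i) w).differentiableAt) (fun s => (X s).gram_det_ne_zero b) ?_
      intro s
      funext i
      change ∑ j, (X s).bil (b i) (b j) * b.repr (A s w) j = _
      conv_rhs => rw [← b.sum_repr (A s w), (X s).sum_right]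
      exact Finset.sum_congr rfl fun j _ => by rw [(X s).smul_right, mul_comm]
    set d' : Fin _ → ℝ := fun i => deriv (fun s => b.repr (A s w) i) t with hd'
    -- The product rule applied to `X(b i, A w)`, compared with the second equation, leaves `X(b i,
    -- A' w) = 0` for all `i`, and nondegeneracy gives `A' w = 0`.
    have hz : ∑ j, d' j • b j = 0 := by
      refine (X t).eq_zero_of_basis b fun i => ?_
      have h3 : HasDerivAt (fun s => ∑ j, b.repr (A s w) j * (X s).bil (b i) (b j))
          (∑ j, (d' j * (X t).bil (b i) (b j) +
            b.repr (A t w) j * (X t).bil (b i) (A t (b j)))) t :=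
        HasDerivAt.fun_sum fun j _ => (hd j).hasDerivAt.mul (h1 t (b i) (b j))
      have h4 : (fun s => ∑ j, b.repr (A s w) j * (X s).bil (b i) (b j)) =
          fun s => (X s).bil (b i) (A s w) := by
        funext s
        conv_rhs => rw [← b.sum_repr (A s w), (X s).sum_right]
        exact Finset.sum_congr rfl fun j _ => by rw [(X s).smul_right]
      rw [h4] at h3
      have h5 := h3.unique (h2 t (b i) w)
      have h6 : (X t).bil (b i) (A t (A t w)) =
          ∑ j, b.repr (A t w) j * (X t).bil (b i) (A t (b j)) := by
        conv_lhs => rw [← b.sum_repr (A t w), map_sum, (X t).sum_right]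
        exact Finset.sum_congr rfl fun j _ => by rw [map_smul, (X t).smul_right]
      rw [Finset.sum_add_distrib, h6, add_eq_right] at h5
      rw [(X t).sum_right, ← h5]
      exact Finset.sum_congr rfl fun j _ => by rw [(X t).smul_right]
    have h7 := Fintype.linearIndependent_iff.mp b.linearIndependent d' hz i
    rw [← h7]
    exact (hd i).hasDerivAt
  intro t w
  refine b.ext_elem fun i => ?_
  exact is_const_of_deriv_eq_zero (fun s => (hdiff w i s).differentiableAt)
    (fun s => (hdiff w i s).deriv) t 0

/-- The form `P` itself is taken as the inner product, for which `A` is symmetric, and the spectral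
theorem is applied. -/
lemma PosForm.exists_eigenbasis [FiniteDimensional ℝ V] (P : PosForm V) {A : V →ₗ[ℝ] V}
    (hA : ∀ v w, P.bil v (A w) = P.bil (A v) w) :
    ∃ (e : Module.Basis (Fin (Module.finrank ℝ V)) ℝ V) (φ : Fin (Module.finrank ℝ V) → ℝ),
      (∀ i, A (e i) = φ i • e i) ∧ ∀ v i, P.bil v (e i) = e.repr v i := by
  let core : InnerProductSpace.Core ℝ V :=
    { inner := fun v w => P.bil v w
      conj_inner_symm := fun v w => P.symm w v
      re_inner_nonneg := fun v => P.self_nonneg v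
      add_left := fun u v w => P.add_left u v w
      smul_left := fun v w a => P.smul_left a v w
      definite := fun v hv => by
        by_contra h
        exact (P.pos h).ne' hv }
  let : NormedAddCommGroup V := core.toNormedAddCommGroup
  let : InnerProductSpace ℝ V := InnerProductSpace.ofCore core.toCore
  have hs : A.IsSymmetric := fun v w => (hA v w).symm
  refine ⟨(hs.eigenvectorBasis rfl).toBasis, hs.eigenvalues rfl, fun i => ?_, fun v i => ?_⟩
  · rw [OrthonormalBasis.coe_toBasis]
    exact hs.apply_eigenvectorBasis rfl i
  · rw [OrthonormalBasis.coe_toBasis, OrthonormalBasis.coe_toBasis_repr_apply,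
      OrthonormalBasis.repr_apply_apply]
    exact P.symm _ _

/-- Canonical form of a geodesic. -/
lemma IsGeodesicForm.exists_canonical [FiniteDimensional ℝ V] {X : ℝ → PosForm V}
    (h : IsGeodesicForm X) :
    ∃ (e : Module.Basis (Fin (Module.finrank ℝ V)) ℝ V) (φ : Fin (Module.finrank ℝ V) → ℝ),
      ∀ t, X t = basisForm e fun i => φ i * t := by
  obtain ⟨A, hA⟩ := h.exists_operator
  -- Both sides are the derivative of the symmetric expression `X(v, w)`.
  have hs : ∀ v w, (X 0).bil v (A w) = (X 0).bil (A v) w := by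
    intro v w
    have h1 := hA 0 w v
    simp only [(X _).symm w] at h1
    exact (hA 0 v w).unique h1
  obtain ⟨e, φ, he, hr⟩ := (X 0).exists_eigenbasis hs
  refine ⟨e, φ, fun t => ?_⟩
  -- For an eigenvector `e i` the function `X(v, e i)` solves `y' = φ i y`.
  have key : ∀ v i t, (X t).bil v (e i) = Real.exp (φ i * t) * e.repr v i := by
    intro v i t
    have h1 : ∀ s, HasDerivAt (fun s => Real.exp (-(φ i * s)) * (X s).bil v (e i)) 0 s := by
      intro s
      have h2 := hA s v (e i)
      rw [he, (X s).smul_right] at h2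
      have h3 : HasDerivAt (fun s => Real.exp (-(φ i * s))) (Real.exp (-(φ i * s)) * (-φ i)) s := by
        refine HasDerivAt.exp ?_
        simpa using ((hasDerivAt_id' s).const_mul (φ i)).fun_neg
      exact (h3.fun_mul h2).congr_deriv (by ring)
    have h5 := is_const_of_deriv_eq_zero (fun s => (h1 s).differentiableAt)
      (fun s => (h1 s).deriv) t 0
    simp only [mul_zero, neg_zero, Real.exp_zero, one_mul] at h5
    rw [← hr, ← h5, ← mul_assoc, ← Real.exp_add, add_neg_cancel, Real.exp_zero, one_mul]
  rw [PosForm.ext_iff']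
  intro v w
  rw [basisForm_apply]
  conv_lhs => rw [← e.sum_repr w, (X t).sum_right]
  refine Finset.sum_congr rfl fun i _ => ?_
  rw [(X t).smul_right, key]
  ring

lemma isGeodesicForm_basisForm {ι : Type} [Fintype ι] (e : Module.Basis ι ℝ V) (φ : ι → ℝ) :
    IsGeodesicForm fun t => basisForm e fun i => φ i * t := by
  set A : V →ₗ[ℝ] V := e.constr ℝ fun i => φ i • e i with hA
  have hAr : ∀ w i, e.repr (A w) i = φ i * e.repr w i := by
    intro w i
    rw [hA, Module.Basis.constr_apply_fintype, map_sum, Finset.sum_apply']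
    simp only [map_smul, Finsupp.smul_apply, Module.Basis.repr_self, smul_eq_mul,
      Module.Basis.equivFun_apply]
    rw [Finset.sum_eq_single i]
    · rw [Finsupp.single_eq_same]
      ring
    · intro j _ hj
      rw [Finsupp.single_eq_of_ne (Ne.symm hj)]
      ring
    · exact fun h => absurd (Finset.mem_univ i) h
  have key : ∀ t v w, HasDerivAt (fun s => (basisForm e fun i => φ i * s).bil v w)
      ((basisForm e fun i => φ i * t).bil v (A w)) t := by
    intro t v w
    simp only [basisForm_apply, hAr]
    refine HasDerivAt.fun_sum fun i _ => ?_
    have h1 : HasDerivAt (fun s => Real.exp (φ i * s)) (Real.exp (φ i * t) * φ i) t := by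
      refine HasDerivAt.exp ?_
      simpa using (hasDerivAt_id t).const_mul (φ i)
    have h2 := (h1.mul_const (e.repr v i)).mul_const (e.repr w i)
    exact h2.congr_deriv (by ring)
  exact ⟨fun _ => A, key, fun t v w => key t v (A w)⟩

lemma hasCanonicalForm_iff {n : ℕ} {x : ℝ → PE V} {e : Module.Basis (Fin n) ℝ V}
    {φ : Fin n → ℝ} : HasCanonicalForm x e φ ↔ ∀ t, (basisForm e fun i => φ i * t).cls = x t := by
  refine forall_congr' fun t => ⟨?_, fun h => ⟨_, h, fun v w => basisForm_apply _ _ v w⟩⟩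
  rintro ⟨P, hP, h⟩
  rw [← hP]
  congr 1
  rw [PosForm.ext_iff']
  intro v w
  rw [basisForm_apply]
  exact (h v w).symm

end Geodesics

/-! ### Asymptotics of geodesics -/

section ExpSums

lemma tendsto_exp_mul_atTop_zero {a : ℝ} (ha : a < 0) :
    Tendsto (fun t : ℝ => Real.exp (a * t)) atTop (𝓝 0) :=
  Real.tendsto_exp_atBot.comp (tendsto_id.const_mul_atTop_of_neg ha)

lemma tendsto_expSum {ι : Type} [Fintype ι] {φ a : ι → ℝ} {r : ℝ} (h : ∀ i, r < φ i → a i = 0) :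
    Tendsto (fun t : ℝ => Real.exp (-(r * t)) * ∑ i, Real.exp (φ i * t) * a i) atTop
      (𝓝 (∑ i, if φ i = r then a i else 0)) := by
  have e : (fun t : ℝ => Real.exp (-(r * t)) * ∑ i, Real.exp (φ i * t) * a i) =
      fun t => ∑ i, Real.exp ((φ i - r) * t) * a i := by
    funext t
    rw [Finset.mul_sum]
    refine Finset.sum_congr rfl fun i _ => ?_
    rw [← mul_assoc, ← Real.exp_add]
    congr 2
    ring
  rw [e]
  refine tendsto_finsetSum _ fun i _ => ?_
  rcases lt_trichotomy (φ i) r with hi | hi | hi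
  · rw [if_neg hi.ne]
    have := (tendsto_exp_mul_atTop_zero (sub_neg.mpr hi)).mul_const (a i)
    rwa [zero_mul] at this
  · simp only [hi, sub_self, zero_mul, Real.exp_zero, one_mul, if_true]
    exact tendsto_const_nhds
  · simp only [h i hi, mul_zero, ite_self]
    exact tendsto_const_nhds

/-- Nonnegative terms cannot cancel, so one exponent above `r` would make the sum unbounded. -/
lemma eq_zero_of_tendsto_expSum {ι : Type} [Fintype ι] {φ a : ι → ℝ} {r L : ℝ} (ha : ∀ i, 0 ≤ a i)
    (h : Tendsto (fun t : ℝ => Real.exp (-(r * t)) * ∑ i, Real.exp (φ i * t) * a i) atTop (𝓝 L))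
    (i : ι) (hi : r < φ i) : a i = 0 := by
  by_contra hne
  have hpos : 0 < a i := lt_of_le_of_ne (ha i) (Ne.symm hne)
  have h1 : Tendsto (fun t : ℝ => Real.exp ((φ i - r) * t) * a i) atTop atTop :=
    (Real.tendsto_exp_atTop.comp (tendsto_id.const_mul_atTop (sub_pos.mpr hi))).atTop_mul_const hpos
  refine not_tendsto_nhds_of_tendsto_atTop (tendsto_atTop_mono (fun t => ?_) h1) L h
  have h2 : Real.exp (φ i * t) * a i ≤ ∑ i, Real.exp (φ i * t) * a i :=
    Finset.single_le_sum (f := fun i => Real.exp (φ i * t) * a i)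
      (fun i _ => mul_nonneg (Real.exp_pos _).le (ha i)) (Finset.mem_univ i)
  calc Real.exp ((φ i - r) * t) * a i = Real.exp (-(r * t)) * (Real.exp (φ i * t) * a i) := by
        rw [← mul_assoc, ← Real.exp_add]
        congr 2
        ring
    _ ≤ _ := mul_le_mul_of_nonneg_left h2 (Real.exp_pos _).le

end ExpSums

section Asymptotics

variable {n : ℕ} {F F' : PFlag (Sp n)} {ι : Cell F → Type}

/-- The coordinates of the image of a vector in a subquotient. -/
def coordAt (e : ∀ c : Cell F, Module.Basis (ι c) ℝ c.Gr) (c : Cell F) (i : ι c) :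
    Sp n →ₗ[ℝ] ℝ := (e c).coord i ∘ₗ c.quot

variable {e : ∀ c : Cell F, Module.Basis (ι c) ℝ c.Gr} {φ : ∀ c : Cell F, ι c → ℝ}

lemma coordAt_apply (c : Cell F) (i : ι c) (v : Sp n) :
    coordAt e c i v = (e c).repr (c.quot v) i := rfl

lemma coordAt_of_mem {c : Cell F} {v : Sp n} (hv : v ∈ c.hi) (i : ι c) :
    coordAt e c i v = (e c).repr (c.proj v hv) i := by
  rw [coordAt_apply, c.quot_of_mem hv]

lemma coordAt_lift (c : Cell F) (x : c.Gr) (i : ι c) :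
    coordAt e c i (c.lift x) = (e c).repr x i := by
  rw [coordAt_apply, c.quot_lift]

lemma coordAt_eq_zero {c : Cell F} {v : Sp n} (hv : v ∈ c.hi) :
    (∀ i, coordAt e c i v = 0) ↔ v ∈ c.lo := by
  rw [← c.proj_eq_zero hv]
  constructor
  · intro h
    refine (e c).ext_elem fun i => ?_
    rw [← coordAt_of_mem hv, h, map_zero, Finsupp.zero_apply]
  · intro h i
    rw [coordAt_of_mem hv, h, map_zero, Finsupp.zero_apply]

/-- The vectors whose exponents in the subquotient `c` lie in a given set. -/
def levelSpace (e : ∀ c : Cell F, Module.Basis (ι c) ℝ c.Gr)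
    (φ : ∀ c : Cell F, ι c → ℝ) (c : Cell F) (D : Set ℝ) : Submodule ℝ (Sp n) where
  carrier := {v | v ∈ c.hi ∧ ∀ i, φ c i ∉ D → coordAt e c i v = 0}
  zero_mem' := ⟨c.hi.zero_mem, fun i _ => map_zero _⟩
  add_mem' := fun hv hw => ⟨c.hi.add_mem hv.1 hw.1, fun i hi => by
    rw [map_add, hv.2 i hi, hw.2 i hi, add_zero]⟩
  smul_mem' := fun a v hv => ⟨c.hi.smul_mem a hv.1, fun i hi => by
    rw [map_smul, hv.2 i hi, smul_zero]⟩

lemma mem_levelSpace {c : Cell F} {D : Set ℝ} {v : Sp n} :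
    v ∈ levelSpace e φ c D ↔ v ∈ c.hi ∧ ∀ i, φ c i ∉ D → coordAt e c i v = 0 := Iff.rfl

lemma levelSpace_le_hi (c : Cell F) (D : Set ℝ) : levelSpace e φ c D ≤ c.hi := fun _ h => h.1

lemma lo_le_levelSpace (c : Cell F) (D : Set ℝ) : c.lo ≤ levelSpace e φ c D := fun _ h =>
  ⟨c.lt.le h, fun i _ => (coordAt_eq_zero (c.lt.le h)).mpr h i⟩

lemma levelSpace_mono (c : Cell F) {D D' : Set ℝ} (h : D ⊆ D') :
    levelSpace e φ c D ≤ levelSpace e φ c D' := fun _ hv =>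
  ⟨hv.1, fun i hi => hv.2 i fun h' => hi (h h')⟩

/-- The refinement of a flag by the levels of the exponents. -/
def growthFlag (e : ∀ c : Cell F, Module.Basis (ι c) ℝ c.Gr)
    (φ : ∀ c : Cell F, ι c → ℝ) : PFlag (Sp n) where
  carrier := F.carrier ∪ {W | ∃ c D, IsLowerSet D ∧ W = levelSpace e φ c D}
  chain := by
    have key : ∀ c D, ∀ W ∈ F.carrier, W ≤ levelSpace e φ c D ∨ levelSpace e φ c D ≤ W := by
      intro c D W hW
      rcases c.le_lo_or_hi_le hW with h | h
      · exact Or.inl (h.trans (lo_le_levelSpace c D))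
      · exact Or.inr ((levelSpace_le_hi c D).trans h)
    rintro A (hA | ⟨c, D, hD, rfl⟩) B (hB | ⟨c', D', hD', rfl⟩) hne
    · exact F.chain hA hB hne
    · exact key c' D' A hA
    · exact (key c D B hB).symm
    · rcases c.trichotomy c' with rfl | h | h
      · rcases hD.total hD' with h | h
        · exact Or.inl (levelSpace_mono c h)
        · exact Or.inr (levelSpace_mono c h)
      · exact Or.inl ((levelSpace_le_hi c D).trans (h.trans (lo_le_levelSpace c' D')))
      · exact Or.inr ((levelSpace_le_hi c' D').trans (h.trans (lo_le_levelSpace c D)))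
  bot_mem := Or.inl F.bot_mem
  top_mem := Or.inl F.top_mem

lemma subset_growthFlag : F.carrier ⊆ (growthFlag e φ).carrier := Set.subset_union_left

lemma levelSpace_mem {c : Cell F} {D : Set ℝ} (hD : IsLowerSet D) :
    levelSpace e φ c D ∈ (growthFlag e φ).carrier := Or.inr ⟨c, D, hD, rfl⟩

variable [∀ c, Fintype (ι c)]

/-- The boundary data given by numbers `ψ` and forms `Q` are the leading terms of the forms
diagonal in the bases `e` with the exponents `φ`. -/
structure IsAsymptotic (e : ∀ c : Cell F, Module.Basis (ι c) ℝ c.Gr)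
    (φ : ∀ c : Cell F, ι c → ℝ) (ψ : Cell F' → ℝ) (Q : ∀ d : Cell F', PosForm d.Gr) : Prop where
  vanish : ∀ {c : Cell F} {d : Cell F'}, d.Inside c → ∀ {v : Sp n}, v ∈ d.hi →
    ∀ i, ψ d < φ c i → coordAt e c i v = 0
  form : ∀ {c : Cell F} {d : Cell F'}, d.Inside c → ∀ {v w : Sp n} (hv : v ∈ d.hi) (hw : w ∈ d.hi),
    (Q d).bil (d.proj v hv) (d.proj w hw) =
      ∑ i, if φ c i = ψ d then coordAt e c i v * coordAt e c i w else 0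

lemma basisForm_proj {c : Cell F} {v w : Sp n} (hv : v ∈ c.hi) (hw : w ∈ c.hi) (t : ℝ) :
    (basisForm (e c) fun i => φ c i * t).bil (c.proj v hv) (c.proj w hw) =
      ∑ i, Real.exp (φ c i * t) * (coordAt e c i v * coordAt e c i w) := by
  rw [basisForm_apply]
  refine Finset.sum_congr rfl fun i _ => ?_
  rw [coordAt_of_mem hv, coordAt_of_mem hw, mul_assoc]

lemma IsAsymptotic.tendsto {ψ : Cell F' → ℝ} {Q : ∀ d : Cell F', PosForm d.Gr}
    (h : IsAsymptotic e φ ψ Q) {c : Cell F} {d : Cell F'} (hdc : d.Inside c) {v w : Sp n}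
    (hv : v ∈ d.hi) (hw : w ∈ d.hi) :
    Tendsto (fun t : ℝ => Real.exp (-(ψ d * t)) * (basisForm (e c) fun i => φ c i * t).bil
      (c.proj v (hdc.2 hv)) (c.proj w (hdc.2 hw))) atTop (𝓝
        ((Q d).bil (d.proj v hv) (d.proj w hw))) := by
  simp only [basisForm_proj]
  rw [h.form hdc hv hw]
  refine tendsto_expSum fun i hi => ?_
  rw [h.vanish hdc hv i hi, zero_mul]

/-- On the diagonal the coefficients are squares, so a finite limit excludes all larger exponents.
The form is then read off by uniqueness of limits. -/
lemma IsAsymptotic.of_tendsto {ψ : Cell F' → ℝ} {Q : ∀ d : Cell F', PosForm d.Gr}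
    (h : ∀ (c : Cell F) (d : Cell F') (hdc : d.Inside c) (v w : Sp n) (hv : v ∈ d.hi)
      (hw : w ∈ d.hi), Tendsto (fun t : ℝ => Real.exp (-(ψ d * t)) *
        (basisForm (e c) fun i => φ c i * t).bil (c.proj v (hdc.2 hv)) (c.proj w (hdc.2 hw))) atTop
        (𝓝 ((Q d).bil (d.proj v hv) (d.proj w hw)))) : IsAsymptotic e φ ψ Q := by
  have hvan : ∀ {c : Cell F} {d : Cell F'}, d.Inside c → ∀ {v : Sp n}, v ∈ d.hi →
      ∀ i, ψ d < φ c i → coordAt e c i v = 0 := by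
    intro c d hdc v hv i hi
    have h1 := h c d hdc v v hv hv
    simp only [basisForm_proj] at h1
    exact mul_self_eq_zero.mp (eq_zero_of_tendsto_expSum (fun i => mul_self_nonneg _) h1 i hi)
  refine ⟨hvan, fun {c d} hdc v w hv hw => ?_⟩
  have h1 := h c d hdc v w hv hw
  simp only [basisForm_proj] at h1
  refine tendsto_nhds_unique h1 (tendsto_expSum fun i hi => ?_)
  rw [hvan hdc hv i hi, zero_mul]

lemma IsAsymptotic.pos {ψ : Cell F' → ℝ} {Q : ∀ d : Cell F', PosForm d.Gr}
    (h : IsAsymptotic e φ ψ Q) {c : Cell F} {d : Cell F'} (hdc : d.Inside c) {v : Sp n}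
    (hv : v ∈ d.hi) (hv' : v ∉ d.lo) : ∃ i, φ c i = ψ d ∧ coordAt e c i v ≠ 0 := by
  by_contra hcon
  push Not at hcon
  have h1 := (Q d).pos (v := d.proj v hv) (fun h0 => hv' ((d.proj_eq_zero hv).mp h0))
  rw [h.form hdc hv hv] at h1
  refine h1.ne' (Finset.sum_eq_zero fun i _ => ?_)
  split_ifs with hi
  · rw [hcon i hi, zero_mul]
  · rfl

lemma IsAsymptotic.mem_lo {ψ : Cell F' → ℝ} {Q : ∀ d : Cell F', PosForm d.Gr}
    (h : IsAsymptotic e φ ψ Q) {c : Cell F} {d : Cell F'} (hdc : d.Inside c) {v : Sp n}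
    (hv : v ∈ d.lo) (i : ι c) (hi : ψ d ≤ φ c i) : coordAt e c i v = 0 := by
  have hv' : v ∈ d.hi := d.lt.le hv
  rcases hi.lt_or_eq with hi | hi
  · exact h.vanish hdc hv' i hi
  · have h1 := h.form hdc hv' hv'
    rw [(d.proj_eq_zero hv').mpr hv, map_zero] at h1
    have h2 := (Finset.sum_eq_zero_iff_of_nonneg (fun i _ => by
      split_ifs
      · exact mul_self_nonneg _
      · exact le_rfl)).mp h1.symm i (Finset.mem_univ i)
    rw [if_pos hi.symm] at h2
    exact mul_self_eq_zero.mp h2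

/-- A converse of `mem_lo`: a vector with only slower exponents has, in the cell of `F'` where it
lives, a nonzero coordinate at the velocity of that cell. Hence this velocity is smaller and the
cell lies below `d`. -/
lemma IsAsymptotic.mem_lo_of_coordAt (hF : F.carrier ⊆ F'.carrier) {ψ : Cell F' → ℝ}
    {Q : ∀ d : Cell F', PosForm d.Gr} (h : IsAsymptotic e φ ψ Q)
    (hψ : ∀ (c : Cell F) (d d' : Cell F'), d.Inside c → d'.Inside c → d.hi ≤ d'.lo → ψ d < ψ d')
    {c : Cell F} {d : Cell F'} (hdc : d.Inside c) {v : Sp n} (hv : v ∈ c.hi)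
    (h0 : ∀ i, ψ d ≤ φ c i → coordAt e c i v = 0) : v ∈ d.lo := by
  by_cases hlo : v ∈ c.lo
  · exact hdc.1 hlo
  · obtain ⟨d', hdc', h1, h2⟩ := Cell.exists_inside_mem hF c hv hlo
    obtain ⟨i, hi, hne⟩ := h.pos hdc' h1 h2
    have h3 : ψ d' < ψ d := by
      by_contra hcon
      exact hne (h0 i (by rw [hi]; exact not_lt.mp hcon))
    rcases d'.trichotomy d with h4 | h4 | h4
    · rw [h4] at h3
      exact absurd h3 (lt_irrefl _)
    · exact h4 h1
    · exact absurd (hψ c d d' hdc hdc' h4) h3.asymm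

/-- The velocity `r` is the greatest exponent of any vector of `d.hi` outside `d.lo`. The level
spaces `≤ r` and `< r` belong to the flag and enclose the cell. -/
lemma growthFlag_cell (d : Cell (growthFlag e φ)) : ∃ c : Cell F, d.Inside c ∧ ∃ r : ℝ,
    d.hi ≤ levelSpace e φ c (Set.Iic r) ∧ d.lo = levelSpace e φ c (Set.Iio r) ∧
      ∃ v ∈ d.hi, ∃ i, φ c i = r ∧ coordAt e c i v ≠ 0 := by
  obtain ⟨c, hdc⟩ := Cell.exists_inside subset_growthFlag d
  obtain ⟨v, hv, hv'⟩ := SetLike.exists_of_lt d.lt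
  have hvc : v ∈ c.hi := hdc.2 hv
  have hne : ∃ i, coordAt e c i v ≠ 0 := by
    by_contra hcon
    push Not at hcon
    exact hv' (hdc.1 ((coordAt_eq_zero hvc).mp hcon))
  obtain ⟨i₀, hi₀⟩ := hne
  obtain ⟨i, hi, hmax⟩ := Finset.exists_max_image (Finset.univ.filter fun i => coordAt e c i v ≠ 0)
    (φ c) ⟨i₀, by simpa using hi₀⟩
  have hi : coordAt e c i v ≠ 0 := by simpa using hi
  have hmax : ∀ k, coordAt e c k v ≠ 0 → φ c k ≤ φ c i := fun k hk => hmax k (by simpa using hk)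
  refine ⟨c, hdc, φ c i, ?_, le_antisymm ?_ ?_, v, hv, i, rfl, hi⟩
  · refine (d.le_lo_or_hi_le (levelSpace_mem (isLowerSet_Iic _))).resolve_left fun h => hv' (h ?_)
    refine ⟨hvc, fun k hk => ?_⟩
    by_contra hcon
    exact hk (hmax k hcon)
  · have hnot : ¬ c.hi ≤ d.lo := fun h => d.not_hi_le_lo (hdc.2.trans h)
    rcases d.lo_mem with h | ⟨c', D, hD, h⟩
    · exact ((c.le_lo_or_hi_le h).resolve_right hnot).trans (lo_le_levelSpace _ _)
    · rcases c.trichotomy c' with rfl | h' | h'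
      · rw [h]
        refine levelSpace_mono c fun x hx => ?_
        by_contra hcon
        have hD' : φ c i ∈ D := hD (not_lt.mp hcon) hx
        refine hv' ?_
        rw [h]
        refine ⟨hvc, fun k hk => ?_⟩
        by_contra hk'
        exact hk (hD (hmax k hk') hD')
      · exact absurd (h'.trans ((lo_le_levelSpace c' D).trans h.ge)) hnot
      · exact h.le.trans ((levelSpace_le_hi c' D).trans (h'.trans (lo_le_levelSpace _ _)))
  · refine (d.le_lo_or_hi_le (levelSpace_mem (isLowerSet_Iio _))).resolve_right fun h => ?_
    exact hi ((h hv).2 i fun h' => lt_irrefl _ (Set.mem_Iio.mp h'))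

/-- The leading form on a subquotient. -/
lemma exists_leadingForm {d : Cell F'} {c : Cell F} {r : ℝ}
    (hlo : ∀ v ∈ d.hi, v ∈ d.lo ↔ ∀ i, φ c i = r → coordAt e c i v = 0) :
    ∃ Q : PosForm d.Gr, ∀ v w (hv : v ∈ d.hi) (hw : w ∈ d.hi),
      Q.bil (d.proj v hv) (d.proj w hw) =
        ∑ i, if φ c i = r then coordAt e c i v * coordAt e c i w else 0 := by
  classical
  -- The coordinates with exponent `r`, the others being replaced by zero. By `hlo` they are
  -- injective on the subquotient, and the leading form is the pull-back of the standard one.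
  set T : d.Gr →ₗ[ℝ] (ι c → ℝ) :=
    LinearMap.pi fun i => (if φ c i = r then (1 : ℝ) else 0) • (coordAt e c i ∘ₗ d.lift) with hT
  have hTa : ∀ x i, T x i = if φ c i = r then coordAt e c i (d.lift x) else 0 := by
    intro x i
    simp only [hT, LinearMap.pi_apply, LinearMap.smul_apply, LinearMap.comp_apply, smul_eq_mul,
      ite_mul, one_mul, zero_mul]
  have hTi : Function.Injective T := by
    rw [← LinearMap.ker_eq_bot, LinearMap.ker_eq_bot']
    intro x hx
    rw [← d.proj_lift x, d.proj_eq_zero, hlo _ (d.lift_mem_hi x)]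
    intro i hi
    have h1 := congrFun hx i
    rwa [hTa, if_pos hi] at h1
  have hlp : ∀ v (hv : v ∈ d.hi) i, φ c i = r →
      coordAt e c i (d.lift (d.proj v hv)) = coordAt e c i v := by
    intro v hv i hi
    have h1 : d.lift (d.proj v hv) - v ∈ d.lo := by
      rw [← d.proj_eq (d.lift_mem_hi _) hv, d.proj_lift]
    have h2 := (hlo _ (d.lt.le h1)).mp h1 i hi
    rwa [map_sub, sub_eq_zero] at h2
  refine ⟨(basisForm (Pi.basisFun ℝ (ι c)) fun _ => 0).pull T hTi, fun v w hv hw => ?_⟩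
  rw [PosForm.pull_apply, basisForm_apply]
  refine Finset.sum_congr rfl fun i _ => ?_
  rw [Pi.basisFun_repr, Pi.basisFun_repr, hTa, hTa, Real.exp_zero, one_mul]
  split_ifs with hi
  · rw [hlp v hv i hi, hlp w hw i hi]
  · rw [zero_mul]

/-- Existence of leading terms. -/
lemma exists_isAsymptotic (e : ∀ c : Cell F, Module.Basis (ι c) ℝ c.Gr)
    (φ : ∀ c : Cell F, ι c → ℝ) :
    ∃ (F' : PFlag (Sp n)) (ψ : Cell F' → ℝ) (Q : ∀ d : Cell F', PosForm d.Gr),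
      F.carrier ⊆ F'.carrier ∧
      (∀ (c : Cell F) (d d' : Cell F'), d.Inside c → d'.Inside c → d.hi ≤ d'.lo → ψ d < ψ d') ∧
      IsAsymptotic e φ ψ Q ∧
      ∀ c i k, φ c i ≠ φ c k → ¬ F'.carrier ⊆ F.carrier := by
  choose C hC ψ hhi hlo v hv i hi hne using fun d : Cell (growthFlag e φ) => growthFlag_cell d
  have hQ : ∀ d : Cell (growthFlag e φ), ∃ Q : PosForm d.Gr, ∀ v w (hv : v ∈ d.hi) (hw : w ∈ d.hi),
      Q.bil (d.proj v hv) (d.proj w hw) =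
        ∑ i, if φ (C d) i = ψ d then coordAt e (C d) i v * coordAt e (C d) i w else 0 := by
    intro d
    refine exists_leadingForm fun v hv => ?_
    rw [hlo, mem_levelSpace]
    have hv' := hhi d hv
    constructor
    · intro h i hi
      exact h.2 i fun h' => (Set.mem_Iio.mp h').ne hi
    · intro h
      refine ⟨hv'.1, fun i hi => ?_⟩
      rcases (not_lt.mp fun h' => hi (Set.mem_Iio.mpr h')).lt_or_eq with h1 | h1
      · exact hv'.2 i (not_le.mpr h1)
      · exact h i h1.symm
  choose Q hQ using hQ
  have hCu : ∀ c d, d.Inside c → c = C d := fun c d hdc => hdc.unique (hC d)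
  refine ⟨growthFlag e φ, ψ, Q, subset_growthFlag, ?_, ⟨?_, ?_⟩, ?_⟩
  · intro c d d' hd hd' hdd'
    obtain rfl := hCu c d hd
    have h1 := hdd' (hv d)
    rw [hlo d', ← hCu _ d' hd'] at h1
    by_contra hcon
    refine hne d (h1.2 (i d) fun h2 => hcon ?_)
    rw [hi d] at h2
    exact h2
  · intro c d hdc v hv i hi
    obtain rfl := hCu c d hdc
    exact (hhi d hv).2 i (not_le.mpr hi)
  · intro c d hdc v w hv hw
    obtain rfl := hCu c d hdc
    exact hQ d v w hv hw
  -- With two different exponents in `c`, the level space at the smaller one contains the first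
  -- basis vector but not the second, so it is a new member strictly inside the cell.
  · have key : ∀ c i k, φ c i < φ c k → ¬ (growthFlag e φ).carrier ⊆ F.carrier := by
      intro c i k hik hsub
      have hmem := hsub (levelSpace_mem (e := e) (φ := φ) (c := c) (isLowerSet_Iic (φ c i)))
      rcases c.le_lo_or_hi_le hmem with h | h
      · have h1 : c.lift (e c i) ∈ levelSpace e φ c (Set.Iic (φ c i)) := by
          refine ⟨c.lift_mem_hi _, fun j hj => ?_⟩
          rw [coordAt_lift, Module.Basis.repr_self, Finsupp.single_eq_of_ne]
          rintro rfl
          exact hj (Set.mem_Iic.mpr le_rfl)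
        have h2 := (coordAt_eq_zero (e := e) (c.lift_mem_hi _)).mpr (h h1) i
        rw [coordAt_lift, Module.Basis.repr_self, Finsupp.single_eq_same] at h2
        exact one_ne_zero h2
      · have h2 := (h (c.lift_mem_hi (e c k))).2 k (not_le.mpr hik)
        rw [coordAt_lift, Module.Basis.repr_self, Finsupp.single_eq_same] at h2
        exact one_ne_zero h2
    intro c i k hik
    rcases hik.lt_or_gt with h | h
    · exact key c i k h
    · exact key c k i h

end Asymptotics

/-! ### Limits of geodesics -/

section FrameBasis

variable {n : ℕ} {F F' : PFlag (Sp n)}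

instance (c : Cell F) : Fintype {i // c.Has i} := Fintype.ofFinite _

/-- The basis of a subquotient given by an adapted frame and by scalar factors. -/
def Adapted.basis {u : Frame n} (h : Adapted u F) (f : Fin n → ℝ) (c : Cell F) :
    Module.Basis {i // c.Has i} ℝ c.Gr :=
  Module.Basis.ofEquivFun
    { toFun := fun x i => Real.exp (f i / 2) * inner ℝ (u i) (c.lift x)
      map_add' := fun x y => by
        funext i
        rw [map_add, inner_add_right, mul_add]
        rfl
      map_smul' := fun a x => by
        funext i
        rw [map_smul, inner_smul_right, RingHom.id_apply, Pi.smul_apply, smul_eq_mul]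
        ring
      invFun := fun a => ∑ i, (a i * Real.exp (-(f i / 2))) • c.quot (u i)
      left_inv := fun x => by
        apply c.lift_injective
        rw [map_sum]
        have h1 : ∀ i : {i // c.Has i}, c.lift ((Real.exp (f i / 2) * inner ℝ (u i) (c.lift x) *
            Real.exp (-(f i / 2))) • c.quot (u i)) = inner ℝ (u i) (c.lift x) • u i := by
          intro i
          rw [map_smul, c.quot_of_mem (h.mem_hi i.2), h.lift_proj_frame i.2, mul_right_comm,
            ← Real.exp_add, add_neg_cancel, Real.exp_zero, one_mul]
        simp only [h1]
        conv_rhs => rw [← u.sum_repr' (c.lift x)]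
        classical
        rw [← Finset.sum_subtype (Finset.univ.filter fun i => c.Has i) (by simp)
          (fun i => inner ℝ (u i) (c.lift x) • u i)]
        refine Finset.sum_subset (Finset.subset_univ _) fun i _ hi => ?_
        rw [h.inner_lift_eq_zero (by simpa using hi), zero_smul]
      right_inv := fun a => by
        funext k
        change Real.exp (f k / 2) * inner ℝ (u k)
          (c.lift (∑ i, (a i * Real.exp (-(f i / 2))) • c.quot (u i))) = a k
        rw [map_sum, inner_sum, Finset.sum_eq_single k]
        · rw [map_smul, inner_smul_right, c.quot_of_mem (h.mem_hi k.2), h.lift_proj_frame k.2,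
            Frame.inner_eq, if_pos rfl, mul_one, mul_comm, mul_assoc, ← Real.exp_add,
            neg_add_cancel, Real.exp_zero, mul_one]
        · intro i _ hik
          rw [map_smul, inner_smul_right, c.quot_of_mem (h.mem_hi i.2), h.lift_proj_frame i.2,
            Frame.inner_eq, if_neg fun e => hik (Subtype.ext e.symm), mul_zero]
        · exact fun h => absurd (Finset.mem_univ k) h }

lemma Adapted.basis_repr {u : Frame n} (h : Adapted u F) (f : Fin n → ℝ) (c : Cell F)
    (x : c.Gr) (i : {i // c.Has i}) :
    (h.basis f c).repr x i = Real.exp (f i / 2) * inner ℝ (u i) (c.lift x) := by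
  rw [← Module.Basis.equivFun_apply, Adapted.basis, Module.Basis.equivFun_ofEquivFun]
  rfl

lemma Adapted.coordAt_basis {u : Frame n} (h : Adapted u F) (f : Fin n → ℝ) {c : Cell F}
    {v : Sp n} (hv : v ∈ c.hi) (i : {i // c.Has i}) :
    coordAt (h.basis f) c i v = Real.exp (f i / 2) * inner ℝ (u i) v := by
  rw [coordAt_of_mem hv, h.basis_repr, h.inner_lift_proj i.2]

/-- Realises prescribed boundary data: each vector of an adapted frame gets as exponent the velocity
of its cell. Strict monotonicity ensures that, inside `c`, the exponent `ψ d` occurs only at the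
indices of `d`. -/
lemma Adapted.isAsymptotic {u : Frame n} (h : Adapted u F') (hF : F.carrier ⊆ F'.carrier)
    (f : Fin n → ℝ) {ψ : Cell F' → ℝ}
    (hψ : ∀ (c : Cell F) (d d' : Cell F'), d.Inside c → d'.Inside c → d.hi ≤ d'.lo → ψ d < ψ d') :
    IsAsymptotic ((h.mono hF).basis f) (fun _ i => ψ (F'.cellOf i)) ψ
      fun d => (diagForm u f).pull d.lift d.lift_injective := by
  have hin : ∀ (c : Cell F) (i : {i // c.Has i}), (F'.cellOf i).Inside c := fun c i =>
    Cell.inside_of_has hF (F'.cellOf_has _) i.2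
  refine ⟨?_, ?_⟩
  · intro c d hdc v hv i hi
    rw [Adapted.coordAt_basis _ _ (hdc.2 hv)]
    rcases d.trichotomy (F'.cellOf i) with h1 | h1 | h1
    · rw [← h1] at hi
      exact absurd hi (lt_irrefl _)
    · rw [Submodule.inner_left_of_mem_orthogonal (h1 hv) (h.mem_orth (F'.cellOf_has i)), mul_zero]
    · exact absurd (hψ c _ _ (hin c i) hdc h1) hi.asymm
  · intro c d hdc v w hv hw
    rw [PosForm.pull_apply, diagForm_apply]
    simp only [Adapted.coordAt_basis _ _ (hdc.2 hv), Adapted.coordAt_basis _ _ (hdc.2 hw)]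
    classical
    rw [← Finset.sum_subtype (Finset.univ.filter fun i => c.Has i) (by simp)
      (fun i => if ψ (F'.cellOf i) = ψ d then
        (Real.exp (f i / 2) * inner ℝ (u i) v) * (Real.exp (f i / 2) * inner ℝ (u i) w) else 0)]
    rw [Finset.sum_filter]
    refine Finset.sum_congr rfl fun i _ => ?_
    by_cases hd : d.Has i
    · have he : Real.exp (f i) = Real.exp (f i / 2) * Real.exp (f i / 2) := by
        rw [← Real.exp_add, add_halves]
      rw [if_pos (hd.of_inside hdc), Cell.has_iff.mp hd, if_pos rfl, h.inner_lift_proj hd,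
        h.inner_lift_proj hd, he]
      ring
    · rw [h.inner_lift_eq_zero hd, mul_zero, zero_mul]
      split_ifs with hc hi
      · exfalso
        rcases d.trichotomy (F'.cellOf i) with h1 | h1 | h1
        · exact hd (Cell.has_iff.mpr h1.symm)
        · exact (hψ c _ _ hdc (hin c ⟨i, hc⟩) h1).ne' hi
        · exact (hψ c _ _ (hin c ⟨i, hc⟩) hdc h1).ne hi
      · rfl
      · rfl

end FrameBasis

section Limits

variable {β : ℕ} {m : Fin β → ℕ} {F : FlagTuple m}

lemma basisForm_cls_eq {V : Type} [AddCommGroup V] [Module ℝ V] {ι : Type} [Fintype ι]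
    {e : Module.Basis ι ℝ V} {f g : ι → ℝ} :
    (basisForm e f).cls = (basisForm e g).cls ↔ ∃ r, ∀ i, g i = r + f i := by
  classical
  rw [PosForm.cls_eq]
  simp only [basisForm_apply]
  constructor
  · rintro ⟨a, ha, h⟩
    refine ⟨Real.log a, fun i => ?_⟩
    have h1 := h (e i) (e i)
    simp only [Module.Basis.repr_self, Finsupp.single_apply, mul_ite, mul_one, mul_zero,
      Finset.sum_ite_eq, Finset.mem_univ, if_true] at h1
    rw [← Real.exp_injective.eq_iff, h1, Real.exp_add, Real.exp_log ha]
  · rintro ⟨r, h⟩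
    refine ⟨Real.exp r, Real.exp_pos r, fun v w => ?_⟩
    rw [Finset.mul_sum]
    refine Finset.sum_congr rfl fun i _ => ?_
    rw [h i, Real.exp_add]
    ring

variable {ι : ∀ τ, Cell (F τ) → Type} [∀ τ c, Fintype (ι τ c)]
  {e : ∀ τ c, Module.Basis (ι τ c) ℝ c.Gr} {φ : ∀ τ c, ι τ c → ℝ}

lemma IsGeodesic.exists_ne {γ : ℝ → Fiber F} (hγ : IsGeodesic γ)
    (h : ∀ t τ c, (basisForm (e τ c) fun i => φ τ c i * t).cls = γ t τ c) :
    ∃ τ c i k, φ τ c i ≠ φ τ c k := by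
  by_contra hcon
  push Not at hcon
  refine hγ.2 fun t => ?_
  funext τ c
  rw [← h, ← h, basisForm_cls_eq]
  rcases isEmpty_or_nonempty (ι τ c) with h0 | ⟨⟨i₀⟩⟩
  · exact ⟨0, fun i => isEmptyElim i⟩
  · refine ⟨-(φ τ c i₀ * t), fun i => ?_⟩
    rw [hcon τ c i i₀]
    ring

lemma isGeodesic_of_canonical {γ : ℝ → Fiber F}
    (h : ∀ t τ c, (basisForm (e τ c) fun i => φ τ c i * t).cls = γ t τ c)
    (hne : ∃ τ c i k, φ τ c i ≠ φ τ c k) : IsGeodesic γ := by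
  refine ⟨fun τ c => ⟨_, isGeodesicForm_basisForm (e τ c) (φ τ c), fun t => h t τ c⟩,
    fun hcon => ?_⟩
  obtain ⟨τ, c, i, k, hik⟩ := hne
  have h1 := congrFun (congrFun (hcon 1) τ) c
  rw [← h, ← h, basisForm_cls_eq] at h1
  obtain ⟨r, hr⟩ := h1
  have h2 := hr i
  have h3 := hr k
  exact hik (by linarith)

lemma isGeodesicLimit_of_isAsymptotic {γ : ℝ → Fiber F}
    (h : ∀ t τ c, (basisForm (e τ c) fun i => φ τ c i * t).cls = γ t τ c) {p : BoundaryData F}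
    {ψ : Velocity F p.flag} {Q : ∀ τ, ∀ d : Cell (p.flag τ), PosForm d.Gr} (hψ : ψ.cls = p.vel)
    (hQ : ∀ τ d, (Q τ d).cls = p.forms τ d)
    (has : ∀ τ, IsAsymptotic (e τ) (φ τ) (ψ.1 τ) (Q τ)) : IsGeodesicLimit γ p :=
  ⟨fun τ c t => basisForm (e τ c) fun i => φ τ c i * t, ψ, Q,
    fun τ c => isGeodesicForm_basisForm (e τ c) (φ τ c), fun τ c t => h t τ c, hψ, hQ,
    fun τ _ _ hdc _ _ hv hw => (has τ).tendsto hdc hv hw⟩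

lemma exists_boundaryData (e : ∀ τ c, Module.Basis (ι τ c) ℝ c.Gr) (φ : ∀ τ c, ι τ c → ℝ)
    (hne : ∃ τ c i k, φ τ c i ≠ φ τ c k) :
    ∃ (F' : FlagTuple m) (_ : Refines F F') (ψ : Velocity F F')
      (Q : ∀ τ, ∀ d : Cell (F' τ), PosForm d.Gr),
      ∀ τ, IsAsymptotic (e τ) (φ τ) (ψ.1 τ) (Q τ) := by
  choose F' ψ Q hF hψ has hnot using fun τ => exists_isAsymptotic (e τ) (φ τ)
  obtain ⟨τ, c, i, k, hik⟩ := hne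
  exact ⟨F', ⟨hF, τ, hnot τ c i k hik⟩, ⟨ψ, hψ⟩, Q, has⟩

lemma exists_canonical_of_forms {X : ∀ τ, ∀ c : Cell (F τ), ℝ → PosForm c.Gr}
    (hX : ∀ τ c, IsGeodesicForm (X τ c)) :
    ∃ (e : ∀ τ, ∀ c : Cell (F τ), Module.Basis (Fin (Module.finrank ℝ c.Gr)) ℝ c.Gr)
      (φ : ∀ τ, ∀ c : Cell (F τ), Fin (Module.finrank ℝ c.Gr) → ℝ),
      ∀ τ c t, X τ c t = basisForm (e τ c) fun i => φ τ c i * t := by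
  choose e φ h using fun τ c => (hX τ c).exists_canonical
  exact ⟨e, φ, h⟩

/-- Every geodesic has boundary data. -/
lemma IsGeodesic.exists_limit {γ : ℝ → Fiber F} (hγ : IsGeodesic γ) :
    ∃ p, IsGeodesicLimit γ p := by
  choose X hX hXγ using hγ.1
  obtain ⟨e, φ, h⟩ := exists_canonical_of_forms hX
  have hc : ∀ t τ c, (basisForm (e τ c) fun i => φ τ c i * t).cls = γ t τ c := fun t τ c => by
    rw [← h]
    exact hXγ τ c t
  obtain ⟨F', hF, ψ, Q, has⟩ := exists_boundaryData e φ (hγ.exists_ne hc)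
  exact ⟨⟨F', hF, ψ.cls, fun τ d => (Q τ d).cls⟩,
    isGeodesicLimit_of_isAsymptotic hc rfl (fun _ _ => rfl) has⟩

/-- Leading terms of a geodesic with given boundary data. -/
lemma IsGeodesicLimit.exists_isAsymptotic {γ : ℝ → Fiber F} {p : BoundaryData F}
    (h : IsGeodesicLimit γ p) :
    ∃ (e : ∀ τ, ∀ c : Cell (F τ), Module.Basis (Fin (Module.finrank ℝ c.Gr)) ℝ c.Gr)
      (φ : ∀ τ, ∀ c : Cell (F τ), Fin (Module.finrank ℝ c.Gr) → ℝ) (ψ : Velocity F p.flag)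
      (Q : ∀ τ, ∀ d : Cell (p.flag τ), PosForm d.Gr),
      (∀ t τ c, (basisForm (e τ c) fun i => φ τ c i * t).cls = γ t τ c) ∧ ψ.cls = p.vel ∧
      (∀ τ d, (Q τ d).cls = p.forms τ d) ∧ ∀ τ, IsAsymptotic (e τ) (φ τ) (ψ.1 τ) (Q τ) := by
  obtain ⟨X, ψ, Q, hX, hXγ, hψ, hQ, hlim⟩ := h
  obtain ⟨e, φ, h⟩ := exists_canonical_of_forms hX
  refine ⟨e, φ, ψ, Q, fun t τ c => by rw [← h]; exact hXγ τ c t, hψ, hQ, fun τ => ?_⟩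
  refine IsAsymptotic.of_tendsto fun c d hdc v w hv hw => ?_
  have h1 := hlim τ c d hdc v w hv hw
  simp only [h] at h1
  exact h1

/-- All boundary data occur. -/
lemma BoundaryData.exists_geodesic (p : BoundaryData F) :
    ∃ γ : ℝ → Fiber F, IsGeodesic γ ∧ IsGeodesicLimit γ p := by
  obtain ⟨ψ, hψ⟩ := p.vel.exists_rep
  have hs := Fiber.isSpectral p.forms
  have had : ∀ τ, Adapted (Fiber.frame p.forms τ) (p.flag τ) := fun τ => (hs τ).adapted
  set f : ∀ τ, Fin (m τ) → ℝ := fun τ i => Fiber.exps p.forms ⟨τ, i⟩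
  set e : ∀ τ, ∀ c : Cell (F τ), Module.Basis {i // c.Has i} ℝ c.Gr := fun τ =>
    ((had τ).mono (p.refines.1 τ)).basis (f τ)
  set φ : ∀ τ, ∀ c : Cell (F τ), {i // c.Has i} → ℝ := fun τ _ i => ψ.1 τ ((p.flag τ).cellOf i)
  refine ⟨fun t τ c => (basisForm (e τ c) fun i => φ τ c i * t).cls, ?_, ?_⟩
  · refine isGeodesic_of_canonical (fun _ _ _ => rfl) ?_
    by_contra hcon
    push Not at hcon
    refine p.refines.not_part_le fun x y hxy => ?_
    rw [← ψ.fn_eq_iff p.refines hxy]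
    obtain ⟨τ, i⟩ := x
    obtain ⟨σ, k⟩ := y
    obtain rfl : τ = σ := F.part.2 hxy
    have hik := FlagTuple.part_rel.mp hxy
    exact hcon τ ((F τ).cellOf i) ⟨i, (F τ).cellOf_has i⟩
      ⟨k, by rw [PFlag.rel_def.mp hik]; exact (F τ).cellOf_has k⟩
  · exact isGeodesicLimit_of_isAsymptotic (fun _ _ _ => rfl) hψ (fun τ d => (hs τ).form d)
      fun τ => (had τ).isAsymptotic (p.refines.1 τ) (f τ) (ψ.2 τ)

end Limits

/-! ### Solvable pencils -/

section LinearAlgebra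

variable {V : Type} [AddCommGroup V] [Module ℝ V] {ι : Type}

lemma repr_eq_zero_of_mem_span {f : Module.Basis ι ℝ V} {φ : ι → ℝ} {i : ι} {x : V}
    (hx : x ∈ Submodule.span ℝ (f '' {j | φ j < φ i})) : f.repr x i = 0 := by
  by_contra h
  have h1 : φ i < φ i := f.mem_span_image.mp hx (Finsupp.mem_support_iff.mpr h)
  exact lt_irrefl _ h1

variable [Fintype ι]

lemma Basis.finrank_span_image (b : Module.Basis ι ℝ V) (S : Set ι) :
    Module.finrank ℝ (Submodule.span ℝ (b '' S)) = S.ncard := by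
  classical
  have hli : LinearIndependent ℝ (fun x : S => b x) :=
    b.linearIndependent.comp _ Subtype.val_injective
  have := finrank_span_eq_card hli
  rw [← Nat.card_eq_fintype_card, Nat.card_coe_set_eq] at this
  rw [← this, Set.image_eq_range]

/-- Triangularity gives one inclusion, and the dimensions agree because both families are bases. -/
lemma pencil_span_eq {e f : Module.Basis ι ℝ V} {φ : ι → ℝ} {s : ℝ → ℝ}
    (h : ∀ i, f i - s (φ i) • e i ∈ Submodule.span ℝ (e '' {j | φ j < φ i})) (r : ℝ) :
    Submodule.span ℝ (f '' {j | φ j < r}) = Submodule.span ℝ (e '' {j | φ j < r}) := by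
  have : FiniteDimensional ℝ V := e.finiteDimensional_of_finite
  refine Submodule.eq_of_le_of_finrank_eq ?_ ?_
  · rw [Submodule.span_le]
    rintro _ ⟨i, hi, rfl⟩
    have hi : φ i < r := hi
    have h1 := Submodule.span_mono (Set.image_mono fun j (hj : φ j < φ i) => hj.trans hi) (h i)
    have h2 := Submodule.smul_mem _ (s (φ i))
      (Submodule.subset_span (Set.mem_image_of_mem e (show i ∈ {j | φ j < r} from hi)) :
        e i ∈ Submodule.span ℝ (e '' {j | φ j < r}))
    have h3 := Submodule.add_mem _ h1 h2
    rwa [sub_add_cancel] at h3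
  · rw [Basis.finrank_span_image, Basis.finrank_span_image]

/-- Coordinates in two bases that differ by a block triangular matrix with scalar diagonal
blocks. -/
lemma pencil_repr {e f : Module.Basis ι ℝ V} {φ : ι → ℝ} {s : ℝ → ℝ}
    (h : ∀ i, f i - s (φ i) • e i ∈ Submodule.span ℝ (e '' {j | φ j < φ i})) :
    (∀ i, s (φ i) ≠ 0) ∧ ∀ v r, (∀ j, r < φ j → e.repr v j = 0) →
      (∀ i, r < φ i → f.repr v i = 0) ∧ ∀ i, φ i = r → f.repr v i = (s r)⁻¹ * e.repr v i := by
  classical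
  -- A vanishing factor would put `f i` in the span of the `f j` with smaller exponents.
  have hs : ∀ i, s (φ i) ≠ 0 := by
    intro i h0
    have h1 := h i
    rw [h0, zero_smul, sub_zero, ← pencil_span_eq h] at h1
    have h2 := repr_eq_zero_of_mem_span h1
    rw [Module.Basis.repr_self, Finsupp.single_eq_same] at h2
    exact one_ne_zero h2
  have hlt : ∀ i j, φ j < φ i → f.repr (e j) i = 0 := by
    intro i j hij
    have h1 : e j ∈ Submodule.span ℝ (e '' {j | φ j < φ i}) :=
      Submodule.subset_span (Set.mem_image_of_mem e hij)
    rw [← pencil_span_eq h] at h1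
    exact repr_eq_zero_of_mem_span h1
  have heq : ∀ i j, φ j = φ i → f.repr (e j) i = if j = i then (s (φ i))⁻¹ else 0 := by
    intro i j hij
    have h1 := h j
    rw [← pencil_span_eq h, hij] at h1
    have h2 := repr_eq_zero_of_mem_span h1
    rw [map_sub, map_smul, Finsupp.sub_apply, Finsupp.smul_apply, Module.Basis.repr_self,
      Finsupp.single_apply, smul_eq_mul, sub_eq_zero] at h2
    rw [eq_comm, ← mul_right_inj' (hs i), ← h2]
    split_ifs with hji
    · exact mul_inv_cancel₀ (hs i)
    · exact mul_zero _
  refine ⟨hs, fun v r hv => ?_⟩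
  have hexp : ∀ i, f.repr v i = ∑ j, e.repr v j * f.repr (e j) i := by
    intro i
    conv_lhs => rw [← e.sum_repr v]
    rw [map_sum, Finset.sum_apply']
    simp only [map_smul, Finsupp.smul_apply, smul_eq_mul]
  refine ⟨fun i hi => ?_, fun i hi => ?_⟩
  · rw [hexp]
    refine Finset.sum_eq_zero fun j _ => ?_
    rcases lt_or_ge r (φ j) with hj | hj
    · rw [hv j hj, zero_mul]
    · rw [hlt i j (hj.trans_lt hi), mul_zero]
  · rw [hexp, Finset.sum_eq_single i]
    · rw [heq i i rfl, if_pos rfl, hi, mul_comm]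
    · intro j _ hji
      rcases lt_trichotomy (φ j) r with hj | hj | hj
      · rw [hlt i j (by rw [hi]; exact hj), mul_zero]
      · rw [heq i j (by rw [hi, hj]), if_neg hji, mul_zero]
      · rw [hv j hj, zero_mul]
    · exact fun h => absurd (Finset.mem_univ i) h

/-- A change of basis orthogonal inside the blocks of equal exponents. -/
lemma exists_basis_of_orthonormal [DecidableEq ι] {e' : Module.Basis ι ℝ V} {φ' θ : ι → ℝ}
    {g : ι → V}
    (hg : ∀ i k, ∑ j, e'.repr (g i) j * e'.repr (g k) j = if i = k then 1 else 0)
    (hθ : ∀ i j, e'.repr (g i) j ≠ 0 → φ' j = θ i) :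
    ∃ f : Module.Basis ι ℝ V, (∀ i, f i = g i) ∧
      ∀ t : ℝ, basisForm e' (fun i => φ' i * t) = basisForm f fun i => θ i * t := by
  have hli : LinearIndependent ℝ g := by
    rw [Fintype.linearIndependent_iff]
    intro x hx k
    have h1 : ∑ j, e'.repr (∑ i, x i • g i) j * e'.repr (g k) j = x k := by
      have h2 : ∀ j, e'.repr (∑ i, x i • g i) j * e'.repr (g k) j =
          ∑ i, x i * (e'.repr (g i) j * e'.repr (g k) j) := by
        intro j
        rw [map_sum, Finset.sum_apply', Finset.sum_mul]
        simp only [map_smul, Finsupp.smul_apply, smul_eq_mul, mul_assoc]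
      simp only [h2]
      rw [Finset.sum_comm]
      simp only [← Finset.mul_sum, hg, mul_ite, mul_one, mul_zero, Finset.sum_ite_eq',
        Finset.mem_univ, if_true]
    rw [← h1, hx]
    exact Finset.sum_eq_zero fun j _ => by rw [map_zero, Finsupp.zero_apply, zero_mul]
  have : FiniteDimensional ℝ V := e'.finiteDimensional_of_finite
  have hspan := hli.span_eq_top_of_card_eq_finrank' (Module.finrank_eq_card_basis e').symm
  set f := Module.Basis.mk hli hspan.ge with hf
  have hfg : ∀ i, f i = g i := fun i => Module.Basis.mk_apply _ _ i
  refine ⟨f, hfg, fun t => ?_⟩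
  rw [PosForm.ext_iff']
  have key : (basisForm e' fun i => φ' i * t).bil = (basisForm f fun i => θ i * t).bil := by
    refine f.ext fun i => f.ext fun k => ?_
    rw [basisForm_apply, basisForm_apply]
    simp only [Module.Basis.repr_self, Finsupp.single_apply]
    rw [hfg, hfg]
    have h1 : ∀ j, Real.exp (φ' j * t) * e'.repr (g i) j * e'.repr (g k) j =
        Real.exp (θ i * t) * (e'.repr (g i) j * e'.repr (g k) j) := by
      intro j
      by_cases h0 : e'.repr (g i) j = 0
      · rw [h0]
        ring
      · rw [hθ i j h0, mul_assoc]
    simp only [h1]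
    rw [← Finset.mul_sum, hg]
    simp only [mul_ite, mul_one, mul_zero, Finset.sum_ite_eq, Finset.mem_univ, if_true]
    split_ifs with h2
    · rw [h2]
    · rfl
  intro v w
  rw [key]

end LinearAlgebra

section Pencil

variable {n : ℕ} {F F' : PFlag (Sp n)} {ι : Cell F → Type} [∀ c, Fintype (ι c)]
  {e : ∀ c : Cell F, Module.Basis (ι c) ℝ c.Gr} {φ : ∀ c : Cell F, ι c → ℝ}

/-- The change of basis divides the leading coordinates of a cell by one scalar `s`, so the leading
form is divided by its square and its class is unchanged; the reparametrisation multiplies the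
velocities by `a`. -/
lemma IsAsymptotic.pencil (hF : F.carrier ⊆ F'.carrier) {ψ : Cell F' → ℝ}
    {Q : ∀ d : Cell F', PosForm d.Gr} (h : IsAsymptotic e φ ψ Q)
    {f : ∀ c : Cell F, Module.Basis (ι c) ℝ c.Gr} {s : Cell F → ℝ → ℝ} {a : ℝ} (ha : 0 < a)
    (hs : ∀ c i, f c i - s c (φ c i) • e c i ∈
      Submodule.span ℝ (e c '' {j | φ c j < φ c i})) :
    ∃ Q' : ∀ d : Cell F', PosForm d.Gr, (∀ d, (Q' d).cls = (Q d).cls) ∧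
      IsAsymptotic f (fun c i => a * φ c i) (fun d => a * ψ d) Q' := by
  choose C hC using fun d : Cell F' => Cell.exists_inside hF d
  have hs0 : ∀ d, s (C d) (ψ d) ≠ 0 := by
    intro d
    obtain ⟨v, hv, hv'⟩ := SetLike.exists_of_lt d.lt
    obtain ⟨i, hi, -⟩ := h.pos (hC d) hv hv'
    rw [← hi]
    exact (pencil_repr (hs (C d))).1 i
  have hκ : ∀ d, 0 < ((s (C d) (ψ d))⁻¹) ^ 2 := fun d => by
    have := hs0 d
    positivity
  have hrepr : ∀ {c : Cell F} {d : Cell F'}, d.Inside c → ∀ {v : Sp n}, v ∈ d.hi →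
      (∀ i, ψ d < φ c i → coordAt f c i v = 0) ∧
        ∀ i, φ c i = ψ d → coordAt f c i v = (s c (ψ d))⁻¹ * coordAt e c i v := fun hdc _ hv =>
    (pencil_repr (hs _)).2 _ _ fun j hj => h.vanish hdc hv j hj
  refine ⟨fun d => (Q d).scale _ (hκ d), fun d => PosForm.scale_cls _ _ _, ⟨?_, ?_⟩⟩
  · intro c d hdc v hv i hi
    exact (hrepr hdc hv).1 i (lt_of_mul_lt_mul_left hi ha.le)
  · intro c d hdc v w hv hw
    obtain rfl := (hC d).unique hdc
    rw [PosForm.scale_apply, h.form hdc hv hw, Finset.mul_sum]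
    refine Finset.sum_congr rfl fun i _ => ?_
    by_cases hi : φ (C d) i = ψ d
    · rw [if_pos hi, if_pos (by rw [hi]), (hrepr hdc hv).2 i hi, (hrepr hdc hw).2 i hi]
      ring
    · rw [if_neg hi, if_neg fun e => hi (mul_left_cancel₀ ha.ne' e), mul_zero]

lemma IsAsymptotic.exists_cell [∀ c, DecidableEq (ι c)] (hF : F.carrier ⊆ F'.carrier)
    {ψ : Cell F' → ℝ}
    {Q : ∀ d : Cell F', PosForm d.Gr} (h : IsAsymptotic e φ ψ Q) (c : Cell F) (i : ι c) :
    ∃ d : Cell F', d.Inside c ∧ c.lift (e c i) ∈ d.hi ∧ φ c i = ψ d := by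
  have hcoord : ∀ k, coordAt e c k (c.lift (e c i)) = if i = k then 1 else 0 := fun k => by
    rw [coordAt_lift, Module.Basis.repr_self, Finsupp.single_apply]
  have hlo : c.lift (e c i) ∉ c.lo := by
    rw [← coordAt_eq_zero (e := e) (c.lift_mem_hi _)]
    intro h0
    have h1 := h0 i
    rw [hcoord, if_pos rfl] at h1
    exact one_ne_zero h1
  obtain ⟨d, hdc, h1, h2⟩ := Cell.exists_inside_mem hF c (c.lift_mem_hi (e c i)) hlo
  obtain ⟨k, hk, hne⟩ := h.pos hdc h1 h2
  refine ⟨d, hdc, h1, ?_⟩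
  rw [hcoord] at hne
  by_cases hik : i = k
  · rw [hik, hk]
  · rw [if_neg hik] at hne
    exact absurd rfl hne

/-- Two families of forms with proportional leading terms lie in one solvable pencil. -/
lemma IsAsymptotic.exists_pencil [∀ c, DecidableEq (ι c)] (hF : F.carrier ⊆ F'.carrier)
    {ψ ψ' : Cell F' → ℝ} {Q Q' : ∀ d : Cell F', PosForm d.Gr} (h : IsAsymptotic e φ ψ Q)
    {e' : ∀ c : Cell F, Module.Basis (ι c) ℝ c.Gr} {φ' : ∀ c : Cell F, ι c → ℝ}
    (h' : IsAsymptotic e' φ' ψ' Q')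
    (hψ : ∀ (c : Cell F) (d d' : Cell F'), d.Inside c → d'.Inside c → d.hi ≤ d'.lo → ψ d < ψ d')
    {a : ℝ} (ha : 0 < a) {b : Cell F → ℝ}
    (hψ' : ∀ (c : Cell F) (d : Cell F'), d.Inside c → ψ' d = a * ψ d + b c)
    (hQ : ∀ d, (Q d).cls = (Q' d).cls) (c : Cell F) :
    ∃ (f : Module.Basis (ι c) ℝ c.Gr) (s : ℝ → ℝ),
      (∀ t, (basisForm f fun i => a * φ c i * t).cls = (basisForm (e' c) fun i => φ' c i * t).cls) ∧
      ∀ i, f i - s (φ c i) • e c i ∈ Submodule.span ℝ (e c '' {j | φ c j < φ c i}) := by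
  have hQ := fun d => PosForm.cls_eq.mp (hQ d)
  choose κ hκ hQ using hQ
  choose D hDc hDv hφ using fun i => h.exists_cell hF c i
  have hinj : ∀ d d' : Cell F', d.Inside c → d'.Inside c → ψ d = ψ d' → d = d' := by
    intro d d' hd hd' he
    rcases d.trichotomy d' with h1 | h1 | h1
    · exact h1
    · exact absurd he (hψ c d d' hd hd' h1).ne
    · exact absurd he (hψ c d' d hd' hd h1).ne'
  have hinj' : ∀ i k, ψ' (D i) = ψ' (D k) → D i = D k := by
    intro i k hik
    rw [hψ' c _ (hDc i), hψ' c _ (hDc k), add_left_inj, mul_right_inj' ha.ne'] at hik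
    exact hinj _ _ (hDc i) (hDc k) hik
  have hstr' : ∀ (c : Cell F) (d d' : Cell F'), d.Inside c → d'.Inside c → d.hi ≤ d'.lo →
      ψ' d < ψ' d' := by
    intro c d d' hd hd' hdd'
    rw [hψ' c d hd, hψ' c d' hd']
    have := mul_lt_mul_of_pos_left (hψ c d d' hd hd' hdd') ha
    linarith
  have hsq : ∀ d, (√(κ d))⁻¹ * (√(κ d))⁻¹ = (κ d)⁻¹ := fun d => by
    rw [← mul_inv, Real.mul_self_sqrt (hκ d).le]
  -- `y i` is the leading part of `e i` in the basis `e'`. As the leading forms agree up to the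
  -- factor `κ`, the vectors `y i / √κ` are orthonormal in the coordinates of `e'` and form the
  -- required basis.
  set y : ι c → c.Gr := fun i =>
    ∑ j, (if φ' c j = ψ' (D i) then (e' c).repr (e c i) j else 0) • e' c j with hy
  have hyr : ∀ i j, (e' c).repr (y i) j =
      if φ' c j = ψ' (D i) then (e' c).repr (e c i) j else 0 := by
    intro i j
    rw [hy]
    simp only
    rw [(e' c).repr_sum_self]
  set g : ι c → c.Gr := fun i => (√(κ (D i)))⁻¹ • y i with hg
  have hgr : ∀ i j, (e' c).repr (g i) j =
      (√(κ (D i)))⁻¹ * if φ' c j = ψ' (D i) then (e' c).repr (e c i) j else 0 := by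
    intro i j
    rw [hg]
    simp only
    rw [map_smul, Finsupp.smul_apply, smul_eq_mul, hyr]
  obtain ⟨f, hf, hform⟩ := exists_basis_of_orthonormal (e' := e' c) (φ' := φ' c)
    (θ := fun i => ψ' (D i)) (g := g) (by
      intro i k
      simp only [hgr]
      by_cases hD : D i = D k
      · have hvk : c.lift (e c k) ∈ (D i).hi := by
          rw [hD]
          exact hDv k
        have h1 := h'.form (hDc i) (hDv i) hvk
        rw [hQ, h.form (hDc i) (hDv i) hvk] at h1
        simp only [coordAt_lift] at h1
        have h2 : (∑ l, if φ c l = ψ (D i) then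
            (e c).repr (e c i) l * (e c).repr (e c k) l else 0) =
            if i = k then 1 else 0 := by
          simp only [Module.Basis.repr_self, Finsupp.single_apply]
          rw [Finset.sum_eq_single i]
          · rw [if_pos (hφ i), if_pos rfl, one_mul]
            exact if_congr eq_comm rfl rfl
          · intro l _ hl
            rw [if_neg (Ne.symm hl), zero_mul, ite_self]
          · exact fun h => absurd (Finset.mem_univ i) h
        rw [h2] at h1
        have h3 : ∀ j, ((√(κ (D i)))⁻¹ * if φ' c j = ψ' (D i) then (e' c).repr (e c i) j else 0) *
            ((√(κ (D k)))⁻¹ * if φ' c j = ψ' (D k) then (e' c).repr (e c k) j else 0) =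
            (κ (D i))⁻¹ * if φ' c j = ψ' (D i) then
              (e' c).repr (e c i) j * (e' c).repr (e c k) j else 0 := by
          intro j
          rw [← hD, ← hsq]
          split_ifs
          · ring
          · ring
        simp only [h3]
        rw [← Finset.mul_sum, ← h1, ← mul_assoc, inv_mul_cancel₀ (hκ _).ne', one_mul]
      · rw [if_neg fun e => hD (by rw [e])]
        refine Finset.sum_eq_zero fun j _ => ?_
        by_cases h1 : φ' c j = ψ' (D i)
        · rw [if_neg (c := φ' c j = ψ' (D k)) fun h2 => hD (hinj' i k (h1.symm.trans h2)), mul_zero,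
            mul_zero]
        · rw [if_neg h1, mul_zero, zero_mul])
    (by
      intro i j hne
      by_contra h1
      rw [hgr, if_neg h1, mul_zero] at hne
      exact hne rfl)
  classical
  -- The factor is a function of the exponent alone because, inside `c`, different cells have
  -- different velocities. The value off the spectrum is irrelevant.
  set s : ℝ → ℝ := fun r => if hr : ∃ i, φ c i = r then (√(κ (D hr.choose)))⁻¹ else 0 with hs
  have hsi : ∀ i, s (φ c i) = (√(κ (D i)))⁻¹ := by
    intro i
    have hr : ∃ k, φ c k = φ c i := ⟨i, rfl⟩
    rw [hs]
    simp only
    rw [dif_pos hr, hinj (D hr.choose) (D i) (hDc _) (hDc _)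
      (by rw [← hφ, ← hφ]; exact hr.choose_spec)]
  refine ⟨f, s, fun t => ?_, fun i => ?_⟩
  · rw [hform t, basisForm_cls_eq]
    refine ⟨b c * t, fun i => ?_⟩
    rw [hψ' c _ (hDc i), hφ i]
    ring
  · set x : c.Gr := e c i - y i with hx
    have h1 : f i - s (φ c i) • e c i = -(s (φ c i)) • x := by
      rw [hf, hsi, hx, hg]
      simp only
      module
    rw [h1]
    refine Submodule.smul_mem _ _ ((e c).mem_span_image.mpr fun k hk => ?_)
    by_contra hcon
    refine Finsupp.mem_support_iff.mp hk ?_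
    rw [← coordAt_lift]
    -- The remainder `x` has in the basis `e'` only exponents below the velocity of the cell, so it
    -- lies in `(D i).lo`; a vector there has in the basis `e` only exponents below `φ c i`.
    refine h.mem_lo (hDc i) ?_ k (by rw [← hφ]; exact not_lt.mp hcon)
    refine h'.mem_lo_of_coordAt hF hstr' (hDc i) (c.lift_mem_hi x) fun j hj => ?_
    rw [coordAt_lift, hx, map_sub, Finsupp.sub_apply, hyr]
    rcases hj.lt_or_eq with hj | hj
    · rw [if_neg hj.ne', sub_zero, ← coordAt_lift (e := e')]
      exact h'.vanish (hDc i) (hDv i) j hj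
    · rw [if_pos hj.symm, sub_self]

end Pencil

section PencilLimits

variable {β : ℕ} {m : Fin β → ℕ} {F : FlagTuple m}

/-- A velocity multiplied by a positive number. -/
def Velocity.smul {F F' : FlagTuple m} (ψ : Velocity F F') (a : ℝ) (ha : 0 < a) :
    Velocity F F' :=
  ⟨fun τ d => a * ψ.1 τ d, fun τ c d d' hd hd' h =>
    mul_lt_mul_of_pos_left (ψ.2 τ c d d' hd hd' h) ha⟩

lemma Velocity.smul_cls {F F' : FlagTuple m} (ψ : Velocity F F') {a : ℝ} (ha : 0 < a) :
    (ψ.smul a ha).cls = ψ.cls :=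
  (Quotient.sound ⟨a, fun _ _ => 0, ha, fun _ _ _ _ => (add_zero _).symm⟩ : ψ.cls = _).symm

/-- Solvable pencils are the classes of geodesics with the same boundary data. -/
lemma sameSolvablePencil_iff {γ μ : ℝ → Fiber F} (hγ : IsGeodesic γ) :
    SameSolvablePencil γ μ ↔ ∃ p, IsGeodesicLimit γ p ∧ IsGeodesicLimit μ p := by
  constructor
  · rintro ⟨a, ha, h⟩
    choose n e f φ s hγc hμc hs using h
    have h1 : ∀ t τ c, (basisForm (e τ c) fun i => φ τ c i * t).cls = γ t τ c := fun t τ c =>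
      hasCanonicalForm_iff.mp (hγc τ c) t
    have h2 : ∀ t τ c, (basisForm (f τ c) fun i => a * φ τ c i * t).cls = μ t τ c := fun t τ c =>
      hasCanonicalForm_iff.mp (hμc τ c) t
    obtain ⟨F', hF, ψ, Q, has⟩ := exists_boundaryData e φ (hγ.exists_ne h1)
    choose Q' hQ' has' using fun τ => (has τ).pencil (hF.1 τ) ha (hs τ)
    exact ⟨⟨F', hF, ψ.cls, fun τ d => (Q τ d).cls⟩,
      isGeodesicLimit_of_isAsymptotic h1 rfl (fun _ _ => rfl) has,
      isGeodesicLimit_of_isAsymptotic (ψ := ψ.smul a ha) h2 (ψ.smul_cls ha) hQ' has'⟩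
  · rintro ⟨p, hγp, hμp⟩
    obtain ⟨e, φ, ψ, Q, h1, hψ, hQ, has⟩ := hγp.exists_isAsymptotic
    obtain ⟨e', φ', ψ', Q', h1', hψ', hQ', has'⟩ := hμp.exists_isAsymptotic
    obtain ⟨a, b, ha, hab⟩ := Quotient.exact (hψ.trans hψ'.symm)
    refine ⟨a, ha, fun τ c => ?_⟩
    obtain ⟨f, s, hf, hs⟩ := (has τ).exists_pencil (p.refines.1 τ) (has' τ) (ψ.2 τ) ha
      (fun c d hdc => hab τ c d hdc) (fun d => (hQ τ d).trans (hQ' τ d).symm) c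
    exact ⟨_, e τ c, f, φ τ c, s, hasCanonicalForm_iff.mpr fun t => h1 t τ c,
      hasCanonicalForm_iff.mpr fun t => (hf t).trans (h1' t τ c), hs⟩

end PencilLimits

/-! ### Convergence of geodesics -/

section Convergence

variable {n : ℕ} {F F' : PFlag (Sp n)}

/-- The point of the Satake compactification given by forms on the subquotients of a flag. -/
abbrev satakeOf (Q : ∀ c : Cell F, PosForm c.Gr) : Satake n := ⟨F, fun c => (Q c).cls⟩

lemma Adapted.pull_diagForm_apply {u : Frame n} (h : Adapted u F) (f : Fin n → ℝ) {c : Cell F}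
    (x y : c.Gr) (g : Fin n → ℝ) {a : ℝ}
    (hfg : ∀ i, c.Has i → Real.exp (f i) = a * Real.exp (g i)) :
    ((diagForm u f).pull c.lift c.lift_injective).bil x y =
      a * ((diagForm u g).pull c.lift c.lift_injective).bil x y := by
  rw [PosForm.pull_apply, PosForm.pull_apply, diagForm_apply, diagForm_apply, Finset.mul_sum]
  refine Finset.sum_congr rfl fun i _ => ?_
  by_cases hi : c.Has i
  · rw [hfg i hi]
    ring
  · rw [h.inner_lift_eq_zero hi]
    ring

/-- Simultaneous diagonalization of given forms on the subquotients. -/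
lemma exists_isSpectral_forms (Q : ∀ c : Cell F, PosForm c.Gr) :
    ∃ u f, IsSpectral u f (satakeOf Q) ∧
      ∀ c, (diagForm u f).pull c.lift c.lift_injective = Q c := by
  obtain ⟨u, f, h⟩ := exists_isSpectral (satakeOf Q)
  have had : Adapted u F := h.adapted
  choose κ hκ hQ using fun c : Cell F => PosForm.cls_eq.mp (h.form c)
  -- A shift of the exponents by a constant in each cell turns equality of classes into equality of
  -- forms.
  set g : Fin n → ℝ := fun i => f i + Real.log (κ (F.cellOf i)) with hg
  have hgf : ∀ (c : Cell F) i, c.Has i → Real.exp (g i) = κ c * Real.exp (f i) := by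
    intro c i hi
    have hi' : F.cellOf i = c := Cell.has_iff.mp hi
    rw [hg]
    simp only
    rw [hi', Real.exp_add, Real.exp_log (hκ c), mul_comm]
  have hform : ∀ c : Cell F, (diagForm u g).pull c.lift c.lift_injective = Q c := fun c => by
    rw [PosForm.ext_iff']
    intro x y
    rw [had.pull_diagForm_apply g x y f (hgf c), hQ c]
  refine ⟨u, g, ⟨had, fun i k hle hik => ?_, fun c => ?_⟩, hform⟩
  · have hik' : F.cellOf i = F.cellOf k := PFlag.rel_def.mp hik
    have := h.anti i k hle hik
    rw [hg]
    simp only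
    rw [hik']
    linarith
  · exact congrArg PosForm.cls (hform c)

variable {ι : Cell F → Type} [∀ c, Fintype (ι c)]
  {e : ∀ c : Cell F, Module.Basis (ι c) ℝ c.Gr} {φ : ∀ c : Cell F, ι c → ℝ}

/-- A product of coordinates from two cells involves only exponents up to the smaller velocity,
which is less than the mean of the two velocities. These are the off-diagonal entries in the
asymptotic theorem. -/
lemma IsAsymptotic.tendsto_of_ne {ψ : Cell F' → ℝ} {Q : ∀ d : Cell F', PosForm d.Gr}
    (h : IsAsymptotic e φ ψ Q)
    (hψ : ∀ (c : Cell F) (d d' : Cell F'), d.Inside c → d'.Inside c → d.hi ≤ d'.lo → ψ d < ψ d')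
    {c : Cell F} {d d' : Cell F'} (hd : d.Inside c) (hd' : d'.Inside c) (hne : d ≠ d') {v w : Sp n}
    (hv : v ∈ d.hi) (hw : w ∈ d'.hi) :
    Tendsto (fun t : ℝ => Real.exp (-((ψ d + ψ d') / 2 * t)) *
      (basisForm (e c) fun i => φ c i * t).bil (c.proj v (hd.2 hv)) (c.proj w (hd'.2 hw)))
      atTop (𝓝 0) := by
  simp only [basisForm_proj]
  have hlt : ψ d ≠ ψ d' := by
    rcases d.trichotomy d' with h1 | h1 | h1
    · exact absurd h1 hne
    · exact (hψ c d d' hd hd' h1).ne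
    · exact (hψ c d' d hd' hd h1).ne'
  have key : ∀ i, (ψ d + ψ d') / 2 ≤ φ c i → coordAt e c i v * coordAt e c i w = 0 := by
    intro i hi
    rcases hlt.lt_or_gt with h1 | h1
    · rw [h.vanish hd hv i (by linarith), zero_mul]
    · rw [h.vanish hd' hw i (by linarith), mul_zero]
  have h1 := tendsto_expSum (φ := φ c) (a := fun i => coordAt e c i v * coordAt e c i w)
    (r := (ψ d + ψ d') / 2) fun i hi => key i hi.le
  rwa [Finset.sum_eq_zero fun i _ => by
    split_ifs with hi
    · exact key i hi.ge
    · rfl] at h1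

/-- Convergence of forms to their leading terms. -/
lemma IsAsymptotic.tendsto_satake (hF : F.carrier ⊆ F'.carrier) {ψ : Cell F' → ℝ}
    {Q : ∀ d : Cell F', PosForm d.Gr} (h : IsAsymptotic e φ ψ Q)
    (hψ : ∀ (c : Cell F) (d d' : Cell F'), d.Inside c → d'.Inside c → d.hi ≤ d'.lo → ψ d < ψ d') :
    ∃ (w : ℝ → Frame n) (g : ℝ → Fin n → ℝ) (u : Frame n) (f : Fin n → ℝ),
      (∀ t, IsSpectral (w t) (g t)
        (satakeOf fun c => basisForm (e c) fun i => φ c i * t)) ∧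
      IsSpectral u f (satakeOf Q) ∧
      (∀ i, Tendsto (fun t => g t i - ψ (F'.cellOf i) * t) atTop (𝓝 (f i))) ∧
      Tendsto (fun t => (satakeOf fun c => basisForm (e c) fun i => φ c i * t)) atTop
        (𝓝 (satakeOf Q)) := by
  choose w g hw hwX using fun t : ℝ => exists_isSpectral_forms
    fun c : Cell F => basisForm (e c) fun i => φ c i * t
  obtain ⟨u, f, hu, huQ⟩ := exists_isSpectral_forms Q
  have hwa : ∀ t, Adapted (w t) F := fun t => (hw t).adapted
  have hua : Adapted u F' := hu.adapted
  have hua' : Adapted u F := hua.mono hF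
  have hfX : ∀ t (c : Cell F) (i k : Fin n) (hi : c.Has i) (hk : c.Has k),
      (diagForm (w t) (g t)).bil (u i) (u k) = (basisForm (e c) fun i => φ c i * t).bil
        (c.proj (u i) (hua'.mem_hi hi)) (c.proj (u k) (hua'.mem_hi hk)) := by
    intro t c i k hi hk
    rw [← hwX t c, PosForm.pull_apply, hua'.lift_proj_frame hi, hua'.lift_proj_frame hk]
  -- The forms preserve the blocks of `F`, and the blocks of `F'` are those of equal growth with
  -- shifts `ψ t`. The spectral frame `u` of the limiting forms serves as a constant comparison
  -- frame.
  obtain ⟨h1, h2, h3⟩ := tendsto_spectral (l := atTop) (S := F.rel) (T := F'.rel) (w := w)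
    (w' := fun _ => u) (u := u) (g := g) (b := fun t i => ψ (F'.cellOf i) * t) (f := f)
    (fun t i => (hwa t).span_eq hua' i) (fun t i k hle hik => (hw t).anti i k hle hik)
    (fun i k hle hik => hu.anti i k hle hik)
    (fun t i k hik => by rw [PFlag.rel_def.mp hik])
    (fun i k hle hik hik' => by
      have h4 : ψ (F'.cellOf k) < ψ (F'.cellOf i) := by
        refine hψ (F.cellOf i) _ _ ?_ (PFlag.cellOf_inside hF i) ?_
        · rw [PFlag.rel_def.mp hik]
          exact PFlag.cellOf_inside hF k
        · exact Cell.hi_le_lo_of_lt (fun e => hik' (PFlag.rel_def.mpr e.symm)) (F'.cellOf_has i)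
            (F'.cellOf_has k) hle
      simp only [← sub_mul]
      exact tendsto_id.const_mul_atTop (sub_pos.mpr h4))
    (fun i => tendsto_const_nhds)
    (fun i k => by
      have hexp : ∀ t : ℝ, -(ψ (F'.cellOf i) * t + ψ (F'.cellOf k) * t) / 2 =
          -((ψ (F'.cellOf i) + ψ (F'.cellOf k)) / 2 * t) := fun t => by ring
      simp only [hexp]
      have hid := F'.cellOf_has i
      have hkd := F'.cellOf_has k
      by_cases hik : F.rel i k
      · have hic := F.cellOf_has i
        have hkc : (F.cellOf i).Has k := by
          rw [PFlag.rel_def.mp hik]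
          exact F.cellOf_has k
        have hin := Cell.inside_of_has hF hid hic
        have hin' := Cell.inside_of_has hF hkd hkc
        simp only [hfX _ _ i k hic hkc]
        by_cases hd : F'.cellOf i = F'.cellOf k
        · have hkd' : (F'.cellOf i).Has k := by
            rw [hd]
            exact hkd
          have h5 := h.tendsto hin (hua.mem_hi hid) (hua.mem_hi hkd')
          rw [← hd]
          simp only [add_self_div_two]
          rw [← huQ, PosForm.pull_apply, hua.lift_proj_frame hid, hua.lift_proj_frame hkd',
            diagForm_frame] at h5
          exact h5
        · rw [if_neg fun e => hd (by rw [e])]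
          exact h.tendsto_of_ne hψ hin hin' hd (hua.mem_hi hid) (hua.mem_hi hkd)
      · have h0 : ∀ t, (diagForm (w t) (g t)).bil (u i) (u k) = 0 := by
          intro t
          rw [diagForm_apply]
          refine Finset.sum_eq_zero fun j _ => ?_
          by_cases hj : F.rel j i
          · rw [(hwa t).inner_frame_eq_zero hua' fun hjk =>
              hik (F.rel.trans (F.rel.symm hj) hjk), mul_zero]
          · rw [(hwa t).inner_frame_eq_zero hua' hj, mul_zero, zero_mul]
        simp only [h0, mul_zero]
        rw [if_neg fun e => hik (by rw [e])]
        exact tendsto_const_nhds)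
  refine ⟨w, g, u, f, hw, hu, h1, Karpelevich.tendsto_satake hw hu (fun i k => ?_) h3⟩
  by_cases hik : F.rel i k
  · refine (h2 i k hik).congr fun t => ?_
    exact (ratioOf_of_rel hik _).symm
  · have h0 : ∀ t, ratioOf F.rel (g t) i k = 0 := fun t => by
      by_contra hne
      exact hik (ratioOf_ne_zero.mp hne)
    have h0' : ratioOf F'.rel f i k = 0 := by
      by_contra hne
      exact hik (PFlag.rel_mono hF (ratioOf_ne_zero.mp hne))
    refine Tendsto.congr (f₁ := fun _ => (0 : ℝ)) (fun t => (h0 t).symm) ?_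
    have h6 : Tendsto (fun _ : ℝ => (0 : ℝ)) atTop (𝓝 (ratioOf F'.rel f i k)) := by
      rw [h0']
      exact tendsto_const_nhds
    exact h6

end Convergence

section KarpConvergence

variable {β : ℕ} {m : Fin β → ℕ} {F : FlagTuple m}

/-- The logarithms of eigenvalues are determined up to additive constants. -/
lemma Fiber.pt_exps (Q : Fiber F) {u : ∀ τ, Frame (m τ)} {g : ∀ τ, Fin (m τ) → ℝ}
    (h : ∀ τ, IsSpectral (u τ) (g τ) (Q.sat τ)) {a : Part m} (ha : a.1 ≤ F.part.1) (s : ℝ) :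
    a.pt Q.exps s = a.pt (fun x => g x.1 x.2) s := by
  refine Part.pt_congr ?_ s
  rintro ⟨τ, i⟩ ⟨σ, k⟩ hik
  obtain rfl : τ = σ := a.2 hik
  have hik : (F τ).rel i k := FlagTuple.part_rel.mp (ha hik)
  exact ((h τ).unique (Q.isSpectral τ)).1 i k hik

/-- Geodesics of all the boundary symmetric spaces converge to their boundary data. -/
lemma IsGeodesicLimit.tendsto {γ : ℝ → Fiber F} {p : BoundaryData F} (h : IsGeodesicLimit γ p) :
    (∀ a : Part m, a.1 ≤ F.part.1 →
      Tendsto (fun t => (KarpAt.inner (γ t)).vel a) atTop (𝓝 (p.toKarp.vel a))) ∧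
    ∀ τ, Tendsto (fun t => (KarpAt.inner (γ t)).sat τ) atTop (𝓝 (p.toKarp.sat τ)) := by
  obtain ⟨e, φ, ψ, Q, h1, hψ, hQ, has⟩ := h.exists_isAsymptotic
  choose w g u f hw hu hg hlim using fun τ => (has τ).tendsto_satake (p.refines.1 τ) (ψ.2 τ)
  have hγ : ∀ t τ, (satakeOf fun c => basisForm (e τ c) fun i => φ τ c i * t) =
      Fiber.sat (γ t) τ := fun t τ =>
    congrArg (fun x : ∀ c : Cell (F τ), PE c.Gr => (⟨F τ, x⟩ : Satake (m τ)))
      (funext fun c => h1 t τ c)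
  have hp : ∀ τ, satakeOf (Q τ) = Fiber.sat p.forms τ := fun τ =>
    congrArg (fun x : ∀ d : Cell (p.flag τ), PE d.Gr => (⟨p.flag τ, x⟩ : Satake (m τ)))
      (funext fun d => hQ τ d)
  simp only [hγ] at hw hlim
  simp only [hp] at hu hlim
  refine ⟨fun a ha => ?_, hlim⟩
  have hvel : ∀ t, (KarpAt.inner (γ t)).vel a = a.pt (fun x => g x.1 t x.2) 1 := fun t =>
    Fiber.pt_exps (γ t) (fun τ => hw τ t) ha 1
  simp only [hvel]
  have hgψ : Tendsto (fun t (x : Idx m) => g x.1 t x.2 - ψ.fn x * t) atTop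
      (𝓝 fun x => f x.1 x.2) := tendsto_pi_nhds.mpr fun x => hg x.1 x.2
  rw [BoundaryData.toKarp, ← hψ]
  -- Modulo a partition that refines the new flag the growing terms `ψ t` cancel and the exponents
  -- converge to those of the limiting forms. Otherwise the point `(g : 1) = (g / t : 1 / t)` tends
  -- to `(ψ : 0)`.
  by_cases ha' : a.1 ≤ p.flag.part.1
  · rw [KarpAt.vel_bdry_of_le p.refines _ _ ha', KarpAt.vel_inner, Fiber.pt_exps p.forms hu ha' 1]
    have h2 := Part.tendsto_pt ((a.continuous_mk.tendsto _).comp hgψ)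
      (tendsto_const_nhds (x := (1 : ℝ))) (Eventually.of_forall fun _ => one_pos)
      (Or.inr one_ne_zero) zero_le_one
    refine h2.congr fun t => Part.pt_congr (fun x y hxy => ?_) 1
    rw [ψ.fn_eq (ha' hxy)]
    ring
  · rw [KarpAt.vel_bdry_of_not_le p.refines ψ _ ha ha']
    have hquot : Tendsto (fun t (x : Idx m) => t⁻¹ * g x.1 t x.2) atTop (𝓝 ψ.fn) := by
      refine tendsto_pi_nhds.mpr fun x => ?_
      have h2 := (tendsto_inv_atTop_zero (𝕜 := ℝ)).mul (tendsto_pi_nhds.mp hgψ x)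
      have h3 := h2.add_const (ψ.fn x)
      rw [zero_mul, zero_add] at h3
      refine h3.congr' ?_
      filter_upwards [eventually_gt_atTop 0] with t ht
      field_simp
      ring
    have h2 := Part.tendsto_pt ((a.continuous_mk.tendsto _).comp hquot) tendsto_inv_atTop_zero
      ((eventually_gt_atTop 0).mono fun t ht => inv_pos.mpr ht)
      (Or.inl fun e => ha' ((ψ.mk_fn_eq_zero p.refines ha).mp e)) le_rfl
    refine h2.congr' ?_
    filter_upwards [eventually_gt_atTop 0] with t ht
    have h3 := Part.pt_smul (a := a) (g := fun x => g x.1 t x.2) (s := 1) (Or.inr one_ne_zero)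
      zero_le_one (inv_pos.mpr ht)
    rw [mul_one] at h3
    exact h3

end KarpConvergence

end Karpelevich

end

open Karpelevich in
theorem theorem5p2 {β : ℕ} (m : Fin β → ℕ) (hm : ∀ τ, 0 < m τ) :
    -- every geodesic has boundary data, all boundary data occur, and they classify solvable pencils
    (∀ F : FlagTuple m,
      (∀ γ : ℝ → Fiber F, IsGeodesic γ → ∃ p, IsGeodesicLimit γ p) ∧
      (∀ p : BoundaryData F, ∃ γ : ℝ → Fiber F, IsGeodesic γ ∧ IsGeodesicLimit γ p) ∧
      (∀ γ μ : ℝ → Fiber F, IsGeodesic γ → IsGeodesic μ →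
        (SameSolvablePencil γ μ ↔ ∃ p, IsGeodesicLimit γ p ∧ IsGeodesicLimit μ p))) ∧
    -- the velocity compactification and the Satake--Furstenberg compactification
    IsCompactification (VelComp.inner : Space m → VelComp m) ∧
    ∃ TS : ∀ τ, TopologicalSpace (Satake (m τ)),
      (∀ τ, IsSatakeTopology (TS τ)) ∧
      IsCompactification (fun (x : Space m) (τ : Fin β) => satakeIncl (x τ)) ∧
      -- the topology of the Karpelevich compactification
      ∃ TK : TopologicalSpace (Karp m),
        CompactSpace (Karp m) ∧ TopologicalSpace.MetrizableSpace (Karp m) ∧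
        IsOpenEmbedding (karpIncl m) ∧ DenseRange (karpIncl m) ∧
        -- geodesics of the space and of all the boundary symmetric spaces
        (∀ (F : FlagTuple m) (P : Place (FlagTuple.trivial m) F) (γ : ℝ → Fiber F)
          (p : BoundaryData F), IsGeodesic γ → IsGeodesicLimit γ p →
          Tendsto (fun t => P.embed (KarpAt.inner (γ t))) atTop (𝓝 (P.embed p.toKarp))) ∧
        -- realisation as a hybrid
        ∃ Φ : Karp m ≃ₜ hybrid (VelComp.inner : Space m → VelComp m)
            (fun (x : Space m) (τ : Fin β) => satakeIncl (x τ)),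
          ∀ x : Space m, (Φ (karpIncl m x) : VelComp m × (∀ τ, Satake (m τ))) =
            (VelComp.inner x, fun τ => satakeIncl (x τ)) := by
  refine ⟨fun F => ⟨fun γ hγ => hγ.exists_limit, fun p => p.exists_geodesic,
    fun γ μ hγ _ => sameSolvablePencil_iff hγ⟩, VelComp.isCompactification hm,
    fun τ => satakeTopology (m τ), fun τ => isSatakeTopology (m τ),
    isCompactification_spaceSatake m, karpTopology m, karpTopology_compactSpace hm,
    karpTopology_metrizableSpace hm, isOpenEmbedding_karpIncl hm, denseRange_karpIncl hm, ?_,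
    karpHomeo hm, karpMap_karpIncl hm⟩
  intro F P γ p _ hp
  obtain ⟨hv, hs⟩ := hp.tendsto
  exact P.tendsto_embed p.refines p.vel (KarpAt.inner p.forms) hv hs
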